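/- **Setting.** Let $\Omega\subset\mathbb R^3$ be a non-empty bounded convex open set with smooth boundary and unit outer normal $n(x)$, let $\Gamma_\pm=\{(x,v)\in\partial\Omega\times\mathbb R^3:\ \pm n(x)\cdot v>0\}$, and let $d\sigma=|n(x)\cdot v|\,d\mu(x)\,dv$, where $\mu$ is the surface measure on $\partial\Omega$. Let $\mathbf E=(0,E_2,E_3)\in C^1(\overline\Omega;\mathbb R^3)$ (the pseudo-3D case). Let $\mathcal V\subset\mathbb R^3$ be open, $\beta>0$, $\varphi_0\in C^2(\overline\Omega\times\mathbb R^3)$, $\varphi(t,x,v)=-\beta t+\varphi_0(x,v)$ and $\Psi=-\beta+v\cdot\nabla_x\varphi_0+\mathbf E\cdot\nabla_v\varphi_0$. Suppose that $$R=\sup_{\overline\Omega\times\mathcal V}\varphi_0<\infty,\qquad r=\inf_{\overline\Omega\times\mathcal V}\varphi_0,\qquad R>r>0,\qquad T>\frac{R-r}{\beta},$$ that $\Psi\ge\gamma_0$ on $\overline\Omega\times\mathcal V$ for some $\gamma_0>0$, and that $\Psi$ and $(v\cdot\nabla_x+\mathbf E\cdot\nabla_v)\Psi$ are bounded on $\overline\Omega\times\mathcal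 V$. (For instance $\varphi_0=x_1v_1$, if $x_1\ge d>0$ on $\overline\Omega$, $\mathcal V=\{a<v_1^2<b,\ v_1>0\}$ with $0<\beta<a<b$, and $T$ is large enough.) Let $I\subset\mathbb R$ be open and $\mathcal U\subset\mathbb R^3$ measurable with $\mathcal U\subset\{v: v_1\in I\}\subset\mathcal V$. Let $C_0,C_1\in\mathbb R$ and $C_2>0$. **Lemma.** There are constants $c,C>0$, depending only on $\Omega,\mathbf E,T,\beta,\varphi_0,\mathcal V,I,\mathcal U,C_0,C_1,C_2$, such that the following holds. Let $q=q(x,v)$ be measurable with $|q|\le C_0$ a.e. in $\Omega\times\mathbb R^3$. Let $k(t,x,v)=k_0(x,v)k_1(t,x,v)$, where $k_0\in L^2(\Omega\times\mathbb R^3)$ vanishes for a.e. $(x,v)$ with $v\notin\mathcal U$, and where $k_1$ is measurable on $(0,T)\times\Omega\times\mathcal U$ and, for a.e. $(x,v)\in\Omega\times\mathcal U$, lies in $W^{1,1}(0,T)$ as a function of $t$, with initial value $k_1(0,x,v)$, and $$|k_1(0,x,v)|\le C_1,\qquad |k_1(0,x,v)|\ge C_2,\qquad |\partial_tk_1|\le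 C_1$$ almost everywhere on $\Omega\times\mathcal U$ and on $(0,T)\times\Omega\times\mathcal U$, respectively. Let $u\in L^2((0,T)\times\Omega\times\mathbb R^3)$ be a weak solution, with a trace on $(0,T)\times(\Gamma_+\cup\Gamma_-)$ that is locally integrable with respect to $dt\,d\sigma$, of $$\partial_tu+v\cdot\nabla_xu+\mathbf E\cdot\nabla_vu+qu=k\ \text{ in }(0,T)\times\Omega\times\mathbb R^3,\qquad u(0,x,v)=0\ \text{ in }\Omega\times\mathbb R^3.$$ Suppose that $u$ and $\partial_tu$ belong to $L^2([0,T];L^2(\Gamma_-))$, and that the boundary values of $u$ on $\Gamma_-$ are compatible with the initial data, that is, $u|_{\Gamma_-}$ has initial value $0$ at $t=0$. Then the trace of $u$ on $\Gamma_+$ has a weak time derivative $\partial_tu\in L^2([0,T];L^2(\Gamma_+))$ (and initial value $0$), and $$\int_{\Omega\times\mathbb R^3}|k_0|^2\,dx\,dv\le C\int_0^T\int_{\Gamma_+\cup\Gamma_-}|\partial_tu|^2\,d\sigma\,dt .$$ If moreover $u=0$ on $(0,T)\times\Gamma_-$, then $$c\int_0^T\int_{\Gamma_+}|\partial_tu|^2\,d\sigma\,dt\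 \le\ \int_{\Omega\times\mathbb R^3}|k_0|^2\,dx\,dv\ \le\ C\int_0^T\int_{\Gamma_+}|\partial_tu|^2\,d\sigma\,dt .$$ -/

import Mathlib

open MeasureTheory Set Filter Topology
open scoped ContDiff

noncomputable section

/-- Three-dimensional Euclidean space. The first coordinate of `v` is `v 0`. -/
abbrev R3 : Type := EuclideanSpace ℝ (Fin 3)

/-- Phase space: pairs `(x, v)` of a position and a velocity. -/
abbrev Phase : Type := R3 × R3

/-! ### The domain and its boundary -/

/-- `ρ` is a smooth defining function of `Ω` near the boundary point `x`: `ρ x = 0`,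
`∇ρ x ≠ 0`, and near `x` the set `Ω` is `{ρ < 0}`. -/
structure IsLocalDefiningFunction (Ω : Set R3) (x : R3) (ρ : R3 → ℝ) : Prop where
  smooth : ContDiff ℝ ∞ ρ
  zero : ρ x = 0
  gradient_ne_zero : gradient ρ x ≠ 0
  mem_iff : ∀ᶠ y in 𝓝 x, y ∈ Ω ↔ ρ y < 0

/-- The boundary of `Ω` is smooth. -/
def HasSmoothBoundary (Ω : Set R3) : Prop :=
  ∀ x ∈ frontier Ω, ∃ ρ : R3 → ℝ, IsLocalDefiningFunction Ω x ρ

open Classical in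
/-- The unit outer normal `n(x) = ∇ρ(x) / |∇ρ(x)|`; it does not depend on the defining function
`ρ`. It is `0` at points where there is no defining function. -/
def outerNormal (Ω : Set R3) (x : R3) : R3 :=
  if h : ∃ ρ : R3 → ℝ, IsLocalDefiningFunction Ω x ρ then
    ‖gradient h.choose x‖⁻¹ • gradient h.choose x
  else 0

/-- The outgoing part `Γ₊` of the boundary of the phase space. -/
def outgoing (Ω : Set R3) : Set Phase :=
  {z | z.1 ∈ frontier Ω ∧ 0 < inner ℝ (outerNormal Ω z.1) z.2}

/-- The incoming part `Γ₋` of the boundary of the phase space. -/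
def incoming (Ω : Set R3) : Set Phase :=
  {z | z.1 ∈ frontier Ω ∧ inner ℝ (outerNormal Ω z.1) z.2 < 0}

/-- The measure `dσ = |n(x) · v| dμ(x) dv` on `∂Ω × ℝ³`, where `μ` is the surface measure: the
two-dimensional Hausdorff measure on `∂Ω`, normalized to be the Lebesgue measure on planes. -/
def boundaryMeasure (Ω : Set R3) : Measure Phase :=
  (((Measure.euclideanHausdorffMeasure 2 : Measure R3).restrict (frontier Ω)).prod
    (volume : Measure R3)).withDensity
      (fun z => ENNReal.ofReal |inner ℝ (outerNormal Ω z.1) z.2|)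

/-- `dσ` on `Γ₊`. -/
def sigmaOut (Ω : Set R3) : Measure Phase := (boundaryMeasure Ω).restrict (outgoing Ω)

/-- `dσ` on `Γ₋`. -/
def sigmaIn (Ω : Set R3) : Measure Phase := (boundaryMeasure Ω).restrict (incoming Ω)

/-- `dx dv` on `Ω × ℝ³`. -/
def interiorMeasure (Ω : Set R3) : Measure Phase := volume.restrict (Ω ×ˢ univ)

/-- The measure `dt ⊗ ν` on `(0,T) × Phase`. -/
def timeCylinder (T : ℝ) (ν : Measure Phase) : Measure (ℝ × Phase) :=
  ((volume : Measure ℝ).restrict (Ioo 0 T)).prod ν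

/-! ### Weak derivatives in time -/

/-- For `ν`-almost every `z`, the function `f(·, z)` belongs to `W^{1,1}(0,T)`, with weak
derivative `f'(·, z)` and initial value `f₀ z`. -/
def HasWeakTimeDeriv (T : ℝ) (ν : Measure Phase) (f f' : ℝ × Phase → ℝ) (f₀ : Phase → ℝ) : Prop :=
  ∀ᵐ z ∂ν, IntervalIntegrable (fun s => f' (s, z)) volume 0 T ∧
    ∀ᵐ t ∂((volume : Measure ℝ).restrict (Ioo 0 T)), f (t, z) = f₀ z + ∫ s in (0 : ℝ)..t, f' (s, z)

/-! ### The transport equation -/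

/-- `P₀ η = ∂ₜη + v · ∇ₓη + E · ∇ᵥη` for a differentiable function `η` of `(t, x, v)`. -/
def transport (E : R3 → R3) (η : ℝ × Phase → ℝ) (p : ℝ × Phase) : ℝ :=
  fderiv ℝ η p (1, (p.2.2, E p.2.1))

/-- `u` is a weak solution, with trace `γ` on `(0,T) × ∂Ω × ℝ³`, of
`∂ₜu + v · ∇ₓu + E · ∇ᵥu + q u = S` in `(0,T) × Ω × ℝ³` and `u(0,·) = g`.
The identity is obtained by multiplying with `η` and integrating by parts (`E = E(x)` has no
divergence in `v`); the boundary terms define the initial value and the traces on `Γ₊`, `Γ₋`. -/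
structure IsWeakSolution (Ω : Set R3) (E : R3 → R3) (T : ℝ) (q : Phase → ℝ)
    (S : ℝ × Phase → ℝ) (g : Phase → ℝ) (u γ : ℝ × Phase → ℝ) : Prop where
  memLp : MemLp u 2 (timeCylinder T (interiorMeasure Ω))
  trace_locallyIntegrable : LocallyIntegrable γ (timeCylinder T (boundaryMeasure Ω))
  weak : ∀ η : ℝ × Phase → ℝ, ContDiff ℝ 1 η → HasCompactSupport η →
    tsupport η ⊆ Iio T ×ˢ univ →
    (∫ p, u p * (-transport E η p + q p.2 * η p) ∂(timeCylinder T (interiorMeasure Ω)))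
        + (∫ p, γ p * η p ∂(timeCylinder T (sigmaOut Ω)))
        - (∫ p, γ p * η p ∂(timeCylinder T (sigmaIn Ω)))
      = (∫ p, S p * η p ∂(timeCylinder T (interiorMeasure Ω)))
        + ∫ z, g z * η (0, z) ∂(interiorMeasure Ω)

/-! ### The weight function -/

/-- `(v · ∇ₓ + E · ∇ᵥ) f` on `closure Ω × ℝ³`. -/
def spaceTransport (Ω : Set R3) (E : R3 → R3) (f : Phase → ℝ) (z : Phase) : ℝ :=
  fderivWithin ℝ f (closure Ω ×ˢ univ) z (z.2, E z.1)

/-- `Ψ = P₀ φ` for the weight `φ(t,x,v) = -β t + φ₀(x,v)`. -/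
def weightPsi (Ω : Set R3) (E : R3 → R3) (β : ℝ) (φ₀ : Phase → ℝ) (z : Phase) : ℝ :=
  -β + spaceTransport Ω E φ₀ z

/-- `φ(t,x,v) = -β t + φ₀(x,v)` is an admissible weight function on `closure Ω × V`, and `T` is
large enough for it. -/
structure IsAdmissibleWeight (Ω : Set R3) (E : R3 → R3) (V : Set R3) (T β : ℝ)
    (φ₀ : Phase → ℝ) : Prop where
  beta_pos : 0 < β
  contDiffOn : ContDiffOn ℝ 2 φ₀ (closure Ω ×ˢ univ)
  range : ∃ R r : ℝ, IsLUB (φ₀ '' (closure Ω ×ˢ V)) R ∧ IsGLB (φ₀ '' (closure Ω ×ˢ V)) r ∧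
    0 < r ∧ r < R ∧ (R - r) / β < T
  psi_lower : ∃ c : ℝ, 0 < c ∧ ∀ z ∈ closure Ω ×ˢ V, c ≤ weightPsi Ω E β φ₀ z
  psi_bounded : ∃ M : ℝ, ∀ z ∈ closure Ω ×ˢ V, |weightPsi Ω E β φ₀ z| ≤ M
  transport_psi_bounded : ∃ M : ℝ, ∀ z ∈ closure Ω ×ˢ V,
    |spaceTransport Ω E (weightPsi Ω E β φ₀) z| ≤ M

end

/-! ### The outer normal of a convex domain -/

/-! Along a characteristic the equation is a scalar linear ODE, so Duhamel's formula gives the trace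
at an outgoing point `z`. Let `ℓ(z)` be the duration of the chord that ends at `z`, and let `b_z(r)`
be the attenuation times the value of `k₀` at the point reached from `z` after going back for a time
`r`. Then the trace at time `t` is `∫ b_z(r) k₁(t - r, ·) dr` over `0 < r < ℓ(z)`, plus the
attenuated inflow at time `t - ℓ(z)`, where `k₁` is zero at negative times
(`IsReducedProblem.duhamel`).

Differentiation in `t` turns this Volterra equation of the first kind into one of the second kind
(`IsReducedProblem.ae_trace_eq`): the rate `w(t)` is `b_z(t) k₁(0, ·)`, plus `∫ b_z(r) ∂ₜk₁(t - r,
·) dr` over `0 < r < t`, plus the rate of the inflow at time `t - ℓ(z)`. Where `b_z(t) ≠ 0` one has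
`t < ℓ(z)`, so the inflow has not yet reached `z` and its rate is zero. As `|k₁(0, ·)| ≥ C₂`, an
exponentially weighted estimate (`integral_sq_le_of_volterra`) bounds the integral of `b_z²` by that
of `w²` over `(0,T)`. The map from an outgoing point `z` and a backward time `r` to the point of
phase space so reached takes flux measure times `dr` to `dx dv` (`map_backMeasure`), so integration
over `Γ₊` gives the norm of `k₀`. For this the whole support of `k₀` must be seen before time `T`.
That is the role of the weight (`lt_of_mem_backSet`): since `E` has no first component, `v₁` is
conserved, a characteristic with `v₁ ∈ I` keeps its velocity in `V`, and `φ₀` grows along it at rate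
at least `β`, so that it stays in `Ω` for at most `(R - r)/β < T`. The opposite estimate bounds the
three terms of the rate in `L²`. The inflow term is handled by the entry map, which preserves the
flux measure (`TransportGeometry.measurePreserving_entryPoint`).

The solution is only a weak one, so Duhamel's formula has to be extracted from the weak formulation.
The test functions are averages of a function `a` along the backward flow. Near a characteristic
that leaves `Ω` transversally they vanish on `Γ₋`, and inside `Ω` their derivative along the flow is
`a` itself (`IsWeakTriple.tube_identity`). The flow is only known to be Lipschitz, so these averages
have to be approximated by smooth functions (`exists_smooth_approx`). Applied to the constant
solution the identity gives the change of variables; applied to `u` it gives the integrated equation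
up to `Γ₊` (`IsWeakTriple.exit_formula`). Reversal of time and velocity gives the formula down to
`Γ₋`. Almost every point lies on a transversally exiting characteristic (`ae_mem_exitSet`), by
Liouville's theorem (`measurePreserving_flow`) and a covering argument.

The constant function is a weak solution by the divergence theorem. `exists_gaussGreen` proves it
from the gauge of `Ω`, with an unspecified density `λ` of the flux measure that lies between two
positive constants. Hence the value of `u` at the end of a characteristic appears as `γ / λ`
throughout, and only the bounds of `λ` enter the final constants. -/

theorem IsLocalDefiningFunction.hasFDerivAt {Ω : Set R3} {x : R3} {ρ : R3 → ℝ}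
    (hρ : IsLocalDefiningFunction Ω x ρ) (y : R3) :
    HasFDerivAt ρ (InnerProductSpace.toDual ℝ R3 (gradient ρ y)) y :=
  ((hρ.smooth.differentiable (by simp)) y).hasGradientAt.hasFDerivAt

theorem IsLocalDefiningFunction.hasDerivAt_line {Ω : Set R3} {x : R3} {ρ : R3 → ℝ}
    (hρ : IsLocalDefiningFunction Ω x ρ) (w : R3) :
    HasDerivAt (fun t : ℝ => ρ (x + t • w)) (inner ℝ (gradient ρ x) w) 0 := by
  have h1 : HasDerivAt (fun t : ℝ => x + t • w) w 0 := by
    simpa using ((hasDerivAt_id (0 : ℝ)).smul_const w).const_add x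
  have h2 := hρ.hasFDerivAt (x + (0 : ℝ) • w)
  have := h2.comp_hasDerivAt (0 : ℝ) h1
  simpa [Function.comp_def] using this

theorem IsLocalDefiningFunction.eventually_mem_of_inner_neg {Ω : Set R3} {x : R3} {ρ : R3 → ℝ}
    (hρ : IsLocalDefiningFunction Ω x ρ) {w : R3} (hw : inner ℝ (gradient ρ x) w < 0) :
    ∀ᶠ t in 𝓝[>] (0 : ℝ), x + t • w ∈ Ω := by
  have hd := hρ.hasDerivAt_line w
  have hslope := hd.tendsto_slope_zero_right
  have h1 : ∀ᶠ t in 𝓝[>] (0 : ℝ), t⁻¹ • (ρ (x + (0 + t) • w) - ρ (x + (0 : ℝ) • w)) < 0 :=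
    hslope.eventually (gt_mem_nhds hw)
  have hcont : Tendsto (fun t : ℝ => x + t • w) (𝓝[>] 0) (𝓝 x) := by
    have : Continuous (fun t : ℝ => x + t • w) := by fun_prop
    simpa using (this.tendsto 0).mono_left nhdsWithin_le_nhds
  filter_upwards [h1, hcont.eventually hρ.mem_iff, self_mem_nhdsWithin] with t h1 h2 ht
  rw [h2]
  have ht' : 0 < t⁻¹ := inv_pos.2 ht
  simp only [zero_add, zero_smul, add_zero, hρ.zero, sub_zero, smul_eq_mul] at h1
  by_contra hcon
  exact absurd h1 (not_lt.2 (mul_nonneg ht'.le (not_lt.1 hcon)))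

/-- Segments from `x` into `Ω` stay in `Ω` by convexity, so `ρ` is negative along them and its
derivative at `x` is at most zero. The inequality is strict because `y` can be moved slightly in the
direction of the gradient without leaving the open set `Ω`. -/
theorem IsLocalDefiningFunction.inner_gradient_neg {Ω : Set R3} (hΩo : IsOpen Ω)
    (hΩc : Convex ℝ Ω) {x : R3} {ρ : R3 → ℝ} (hρ : IsLocalDefiningFunction Ω x ρ)
    (hx : x ∈ frontier Ω) {y : R3} (hy : y ∈ Ω) : inner ℝ (gradient ρ x) (y - x) < 0 := by
  have key : ∀ y ∈ Ω, inner ℝ (gradient ρ x) (y - x) ≤ 0 := by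
    intro y hy
    by_contra! hcon
    have hd := (hρ.hasDerivAt_line (y - x)).tendsto_slope_zero_right
    have h1 := hd.eventually (lt_mem_nhds hcon)
    have hcont : Tendsto (fun t : ℝ => x + t • (y - x)) (𝓝[>] 0) (𝓝 x) := by
      have : Continuous (fun t : ℝ => x + t • (y - x)) := by fun_prop
      simpa using (this.tendsto 0).mono_left nhdsWithin_le_nhds
    have hIoc : ∀ᶠ t in 𝓝[>] (0 : ℝ), t ∈ Ioc (0 : ℝ) 1 := Ioc_mem_nhdsGT one_pos
    obtain ⟨t, h1, h2, ht⟩ := (h1.and ((hcont.eventually hρ.mem_iff).and hIoc)).exists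
    have hmem : x + t • (y - x) ∈ Ω := by
      have := hΩc.add_smul_sub_mem_interior' (frontier_subset_closure hx)
        (by rwa [hΩo.interior_eq]) ht
      rwa [hΩo.interior_eq] at this
    have h3 := h2.1 hmem
    simp only [zero_add, zero_smul, add_zero, hρ.zero, sub_zero, smul_eq_mul] at h1
    have ht' : 0 < t⁻¹ := inv_pos.2 ht.1
    nlinarith
  have hcont : Tendsto (fun t : ℝ => y + t • gradient ρ x) (𝓝[>] 0) (𝓝 y) := by
    have : Continuous (fun t : ℝ => y + t • gradient ρ x) := by fun_prop
    simpa using (this.tendsto 0).mono_left nhdsWithin_le_nhds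
  obtain ⟨t, h1, ht⟩ := ((hcont.eventually (hΩo.mem_nhds hy)).and self_mem_nhdsWithin).exists
  have h2 := key _ h1
  have h3 : inner ℝ (gradient ρ x) (y + t • gradient ρ x - x)
      = inner ℝ (gradient ρ x) (y - x) + t * ‖gradient ρ x‖ ^ 2 := by
    rw [add_sub_right_comm, inner_add_right, inner_smul_right, real_inner_self_eq_norm_sq]
  have h4 : 0 < ‖gradient ρ x‖ := norm_pos_iff.2 hρ.gradient_ne_zero
  have h5 : 0 < t * ‖gradient ρ x‖ ^ 2 := mul_pos ht (by positivity)
  linarith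

/-- Two vectors are positively parallel if the open half space of one is contained in the closed
half space of the other. -/
theorem normalize_eq_of_halfSpace {F : Type*} [NormedAddCommGroup F] [InnerProductSpace ℝ F]
    {g m : F} (hg : g ≠ 0) (hm : m ≠ 0)
    (h : ∀ w, inner ℝ g w < 0 → inner ℝ m w ≤ 0) : ‖m‖⁻¹ • m = ‖g‖⁻¹ • g := by
  have hg' : 0 < ‖g‖ := norm_pos_iff.2 hg
  have hm' : 0 < ‖m‖ := norm_pos_iff.2 hm
  have hcl : ∀ w, inner ℝ g w ≤ 0 → inner ℝ m w ≤ 0 := by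
    intro w hw
    have h1 : ∀ ε > (0 : ℝ), inner ℝ m w ≤ ε * inner ℝ m g := by
      intro ε hε
      have := h (w - ε • g) (by
        rw [inner_sub_right, inner_smul_right, real_inner_self_eq_norm_sq]
        have : 0 < ε * ‖g‖ ^ 2 := by positivity
        linarith)
      rw [inner_sub_right, inner_smul_right] at this
      linarith
    have h2 : Tendsto (fun ε : ℝ => ε * inner ℝ m g) (𝓝[>] 0) (𝓝 0) := by
      have : Continuous (fun ε : ℝ => ε * inner ℝ m g) := by fun_prop
      simpa using (this.tendsto 0).mono_left nhdsWithin_le_nhds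
    exact ge_of_tendsto h2 (by filter_upwards [self_mem_nhdsWithin] with ε hε using h1 ε hε)
  have h1 : 0 ≤ inner ℝ m g := by
    have := hcl (-g) (by rw [inner_neg_right, real_inner_self_eq_norm_sq]; nlinarith)
    rw [inner_neg_right] at this
    linarith
  -- This vector is orthogonal to `g`. Its product with `m` is `‖g‖²‖m‖² - ⟪m, g⟫²`, so the bound
  -- forces equality in the Cauchy–Schwarz inequality.
  have h2 := hcl (‖g‖ ^ 2 • m - inner ℝ m g • g) (by
    rw [inner_sub_right, inner_smul_right, inner_smul_right, real_inner_self_eq_norm_sq,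
      real_inner_comm]
    exact le_of_eq (by ring))
  rw [inner_sub_right, inner_smul_right, inner_smul_right, real_inner_self_eq_norm_sq] at h2
  have h3 : ‖m‖ * ‖g‖ ≤ inner ℝ m g :=
    abs_le_of_sq_le_sq' (by nlinarith) h1 |>.2
  have h4 : inner ℝ m g = ‖m‖ * ‖g‖ := le_antisymm (real_inner_le_norm _ _) h3
  rw [inner_eq_norm_mul_iff_real] at h4
  rw [inv_smul_eq_iff₀ hm'.ne', smul_smul, mul_comm, ← smul_smul, ← h4, smul_smul,
    inv_mul_cancel₀ hg'.ne', one_smul]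

/-- Every direction `w` with `⟪∇ρ, w⟫ < 0` enters `Ω`, so a supporting vector `m` has `⟪m, w⟫ ≤ 0`
for these `w` and is a positive multiple of `∇ρ`. This frees the normal from the choice of a
defining function and later identifies it with the normalized gradient of the gauge. -/
theorem outerNormal_eq_of_support {Ω : Set R3} (hΩs : HasSmoothBoundary Ω) {x : R3}
    (hx : x ∈ frontier Ω) {m : R3} (hm : m ≠ 0) (h : ∀ y ∈ Ω, inner ℝ m (y - x) ≤ 0) :
    outerNormal Ω x = ‖m‖⁻¹ • m := by
  have hex := hΩs x hx
  rw [outerNormal, dif_pos hex]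
  refine (normalize_eq_of_halfSpace hex.choose_spec.gradient_ne_zero hm fun w hw => ?_).symm
  obtain ⟨t, ht, ht0⟩ := ((hex.choose_spec.eventually_mem_of_inner_neg hw).and
    self_mem_nhdsWithin).exists
  have := h _ ht
  rw [add_sub_cancel_left, inner_smul_right] at this
  have ht0 : 0 < t := ht0
  by_contra! hcon
  nlinarith [mul_pos ht0 hcon]

section Normal

variable {Ω : Set R3} (hΩo : IsOpen Ω) (hΩc : Convex ℝ Ω) (hΩs : HasSmoothBoundary Ω)
include hΩo hΩc hΩs

theorem outerNormal_eq {x : R3} (hx : x ∈ frontier Ω) {ρ : R3 → ℝ}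
    (hρ : IsLocalDefiningFunction Ω x ρ) :
    outerNormal Ω x = ‖gradient ρ x‖⁻¹ • gradient ρ x :=
  outerNormal_eq_of_support hΩs hx hρ.gradient_ne_zero
    fun _ hy => (hρ.inner_gradient_neg hΩo hΩc hx hy).le

theorem norm_outerNormal {x : R3} (hx : x ∈ frontier Ω) : ‖outerNormal Ω x‖ = 1 := by
  obtain ⟨ρ, hρ⟩ := hΩs x hx
  rw [outerNormal_eq hΩo hΩc hΩs hx hρ, norm_smul, norm_inv, norm_norm,
    inv_mul_cancel₀ (norm_ne_zero_iff.2 hρ.gradient_ne_zero)]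

theorem inner_outerNormal_neg {x y : R3} (hx : x ∈ frontier Ω) (hy : y ∈ Ω) :
    inner ℝ (outerNormal Ω x) (y - x) < 0 := by
  obtain ⟨ρ, hρ⟩ := hΩs x hx
  rw [outerNormal_eq hΩo hΩc hΩs hx hρ, inner_smul_left]
  exact mul_neg_of_pos_of_neg (inv_pos.2 (norm_pos_iff.2 hρ.gradient_ne_zero))
    (hρ.inner_gradient_neg hΩo hΩc hx hy)

end Normal

/-! ### Continuity of the outer normal along the boundary. -/

theorem continuous_gradient_of_contDiff {ρ : R3 → ℝ} (h : ContDiff ℝ ∞ ρ) :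
    Continuous (gradient ρ) :=
  (InnerProductSpace.toDual ℝ R3).symm.continuous.comp (h.continuous_fderiv (by simp))

/-- A boundary point near `x` is a limit of points of `Ω`, where `ρ < 0`, and of points of the
complement, where `ρ ≥ 0`; hence `ρ` vanishes there. So one function `ρ` describes the normal on a
whole neighbourhood in the boundary. -/
theorem IsLocalDefiningFunction.eventually_frontier {Ω : Set R3} {x : R3} {ρ : R3 → ℝ}
    (hρ : IsLocalDefiningFunction Ω x ρ) :
    ∀ᶠ y in 𝓝 x, y ∈ frontier Ω → IsLocalDefiningFunction Ω y ρ := by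
  have hcg := continuous_gradient_of_contDiff hρ.smooth
  have h1 : ∀ᶠ y in 𝓝 x, gradient ρ y ≠ 0 :=
    hcg.continuousAt.eventually_ne hρ.gradient_ne_zero
  filter_upwards [h1, hρ.mem_iff.eventually_nhds] with y hy1 hy2 hy
  refine ⟨hρ.smooth, ?_, hy1, hy2⟩
  rw [frontier_eq_closure_inter_closure] at hy
  have hc : ContinuousAt ρ y := hρ.smooth.continuous.continuousAt
  apply le_antisymm
  · by_contra! hcon
    obtain ⟨z, hz1, hz2, hz3⟩ := (mem_closure_iff_frequently.1 hy.1).and_eventually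
      (hy2.and (hc.eventually (lt_mem_nhds hcon))) |>.exists
    exact absurd (hz2.1 hz1) (not_lt.2 hz3.le)
  · by_contra! hcon
    obtain ⟨z, hz1, hz2, hz3⟩ := (mem_closure_iff_frequently.1 hy.2).and_eventually
      (hy2.and (hc.eventually (gt_mem_nhds hcon))) |>.exists
    exact hz1 (hz2.2 hz3)

/-- Points near `x` where the defining function is positive are outside `closure Ω`. -/
theorem IsLocalDefiningFunction.eventually_notMem_closure {Ω : Set R3} {x : R3} {ρ : R3 → ℝ}
    (hρ : IsLocalDefiningFunction Ω x ρ) :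
    ∀ᶠ y in 𝓝 x, 0 < ρ y → y ∉ closure Ω := by
  filter_upwards [hρ.mem_iff.eventually_nhds] with y hy hpos hcl
  have hc : ContinuousAt ρ y := hρ.smooth.continuous.continuousAt
  obtain ⟨z, hz1, hz2, hz3⟩ := (mem_closure_iff_frequently.1 hcl).and_eventually
    (hy.and (hc.eventually (lt_mem_nhds hpos))) |>.exists
  exact absurd (hz2.1 hz1) (not_lt.2 hz3.le)

theorem continuousOn_outerNormal {Ω : Set R3} (hΩo : IsOpen Ω) (hΩc : Convex ℝ Ω)
    (hΩs : HasSmoothBoundary Ω) : ContinuousOn (outerNormal Ω) (frontier Ω) := by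
  intro x hx
  obtain ⟨ρ, hρ⟩ := hΩs x hx
  have hcg := continuous_gradient_of_contDiff hρ.smooth
  have h1 : ContinuousAt (fun y => ‖gradient ρ y‖⁻¹ • gradient ρ y) x :=
    (hcg.norm.continuousAt.inv₀ (norm_ne_zero_iff.2 hρ.gradient_ne_zero)).smul hcg.continuousAt
  refine h1.continuousWithinAt.congr_of_eventuallyEq ?_ (outerNormal_eq hΩo hΩc hΩs hx hρ)
  filter_upwards [nhdsWithin_le_nhds hρ.eventually_frontier, self_mem_nhdsWithin] with y hy hy'
  exact outerNormal_eq hΩo hΩc hΩs hy' (hy hy')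

/-! ### Hausdorff measure and cone measure on the unit sphere -/

open scoped NNReal ENNReal Pointwise

theorem lipschitzOnWith_normalize {F : Type*} [NormedAddCommGroup F] [NormedSpace ℝ F]
    {r : ℝ≥0} (hr : 0 < r) :
    LipschitzOnWith (2 / r) (fun x : F => ‖x‖⁻¹ • x) {x | (r : ℝ) ≤ ‖x‖} := by
  refine LipschitzOnWith.of_dist_le_mul fun x hx y hy => ?_
  have hr' : (0 : ℝ) < r := hr
  have hx0 : 0 < ‖x‖ := hr'.trans_le hx
  have hy0 : 0 < ‖y‖ := hr'.trans_le hy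
  rw [dist_eq_norm, dist_eq_norm]
  have h1 : ‖x‖⁻¹ • x - ‖y‖⁻¹ • y = ‖x‖⁻¹ • (x - y) + (‖x‖⁻¹ - ‖y‖⁻¹) • y := by
    rw [smul_sub, sub_smul]; abel
  have h2 : ‖(‖x‖⁻¹ - ‖y‖⁻¹) • y‖ ≤ ‖x‖⁻¹ * ‖x - y‖ := by
    have h3 : (‖x‖⁻¹ - ‖y‖⁻¹) * ‖y‖ = ‖x‖⁻¹ * (‖y‖ - ‖x‖) := by field_simp
    rw [norm_smul, Real.norm_eq_abs, ← abs_of_pos hy0, ← abs_mul, abs_of_pos hy0, h3, abs_mul,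
      abs_of_pos (inv_pos.2 hx0)]
    gcongr
    rw [norm_sub_rev]
    exact abs_norm_sub_norm_le y x
  calc ‖‖x‖⁻¹ • x - ‖y‖⁻¹ • y‖ ≤ ‖x‖⁻¹ * ‖x - y‖ + ‖x‖⁻¹ * ‖x - y‖ := by
        rw [h1]
        refine (norm_add_le _ _).trans (add_le_add ?_ h2)
        rw [norm_smul, norm_inv, norm_norm]
    _ = 2 / ‖x‖ * ‖x - y‖ := by ring
    _ ≤ 2 / r * ‖x - y‖ := by gcongr; exact hx
    _ = ((2 / r : ℝ≥0) : ℝ) * ‖x - y‖ := by simp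

/-- The point of the affine plane `x i = 1` with the other coordinates `a`. -/
noncomputable def planePoint (i : Fin 3) (a : Fin 2 → ℝ) : R3 := WithLp.toLp 2 (i.insertNth 1 a)

/-- Central projection onto the affine plane `x i = 1`. -/
noncomputable def planeCoord (i : Fin 3) (x : R3) : Fin 2 → ℝ := fun k => x (i.succAbove k) / x i

theorem planePoint_same (i : Fin 3) (a : Fin 2 → ℝ) : planePoint i a i = 1 := by
  simp [planePoint]

theorem planePoint_succAbove (i : Fin 3) (a : Fin 2 → ℝ) (k : Fin 2) :
    planePoint i a (i.succAbove k) = a k := by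
  simp [planePoint]

theorem smul_planePoint_planeCoord {i : Fin 3} {x : R3} (hx : x i ≠ 0) :
    x i • planePoint i (planeCoord i x) = x := by
  ext k
  rcases Fin.eq_self_or_eq_succAbove i k with rfl | ⟨k, rfl⟩
  · simp [planePoint_same]
  · simp only [PiLp.smul_apply, planePoint_succAbove, planeCoord, smul_eq_mul]
    field_simp

theorem planeCoord_smul {i : Fin 3} {x : R3} {r : ℝ} (hr : r ≠ 0) :
    planeCoord i (r • x) = planeCoord i x := by
  ext k
  simp only [planeCoord, PiLp.smul_apply, smul_eq_mul]
  exact mul_div_mul_left _ _ hr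

theorem planeCoord_planePoint (i : Fin 3) (a : Fin 2 → ℝ) : planeCoord i (planePoint i a) = a := by
  ext k
  simp [planeCoord, planePoint_same, planePoint_succAbove]

theorem one_le_norm_planePoint (i : Fin 3) (a : Fin 2 → ℝ) : 1 ≤ ‖planePoint i a‖ := by
  have := PiLp.norm_apply_le (planePoint i a) i
  rwa [planePoint_same, norm_one] at this

theorem lipschitzWith_planePoint (i : Fin 3) : LipschitzWith 2 (planePoint i) := by
  refine LipschitzWith.of_dist_le_mul fun a b => ?_
  rw [EuclideanSpace.dist_eq, Fin.sum_univ_succAbove _ i]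
  simp only [planePoint_same, planePoint_succAbove, Fin.sum_univ_two]
  have h0 := dist_le_pi_dist a b 0
  have h1 := dist_le_pi_dist a b 1
  refine Real.sqrt_le_iff.2 ⟨by positivity, ?_⟩
  have := pow_le_pow_left₀ dist_nonneg h0 2
  have := pow_le_pow_left₀ dist_nonneg h1 2
  simp only [dist_self, NNReal.coe_ofNat]
  nlinarith [sq_nonneg (dist a b)]

/-- One of the six pieces of the sphere. -/
def sphereFace (i : Fin 3) (e : ℝ) : Set R3 := {x | ‖x‖ = 1 ∧ 1 / 2 ≤ e * x i}

theorem normalize_planePoint_planeCoord {i : Fin 3} {e : ℝ} (he : |e| = 1) {x : R3}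
    (hx : x ∈ sphereFace i e) :
    e • (‖planePoint i (planeCoord i x)‖⁻¹ • planePoint i (planeCoord i x)) = x := by
  have hee : e * e = 1 := by rw [← abs_mul_abs_self, he, one_mul]
  have hpos : 0 < e * x i := lt_of_lt_of_le (by norm_num) hx.2
  have hxi : x i ≠ 0 := by rintro h; simp [h] at hpos
  have h1 := smul_planePoint_planeCoord hxi
  have habs : |x i| = e * x i := by rw [← abs_of_pos hpos, abs_mul, he, one_mul]
  have h2 : |x i| * ‖planePoint i (planeCoord i x)‖ = 1 := by
    rw [← Real.norm_eq_abs, ← norm_smul, h1, hx.1]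
  have h3 : ‖planePoint i (planeCoord i x)‖⁻¹ = e * x i := by
    rw [← habs]; exact (eq_inv_of_mul_eq_one_left h2).symm
  rw [h3, smul_smul, ← mul_assoc, hee, one_mul, h1]

theorem lipschitzOnWith_planeCoord {i : Fin 3} {e : ℝ} (he : |e| = 1) :
    LipschitzOnWith 8 (planeCoord i) (sphereFace i e) := by
  refine LipschitzOnWith.of_dist_le_mul fun x hx y hy => ?_
  refine (dist_pi_le_iff (by positivity)).2 fun k => ?_
  have hxi : 1 / 2 ≤ |x i| := by
    have := hx.2.trans (le_abs_self _); rwa [abs_mul, he, one_mul] at this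
  have hyi : 1 / 2 ≤ |y i| := by
    have := hy.2.trans (le_abs_self _); rwa [abs_mul, he, one_mul] at this
  have hx0 : x i ≠ 0 := by intro h; rw [h] at hxi; norm_num at hxi
  have hy0 : y i ≠ 0 := by intro h; rw [h] at hyi; norm_num at hyi
  have hd : ∀ l, |x l - y l| ≤ dist x y := fun l => by
    have := PiLp.norm_apply_le (x - y) l
    rwa [PiLp.sub_apply, Real.norm_eq_abs, ← dist_eq_norm] at this
  have hy1 : ∀ l, |y l| ≤ 1 := fun l => by
    have := PiLp.norm_apply_le y l
    rwa [hy.1] at this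
  rw [Real.dist_eq, planeCoord, planeCoord]
  have hid : x (i.succAbove k) / x i - y (i.succAbove k) / y i
      = ((x (i.succAbove k) - y (i.succAbove k)) * y i - y (i.succAbove k) * (x i - y i))
        / (x i * y i) := by
    field_simp; ring
  rw [hid, abs_div, abs_mul, div_le_iff₀ (by positivity)]
  have h1 := hd (i.succAbove k)
  have h2 := hd i
  have hD : 0 ≤ dist x y := dist_nonneg
  calc _ ≤ |x (i.succAbove k) - y (i.succAbove k)| * |y i| + |y (i.succAbove k)| * |x i - y i| := by
        rw [← abs_mul, ← abs_mul]; exact abs_sub _ _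
    _ ≤ dist x y * 1 + 1 * dist x y := by
        gcongr
        · exact hy1 i
        · exact hy1 _
    _ = (8 : ℝ≥0) * dist x y * (1 / 2 * (1 / 2)) := by simp; ring
    _ ≤ (8 : ℝ≥0) * dist x y * (|x i| * |y i|) := by gcongr

/-- A truncated cone over a set in the plane `x i = 1`. -/
def planeCone (i : Fin 3) (e c : ℝ) (B : Set (Fin 2 → ℝ)) : Set R3 :=
  {x | (0 < e * x i ∧ e * x i < c) ∧ planeCoord i x ∈ B}

theorem measurable_planeCoord (i : Fin 3) : Measurable (planeCoord i) :=
  measurable_pi_lambda _ fun k => by unfold planeCoord; fun_prop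

/-- By Fubini: the slice at height `x i = r` is `r • B`, of area `r²` times that of `B`. -/
theorem volume_planeCone (i : Fin 3) (e c : ℝ) {B : Set (Fin 2 → ℝ)} (hB : MeasurableSet B) :
    volume (planeCone i e c B)
      = (∫⁻ r in {r : ℝ | 0 < e * r ∧ e * r < c}, ENNReal.ofReal (|r| ^ 2)) * volume B := by
  have hmK : MeasurableSet (planeCone i e c B) := by
    have hx : Measurable fun x : R3 => e * x i := by fun_prop
    exact ((measurableSet_lt measurable_const hx).inter
      (measurableSet_lt hx measurable_const)).inter (measurable_planeCoord i hB)
  have hmp := (volume_preserving_piFinSuccAbove (fun _ : Fin 3 => ℝ) i).comp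
    (EuclideanSpace.volume_preserving_symm_measurableEquiv_toLp (Fin 3))
  have hmr : MeasurableSet {r : ℝ | 0 < e * r ∧ e * r < c} :=
    (measurableSet_lt measurable_const (measurable_const_mul e)).inter
      (measurableSet_lt (measurable_const_mul e) measurable_const)
  let K' : Set (ℝ × (Fin 2 → ℝ)) := {p | p.1 ∈ {r : ℝ | 0 < e * r ∧ e * r < c} ∧ p.1⁻¹ • p.2 ∈ B}
  have hmK' : MeasurableSet K' :=
    (measurable_fst hmr).inter ((measurable_fst.inv.smul measurable_snd) hB)
  have hpre : planeCone i e c B = ((MeasurableEquiv.piFinSuccAbove (fun _ => ℝ) i) ∘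
      (MeasurableEquiv.toLp 2 (Fin 3 → ℝ)).symm) ⁻¹' K' := by
    ext x
    have : planeCoord i x = (x i)⁻¹ • i.removeNth (⇑x) := by
      ext k; simp [planeCoord, Fin.removeNth, div_eq_inv_mul]
    simp only [planeCone, mem_ofPred_eq, K', this]
    rfl
  rw [hpre, hmp.measure_preimage hmK'.nullMeasurableSet, Measure.volume_eq_prod,
    Measure.prod_apply hmK', ← lintegral_mul_const _ (by fun_prop), ← lintegral_indicator hmr]
  refine lintegral_congr fun r => ?_
  by_cases hr : r ∈ {r : ℝ | 0 < e * r ∧ e * r < c}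
  · have hr0 : r ≠ 0 := by rintro rfl; simp at hr
    have : Prod.mk r ⁻¹' K' = (fun y : Fin 2 → ℝ => r⁻¹ • y) ⁻¹' B := by
      ext y; exact ⟨fun h => h.2, fun h => ⟨hr, h⟩⟩
    rw [this, Measure.addHaar_preimage_smul _ (inv_ne_zero hr0), indicator_of_mem hr]
    simp
  · rw [indicator_of_notMem hr]
    have : Prod.mk r ⁻¹' K' = ∅ := by
      ext y; simp only [K', mem_preimage, mem_ofPred_eq, mem_empty_iff_false, iff_false]
      exact fun h => hr h.1
    rw [this, measure_empty]

theorem hausdorffMeasure_fin_two : (μH[2] : Measure (Fin 2 → ℝ)) = volume := by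
  have := hausdorffMeasure_pi_real (ι := Fin 2)
  simpa using this

theorem coneWeight_pos {e c : ℝ} (he : |e| = 1) (hc : 0 < c) :
    0 < ∫⁻ r in {r : ℝ | 0 < e * r ∧ e * r < c}, ENNReal.ofReal (|r| ^ 2) := by
  have hopen : IsOpen {r : ℝ | 0 < e * r ∧ e * r < c} :=
    (isOpen_lt continuous_const (continuous_const_mul e)).inter
      (isOpen_lt (continuous_const_mul e) continuous_const)
  have hee : e * e = 1 := by rw [← abs_mul_abs_self, he, one_mul]
  rw [setLIntegral_pos_iff (by fun_prop)]
  have : Function.support (fun r : ℝ => ENNReal.ofReal (|r| ^ 2)) ∩ {r : ℝ | 0 < e * r ∧ e * r < c}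
      = {r : ℝ | 0 < e * r ∧ e * r < c} := by
    refine inter_eq_right.2 fun r hr => ?_
    have : r ≠ 0 := by rintro rfl; simp at hr
    simp [Function.mem_support, this]
  rw [this]
  refine hopen.measure_pos _ ⟨e * (c / 2), ?_⟩
  simp only [mem_ofPred_eq, ← mul_assoc, hee, one_mul]
  constructor <;> linarith

theorem coneWeight_lt_top {e c : ℝ} (he : |e| = 1) :
    ∫⁻ r in {r : ℝ | 0 < e * r ∧ e * r < c}, ENNReal.ofReal (|r| ^ 2) < ⊤ := by
  have hsub : {r : ℝ | 0 < e * r ∧ e * r < c} ⊆ Icc (-c) c := by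
    intro r ⟨h1, h2⟩
    have : |r| ≤ c := by
      rw [← one_mul |r|, ← he, ← abs_mul, abs_of_pos h1]; exact h2.le
    exact abs_le.1 this
  refine (lintegral_mono_set hsub).trans_lt ?_
  refine IntegrableOn.setLIntegral_lt_top ?_
  exact (continuous_abs.pow 2).integrableOn_Icc

/-- Points of the face have height between `1/2` and `1`, so the cone over `A` is caught between two
planar cones truncated at these heights. -/
theorem smul_cone_bounds {i : Fin 3} {e : ℝ} (he : |e| = 1) {A : Set R3}
    (hA : A ⊆ sphereFace i e) :
    planeCone i e (1 / 2) (planeCoord i '' A) ⊆ Ioo (0 : ℝ) 1 • A ∧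
      Ioo (0 : ℝ) 1 • A ⊆ planeCone i e 1 (planeCoord i '' A) := by
  constructor
  · rintro x ⟨⟨h0, h1⟩, y, hy, hyx⟩
    have hy2 := (hA hy).2
    have hy0 : y i ≠ 0 := by rintro h; rw [h] at hy2; norm_num at hy2
    have hx0 : x i ≠ 0 := by rintro h; rw [h] at h0; simp at h0
    have he0 : e ≠ 0 := by rintro rfl; simp at he
    have hratio : x i / y i = (e * x i) / (e * y i) := by
      rw [mul_div_mul_left _ _ he0]
    have hypos : 0 < e * y i := lt_of_lt_of_le (by norm_num) hy2
    refine mem_smul.2 ⟨x i / y i, ?_, y, hy, ?_⟩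
    · rw [hratio]
      exact ⟨div_pos h0 hypos, (div_lt_one hypos).2 (h1.trans_le hy2)⟩
    · have h := congrArg (fun z => (x i / y i) • z) (smul_planePoint_planeCoord hy0)
      simp only [smul_smul, div_mul_cancel₀ _ hy0] at h
      rw [← h, hyx, smul_planePoint_planeCoord hx0]
  · rintro _ ⟨r, ⟨hr0, hr1⟩, x, hx, rfl⟩
    have hx2 := (hA hx).2
    have hpos : 0 < e * x i := lt_of_lt_of_le (by norm_num) hx2
    refine ⟨⟨?_, ?_⟩, x, hx, (planeCoord_smul hr0.ne').symm⟩
    · simp only [PiLp.smul_apply, smul_eq_mul]; rw [mul_left_comm]; positivity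
    · simp only [PiLp.smul_apply, smul_eq_mul]; rw [mul_left_comm]
      have : e * x i ≤ 1 := by
        have h1 := PiLp.norm_apply_le x i
        rw [(hA hx).1] at h1
        exact (le_abs_self _).trans (by rw [abs_mul, he, one_mul]; exact h1)
      nlinarith

/-- On a face both quantities are comparable with the area of the central projection of `A` to a
plane: the Hausdorff measure because this projection is Lipschitz with Lipschitz inverse, the volume
of the cone because of the two planar cones. Precise constants are irrelevant. -/
theorem exists_sphereFace_comparison (i : Fin 3) {e : ℝ} (he : |e| = 1) :
    ∃ C : ℝ≥0∞, C ≠ ⊤ ∧ ∀ A : Set R3, MeasurableSet A → A ⊆ sphereFace i e →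
      μH[2] A ≤ C * volume (Ioo (0 : ℝ) 1 • A) ∧ volume (Ioo (0 : ℝ) 1 • A) ≤ C * μH[2] A := by
  set w₁ := ∫⁻ r in {r : ℝ | 0 < e * r ∧ e * r < 1 / 2}, ENNReal.ofReal (|r| ^ 2) with hw₁
  set w₂ := ∫⁻ r in {r : ℝ | 0 < e * r ∧ e * r < 1}, ENNReal.ofReal (|r| ^ 2) with hw₂
  have hw₁0 : w₁ ≠ 0 := (coneWeight_pos he (by norm_num)).ne'
  have hw₁t : w₁ ≠ ⊤ := (coneWeight_lt_top he).ne
  have hw₂t : w₂ ≠ ⊤ := (coneWeight_lt_top he).ne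
  refine ⟨4 ^ (2 : ℝ) * w₁⁻¹ + w₂ * 8 ^ (2 : ℝ), ?_, fun A hAm hA => ?_⟩
  · refine ENNReal.add_ne_top.2 ⟨ENNReal.mul_ne_top ?_ (ENNReal.inv_ne_top.2 hw₁0),
      ENNReal.mul_ne_top hw₂t ?_⟩
    all_goals exact ENNReal.rpow_ne_top_of_nonneg (by norm_num) (by norm_num)
  set B := planeCoord i '' A with hB
  let b : (Fin 2 → ℝ) → R3 := fun a => e • (‖planePoint i a‖⁻¹ • planePoint i a)
  have hbA : ∀ x ∈ A, b (planeCoord i x) = x := fun x hx =>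
    normalize_planePoint_planeCoord he (hA hx)
  have he0 : e ≠ 0 := by rintro rfl; simp at he
  have hb : LipschitzWith 4 b := by
    have h1 := (lipschitzOnWith_normalize (F := R3) one_pos).comp
      (lipschitzWith_planePoint i).lipschitzOnWith (s := univ)
      (fun a _ => by simpa using one_le_norm_planePoint i a)
    have h2 : LipschitzWith (2 / 1 * 2) (fun a => ‖planePoint i a‖⁻¹ • planePoint i a) :=
      lipschitzOnWith_univ.1 h1
    have h3 := (lipschitzWith_smul (β := R3) e).comp h2
    have : ‖e‖₊ * (2 / 1 * 2) = 4 := by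
      have : ‖e‖₊ = 1 := by ext; simpa using he
      rw [this]; norm_num
    rwa [this] at h3
  have hABimg : b '' B = A := by
    rw [hB, image_image]
    exact (image_congr hbA).trans (image_id' A)
  have hBpre : B = b ⁻¹' A := by
    ext a
    constructor
    · rintro ⟨x, hx, rfl⟩
      simpa [hbA x hx] using hx
    · intro ha
      refine ⟨b a, ha, ?_⟩
      have hn : ‖planePoint i a‖⁻¹ ≠ 0 :=
        inv_ne_zero (by have := one_le_norm_planePoint i a; positivity)
      simp only [b]
      rw [planeCoord_smul he0, planeCoord_smul hn, planeCoord_planePoint]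
  have hBm : MeasurableSet B := hBpre ▸ hb.continuous.measurable hAm
  obtain ⟨hc1, hc2⟩ := smul_cone_bounds he hA
  have h1 : μH[2] A ≤ 4 ^ (2 : ℝ) * volume B := by
    have := hb.hausdorffMeasure_image_le (d := 2) (by norm_num) B
    rwa [hABimg, hausdorffMeasure_fin_two] at this
  have h2 : volume B ≤ 8 ^ (2 : ℝ) * μH[2] A := by
    have := ((lipschitzOnWith_planeCoord he).mono hA).hausdorffMeasure_image_le
      (d := 2) (by norm_num)
    rwa [hausdorffMeasure_fin_two] at this
  have h3 : w₁ * volume B ≤ volume (Ioo (0 : ℝ) 1 • A) := by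
    rw [hw₁, ← volume_planeCone i e (1 / 2) hBm]; exact measure_mono hc1
  have h4 : volume (Ioo (0 : ℝ) 1 • A) ≤ w₂ * volume B := by
    rw [hw₂, ← volume_planeCone i e 1 hBm]; exact measure_mono hc2
  constructor
  · calc μH[2] A ≤ 4 ^ (2 : ℝ) * volume B := h1
      _ = 4 ^ (2 : ℝ) * w₁⁻¹ * (w₁ * volume B) := by
          rw [mul_assoc, ← mul_assoc w₁⁻¹ w₁, ENNReal.inv_mul_cancel hw₁0 hw₁t, one_mul]
      _ ≤ _ := by gcongr; exact le_self_add
  · calc _ ≤ w₂ * volume B := h4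
      _ ≤ w₂ * (8 ^ (2 : ℝ) * μH[2] A) := by gcongr
      _ ≤ _ := by rw [← mul_assoc]; gcongr; exact le_add_self

/-- If all coordinates were smaller than `1/2` in absolute value, the sum of their squares would be
less than `3/4`. -/
theorem sphere_subset_iUnion_sphereFace {x : R3} (hx : ‖x‖ = 1) :
    ∃ p : Fin 3 × Bool, x ∈ sphereFace p.1 (if p.2 then 1 else -1) := by
  by_contra! hcon
  have h1 : ∀ i, |x i| < 1 / 2 := by
    intro i
    have h1 := hcon (i, true)
    have h2 := hcon (i, false)
    simp only [sphereFace, mem_ofPred_eq, hx, true_and, not_le, if_true, one_mul] at h1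
    simp only [sphereFace, mem_ofPred_eq, hx, true_and, not_le, Bool.false_eq_true, if_false] at h2
    exact abs_lt.2 ⟨by linarith, h1⟩
  have h2 : ‖x‖ ^ 2 = ∑ i, |x i| ^ 2 := by
    rw [EuclideanSpace.norm_sq_eq]; rfl
  rw [hx, Fin.sum_univ_three] at h2
  have h3 : ∀ i, |x i| ^ 2 < 1 / 4 := fun i => by
    have := h1 i
    nlinarith [abs_nonneg (x i)]
  linarith [h3 0, h3 1, h3 2]

/-- The spherical measure in polar coordinates is defined through volumes of cones, whereas surface
measure is a Hausdorff measure; this comparison links the two. -/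
theorem exists_sphere_comparison :
    ∃ C : ℝ≥0∞, C ≠ ⊤ ∧ ∀ A : Set R3, MeasurableSet A → A ⊆ Metric.sphere 0 1 →
      μH[2] A ≤ C * volume (Ioo (0 : ℝ) 1 • A) ∧ volume (Ioo (0 : ℝ) 1 • A) ≤ C * μH[2] A := by
  have he : ∀ p : Fin 3 × Bool, |(if p.2 then 1 else -1 : ℝ)| = 1 := by
    rintro ⟨i, b⟩; cases b <;> simp
  choose C hC hCA using fun p : Fin 3 × Bool => exists_sphereFace_comparison p.1 (he p)
  refine ⟨∑ p, C p, ENNReal.sum_ne_top.2 fun p _ => hC p, fun A hAm hA => ?_⟩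
  let F : Fin 3 × Bool → Set R3 := fun p => A ∩ sphereFace p.1 (if p.2 then 1 else -1)
  have hF : A = ⋃ p, F p := by
    rw [← inter_iUnion]
    refine (inter_eq_left.2 fun x hx => ?_).symm
    exact mem_iUnion.2 (sphere_subset_iUnion_sphereFace (mem_sphere_zero_iff_norm.1 (hA hx)))
  have hFm : ∀ p, MeasurableSet (F p) := fun p => by
    refine hAm.inter (MeasurableSet.inter (s₁ := {x : R3 | ‖x‖ = 1}) ?_ ?_)
    · exact measurableSet_eq_fun (measurable_norm (α := R3)) measurable_const
    · exact measurableSet_le measurable_const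
        ((measurable_const_mul _).comp (by fun_prop : Measurable fun x : R3 => x.ofLp p.1))
  have hFA : ∀ p, F p ⊆ A := fun p => inter_subset_left
  constructor
  · calc μH[2] A ≤ ∑ p, μH[2] (F p) := by
          conv_lhs => rw [hF]
          exact measure_iUnion_fintype_le _ _
      _ ≤ ∑ p, C p * volume (Ioo (0 : ℝ) 1 • F p) :=
          Finset.sum_le_sum fun p _ => (hCA p _ (hFm p) inter_subset_right).1
      _ ≤ ∑ p, C p * volume (Ioo (0 : ℝ) 1 • A) := by
          gcongr with p; exact hFA p
      _ = _ := by rw [Finset.sum_mul]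
  · calc volume (Ioo (0 : ℝ) 1 • A) ≤ ∑ p, volume (Ioo (0 : ℝ) 1 • F p) := by
          conv_lhs => rw [hF, smul_iUnion]
          exact measure_iUnion_fintype_le _ _
      _ ≤ ∑ p, C p * μH[2] (F p) :=
          Finset.sum_le_sum fun p _ => (hCA p _ (hFm p) inter_subset_right).2
      _ ≤ ∑ p, C p * μH[2] A := by
          gcongr with p; exact hFA p
      _ = _ := by rw [Finset.sum_mul]

/-! ### The cone measure on the boundary of a convex domain -/

theorem lintegral_polar {h : R3 → ℝ≥0∞} (hh : Measurable h) :
    ∫⁻ x, h x = ∫⁻ w : Metric.sphere (0 : R3) 1, (∫⁻ r in Ioi (0 : ℝ),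
      ENNReal.ofReal (r ^ 2) * h (r • (w : R3))) ∂(volume : Measure R3).toSphere := by
  have hdim : Module.finrank ℝ R3 = 3 := by simp
  have hmp := (volume : Measure R3).measurePreserving_homeomorphUnitSphereProd
  rw [hdim] at hmp
  have h1 : ∫⁻ x, h x = ∫⁻ x : ({0}ᶜ : Set R3), h x ∂((volume : Measure R3).comap (↑)) := by
    rw [lintegral_subtype_comap (measurableSet_singleton _).compl, restrict_compl_singleton]
  have hg : Measurable fun q : Metric.sphere (0 : R3) 1 × Ioi (0 : ℝ) =>
      h ((q.2 : ℝ) • (q.1 : R3)) := by fun_prop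
  have h2 := hmp.lintegral_comp hg
  have h3 : ∀ x : ({0}ᶜ : Set R3), h x = h (((homeomorphUnitSphereProd R3 x).2 : ℝ) •
      ((homeomorphUnitSphereProd R3 x).1 : R3)) := by
    intro x
    have := congrArg Subtype.val ((homeomorphUnitSphereProd R3).symm_apply_apply x)
    change (((homeomorphUnitSphereProd R3 x).2 : ℝ) •
      ((homeomorphUnitSphereProd R3 x).1 : R3)) = x at this
    rw [this]
  rw [h1, lintegral_congr h3, h2, lintegral_prod _ hg.aemeasurable]
  refine lintegral_congr fun w => ?_
  rw [Measure.volumeIoiPow, lintegral_withDensity_eq_lintegral_mul _ (by fun_prop) (by fun_prop)]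
  rw [← lintegral_subtype_comap measurableSet_Ioi
    (fun r : ℝ => ENNReal.ofReal (r ^ 2) * h (r • (w : R3)))]
  rfl

theorem lintegral_Ioi_comp_mul_left {a : ℝ} (ha : 0 < a) {F : ℝ → ℝ≥0∞} (hF : Measurable F) :
    ∫⁻ r in Ioi (0 : ℝ), F r = ENNReal.ofReal a * ∫⁻ r in Ioi (0 : ℝ), F (a * r) := by
  rw [← lintegral_indicator measurableSet_Ioi, ← lintegral_indicator measurableSet_Ioi]
  conv_lhs => rw [← Real.smul_map_volume_mul_left ha.ne']
  rw [lintegral_smul_measure, abs_of_pos ha,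
    lintegral_map (hF.indicator measurableSet_Ioi) (measurable_const_mul a), smul_eq_mul]
  congr 1
  refine lintegral_congr fun r => ?_
  by_cases hr : 0 < r
  · rw [indicator_of_mem (mem_Ioi.2 (mul_pos ha hr)), indicator_of_mem (mem_Ioi.2 hr)]
  · rw [indicator_of_notMem (by simpa [ha] using hr), indicator_of_notMem (by simpa using hr)]

section Cone

variable {Ω : Set R3}

/-- Radial projection to the boundary of `Ω`. -/
noncomputable def radialProj (Ω : Set R3) (x : R3) : R3 := (gauge Ω x)⁻¹ • x

theorem lipschitzOnWith_radialProj {r R : ℝ} (hr : 0 < r) (hR : 0 < R) (hΩc : Convex ℝ Ω)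
    (hrΩ : Metric.ball 0 r ⊆ Ω) (hΩR : Ω ⊆ Metric.closedBall 0 R) :
    LipschitzOnWith (R + R ^ 2 / r).toNNReal (radialProj Ω) (Metric.sphere 0 1) := by
  refine LipschitzOnWith.of_dist_le_mul fun x hx y hy => ?_
  have hx1 : ‖x‖ = 1 := mem_sphere_zero_iff_norm.1 hx
  have hy1 : ‖y‖ = 1 := mem_sphere_zero_iff_norm.1 hy
  have habs : Absorbent ℝ Ω := (absorbent_ball_zero hr).mono hrΩ
  have hlow : ∀ z : R3, ‖z‖ = 1 → 1 / R ≤ gauge Ω z := fun z hz => by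
    have := le_gauge_of_subset_closedBall (x := z) habs hR.le hΩR
    rwa [hz] at this
  have hjx := hlow x hx1
  have hjy := hlow y hy1
  have hjx0 : 0 < gauge Ω x := (by positivity : 0 < 1 / R).trans_le hjx
  have hjy0 : 0 < gauge Ω y := (by positivity : 0 < 1 / R).trans_le hjy
  have hlip := (hΩc.lipschitzWith_gauge (r := ⟨r, hr.le⟩) hr hrΩ).dist_le_mul x y
  rw [Real.coe_toNNReal _ (by positivity), radialProj, radialProj, dist_eq_norm, dist_eq_norm]
  have h1 : (gauge Ω x)⁻¹ • x - (gauge Ω y)⁻¹ • y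
      = (gauge Ω x)⁻¹ • (x - y) + ((gauge Ω x)⁻¹ - (gauge Ω y)⁻¹) • y := by
    rw [smul_sub, sub_smul]; abel
  have hxi : (gauge Ω x)⁻¹ ≤ R := by
    rw [inv_le_comm₀ hjx0 hR]; simpa using hjx
  have hyi : (gauge Ω y)⁻¹ ≤ R := by
    rw [inv_le_comm₀ hjy0 hR]; simpa using hjy
  have h2 : |(gauge Ω x)⁻¹ - (gauge Ω y)⁻¹| ≤ R ^ 2 / r * ‖x - y‖ := by
    have h3 : (gauge Ω x)⁻¹ - (gauge Ω y)⁻¹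
        = (gauge Ω x)⁻¹ * (gauge Ω y)⁻¹ * (gauge Ω y - gauge Ω x) := by field_simp
    rw [h3, abs_mul, abs_of_pos (by positivity), abs_sub_comm, ← Real.dist_eq]
    rw [dist_eq_norm x y] at hlip
    calc _ ≤ R * R * (((⟨r, hr.le⟩ : ℝ≥0)⁻¹ : ℝ≥0) * ‖x - y‖) := by gcongr
      _ = R ^ 2 / r * ‖x - y‖ := by
        change R * R * (r⁻¹ * ‖x - y‖) = _
        ring
  calc _ ≤ (gauge Ω x)⁻¹ * ‖x - y‖ + |(gauge Ω x)⁻¹ - (gauge Ω y)⁻¹| * ‖y‖ := by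
        rw [h1]
        refine (norm_add_le _ _).trans_eq ?_
        rw [norm_smul, norm_smul, Real.norm_eq_abs, Real.norm_eq_abs, abs_of_pos (inv_pos.2 hjx0)]
    _ ≤ R * ‖x - y‖ + R ^ 2 / r * ‖x - y‖ * 1 := by rw [hy1]; gcongr
    _ = _ := by ring

/-- There is a finite measure on the boundary of a convex domain, comparable with the Hausdorff
measure, for which the formula for polar coordinates holds. -/
theorem exists_coneMeasure {r R : ℝ} (hr : 0 < r) (hR : 0 < R) (hΩc : Convex ℝ Ω)
    (hrΩ : Metric.ball 0 r ⊆ Ω) (hΩR : Ω ⊆ Metric.closedBall 0 R) :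
    ∃ ν : Measure R3, IsFiniteMeasure ν ∧
      (∃ C : ℝ≥0∞, C ≠ ⊤ ∧ ∀ A : Set R3, MeasurableSet A →
        ν A ≤ C * μH[2] (A ∩ frontier Ω) ∧ μH[2] (A ∩ frontier Ω) ≤ C * ν A) ∧
      ∀ h : R3 → ℝ≥0∞, Measurable h → ∫⁻ x, h x =
        ∫⁻ y, (∫⁻ ρ in Ioi (0 : ℝ), ENNReal.ofReal (ρ ^ 2) * h (ρ • y)) ∂ν := by
  have habs : Absorbent ℝ Ω := (absorbent_ball_zero hr).mono hrΩ
  have h0 : Ω ∈ 𝓝 (0 : R3) := mem_of_superset (Metric.ball_mem_nhds 0 hr) hrΩ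
  have hlow : ∀ z : R3, ‖z‖ = 1 → 1 / R ≤ gauge Ω z := fun z hz => by
    have := le_gauge_of_subset_closedBall (x := z) habs hR.le hΩR
    rwa [hz] at this
  have hup : ∀ z : R3, ‖z‖ = 1 → gauge Ω z ≤ 1 / r := fun z hz => by
    have := mul_gauge_le_norm (x := z) hrΩ
    rw [hz] at this
    rwa [le_div_iff₀' hr]
  have hjc : Continuous (gauge Ω) := continuous_gauge hΩc h0
  have hpm : Measurable (radialProj Ω) := hjc.measurable.inv.smul measurable_id
  set s : Measure (Metric.sphere (0 : R3) 1) := (volume : Measure R3).toSphere with hs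
  -- The factor `(gauge)⁻³` is the Jacobian of the substitution which replaces `r` by `ρ / gauge` in
  -- `r² dr`, that is, which rescales each ray so that the boundary of `Ω` is at `ρ = 1`.
  set d : Metric.sphere (0 : R3) 1 → ℝ≥0∞ := fun w => ENNReal.ofReal (((gauge Ω w)⁻¹) ^ 3) with hd
  have hdm : Measurable d := by
    have : Measurable fun w : Metric.sphere (0 : R3) 1 => gauge Ω w :=
      hjc.measurable.comp measurable_subtype_coe
    fun_prop
  have hpv : Measurable fun w : Metric.sphere (0 : R3) 1 => radialProj Ω w :=
    hpm.comp measurable_subtype_coe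
  have hdle : ∀ w, d w ≤ ENNReal.ofReal (R ^ 3) := fun w => by
    have h1 := hlow w (mem_sphere_zero_iff_norm.1 w.2)
    have hj0 : 0 < gauge Ω w := (by positivity : 0 < 1 / R).trans_le h1
    refine ENNReal.ofReal_le_ofReal (pow_le_pow_left₀ (by positivity) ?_ 3)
    rw [inv_le_comm₀ hj0 hR]; simpa using h1
  have hled : ∀ w, ENNReal.ofReal (r ^ 3) ≤ d w := fun w => by
    have h1 := hlow w (mem_sphere_zero_iff_norm.1 w.2)
    have h2 := hup w (mem_sphere_zero_iff_norm.1 w.2)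
    have hj0 : 0 < gauge Ω w := (by positivity : 0 < 1 / R).trans_le h1
    refine ENNReal.ofReal_le_ofReal (pow_le_pow_left₀ hr.le ?_ 3)
    rw [le_inv_comm₀ hr hj0]; simpa using h2
  have hνA : ∀ A : Set R3, MeasurableSet A →
      (s.withDensity d).map (fun w : Metric.sphere (0 : R3) 1 => radialProj Ω w) A
        = ∫⁻ w in (fun w : Metric.sphere (0 : R3) 1 => radialProj Ω w) ⁻¹' A, d w ∂s := by
    intro A hA
    rw [Measure.map_apply hpv hA, withDensity_apply _ (hpv hA)]
  obtain ⟨C, hCt, hC⟩ := exists_sphere_comparison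
  let r' : ℝ≥0 := ⟨r, hr.le⟩
  set K₁ : ℝ≥0∞ := (((R + R ^ 2 / r).toNNReal : ℝ≥0) : ℝ≥0∞) ^ (2 : ℝ) with hK₁
  set K₂ : ℝ≥0∞ := ((2 / r' : ℝ≥0) : ℝ≥0∞) ^ (2 : ℝ) with hK₂
  have hfin3 : ∀ A : Set (Metric.sphere (0 : R3) 1), MeasurableSet A →
      s A = 3 * volume (Ioo (0 : ℝ) 1 • ((↑) '' A : Set R3)) := by
    intro A hA
    rw [hs, Measure.toSphere_apply' _ hA]
    simp
  refine ⟨(s.withDensity d).map (fun w : Metric.sphere (0 : R3) 1 => radialProj Ω w), ?_, ⟨(ENNReal.ofReal (R ^ 3) * 3 * C * K₂)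
    + K₁ * C * (ENNReal.ofReal (r ^ 3))⁻¹, ?_, ?_⟩, ?_⟩
  · refine ⟨?_⟩
    rw [hνA _ .univ]
    refine (lintegral_mono hdle).trans_lt ?_
    rw [lintegral_const]
    exact ENNReal.mul_lt_top ENNReal.ofReal_lt_top (measure_lt_top _ _)
  · have hr3 : ENNReal.ofReal (r ^ 3) ≠ 0 := by simp; positivity
    refine ENNReal.add_ne_top.2 ⟨?_, ?_⟩
    · refine ENNReal.mul_ne_top (ENNReal.mul_ne_top (ENNReal.mul_ne_top ENNReal.ofReal_ne_top
        (by simp)) hCt) (ENNReal.rpow_ne_top_of_nonneg (by norm_num) ENNReal.coe_ne_top)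
    · refine ENNReal.mul_ne_top (ENNReal.mul_ne_top
        (ENNReal.rpow_ne_top_of_nonneg (by norm_num) ENNReal.coe_ne_top) hCt)
        (ENNReal.inv_ne_top.2 hr3)
  · intro A hA
    set B : Set (Metric.sphere (0 : R3) 1) := (fun w => radialProj Ω w) ⁻¹' A with hB
    have hBm : MeasurableSet B := hpv hA
    set A' : Set R3 := (↑) '' B with hA'
    have hA'm : MeasurableSet A' :=
      (MeasurableEmbedding.subtype_coe Metric.isClosed_sphere.measurableSet).measurableSet_image' hBm
    have hA's : A' ⊆ Metric.sphere 0 1 := by rintro _ ⟨w, _, rfl⟩; exact w.2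
    have himg : radialProj Ω '' A' = A ∩ frontier Ω := by
      ext y
      constructor
      · rintro ⟨_, ⟨w, hw, rfl⟩, rfl⟩
        refine ⟨hw, ?_⟩
        have h1 := hlow w (mem_sphere_zero_iff_norm.1 w.2)
        have hj0 : 0 < gauge Ω w := (by positivity : 0 < 1 / R).trans_le h1
        rw [← gauge_eq_one_iff_mem_frontier hΩc h0, radialProj,
          gauge_smul_of_nonneg (inv_nonneg.2 hj0.le), smul_eq_mul, inv_mul_cancel₀ hj0.ne']
      · rintro ⟨hyA, hyf⟩
        have hg1 : gauge Ω y = 1 := (gauge_eq_one_iff_mem_frontier hΩc h0).2 hyf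
        have hy0 : y ≠ 0 := by rintro rfl; simp at hg1
        have hyn : 0 < ‖y‖ := norm_pos_iff.2 hy0
        have hpy : radialProj Ω (‖y‖⁻¹ • y) = y := by
          rw [radialProj, gauge_smul_of_nonneg (inv_nonneg.2 hyn.le), hg1, smul_smul]
          simp [hyn.ne']
        have hsy : ‖y‖⁻¹ • y ∈ Metric.sphere (0 : R3) 1 := by
          rw [mem_sphere_zero_iff_norm, norm_smul, norm_inv, norm_norm, inv_mul_cancel₀ hyn.ne']
        refine ⟨‖y‖⁻¹ • y, ⟨⟨_, hsy⟩, ?_, rfl⟩, hpy⟩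
        change radialProj Ω (‖y‖⁻¹ • y) ∈ A
        rwa [hpy]
    have himg' : (fun y : R3 => ‖y‖⁻¹ • y) '' (A ∩ frontier Ω) = A' := by
      rw [← himg, image_image]
      refine (image_congr fun x hx => ?_).trans (image_id' A')
      have hx1 : ‖x‖ = 1 := mem_sphere_zero_iff_norm.1 (hA's hx)
      have hj0 : 0 < gauge Ω x := (by positivity : 0 < 1 / R).trans_le (hlow x hx1)
      rw [radialProj, norm_smul, hx1, smul_smul, norm_inv, Real.norm_eq_abs, abs_of_pos hj0]
      simp [hj0.ne']
    have hfr : A ∩ frontier Ω ⊆ {x : R3 | (r' : ℝ) ≤ ‖x‖} := by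
      rintro y ⟨-, hyf⟩
      have hg1 : gauge Ω y = 1 := (gauge_eq_one_iff_mem_frontier hΩc h0).2 hyf
      have := mul_gauge_le_norm (x := y) hrΩ
      rw [hg1, mul_one] at this
      exact this
    -- Radial projection and normalization are inverse to each other between `A'` and `A ∩ frontier
    -- Ω`, and both are Lipschitz; so the two Hausdorff measures are comparable.
    have hH1 : μH[2] (A ∩ frontier Ω) ≤ K₁ * μH[2] A' := by
      rw [← himg]
      exact ((lipschitzOnWith_radialProj hr hR hΩc hrΩ hΩR).mono hA's).hausdorffMeasure_image_le
        (by norm_num)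
    have hH2 : μH[2] A' ≤ K₂ * μH[2] (A ∩ frontier Ω) := by
      rw [← himg']
      exact ((lipschitzOnWith_normalize (F := R3) (r := r') hr).mono
        hfr).hausdorffMeasure_image_le (by norm_num)
    obtain ⟨hC1, hC2⟩ := hC A' hA'm hA's
    rw [hνA A hA]
    constructor
    · calc ∫⁻ w in B, d w ∂s ≤ ∫⁻ w in B, ENNReal.ofReal (R ^ 3) ∂s := lintegral_mono hdle
        _ = ENNReal.ofReal (R ^ 3) * (3 * volume (Ioo (0 : ℝ) 1 • A')) := by
            rw [lintegral_const, Measure.restrict_apply_univ, hfin3 B hBm]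
        _ ≤ ENNReal.ofReal (R ^ 3) * (3 * (C * (K₂ * μH[2] (A ∩ frontier Ω)))) := by
            gcongr
            exact hC2.trans (by gcongr)
        _ = (ENNReal.ofReal (R ^ 3) * 3 * C * K₂) * μH[2] (A ∩ frontier Ω) := by ring
        _ ≤ _ := by gcongr; exact le_self_add
    · have hr3 : ENNReal.ofReal (r ^ 3) ≠ 0 := by simp; positivity
      have hlow' : ENNReal.ofReal (r ^ 3) * volume (Ioo (0 : ℝ) 1 • A') ≤ ∫⁻ w in B, d w ∂s := by
        calc _ ≤ ENNReal.ofReal (r ^ 3) * (3 * volume (Ioo (0 : ℝ) 1 • A')) := by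
              gcongr
              exact le_mul_of_one_le_left zero_le (by norm_num)
          _ = ∫⁻ w in B, ENNReal.ofReal (r ^ 3) ∂s := by
            rw [lintegral_const, Measure.restrict_apply_univ, hfin3 B hBm]
          _ ≤ _ := lintegral_mono hled
      calc μH[2] (A ∩ frontier Ω) ≤ K₁ * (C * volume (Ioo (0 : ℝ) 1 • A')) :=
            hH1.trans (by gcongr)
        _ = K₁ * C * (ENNReal.ofReal (r ^ 3))⁻¹ *
            (ENNReal.ofReal (r ^ 3) * volume (Ioo (0 : ℝ) 1 • A')) := by
            rw [mul_assoc (K₁ * C), ← mul_assoc _ (ENNReal.ofReal (r ^ 3)),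
              ENNReal.inv_mul_cancel hr3 ENNReal.ofReal_ne_top, one_mul, mul_assoc]
        _ ≤ _ := by
          gcongr
          exact le_add_self
  · intro h hh
    have hF : Measurable fun y : R3 =>
        ∫⁻ ρ in Ioi (0 : ℝ), ENNReal.ofReal (ρ ^ 2) * h (ρ • y) := by
      refine Measurable.lintegral_prod_right' (f := fun q : R3 × ℝ =>
        ENNReal.ofReal (q.2 ^ 2) * h (q.2 • q.1)) ?_
      fun_prop
    rw [lintegral_map hF hpv, lintegral_polar hh]
    refine Eq.trans ?_ (lintegral_withDensity_eq_lintegral_mul s hdm (hF.comp hpv)).symm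
    refine lintegral_congr fun w => ?_
    have h1 := hlow w (mem_sphere_zero_iff_norm.1 w.2)
    have hj0 : 0 < gauge Ω w := (by positivity : 0 < 1 / R).trans_le h1
    have hFm : Measurable fun r : ℝ => ENNReal.ofReal (r ^ 2) * h (r • (w : R3)) := by fun_prop
    rw [lintegral_Ioi_comp_mul_left (inv_pos.2 hj0) hFm]
    simp only [Pi.mul_apply, Function.comp_apply, hd]
    rw [← lintegral_const_mul _ (by fun_prop), ← lintegral_const_mul _ (by fun_prop)]
    refine lintegral_congr fun ρ => ?_
    rw [radialProj, smul_smul, mul_comm ρ, ← mul_assoc, ← mul_assoc,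
      ← ENNReal.ofReal_mul (by positivity), ← ENNReal.ofReal_mul (by positivity)]
    congr 2
    ring

end Cone

/-! ### The Gauss–Green formula on a convex domain -/

section GaugeDeriv

variable {F : Type*} [NormedAddCommGroup F] [NormedSpace ℝ F] {s : Set F}

theorem hasFDerivAt_gauge_of_smul {L : F →L[ℝ] ℝ} {y : F} {c : ℝ} (hc : 0 < c)
    (h : HasFDerivAt (gauge s) L (c • y)) : HasFDerivAt (gauge s) L y := by
  have h1 : HasFDerivAt (fun x : F => c • x) (c • ContinuousLinearMap.id ℝ F) y :=
    (hasFDerivAt_id y).const_smul c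
  have h2 := (HasFDerivAt.comp y h h1).const_smul c⁻¹
  have h3 : (fun x : F => c⁻¹ • (gauge s ∘ fun x : F => c • x) x) = gauge s := by
    ext x
    simp only [Function.comp_apply]
    rw [gauge_smul_of_nonneg hc.le, smul_smul, inv_mul_cancel₀ hc.ne', one_smul]
  have h4 : c⁻¹ • L.comp (c • ContinuousLinearMap.id ℝ F) = L := by
    ext x
    simp [hc.ne']
  rw [h4] at h2
  exact h2.congr_of_eventuallyEq (Eventually.of_forall fun x => (congrFun h3 x).symm)

theorem hasFDerivAt_gauge_smul_iff {L : F →L[ℝ] ℝ} {y : F} {c : ℝ} (hc : 0 < c) :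
    HasFDerivAt (gauge s) L (c • y) ↔ HasFDerivAt (gauge s) L y := by
  refine ⟨hasFDerivAt_gauge_of_smul hc, fun h => ?_⟩
  refine hasFDerivAt_gauge_of_smul (inv_pos.2 hc) ?_
  rwa [smul_smul, inv_mul_cancel₀ hc.ne', one_smul]

theorem fderiv_gauge_smul {y : F} {c : ℝ} (hc : 0 < c) :
    fderiv ℝ (gauge s) (c • y) = fderiv ℝ (gauge s) y := by
  by_cases h : DifferentiableAt ℝ (gauge s) y
  · exact ((hasFDerivAt_gauge_smul_iff hc).2 h.hasFDerivAt).fderiv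
  · rw [fderiv_zero_of_not_differentiableAt h, fderiv_zero_of_not_differentiableAt]
    exact fun h' => h ((hasFDerivAt_gauge_smul_iff hc).1 h'.hasFDerivAt).differentiableAt

/-- Euler's identity for a positively homogeneous function of degree one. -/
theorem HasFDerivAt.gauge_apply_self {L : F →L[ℝ] ℝ} {y : F} (h : HasFDerivAt (gauge s) L y) :
    L y = gauge s y := by
  have h1 : HasDerivAt (fun t : ℝ => t • y) y 1 := by
    simpa using (hasDerivAt_id (1 : ℝ)).smul_const y
  have h' : HasFDerivAt (gauge s) L ((1 : ℝ) • y) := by rwa [one_smul]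
  have h2 := h'.comp_hasDerivAt (1 : ℝ) h1
  have h3 : HasDerivAt (fun t : ℝ => t * gauge s y) (gauge s y) 1 := by
    simpa using (hasDerivAt_id (1 : ℝ)).mul_const (gauge s y)
  refine h2.unique (h3.congr_of_eventuallyEq ?_)
  filter_upwards [lt_mem_nhds (zero_lt_one' ℝ)] with t ht
  rw [Function.comp_apply, gauge_smul_of_nonneg ht.le, smul_eq_mul]

/-- From subadditivity: the difference quotient of the gauge at `y` in the direction `z` is at most
`gauge s z`. With Euler's identity it shows that the gradient at a boundary point is a supporting
vector. -/
theorem HasFDerivAt.gauge_apply_le (hs : Convex ℝ s) (habs : Absorbent ℝ s) {L : F →L[ℝ] ℝ}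
    {y : F} (h : HasFDerivAt (gauge s) L y) (z : F) : L z ≤ gauge s z := by
  have h1 : HasDerivAt (fun t : ℝ => y + t • z) z 0 := by
    simpa using ((hasDerivAt_id (0 : ℝ)).smul_const z).const_add y
  have h' : HasFDerivAt (gauge s) L (y + (0 : ℝ) • z) := by simpa using h
  have h2 := (h'.comp_hasDerivAt (0 : ℝ) h1).tendsto_slope_zero_right
  refine le_of_tendsto h2 ?_
  filter_upwards [self_mem_nhdsWithin] with t (ht : 0 < t)
  simp only [Function.comp_apply, zero_add, zero_smul, add_zero, smul_eq_mul]
  rw [inv_mul_le_iff₀ ht]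
  have := gauge_add_le hs habs y (t • z)
  rw [gauge_smul_of_nonneg ht.le, smul_eq_mul] at this
  linarith

end GaugeDeriv

theorem integral_polar_of_lintegral {ν : Measure R3} [IsFiniteMeasure ν]
    (hν : ∀ h : R3 → ℝ≥0∞, Measurable h → ∫⁻ x, h x =
      ∫⁻ y, (∫⁻ ρ in Ioi (0 : ℝ), ENNReal.ofReal (ρ ^ 2) * h (ρ • y)) ∂ν)
    {h : R3 → ℝ} (hm : Measurable h) (hi : Integrable h) :
    ∫ x, h x = ∫ ρ in Ioi (0 : ℝ), ρ ^ 2 * ∫ y, h (ρ • y) ∂ν := by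
  set μ₂ : Measure ℝ := (volume.restrict (Ioi (0 : ℝ))).withDensity
    (fun ρ => ENNReal.ofReal (ρ ^ 2)) with hμ₂
  have hmm : Measurable fun q : R3 × ℝ => q.2 • q.1 := by fun_prop
  have hmap : (ν.prod μ₂).map (fun q : R3 × ℝ => q.2 • q.1) = volume := by
    refine Measure.ext_of_lintegral _ fun g hg => ?_
    rw [lintegral_map hg hmm, lintegral_prod _ (by fun_prop), hν g hg]
    refine lintegral_congr fun y => ?_
    rw [hμ₂, lintegral_withDensity_eq_lintegral_mul _ (by fun_prop) (by fun_prop)]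
    rfl
  rw [← hmap, integral_map hmm.aemeasurable hm.aestronglyMeasurable]
  have hi' : Integrable (fun q : R3 × ℝ => h (q.2 • q.1)) (ν.prod μ₂) := by
    rw [← hmap] at hi
    exact (integrable_map_measure hm.aestronglyMeasurable hmm.aemeasurable).1 hi
  rw [integral_prod_symm _ hi', hμ₂, integral_withDensity_eq_integral_toReal_smul (by fun_prop)
    (by simp)]
  refine setIntegral_congr_fun measurableSet_Ioi fun ρ _ => ?_
  simp only [smul_eq_mul]
  rw [ENNReal.toReal_ofReal (sq_nonneg ρ)]

/-- A ramp from `1` at `1 - ε` to `0` at `1`. -/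
noncomputable def ramp (ε t : ℝ) : ℝ := max 0 (min 1 (ε⁻¹ * (1 - t)))

theorem lipschitzWith_ramp {ε : ℝ} (hε : 0 < ε) :
    LipschitzWith ⟨ε⁻¹, (inv_pos.2 hε).le⟩ (ramp ε) := by
  have h1 : LipschitzWith ⟨ε⁻¹, (inv_pos.2 hε).le⟩ fun t : ℝ => ε⁻¹ * (1 - t) := by
    refine LipschitzWith.of_dist_le_mul fun x y => ?_
    rw [Real.dist_eq, Real.dist_eq, ← mul_sub, abs_mul, abs_of_pos (inv_pos.2 hε),
      show 1 - x - (1 - y) = -(x - y) by ring, abs_neg]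
    rfl
  exact (h1.const_min 1).const_max 0

theorem ramp_nonneg (ε t : ℝ) : 0 ≤ ramp ε t := le_max_left _ _

theorem ramp_le_one (ε t : ℝ) : ramp ε t ≤ 1 := max_le zero_le_one (min_le_left _ _)

theorem ramp_of_one_le {ε t : ℝ} (hε : 0 < ε) (ht : 1 ≤ t) : ramp ε t = 0 := by
  refine max_eq_left ((min_le_right _ _).trans ?_)
  exact mul_nonpos_of_nonneg_of_nonpos (inv_pos.2 hε).le (by linarith)

theorem ramp_of_le {ε t : ℝ} (hε : 0 < ε) (ht : t ≤ 1 - ε) : ramp ε t = 1 := by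
  have : 1 ≤ ε⁻¹ * (1 - t) := by rw [le_inv_mul_iff₀ hε]; linarith
  rw [ramp, min_eq_left this, max_eq_right zero_le_one]

theorem hasDerivAt_ramp {ε t : ℝ} (hε : 0 < ε) (h1 : t ≠ 1) (h2 : t ≠ 1 - ε) :
    HasDerivAt (ramp ε) ((Ioo (1 - ε) 1).indicator (fun _ => -ε⁻¹) t) t := by
  rcases lt_or_gt_of_ne h2 with h | h
  · rw [indicator_of_notMem (fun hh => absurd hh.1 (not_lt.2 h.le))]
    refine (hasDerivAt_const t (1 : ℝ)).congr_of_eventuallyEq ?_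
    filter_upwards [gt_mem_nhds h] with x hx using ramp_of_le hε hx.le
  · rcases lt_or_gt_of_ne h1 with h' | h'
    · rw [indicator_of_mem (show t ∈ Ioo (1 - ε) 1 from ⟨h, h'⟩)]
      have h3 : HasDerivAt (fun t : ℝ => ε⁻¹ * (1 - t)) (-ε⁻¹) t := by
        simpa using ((hasDerivAt_id t).const_sub 1).const_mul ε⁻¹
      refine h3.congr_of_eventuallyEq ?_
      filter_upwards [Ioo_mem_nhds h h'] with x hx
      have hi : 0 < ε⁻¹ := inv_pos.2 hε
      rw [ramp, min_eq_right, max_eq_right]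
      · exact mul_nonneg hi.le (by linarith [hx.2])
      · rw [inv_mul_le_iff₀ hε]; linarith [hx.1]
    · rw [indicator_of_notMem (fun hh => absurd hh.2 (not_lt.2 h'.le))]
      refine (hasDerivAt_const t (0 : ℝ)).congr_of_eventuallyEq ?_
      filter_upwards [lt_mem_nhds h'] with x hx using ramp_of_one_le hε hx.le

/-- The indicator of `Ω` is the limit of ramps of the gauge `j`. Integration by parts puts the
derivative on the ramp and produces the mean of `f ⟪∇j, v⟫` over the shell `1 - ε < j < 1`. In polar
coordinates adapted to `Ω` this is a mean over `ρ` of integrals over the boundary, since `∇j` is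
constant along rays, and it converges to the integral at `ρ = 1`. No regularity of the boundary is
used; `N` is the gradient of the gauge. -/
theorem exists_gaussGreen_of_ball_subset {Ω : Set R3} {r R : ℝ} (hr : 0 < r) (hR : 0 < R)
    (hΩo : IsOpen Ω) (hΩc : Convex ℝ Ω) (hrΩ : Metric.ball 0 r ⊆ Ω)
    (hΩR : Ω ⊆ Metric.closedBall 0 R) :
    ∃ (ν : Measure R3) (N : R3 → R3) (a b : ℝ), IsFiniteMeasure ν ∧
      (∃ C : ℝ≥0∞, C ≠ ⊤ ∧ ∀ A : Set R3, MeasurableSet A →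
        ν A ≤ C * μH[2] (A ∩ frontier Ω) ∧ μH[2] (A ∩ frontier Ω) ≤ C * ν A) ∧
      Measurable N ∧ 0 < a ∧
      (∀ᵐ y ∂ν, a ≤ ‖N y‖ ∧ ‖N y‖ ≤ b ∧ ∀ z ∈ Ω, inner ℝ (N y) (z - y) ≤ 0) ∧
      ∀ f : R3 → ℝ, ContDiff ℝ 1 f → HasCompactSupport f → ∀ v : R3,
        ∫ x in Ω, fderiv ℝ f x v = ∫ y, f y * inner ℝ (N y) v ∂ν := by
  obtain ⟨ν, hνf, ⟨C, hCt, hC⟩, hpolar⟩ := exists_coneMeasure hr hR hΩc hrΩ hΩR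
  have habs : Absorbent ℝ Ω := (absorbent_ball_zero hr).mono hrΩ
  have h0 : Ω ∈ 𝓝 (0 : R3) := mem_of_superset (Metric.ball_mem_nhds 0 hr) hrΩ
  set j : R3 → ℝ := gauge Ω with hj
  have hjc : Continuous j := continuous_gauge hΩc h0
  have hjl : LipschitzWith (⟨r, hr.le⟩ : ℝ≥0)⁻¹ j := hΩc.lipschitzWith_gauge hr hrΩ
  set N : R3 → R3 := gradient j with hN
  have hNm : Measurable N :=
    (InnerProductSpace.toDual ℝ R3).symm.continuous.measurable.comp (measurable_fderiv ℝ j)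
  have hNv : ∀ x v, inner ℝ (N x) v = fderiv ℝ j x v := fun x v => by
    rw [hN, gradient, InnerProductSpace.toDual_symm_apply]
  have hNnorm : ∀ x, ‖N x‖ ≤ r⁻¹ := fun x => by
    rw [hN, gradient, LinearIsometryEquiv.norm_map]
    exact norm_fderiv_le_of_lipschitz ℝ hjl
  have hfr : ∀ᵐ y ∂ν, j y = 1 := by
    have : ν (frontier Ω)ᶜ = 0 := by
      have := (hC (frontier Ω)ᶜ isClosed_frontier.measurableSet.compl).1
      rwa [compl_inter_self, measure_empty, mul_zero, nonpos_iff_eq_zero] at this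
    filter_upwards [compl_mem_ae_iff.2 this] with y hy
    rw [compl_compl] at hy
    exact (gauge_eq_one_iff_mem_frontier hΩc h0).2 hy
  -- Rademacher's theorem gives differentiability almost everywhere in space. The points of
  -- differentiability other than the origin form a cone, so by the polar formula the ray through
  -- `ν`-almost every `y` contains one of them, and then `y` is one too.
  have hdiff : ∀ᵐ y ∂ν, DifferentiableAt ℝ j y := by
    have hDm : MeasurableSet {x | DifferentiableAt ℝ j x} := measurableSet_of_differentiableAt ℝ j
    have h1 : ∫⁻ x, {x | DifferentiableAt ℝ j x}ᶜ.indicator (1 : R3 → ℝ≥0∞) x = 0 := by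
      rw [lintegral_indicator_one hDm.compl]
      exact hjl.ae_differentiableAt
    have hind : Measurable ({x | DifferentiableAt ℝ j x}ᶜ.indicator (1 : R3 → ℝ≥0∞)) :=
      measurable_one.indicator hDm.compl
    rw [hpolar _ hind] at h1
    have hF : Measurable fun y : R3 => ∫⁻ ρ in Ioi (0 : ℝ), ENNReal.ofReal (ρ ^ 2) *
        {x | DifferentiableAt ℝ j x}ᶜ.indicator (1 : R3 → ℝ≥0∞) (ρ • y) := by
      refine Measurable.lintegral_prod_right' (f := fun q : R3 × ℝ =>
        ENNReal.ofReal (q.2 ^ 2) * {x | DifferentiableAt ℝ j x}ᶜ.indicator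
          (1 : R3 → ℝ≥0∞) (q.2 • q.1)) ?_
      fun_prop
    rw [lintegral_eq_zero_iff hF] at h1
    filter_upwards [h1] with y hy
    have hy' : ∫⁻ ρ in Ioi (0 : ℝ), ENNReal.ofReal (ρ ^ 2) *
        {x | DifferentiableAt ℝ j x}ᶜ.indicator (1 : R3 → ℝ≥0∞) (ρ • y) = 0 := hy
    rw [lintegral_eq_zero_iff (by fun_prop)] at hy'
    have hne : (ae (volume.restrict (Ioi (0 : ℝ)))).NeBot := by
      rw [ae_neBot, Ne, Measure.restrict_eq_zero]; simp
    obtain ⟨ρ, hρ1, hρ2⟩ := (hy'.and (ae_restrict_mem measurableSet_Ioi)).exists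
    have hρ0 : (0 : ℝ) < ρ := hρ2
    have hpos : ENNReal.ofReal (ρ ^ 2) ≠ 0 := by simp; positivity
    have hd : DifferentiableAt ℝ j (ρ • y) := by
      by_contra hcon
      have : ENNReal.ofReal (ρ ^ 2) * {x | DifferentiableAt ℝ j x}ᶜ.indicator
        (1 : R3 → ℝ≥0∞) (ρ • y) = 0 := hρ1
      rw [indicator_of_mem (show ρ • y ∈ {x | DifferentiableAt ℝ j x}ᶜ from hcon)] at this
      simp [hρ0.ne'] at this
    exact ((hasFDerivAt_gauge_smul_iff hρ0).1 hd.hasFDerivAt).differentiableAt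
  -- The upper bound is the Lipschitz constant of the gauge. The lower bound follows from `⟪N y, y⟫
  -- = 1` and `‖y‖ ≤ R`.
  refine ⟨ν, N, R⁻¹, r⁻¹, hνf, ⟨C, hCt, hC⟩, hNm, inv_pos.2 hR, ?_, ?_⟩
  · filter_upwards [hfr, hdiff] with y hy1 hy2
    have hNy : inner ℝ (N y) y = 1 := by
      rw [hNv, HasFDerivAt.gauge_apply_self hy2.hasFDerivAt, ← hy1]
    refine ⟨?_, hNnorm y, fun z hz => ?_⟩
    · have h1 : ‖y‖ ≤ R := by
        have := le_gauge_of_subset_closedBall (x := y) habs hR.le hΩR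
        rwa [← hj, hy1, div_le_one hR] at this
      have h2 := real_inner_le_norm (N y) y
      rw [hNy] at h2
      rw [inv_le_iff_one_le_mul₀ hR]
      exact h2.trans (by gcongr)
    · rw [inner_sub_right, hNy, hNv]
      have h1 := HasFDerivAt.gauge_apply_le hΩc habs hy2.hasFDerivAt z
      have h2 := gauge_lt_one_of_mem_of_isOpen hΩo hz
      linarith
  · intro f hf hfc v
    obtain ⟨Kf, hKf⟩ := hf.lipschitzWith_of_hasCompactSupport hfc one_ne_zero
    have hfd : Differentiable ℝ f := hf.differentiable one_ne_zero
    obtain ⟨M, hM⟩ := hfc.exists_bound_of_continuous hf.continuous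
    set B : ℝ → ℝ := fun ρ => ∫ y, f (ρ • y) * inner ℝ (N y) v ∂ν with hB
    have hBc : Continuous B := by
      refine continuous_of_dominated (bound := fun _ => M * (r⁻¹ * ‖v‖)) ?_ ?_ ?_ ?_
      · intro ρ
        have := hf.continuous.measurable
        fun_prop
      · intro ρ
        refine Eventually.of_forall fun y => ?_
        rw [norm_mul]
        gcongr
        · exact (norm_nonneg _).trans (hM 0)
        · exact hM _
        · exact (norm_inner_le_norm _ _).trans (by gcongr; exact hNnorm y)
      · exact integrable_const _
      · refine Eventually.of_forall fun y => ?_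
        have := hf.continuous
        fun_prop
    -- the identity for the ramp
    have hramp : ∀ ε : ℝ, 0 < ε → ε < 1 → ∫ x, fderiv ℝ f x v * ramp ε (j x)
        = ε⁻¹ * ∫ ρ in (1 - ε)..1, ρ ^ 2 * B ρ := by
      intro ε hε hε1
      have h1 := LipschitzWith.integral_lineDeriv_mul_eq (μ := volume)
        ((lipschitzWith_ramp hε).comp hjl) hKf hfc v
      have h2 : ∀ x, lineDeriv ℝ f x (-v) * (ramp ε ∘ j) x = -(fderiv ℝ f x v * ramp ε (j x)) := by
        intro x
        rw [(hfd x).lineDeriv_eq_fderiv, map_neg, Function.comp_apply, neg_mul]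
      rw [integral_congr_ae (Eventually.of_forall h2), integral_neg] at h1
      rw [← neg_eq_iff_eq_neg.2 h1]
      set g : R3 → ℝ := fun x => (Ioo (1 - ε) 1).indicator (fun _ => (1 : ℝ)) (j x) *
        (f x * inner ℝ (N x) v) with hg
      -- Level sets of the gauge are dilates of the boundary of a convex set, hence null. So the two
      -- corners of the ramp do not matter.
      have hlevel : ∀ c : ℝ, 0 < c → ∀ᵐ x : R3, j x ≠ c := by
        intro c hc
        have hfr0 : volume (frontier Ω) = 0 := hΩc.addHaar_frontier volume
        have : volume {x | j x = c} = 0 := by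
          have hsub : {x | j x = c} ⊆ (fun x : R3 => c⁻¹ • x) ⁻¹' frontier Ω := by
            intro x hx
            rw [mem_preimage, ← gauge_eq_one_iff_mem_frontier hΩc h0,
              gauge_smul_of_nonneg (inv_nonneg.2 hc.le)]
            have : gauge Ω x = c := hx
            rw [this, smul_eq_mul, inv_mul_cancel₀ hc.ne']
          refine measure_mono_null hsub ?_
          rw [Measure.addHaar_preimage_smul _ (inv_ne_zero hc.ne'), hfr0, mul_zero]
        exact measure_eq_zero_iff_ae_notMem.1 this
      have h3 : ∀ᵐ x : R3, lineDeriv ℝ (ramp ε ∘ j) x v * f x = -ε⁻¹ * g x := by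
        filter_upwards [hlevel 1 one_pos, hlevel (1 - ε) (by linarith),
          hjl.ae_differentiableAt] with x hx1 hx2 hx3
        have h4 := (hasDerivAt_ramp hε hx1 hx2).hasFDerivAt.comp x hx3.hasFDerivAt
        rw [h4.differentiableAt.lineDeriv_eq_fderiv, h4.fderiv]
        simp only [hg, hNv, ContinuousLinearMap.comp_apply]
        by_cases hx : j x ∈ Ioo (1 - ε) 1
        · simp [hx]; ring
        · simp [hx]
      rw [integral_congr_ae h3, integral_const_mul, ← neg_mul, neg_neg]
      congr 1
      have hgm : Measurable g := by
        have h1 : Measurable fun x => (Ioo (1 - ε) 1).indicator (fun _ => (1 : ℝ)) (j x) :=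
          (measurable_const.indicator measurableSet_Ioo).comp hjc.measurable
        have := hf.continuous.measurable
        fun_prop
      have hgi : Integrable g := by
        refine Integrable.mono' (g := fun x => ‖f x‖ * (r⁻¹ * ‖v‖)) ?_ hgm.aestronglyMeasurable ?_
        · exact (hf.continuous.integrable_of_hasCompactSupport hfc).norm.mul_const _
        · refine Eventually.of_forall fun x => ?_
          rw [hg, norm_mul, norm_mul]
          have h1 : ‖(Ioo (1 - ε) 1).indicator (fun _ => (1 : ℝ)) (j x)‖ ≤ 1 := by
            by_cases hx : j x ∈ Ioo (1 - ε) 1 <;> simp [hx]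
          have h2 : ‖inner ℝ (N x) v‖ ≤ r⁻¹ * ‖v‖ :=
            (norm_inner_le_norm _ _).trans (by gcongr; exact hNnorm x)
          calc _ ≤ 1 * (‖f x‖ * (r⁻¹ * ‖v‖)) := by gcongr
            _ = _ := one_mul _
      rw [integral_polar_of_lintegral hpolar hgm hgi, intervalIntegral.integral_of_le (by linarith),
        integral_Ioc_eq_integral_Ioo]
      have h5 : ∀ ρ ∈ Ioi (0 : ℝ), ρ ^ 2 * ∫ y, g (ρ • y) ∂ν
          = (Ioo (1 - ε) 1).indicator (fun ρ => ρ ^ 2 * B ρ) ρ := by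
        intro ρ hρ
        have hρ0 : (0 : ℝ) < ρ := hρ
        have h6 : ∫ y, g (ρ • y) ∂ν = ∫ y, (Ioo (1 - ε) 1).indicator (fun _ => (1 : ℝ)) ρ *
            (f (ρ • y) * inner ℝ (N y) v) ∂ν := by
          refine integral_congr_ae ?_
          filter_upwards [hfr] with y hy
          have h7 : j (ρ • y) = ρ := by
            rw [hj, gauge_smul_of_nonneg hρ0.le, ← hj, hy, smul_eq_mul, mul_one]
          have h8 : inner ℝ (N (ρ • y)) v = inner ℝ (N y) v := by
            rw [hNv, hNv, hj, fderiv_gauge_smul hρ0]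
          simp only [hg, h7, h8]
        rw [h6, integral_const_mul]
        by_cases hx : ρ ∈ Ioo (1 - ε) 1
        · simp only [indicator_of_mem hx, one_mul, hB]
        · simp only [indicator_of_notMem hx, zero_mul, mul_zero]
      rw [setIntegral_congr_fun measurableSet_Ioi h5, setIntegral_indicator measurableSet_Ioo]
      congr 2
      exact inter_eq_right.2 fun ρ hρ => (by linarith [hρ.1] : (0 : ℝ) < ρ)
    -- let `ε` tend to zero
    set e : ℕ → ℝ := fun n => 1 / ((n : ℝ) + 2) with he
    have he0 : ∀ n, 0 < e n := fun n => by positivity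
    have he1 : ∀ n, e n < 1 := fun n => by
      rw [he, div_lt_one (by positivity)]
      have : (0 : ℝ) ≤ n := Nat.cast_nonneg n
      linarith
    have hetend : Tendsto e atTop (𝓝 0) := by
      have := tendsto_one_div_add_atTop_nhds_zero_nat (𝕜 := ℝ)
      have h2 := this.comp (tendsto_add_atTop_nat 1)
      refine h2.congr fun n => ?_
      simp only [Function.comp_apply, he]
      push_cast
      ring
    have hL : Tendsto (fun n => ∫ x, fderiv ℝ f x v * ramp (e n) (j x)) atTop
        (𝓝 (∫ x in Ω, fderiv ℝ f x v)) := by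
      rw [← integral_indicator hΩo.measurableSet]
      have hfv : Continuous fun x => fderiv ℝ f x v :=
        (hf.continuous_fderiv one_ne_zero).clm_apply continuous_const
      refine tendsto_integral_of_dominated_convergence (fun x => ‖fderiv ℝ f x v‖) ?_ ?_ ?_ ?_
      · intro n
        have := (lipschitzWith_ramp (he0 n)).continuous
        exact (hfv.mul (this.comp hjc)).aestronglyMeasurable
      · refine Integrable.norm (hfv.integrable_of_hasCompactSupport ?_)
        exact (hfc.fderiv_apply ℝ v)
      · intro n
        refine Eventually.of_forall fun x => ?_
        rw [norm_mul, Real.norm_of_nonneg (ramp_nonneg _ _)]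
        exact mul_le_of_le_one_right (norm_nonneg _) (ramp_le_one _ _)
      · refine Eventually.of_forall fun x => ?_
        by_cases hx : x ∈ Ω
        · rw [indicator_of_mem hx]
          have h1 := gauge_lt_one_of_mem_of_isOpen hΩo hx
          refine tendsto_const_nhds.congr' ?_
          filter_upwards [hetend.eventually (gt_mem_nhds (show 0 < 1 - j x by linarith))] with n hn
          rw [ramp_of_le (he0 n) (by linarith), mul_one]
        · rw [indicator_of_notMem hx]
          have h1 : 1 ≤ j x := one_le_gauge_of_notMem (hΩc.starConvex (mem_of_mem_nhds h0))
            (habs x) hx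
          refine tendsto_const_nhds.congr fun n => ?_
          rw [ramp_of_one_le (he0 n) h1, mul_zero]
    -- The mean of `ρ² B ρ` over `(1 - ε, 1)` is a left difference quotient at `1` of a primitive,
    -- so continuity of `B` suffices.
    have hRt : Tendsto (fun n => ∫ x, fderiv ℝ f x v * ramp (e n) (j x)) atTop (𝓝 (B 1)) := by
      have hc : Continuous fun ρ : ℝ => ρ ^ 2 * B ρ := by fun_prop
      have hd : HasDerivAt (fun x => ∫ ρ in (0 : ℝ)..x, ρ ^ 2 * B ρ) (1 ^ 2 * B 1) 1 :=
        intervalIntegral.integral_hasDerivAt_right (hc.intervalIntegrable _ _)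
          (hc.stronglyMeasurableAtFilter _ _) hc.continuousAt
      rw [hasDerivAt_iff_tendsto_slope_zero, one_pow, one_mul] at hd
      have hne : Tendsto (fun n => -e n) atTop (𝓝[≠] 0) := by
        refine tendsto_nhdsWithin_iff.2 ⟨by simpa using hetend.neg, ?_⟩
        exact Eventually.of_forall fun n => (neg_neg_of_pos (he0 n)).ne
      refine (hd.comp hne).congr fun n => ?_
      rw [hramp _ (he0 n) (he1 n)]
      simp only [Function.comp_apply, smul_eq_mul]
      rw [intervalIntegral.integral_interval_sub_left (hc.intervalIntegrable _ _)
        (hc.intervalIntegrable _ _), intervalIntegral.integral_symm, ← sub_eq_add_neg, inv_neg]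
      ring
    have := tendsto_nhds_unique hL hRt
    simpa [hB] using this

/-- The surface measure on `∂Ω`. -/
noncomputable def surfaceMeasure (Ω : Set R3) : Measure R3 :=
  (Measure.euclideanHausdorffMeasure 2 : Measure R3).restrict (frontier Ω)

theorem exists_gaussGreen_translate {Ω : Set R3} (hΩo : IsOpen Ω) (hΩc : Convex ℝ Ω)
    (hΩb : Bornology.IsBounded Ω) (hΩn : Ω.Nonempty) :
    ∃ (ν : Measure R3) (N : R3 → R3) (a b : ℝ), IsFiniteMeasure ν ∧
      (∃ C : ℝ≥0∞, C ≠ ⊤ ∧ ∀ A : Set R3, MeasurableSet A →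
        ν A ≤ C * μH[2] (A ∩ frontier Ω) ∧ μH[2] (A ∩ frontier Ω) ≤ C * ν A) ∧
      Measurable N ∧ 0 < a ∧
      (∀ᵐ y ∂ν, a ≤ ‖N y‖ ∧ ‖N y‖ ≤ b ∧ ∀ z ∈ Ω, inner ℝ (N y) (z - y) ≤ 0) ∧
      ∀ f : R3 → ℝ, ContDiff ℝ 1 f → HasCompactSupport f → ∀ v : R3,
        ∫ x in Ω, fderiv ℝ f x v = ∫ y, f y * inner ℝ (N y) v ∂ν := by
  obtain ⟨x₀, hx₀⟩ := hΩn
  let e : R3 ≃ᵢ R3 := IsometryEquiv.addRight x₀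
  have he : ∀ x, e x = x + x₀ := fun x => rfl
  have hes : ∀ x, e.symm x = x - x₀ := fun x => by
    apply e.injective; rw [e.apply_symm_apply, he, sub_add_cancel]
  have hem : Measurable e := e.continuous.measurable
  have hemb : MeasurableEmbedding e := e.toHomeomorph.measurableEmbedding
  set Ω₀ : Set R3 := e ⁻¹' Ω with hΩ₀
  have ho : IsOpen Ω₀ := hΩo.preimage e.continuous
  have hc : Convex ℝ Ω₀ := hΩc.translate_preimage_left x₀
  obtain ⟨r, hr, hrΩ⟩ := Metric.isOpen_iff.1 ho 0 (by simpa [hΩ₀, he] using hx₀)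
  have hb : Bornology.IsBounded Ω₀ := by
    have := e.symm.isometry.lipschitz.isBounded_image hΩb
    rwa [e.image_symm] at this
  obtain ⟨R, hR, hΩR⟩ := hb.subset_closedBall_lt 0 0
  obtain ⟨ν₀, N₀, a, b, hfin, ⟨C, hCt, hC⟩, hN₀, ha, hae, hgreen⟩ :=
    exists_gaussGreen_of_ball_subset hr hR ho hc hrΩ hΩR
  have hfr : frontier Ω₀ = e ⁻¹' frontier Ω := (e.toHomeomorph.preimage_frontier Ω).symm
  refine ⟨ν₀.map e, fun y => N₀ (e.symm y), a, b, Measure.isFiniteMeasure_map _ _,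
    ⟨C, hCt, fun A hA => ?_⟩, hN₀.comp e.symm.continuous.measurable, ha, ?_, ?_⟩
  · have h := hC (e ⁻¹' A) (hem hA)
    rw [hfr, ← preimage_inter, e.hausdorffMeasure_preimage] at h
    rwa [Measure.map_apply hem hA]
  · rw [hemb.ae_map_iff]
    filter_upwards [hae] with y hy
    refine ⟨?_, ?_, fun z hz => ?_⟩
    · simpa using hy.1
    · simpa using hy.2.1
    · have := hy.2.2 (e.symm z) (by simpa [hΩ₀] using hz)
      rw [hes] at this
      have h2 : e.symm (e y) = y := e.symm_apply_apply y
      change inner ℝ (N₀ (e.symm (e y))) (z - (y + x₀)) ≤ 0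
      rwa [h2, show z - (y + x₀) = z - x₀ - y by abel]
  · intro f hf hfc v
    have h := hgreen (fun x => f (x + x₀)) (by fun_prop) (hfc.comp_homeomorph e.toHomeomorph) v
    rw [hemb.integral_map]
    have h1 : ∫ x in Ω, fderiv ℝ f x v = ∫ x in Ω₀, fderiv ℝ f (x + x₀) v := by
      rw [hΩ₀]
      exact ((measurePreserving_add_right volume x₀).setIntegral_preimage_emb
        hemb (fun x => fderiv ℝ f x v) Ω).symm
    rw [h1]
    have h2 : ∀ x, fderiv ℝ (fun x => f (x + x₀)) x = fderiv ℝ f (x + x₀) :=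
      fun x => fderiv_comp_add_right x₀
    simp only [h2] at h
    rw [h]
    refine integral_congr_ae (Eventually.of_forall fun y => ?_)
    have h3 : e.symm (e y) = y := e.symm_apply_apply y
    change f (y + x₀) * inner ℝ (N₀ y) v = f (y + x₀) * inner ℝ (N₀ (e.symm (e y))) v
    rw [h3]

/-- The Gauss–Green formula on a convex domain, up to a bounded density of the surface measure. -/
theorem exists_gaussGreen {Ω : Set R3} (hΩo : IsOpen Ω) (hΩc : Convex ℝ Ω)
    (hΩb : Bornology.IsBounded Ω) (hΩn : Ω.Nonempty) (hΩs : HasSmoothBoundary Ω) :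
    IsFiniteMeasure (surfaceMeasure Ω) ∧
    ∃ (lam : R3 → ℝ) (a b : ℝ), Measurable lam ∧ 0 < a ∧ (∀ x, a ≤ lam x ∧ lam x ≤ b) ∧
      ∀ f : R3 → ℝ, ContDiff ℝ 1 f → HasCompactSupport f → ∀ v : R3,
        ∫ x in Ω, fderiv ℝ f x v
          = ∫ y, f y * (lam y * inner ℝ (outerNormal Ω y) v) ∂(surfaceMeasure Ω) := by
  obtain ⟨ν, N, a, b, hfin, ⟨C, hCt, hC⟩, hNm, ha, hae, hgreen⟩ :=
    exists_gaussGreen_translate hΩo hΩc hΩb hΩn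
  -- `c` is the factor that normalizes the Hausdorff measure to Lebesgue measure on planes; only `0
  -- < c < ∞` is used.
  obtain ⟨c, hc0, hSA⟩ : ∃ c : ℝ≥0, (c : ℝ≥0∞) ≠ 0 ∧ ∀ A : Set R3, MeasurableSet A →
      surfaceMeasure Ω A = c * μH[2] (A ∩ frontier Ω) := by
    refine ⟨Measure.addHaarScalarFactor (volume : Measure (EuclideanSpace ℝ (Fin 2)))
      μH[((2 : ℕ) : ℝ)], ?_, fun A hA => ?_⟩
    · intro h0
      have h1 := EuclideanSpace.euclideanHausdorffMeasure_eq_volume 2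
      rw [Measure.euclideanHausdorffMeasure_def, ENNReal.coe_eq_zero.1 h0, zero_smul] at h1
      exact (NeZero.ne (volume : Measure (EuclideanSpace ℝ (Fin 2)))) h1.symm
    · rw [surfaceMeasure, Measure.restrict_apply hA, Measure.euclideanHausdorffMeasure_def,
        Measure.smul_apply, ENNReal.smul_def, smul_eq_mul]
      norm_num
  set S := surfaceMeasure Ω with hS
  set K : ℝ≥0∞ := C * (c : ℝ≥0∞)⁻¹ + c * C + 1 with hK
  have hKt : K ≠ ⊤ := ENNReal.add_ne_top.2 ⟨ENNReal.add_ne_top.2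
    ⟨ENNReal.mul_ne_top hCt (ENNReal.inv_ne_top.2 hc0), ENNReal.mul_ne_top ENNReal.coe_ne_top hCt⟩,
    ENNReal.one_ne_top⟩
  have hK0 : K ≠ 0 := by rw [hK]; simp
  have hνS : ∀ A, MeasurableSet A → ν A ≤ K * S A := fun A hA => by
    calc ν A ≤ C * μH[2] (A ∩ frontier Ω) := (hC A hA).1
      _ = C * (c : ℝ≥0∞)⁻¹ * (c * μH[2] (A ∩ frontier Ω)) := by
        rw [mul_assoc, ← mul_assoc (c : ℝ≥0∞)⁻¹, ENNReal.inv_mul_cancel hc0 ENNReal.coe_ne_top,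
          one_mul]
      _ ≤ K * S A := by
        rw [hSA A hA]; gcongr; rw [hK, add_assoc]; exact le_self_add
  have hSν : ∀ A, MeasurableSet A → S A ≤ K * ν A := fun A hA => by
    calc S A = c * μH[2] (A ∩ frontier Ω) := hSA A hA
      _ ≤ c * (C * ν A) := by gcongr; exact (hC A hA).2
      _ ≤ K * ν A := by rw [← mul_assoc]; gcongr; rw [hK]; exact le_add_self.trans le_self_add
  have hSf : IsFiniteMeasure S := ⟨(hSν _ .univ).trans_lt
    (ENNReal.mul_lt_top hKt.lt_top (measure_lt_top _ _))⟩
  refine ⟨hSf, ?_⟩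
  have hacνS : ν ≪ S := Measure.AbsolutelyContinuous.mk fun A hA h0 => by
    have := hνS A hA
    rwa [h0, mul_zero, nonpos_iff_eq_zero] at this
  have hacSν : S ≪ ν := Measure.AbsolutelyContinuous.mk fun A hA h0 => by
    have := hSν A hA
    rwa [h0, mul_zero, nonpos_iff_eq_zero] at this
  have : IsFiniteMeasure S := hSf
  have hld : ν.HaveLebesgueDecomposition S := Measure.haveLebesgueDecomposition_of_sigmaFinite ν S
  set D := ν.rnDeriv S with hD
  have hDm : Measurable D := Measure.measurable_rnDeriv ν S
  have hdens : S.withDensity D = ν := Measure.withDensity_rnDeriv_eq ν S hacνS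
  have hD1 : ∀ᵐ y ∂S, D y ≤ K := by
    refine ae_le_of_forall_setLIntegral_le_of_sigmaFinite hDm fun A hA _ => ?_
    rw [← withDensity_apply D hA, hdens, setLIntegral_const]
    exact hνS A hA
  have hD2 : ∀ᵐ y ∂S, 1 ≤ K * D y := by
    refine ae_le_of_forall_setLIntegral_le_of_sigmaFinite measurable_const fun A hA _ => ?_
    rw [lintegral_const_mul _ hDm, ← withDensity_apply D hA, hdens, setLIntegral_const, one_mul]
    exact hSν A hA
  have hk0 : 0 < K.toReal := ENNReal.toReal_pos hK0 hKt
  -- The vector `N y` supports `Ω`, so it is `‖N y‖` times the outer normal, and the density of the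
  -- flux with respect to surface measure is `dν/dS` times `‖N‖`.
  set lam₀ : R3 → ℝ := fun y => (D y).toReal * ‖N y‖ with hlam₀
  set A₁ : ℝ := K.toReal⁻¹ * a with hA₁
  set B₁ : ℝ := max (K.toReal * b) A₁ with hB₁
  have hA₁0 : 0 < A₁ := by positivity
  -- Clamping changes the density on a null set only and makes the bounds hold at every point.
  refine ⟨fun y => max A₁ (min B₁ (lam₀ y)), A₁, B₁, ?_, hA₁0, ?_, ?_⟩
  · have := hDm.ennreal_toReal
    fun_prop
  · exact fun x => ⟨le_max_left _ _, max_le (le_max_right _ _) (min_le_left _ _)⟩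
  · intro f hf hfc v
    rw [hgreen f hf hfc v]
    conv_lhs => rw [← hdens]
    rw [integral_withDensity_eq_integral_toReal_smul hDm
      (hD1.mono fun y hy => hy.trans_lt hKt.lt_top)]
    refine integral_congr_ae ?_
    filter_upwards [hD1, hD2, hacSν.ae_le hae,
      ae_restrict_mem isClosed_frontier.measurableSet] with y h1 h2 h3 h4
    have hn0 : 0 < ‖N y‖ := ha.trans_le h3.1
    have hN0 : N y ≠ 0 := norm_pos_iff.1 hn0
    have hDt : D y ≠ ⊤ := (h1.trans_lt hKt.lt_top).ne
    have hd1 : (D y).toReal ≤ K.toReal := ENNReal.toReal_mono hKt h1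
    have hd2 : K.toReal⁻¹ ≤ (D y).toReal := by
      have := ENNReal.toReal_mono (ENNReal.mul_ne_top hKt hDt) h2
      rw [ENNReal.toReal_mul, ENNReal.toReal_one] at this
      rwa [inv_le_iff_one_le_mul₀' hk0]
    have hlamA : A₁ ≤ lam₀ y := by
      exact mul_le_mul hd2 h3.1 ha.le ENNReal.toReal_nonneg
    have hlamB : lam₀ y ≤ B₁ := by
      refine le_trans ?_ (le_max_left _ _)
      exact mul_le_mul hd1 h3.2.1 (norm_nonneg _) hk0.le
    rw [min_eq_right hlamB, max_eq_right hlamA, outerNormal_eq_of_support hΩs h4 hN0 h3.2.2,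
      inner_smul_left]
    simp only [hlam₀, smul_eq_mul, conj_trivial]
    field_simp

/-! ### Force fields and their characteristic flow -/

/-- A bounded Lipschitz force field on `ℝ³` without first component. -/
structure IsForceField (E : R3 → R3) (K : ℝ≥0) (M : ℝ) : Prop where
  lipschitz : LipschitzWith K E
  bound : ∀ x, ‖E x‖ ≤ M
  zero : ∀ x, E x 0 = 0

lemma IsForceField.bound_nonneg {E : R3 → R3} {K : ℝ≥0} {M : ℝ} (h : IsForceField E K M) : 0 ≤ M :=
  (norm_nonneg _).trans (h.bound 0)

lemma lipschitzWith_clamp (R : ℝ) :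
    LipschitzWith 1 (fun x : R3 => (WithLp.toLp 2 fun i => max (-R) (min R (x i)) : R3)) := by
  refine LipschitzWith.of_dist_le_mul fun x y => ?_
  rw [NNReal.coe_one, one_mul, EuclideanSpace.dist_eq, EuclideanSpace.dist_eq]
  refine Real.sqrt_le_sqrt (Finset.sum_le_sum fun i _ => ?_)
  have h : dist (max (-R) (min R (x i))) (max (-R) (min R (y i))) ≤ dist (x i) (y i) := by
    rw [Real.dist_eq, Real.dist_eq]
    exact (abs_max_sub_max_le_max _ _ _ _).trans
      (max_le (by simp) ((abs_min_sub_min_le_max _ _ _ _).trans (by simp)))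
  exact pow_le_pow_left₀ dist_nonneg h 2

/-- A `C¹` field on a compact convex set is Lipschitz and extends to a Lipschitz field.
Precomposition with the clamp to a cube makes it bounded, and the projection `P` removes the first
component; neither changes the field on `closure Ω`. A global bounded Lipschitz field has a global
flow. -/
lemma exists_forceField_extension {Ω : Set R3} (hΩc : Convex ℝ Ω)
    (hΩb : Bornology.IsBounded Ω) {E : R3 → R3} (hE : ContDiffOn ℝ 1 E (closure Ω))
    (hE₁ : ∀ x ∈ closure Ω, E x 0 = 0) :
    ∃ (F : R3 → R3) (K : ℝ≥0) (M : ℝ), IsForceField F K M ∧ EqOn F E (closure Ω) := by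
  have hcpt : IsCompact (closure Ω) := hΩb.isCompact_closure
  obtain ⟨K, hK⟩ := LocallyLipschitzOn.exists_lipschitzOnWith_of_compact hcpt
    (fun _ hx => hE.locallyLipschitzOn hΩc.closure hx)
  obtain ⟨g, hg, hgE⟩ := hK.extend_finite_dimension
  obtain ⟨R, hR⟩ := hcpt.isBounded.exists_norm_le
  let P : R3 →L[ℝ] R3 := ContinuousLinearMap.id ℝ R3 -
    (EuclideanSpace.proj (0 : Fin 3)).smulRight (EuclideanSpace.single (0 : Fin 3) (1 : ℝ))
  have hP : ∀ v : R3, v 0 = 0 → P v = v := fun v hv => by simp [P, hv]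
  have hP0 : ∀ v : R3, P v 0 = 0 := fun v => by simp [P]
  let c : R3 → R3 := fun x => WithLp.toLp 2 fun i => max (-R) (min R (x i))
  have hc : LipschitzWith 1 c := lipschitzWith_clamp R
  have hcR : ∀ x ∈ closure Ω, c x = x := by
    intro x hx
    ext i
    have h1 : |x i| ≤ R := (PiLp.norm_apply_le x i).trans (hR x hx)
    rw [abs_le] at h1
    simp [c, h1.1, h1.2]
  have hL : LipschitzWith (‖P‖₊ * (lipschitzExtensionConstant R3 * K * 1)) (fun x => P (g (c x))) :=
    P.lipschitz.comp (hg.comp hc)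
  have hbd : ∃ M, ∀ x, ‖P (g (c x))‖ ≤ M := by
    obtain ⟨M, hM⟩ := (isCompact_closedBall (0 : R3) (3 * |R|)).exists_bound_of_continuousOn
      (f := fun y => P (g y)) ((P.continuous.comp hg.continuous).continuousOn)
    refine ⟨M, fun x => hM _ ?_⟩
    rw [mem_closedBall_zero_iff, EuclideanSpace.norm_eq]
    have h1 : ∀ i, ‖c x i‖ ≤ |R| := by
      intro i
      simp only [c, Real.norm_eq_abs, abs_le]
      exact ⟨(neg_le_neg (le_abs_self R)).trans (le_max_left _ _),
        max_le (neg_le_abs R) ((min_le_left _ _).trans (le_abs_self R))⟩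
    refine (Real.sqrt_le_left (by positivity)).2 ?_
    rw [Fin.sum_univ_three]
    have h2 := fun i => pow_le_pow_left₀ (norm_nonneg _) (h1 i) 2
    nlinarith [h2 0, h2 1, h2 2, sq_nonneg (|R|)]
  obtain ⟨M, hM⟩ := hbd
  refine ⟨fun x => P (g (c x)), _, M, ⟨hL, hM, fun x => hP0 _⟩, fun x hx => ?_⟩
  simp only [hcR x hx]
  rw [← hgE hx, hP _ (hE₁ x hx)]

lemma HasDerivAt.coord {f : ℝ → R3} {f' : R3} {r : ℝ} (hf : HasDerivAt f f' r) (i : Fin 3) :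
    HasDerivAt (fun r => f r i) (f' i) r :=
  (EuclideanSpace.proj (𝕜 := ℝ) i).hasFDerivAt.comp_hasDerivAt r hf

/-- The vector field `(v, E(x))` on phase space. -/
def phaseField (E : R3 → R3) (z : Phase) : Phase := (z.2, E z.1)

lemma IsForceField.lipschitz_phaseField {E : R3 → R3} {K : ℝ≥0} {M : ℝ}
    (h : IsForceField E K M) : LipschitzWith (max 1 K) (phaseField E) := by
  have h2 : LipschitzWith (K * 1) (fun z : Phase => E z.1) := h.lipschitz.comp LipschitzWith.prod_fst
  rw [mul_one] at h2
  exact LipschitzWith.prodMk LipschitzWith.prod_snd h2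

lemma IsForceField.exists_solution_Icc {E : R3 → R3} {K : ℝ≥0} {M : ℝ}
    (h : IsForceField E K M) (z : Phase) {T : ℝ} (hT : 0 < T) :
    ∃ α : ℝ → Phase, α 0 = z ∧ ∀ t ∈ Ioo (-T) T, HasDerivAt α (phaseField E (α t)) t := by
  have hM := h.bound_nonneg
  -- Positions are scaled by `1/N` so that the solution cannot leave the ball of radius `a = ‖v‖ + M
  -- T` before time `T`: there the velocity is at most `2a`, hence the scaled position moves with
  -- speed at most `2a/N = a/T`, while the velocity changes by at most `M T ≤ a`.
  let N : ℝ := 2 * T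
  have hN : 0 < N := by positivity
  let a : ℝ≥0 := ⟨‖z.2‖ + M * T, by positivity⟩
  let L : ℝ≥0 := ⟨max (a / T) M, le_max_of_le_right hM⟩
  let z' : Phase := (N⁻¹ • z.1, z.2)
  let f : Phase → Phase := fun y => (N⁻¹ • y.2, E (N • y.1))
  have hf : LipschitzWith (max (‖N⁻¹‖₊ * 1) (K * (‖N‖₊ * 1))) f :=
    LipschitzWith.prodMk ((lipschitzWith_smul N⁻¹).comp LipschitzWith.prod_snd)
      (h.lipschitz.comp ((lipschitzWith_smul N).comp LipschitzWith.prod_fst))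
  have h0 : (0 : ℝ) ∈ Icc (-T) T := ⟨by linarith, hT.le⟩
  have hPL : IsPicardLindelof (fun _ => f) (tmin := -T) (tmax := T) ⟨0, h0⟩ z' a 0 L
      (max (‖N⁻¹‖₊ * 1) (K * (‖N‖₊ * 1))) := by
    refine IsPicardLindelof.of_time_independent (fun y hy => ?_) hf.lipschitzOnWith ?_
    · rw [Prod.norm_def]
      refine max_le_max ?_ (h.bound _)
      have h1 : ‖y.2 - z.2‖ ≤ a := by
        rw [mem_closedBall_iff_norm] at hy
        exact (norm_snd_le _).trans hy
      have h2 : ‖y.2‖ ≤ 2 * a := by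
        have h3 : ‖z.2‖ ≤ a := by change ‖z.2‖ ≤ ‖z.2‖ + M * T; nlinarith
        linarith [norm_sub_norm_le y.2 z.2]
      simp only [f, norm_smul, norm_inv, Real.norm_eq_abs, abs_of_pos hN]
      rw [le_div_iff₀ hT, inv_mul_eq_div, div_mul_eq_mul_div, div_le_iff₀ hN]
      simp only [N]; nlinarith
    · simp only [sub_zero, zero_sub, neg_neg, max_self, NNReal.coe_zero]
      change max ((a : ℝ) / T) M * T ≤ a
      rw [max_mul_of_nonneg _ _ hT.le, div_mul_cancel₀ _ hT.ne']
      refine max_le le_rfl ?_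
      change M * T ≤ ‖z.2‖ + M * T
      linarith [norm_nonneg z.2]
  obtain ⟨α, hα0, hα⟩ := hPL.exists_eq_forall_mem_Icc_hasDerivWithinAt₀
  refine ⟨fun t => (N • (α t).1, (α t).2), ?_, fun t ht => ?_⟩
  · have : α 0 = z' := hα0
    simp [this, z', smul_smul, hN.ne']
  · have h1 := (hα t (Ioo_subset_Icc_self ht)).hasDerivAt (Icc_mem_nhds ht.1 ht.2)
    have h2 : HasDerivAt (fun t => (α t).1) (f (α t)).1 t := h1.fst
    have h3 : HasDerivAt (fun t => (α t).2) (f (α t)).2 t := h1.snd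
    exact ((h2.const_smul N).prodMk h3).congr_deriv (by simp [phaseField, f, smul_smul, hN.ne'])

lemma IsForceField.exists_solution {E : R3 → R3} {K : ℝ≥0} {M : ℝ}
    (h : IsForceField E K M) (z : Phase) :
    ∃ α : ℝ → Phase, α 0 = z ∧ ∀ t, HasDerivAt α (phaseField E (α t)) t := by
  have hex : ∀ n : ℕ, ∃ α : ℝ → Phase, α 0 = z ∧
      ∀ t ∈ Ioo (-((n : ℝ) + 1)) ((n : ℝ) + 1), HasDerivAt α (phaseField E (α t)) t :=
    fun n => h.exists_solution_Icc z (by positivity)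
  choose α hα0 hα using hex
  have heq : ∀ m n : ℕ, m ≤ n → EqOn (α n) (α m) (Ioo (-((m : ℝ) + 1)) ((m : ℝ) + 1)) := by
    intro m n hmn
    have hmn' : (m : ℝ) ≤ n := by exact_mod_cast hmn
    refine ODE_solution_unique_of_mem_Ioo (v := fun _ => phaseField E) (s := fun _ => univ)
      (K := max 1 K) (t₀ := 0)
      (fun t _ => h.lipschitz_phaseField.lipschitzOnWith) ⟨by linarith [Nat.cast_nonneg (α := ℝ) m],
        by positivity⟩ (fun t ht => ⟨hα n t ⟨by linarith [ht.1], by linarith [ht.2]⟩, mem_univ _⟩)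
      (fun t ht => ⟨hα m t ht, mem_univ _⟩) (by rw [hα0, hα0])
  refine ⟨fun t => α ⌈|t|⌉₊ t, by simp [hα0], fun t => ?_⟩
  have hmem : t ∈ Ioo (-((⌈|t|⌉₊ : ℝ) + 1)) ((⌈|t|⌉₊ : ℝ) + 1) := by
    have h1 := Nat.le_ceil |t|
    have h2 := abs_le.mp h1
    exact ⟨by linarith, by linarith⟩
  refine (hα _ t hmem).congr_of_eventuallyEq ?_
  filter_upwards [Ioo_mem_nhds hmem.1 hmem.2] with s hs
  rcases le_total ⌈|s|⌉₊ ⌈|t|⌉₊ with hle | hle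
  · refine (heq _ _ hle ?_).symm
    have h1 := Nat.le_ceil |s|
    have h2 := abs_le.mp h1
    exact ⟨by linarith, by linarith⟩
  · exact heq _ _ hle hs

open Classical in
/-- The flow of the field `(v, E(x))`. -/
noncomputable def phaseFlow (E : R3 → R3) (s : ℝ) (z : Phase) : Phase :=
  if h : ∃ α : ℝ → Phase, α 0 = z ∧ ∀ t, HasDerivAt α (phaseField E (α t)) t then h.choose s else z

section Flow
variable {E : R3 → R3} {K : ℝ≥0} {M : ℝ} (h : IsForceField E K M)
include h

lemma flow_zero (z : Phase) : phaseFlow E 0 z = z := by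
  rw [phaseFlow, dif_pos (h.exists_solution z)]
  exact (h.exists_solution z).choose_spec.1

lemma hasDerivAt_flow (z : Phase) (s : ℝ) :
    HasDerivAt (fun r => phaseFlow E r z) (phaseField E (phaseFlow E s z)) s := by
  have h1 : (fun r => phaseFlow E r z) = (h.exists_solution z).choose := by
    funext r; rw [phaseFlow, dif_pos (h.exists_solution z)]
  have h2 : phaseFlow E s z = (h.exists_solution z).choose s := congrFun h1 s
  rw [h1, h2]
  exact (h.exists_solution z).choose_spec.2 s

lemma flow_unique {α : ℝ → Phase} (hα : ∀ t, HasDerivAt α (phaseField E (α t)) t) (s : ℝ) :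
    α s = phaseFlow E s (α 0) := by
  refine congrFun (ODE_solution_unique_univ (v := fun _ => phaseField E) (s := fun _ => univ)
    (K := max 1 K) (t₀ := 0) (f := α) (g := fun r => phaseFlow E r (α 0))
    (fun t => h.lipschitz_phaseField.lipschitzOnWith) (fun t => ⟨hα t, mem_univ _⟩)
    (fun t => ⟨hasDerivAt_flow h _ _, mem_univ _⟩) ?_) s
  exact (flow_zero h _).symm

lemma flow_add (s t : ℝ) (z : Phase) :
    phaseFlow E (s + t) z = phaseFlow E s (phaseFlow E t z) := by
  have h1 := flow_unique h (α := fun r => phaseFlow E (r + t) z)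
    (fun r => (hasDerivAt_flow h z (r + t)).comp_add_const r t) s
  simpa using h1

lemma flow_neg_flow (s : ℝ) (z : Phase) : phaseFlow E (-s) (phaseFlow E s z) = z := by
  rw [← flow_add h, neg_add_cancel, flow_zero h]

lemma flow_flow_neg (s : ℝ) (z : Phase) : phaseFlow E s (phaseFlow E (-s) z) = z := by
  rw [← flow_add h, add_neg_cancel, flow_zero h]

lemma hasDerivAt_flow_fst (z : Phase) (s : ℝ) :
    HasDerivAt (fun r => (phaseFlow E r z).1) (phaseFlow E s z).2 s := (hasDerivAt_flow h z s).fst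

lemma hasDerivAt_flow_snd (z : Phase) (s : ℝ) :
    HasDerivAt (fun r => (phaseFlow E r z).2) (E (phaseFlow E s z).1) s :=
  (hasDerivAt_flow h z s).snd

/-- The force depends on the position only, so reversing time and velocity maps solutions to
solutions. Statements about `Γ₋` are thereby reduced to `Γ₊`. -/
lemma flow_reverse (s : ℝ) (z : Phase) :
    phaseFlow E s (z.1, -z.2) = ((phaseFlow E (-s) z).1, -(phaseFlow E (-s) z).2) := by
  have h1 := flow_unique h
    (α := fun r => ((phaseFlow E (-r) z).1, -(phaseFlow E (-r) z).2)) (fun r => ?_) s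
  · rw [h1]; simp [flow_zero h]
  · have h2 := HasDerivAt.scomp r (hasDerivAt_flow_fst h z (-r)) (hasDerivAt_neg r)
    have h3 := (HasDerivAt.scomp r (hasDerivAt_flow_snd h z (-r)) (hasDerivAt_neg r)).neg
    exact (h2.prodMk h3).congr_deriv (by simp [phaseField])

lemma dist_flow_le_of_nonneg {s : ℝ} (hs : 0 ≤ s) (z w : Phase) :
    dist (phaseFlow E s z) (phaseFlow E s w) ≤ dist z w * Real.exp ((max 1 K : ℝ≥0) * s) := by
  have h1 := dist_le_of_trajectories_ODE (v := fun _ => phaseField E) (K := max 1 K) (a := 0) (b := s)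
    (f := fun r => phaseFlow E r z) (g := fun r => phaseFlow E r w) (δ := dist z w)
    (fun _ => h.lipschitz_phaseField)
    (fun r _ => (hasDerivAt_flow h z r).continuousAt.continuousWithinAt)
    (fun r _ => (hasDerivAt_flow h z r).hasDerivWithinAt)
    (fun r _ => (hasDerivAt_flow h w r).continuousAt.continuousWithinAt)
    (fun r _ => (hasDerivAt_flow h w r).hasDerivWithinAt)
    (by rw [flow_zero h, flow_zero h]) s ⟨hs, le_rfl⟩
  simpa using h1

lemma dist_flow_le (s : ℝ) (z w : Phase) :
    dist (phaseFlow E s z) (phaseFlow E s w) ≤ dist z w * Real.exp ((max 1 K : ℝ≥0) * |s|) := by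
  rcases le_total 0 s with hs | hs
  · rw [abs_of_nonneg hs]; exact dist_flow_le_of_nonneg h hs z w
  · rw [abs_of_nonpos hs]
    have hd : ∀ a b : Phase, dist (a.1, -a.2) (b.1, -b.2) = dist a b := fun a b => by
      simp [Prod.dist_eq]
    have h1 := dist_flow_le_of_nonneg h (neg_nonneg.2 hs) (z.1, -z.2) (w.1, -w.2)
    rwa [flow_reverse h, flow_reverse h, hd, hd, neg_neg] at h1

lemma continuous_flow : Continuous (fun p : ℝ × Phase => phaseFlow E p.1 p.2) := by
  rw [continuous_iff_continuousAt]
  rintro ⟨s, z⟩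
  rw [ContinuousAt, tendsto_iff_dist_tendsto_zero]
  have h1 : Tendsto (fun p : ℝ × Phase => dist p.2 z * Real.exp ((max 1 K : ℝ≥0) * |p.1|) +
      dist (phaseFlow E p.1 z) (phaseFlow E s z)) (𝓝 (s, z)) (𝓝 0) := by
    have h2 : Tendsto (fun p : ℝ × Phase => dist p.2 z * Real.exp ((max 1 K : ℝ≥0) * |p.1|))
        (𝓝 (s, z)) (𝓝 0) :=
      Continuous.tendsto' (by fun_prop) _ _ (by simp)
    have h3 : Tendsto (fun p : ℝ × Phase => dist (phaseFlow E p.1 z) (phaseFlow E s z))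
        (𝓝 (s, z)) (𝓝 0) := by
      have h4 := (hasDerivAt_flow h z s).continuousAt
      rw [ContinuousAt, tendsto_iff_dist_tendsto_zero] at h4
      exact h4.comp (continuous_fst.tendsto (s, z))
    simpa using h2.add h3
  refine squeeze_zero (fun _ => dist_nonneg) (fun p => ?_) h1
  exact (dist_triangle _ _ _).trans (add_le_add (dist_flow_le h p.1 p.2 z) le_rfl)

lemma continuous_flow_comp {X : Type*} [TopologicalSpace X] {f : X → ℝ} {g : X → Phase}
    (hf : Continuous f) (hg : Continuous g) : Continuous fun x => phaseFlow E (f x) (g x) :=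
  (continuous_flow h).comp (hf.prodMk hg)

/-- This is where the pseudo-3D assumption acts: the force has no first component, so `v₁` is
conserved. It makes every characteristic with `v₁ ≠ 0` leave `Ω`, and it keeps the condition `v₁ ∈
I` along characteristics. -/
lemma flow_snd_zero (s : ℝ) (z : Phase) : (phaseFlow E s z).2 0 = z.2 0 := by
  have h1 : ∀ r, HasDerivAt (fun r => (phaseFlow E r z).2 0) 0 r := fun r => by
    exact ((hasDerivAt_flow_snd h z r).coord 0).congr_deriv (h.zero _)
  have h3 := is_const_of_deriv_eq_zero (fun r => (h1 r).differentiableAt) (fun r => (h1 r).deriv) s 0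
  simpa [flow_zero h] using h3

lemma flow_fst_zero (s : ℝ) (z : Phase) : (phaseFlow E s z).1 0 = z.1 0 + s * z.2 0 := by
  have h1 : ∀ r, HasDerivAt (fun r => (phaseFlow E r z).1 0 - r * z.2 0) 0 r := fun r => by
    exact (((hasDerivAt_flow_fst h z r).coord 0).sub ((hasDerivAt_id r).mul_const (z.2 0))).congr_deriv
      (by simp [flow_snd_zero h])
  have h3 := is_const_of_deriv_eq_zero (fun r => (h1 r).differentiableAt) (fun r => (h1 r).deriv) s 0
  simp only [flow_zero h, zero_mul, sub_zero] at h3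
  linarith

lemma norm_flow_snd_sub_le (s : ℝ) (z : Phase) : ‖(phaseFlow E s z).2 - z.2‖ ≤ M * |s| := by
  have h1 := convex_univ.norm_image_sub_le_of_norm_hasDerivWithin_le (x := (0 : ℝ)) (y := s) (C := M)
    (fun r _ => (hasDerivAt_flow_snd h z r).hasDerivWithinAt) (fun r _ => h.bound _)
    (mem_univ _) (mem_univ _)
  simpa [flow_zero h] using h1

lemma norm_flow_fst_sub_le (s : ℝ) (z : Phase) :
    ‖(phaseFlow E s z).1 - z.1 - s • z.2‖ ≤ M * s ^ 2 := by
  have hd : ∀ r, HasDerivAt (fun r => (phaseFlow E r z).1 - r • z.2) ((phaseFlow E r z).2 - z.2) r :=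
    fun r => ((hasDerivAt_flow_fst h z r).sub ((hasDerivAt_id r).smul_const z.2)).congr_deriv
      (by rw [one_smul])
  have h1 := (convex_uIcc (0 : ℝ) s).norm_image_sub_le_of_norm_hasDerivWithin_le
    (x := (0 : ℝ)) (y := s) (C := M * |s|) (fun r _ => (hd r).hasDerivWithinAt)
    (fun r hr => (norm_flow_snd_sub_le h r z).trans
      (mul_le_mul_of_nonneg_left (by simpa using abs_sub_left_of_mem_uIcc hr) h.bound_nonneg))
    left_mem_uIcc right_mem_uIcc
  simp only [flow_zero h, zero_smul, sub_zero, Real.norm_eq_abs] at h1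
  rw [sub_right_comm, ← sq_abs s, sq, ← mul_assoc]
  exact h1

end Flow

/-! ### Liouville's theorem -/

/-- One step of the symplectic Euler scheme. -/
def symplecticStep (E : R3 → R3) (r : ℝ) (z : Phase) : Phase :=
  (z.1 + r • z.2, z.2 + r • E (z.1 + r • z.2))

section Liouville
variable {E : R3 → R3} {K : ℝ≥0} {M : ℝ} (h : IsForceField E K M)
include h

/-- The step is a composition of two shears, one in the position and one in the velocity, each of
which translates the fibres. -/
lemma measurePreserving_symplecticStep (r : ℝ) :
    MeasurePreserving (symplecticStep E r) volume volume := by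
  have hE := h.lipschitz.continuous
  have h1 : MeasurePreserving (fun z : Phase => (z.1, z.2 + r • E z.1)) volume volume := by
    refine MeasurePreserving.skew_product (g := fun x v => v + r • E x) (MeasurePreserving.id _)
      (by fun_prop) (Eventually.of_forall fun x => ?_)
    exact (measurePreserving_add_right volume (r • E x)).map_eq
  have h2 : MeasurePreserving (fun z : Phase => (z.1, z.2 + r • z.1)) volume volume := by
    refine MeasurePreserving.skew_product (g := fun x v => v + r • x) (MeasurePreserving.id _)
      (by fun_prop) (Eventually.of_forall fun x => ?_)
    exact (measurePreserving_add_right volume (r • x)).map_eq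
  have h3 : MeasurePreserving (Prod.swap : Phase → Phase) volume volume :=
    Measure.measurePreserving_swap
  exact h1.comp (h3.comp (h2.comp h3))

lemma symplecticStep_dist_le {r A : ℝ} (hr : |r| ≤ A) (a b : Phase) :
    dist (symplecticStep E r a) (symplecticStep E r b) ≤
      (1 + (1 + K * (1 + A)) * |r|) * dist a b := by
  have hA : 0 ≤ A := (abs_nonneg r).trans hr
  have hr0 := abs_nonneg r
  have hd := dist_nonneg (x := a) (y := b)
  have h1 : dist a.1 b.1 ≤ dist a b := le_max_left _ _
  have h2 : dist a.2 b.2 ≤ dist a b := le_max_right _ _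
  have h3 : dist (a.1 + r • a.2) (b.1 + r • b.2) ≤ (1 + |r|) * dist a b := by
    refine (dist_add_add_le _ _ _ _).trans ?_
    rw [dist_smul₀, Real.norm_eq_abs]
    nlinarith
  have hK : (0 : ℝ) ≤ K := K.2
  have h4 : dist (E (a.1 + r • a.2)) (E (b.1 + r • b.2)) ≤ K * ((1 + A) * dist a b) := by
    refine (h.lipschitz.dist_le_mul _ _).trans (mul_le_mul_of_nonneg_left (h3.trans ?_) hK)
    gcongr
  rw [Prod.dist_eq]
  refine max_le (h3.trans ?_) ?_
  · refine mul_le_mul_of_nonneg_right ?_ hd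
    have : 0 ≤ K * (1 + A) * |r| := by positivity
    linarith
  · refine (dist_add_add_le _ _ _ _).trans ?_
    rw [dist_smul₀, Real.norm_eq_abs]
    have h5 := mul_le_mul_of_nonneg_left h4 hr0
    have h6 : 0 ≤ |r| * dist a b := by positivity
    have h7 : |r| * dist (E (a.1 + r • a.2)) (E (b.1 + r • b.2)) ≤ K * (1 + A) * |r| * dist a b := by
      linarith
    linarith

lemma symplecticStep_dist_flow_le {r A B : ℝ} (hr : |r| ≤ A) (w : Phase) (hw : ‖w.2‖ ≤ B) :
    dist (symplecticStep E r w) (phaseFlow E r w) ≤ (M + K * (M * A + B)) * r ^ 2 := by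
  have hM := h.bound_nonneg
  have hA : 0 ≤ A := (abs_nonneg r).trans hr
  have hB : 0 ≤ B := (norm_nonneg _).trans hw
  have hK : (0 : ℝ) ≤ K := K.2
  rw [dist_comm, dist_eq_norm, Prod.norm_def]
  refine max_le ?_ ?_
  · have h1 := norm_flow_fst_sub_le h r w
    have h2 : (phaseFlow E r w - symplecticStep E r w).1 = (phaseFlow E r w).1 - w.1 - r • w.2 := by
      simp only [symplecticStep, Prod.fst_sub]; abel
    rw [h2]
    refine h1.trans (mul_le_mul_of_nonneg_right ?_ (sq_nonneg r))
    have : 0 ≤ K * (M * A + B) := by positivity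
    linarith
  · have hd : ∀ t, HasDerivAt (fun t => (phaseFlow E t w).2 - t • E (w.1 + r • w.2))
        (E (phaseFlow E t w).1 - E (w.1 + r • w.2)) t := fun t =>
      ((hasDerivAt_flow_snd h w t).sub ((hasDerivAt_id t).smul_const _)).congr_deriv
        (by rw [one_smul])
    have hb : ∀ t ∈ uIcc 0 r, ‖E (phaseFlow E t w).1 - E (w.1 + r • w.2)‖ ≤
        K * (M * A + B) * |r| := by
      intro t ht
      have ht1 : |t| ≤ |r| := by simpa using abs_sub_left_of_mem_uIcc ht
      have ht2 : |t - r| ≤ |r| := by simpa [abs_sub_comm] using abs_sub_right_of_mem_uIcc ht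
      rw [← dist_eq_norm]
      refine (h.lipschitz.dist_le_mul _ _).trans ?_
      rw [mul_assoc]
      refine mul_le_mul_of_nonneg_left ?_ hK
      rw [dist_eq_norm, show (phaseFlow E t w).1 - (w.1 + r • w.2) =
        ((phaseFlow E t w).1 - w.1 - t • w.2) + (t - r) • w.2 by rw [sub_smul]; abel]
      refine (norm_add_le _ _).trans ?_
      rw [norm_smul, Real.norm_eq_abs, add_mul]
      refine add_le_add ((norm_flow_fst_sub_le h t w).trans ?_) ?_
      · rw [← sq_abs, sq, mul_assoc]
        exact mul_le_mul_of_nonneg_left (mul_le_mul (ht1.trans hr) ht1 (abs_nonneg _) hA) hM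
      · rw [mul_comm B]
        exact mul_le_mul ht2 hw (norm_nonneg _) (abs_nonneg _)
    have h1 := (convex_uIcc (0 : ℝ) r).norm_image_sub_le_of_norm_hasDerivWithin_le
      (x := (0 : ℝ)) (y := r) (C := K * (M * A + B) * |r|) (fun t _ => (hd t).hasDerivWithinAt)
      hb left_mem_uIcc right_mem_uIcc
    have h2 : (phaseFlow E r w - symplecticStep E r w).2 =
        (phaseFlow E r w).2 - r • E (w.1 + r • w.2) -
          ((phaseFlow E 0 w).2 - (0 : ℝ) • E (w.1 + r • w.2)) := by
      simp only [symplecticStep, Prod.snd_sub, flow_zero h, zero_smul, sub_zero]; abel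
    rw [h2]
    refine h1.trans ?_
    rw [sub_zero, Real.norm_eq_abs, mul_assoc, ← sq, sq_abs]
    exact mul_le_mul_of_nonneg_right (by linarith) (sq_nonneg r)

/-- Discrete Gronwall argument: every step adds a local error of order `r²`, and earlier errors grow
at each step by the Lipschitz constant `q = 1 + O(|r|)` of the scheme. The velocity stays bounded
along the exact flow because the force is bounded. -/
lemma dist_iterate_symplecticStep_le (z : Phase) {r A : ℝ} (n : ℕ) (hr : n * |r| ≤ A) (hrA : |r| ≤ A) :
    dist ((symplecticStep E r)^[n] z) (phaseFlow E (n * r) z) ≤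
      n * ((M + K * (M * A + (‖z.2‖ + M * A))) * r ^ 2) * (1 + (1 + K * (1 + A)) * |r|) ^ n := by
  have hM := h.bound_nonneg
  have hA : 0 ≤ A := (abs_nonneg r).trans hrA
  have hK : (0 : ℝ) ≤ K := K.2
  set C := (M + K * (M * A + (‖z.2‖ + M * A))) * r ^ 2
  set q := 1 + (1 + K * (1 + A)) * |r|
  have hC : 0 ≤ C := by positivity
  have hq : 1 ≤ q := by
    have : 0 ≤ (1 + K * (1 + A)) * |r| := by positivity
    linarith
  induction n with
  | zero => simp [flow_zero h]
  | succ n ih =>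
    have hn : (n : ℝ) * |r| ≤ A := le_trans (by gcongr; simp) hr
    have ih' := ih hn
    rw [Function.iterate_succ_apply']
    have h1 : phaseFlow E ((n + 1 : ℕ) * r) z = phaseFlow E r (phaseFlow E (n * r) z) := by
      rw [← flow_add h]; congr 1; push_cast; ring
    have h2 : ‖(phaseFlow E (n * r) z).2‖ ≤ ‖z.2‖ + M * A := by
      have h3 := norm_flow_snd_sub_le h (n * r) z
      rw [abs_mul, Nat.abs_cast] at h3
      have h4 := norm_sub_norm_le (phaseFlow E (n * r) z).2 z.2
      have h5 := mul_le_mul_of_nonneg_left hn hM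
      linarith
    rw [h1]
    refine (dist_triangle _ (symplecticStep E r (phaseFlow E (n * r) z)) _).trans ?_
    refine (add_le_add (symplecticStep_dist_le h hrA _ _)
      (symplecticStep_dist_flow_le h hrA _ h2)).trans ?_
    have h6 : C ≤ C * q ^ (n + 1) := le_mul_of_one_le_right hC (one_le_pow₀ hq)
    have h7 := mul_le_mul_of_nonneg_left ih' (zero_le_one.trans hq)
    push_cast
    calc q * _ + C ≤ q * (n * C * q ^ n) + C * q ^ (n + 1) := add_le_add h7 h6
      _ = _ := by ring

lemma tendsto_iterate_symplecticStep (T : ℝ) (z : Phase) :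
    Tendsto (fun n : ℕ => (symplecticStep E (T / (n + 1 : ℕ)))^[n + 1] z) atTop
      (𝓝 (phaseFlow E T z)) := by
  rw [tendsto_iff_dist_tendsto_zero]
  have hK : (0 : ℝ) ≤ K := K.2
  set C := M + K * (M * |T| + (‖z.2‖ + M * |T|))
  have hC : 0 ≤ C := by have := h.bound_nonneg; positivity
  set c := 1 + (K : ℝ) * (1 + |T|)
  have hc : 0 ≤ c := by positivity
  have hlim : Tendsto (fun n : ℕ => C * T ^ 2 * Real.exp (c * |T|) * (1 / ((n : ℝ) + 1))) atTop
      (𝓝 0) := by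
    simpa using tendsto_one_div_add_atTop_nhds_zero_nat.const_mul (C * T ^ 2 * Real.exp (c * |T|))
  refine squeeze_zero (fun _ => dist_nonneg) (fun n => ?_) hlim
  have hn : (0 : ℝ) < (n + 1 : ℕ) := by positivity
  have habs : |T / (n + 1 : ℕ)| = |T| / (n + 1 : ℕ) := by rw [abs_div, Nat.abs_cast]
  have h1 := dist_iterate_symplecticStep_le h z (r := T / (n + 1 : ℕ)) (A := |T|) (n + 1)
    (by rw [habs, mul_div_cancel₀ _ hn.ne'])
    (by rw [habs]; exact div_le_self (abs_nonneg _) (by push_cast; linarith [Nat.cast_nonneg (α := ℝ) n]))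
  rw [mul_div_cancel₀ _ hn.ne'] at h1
  refine h1.trans ?_
  have h2 : (1 + c * |T / (n + 1 : ℕ)|) ^ (n + 1) ≤ Real.exp (c * |T|) := by
    have h3 : 1 + c * |T / (n + 1 : ℕ)| ≤ Real.exp (c * |T / (n + 1 : ℕ)|) := by
      linarith [Real.add_one_le_exp (c * |T / (n + 1 : ℕ)|)]
    refine (pow_le_pow_left₀ (by positivity) h3 _).trans ?_
    rw [← Real.exp_nat_mul, habs]
    apply le_of_eq; congr 1; field_simp
  calc _ ≤ ((n + 1 : ℕ) : ℝ) * (C * (T / (n + 1 : ℕ)) ^ 2) * Real.exp (c * |T|) :=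
        mul_le_mul_of_nonneg_left h2 (by positivity)
    _ = _ := by push_cast; field_simp

/-- The field is merely Lipschitz, so no Jacobian is computed. The flow is the pointwise limit of
volume preserving schemes. For open `O`, a point sent to `O` by the flow is sent to `O` by all late
schemes, and Fatou's lemma gives the inequality; outer regularity passes to measurable sets. -/
lemma map_flow_le (T : ℝ) : Measure.map (phaseFlow E T) volume ≤ (volume : Measure Phase) := by
  have hcont : Continuous (phaseFlow E T) := continuous_flow_comp h continuous_const continuous_id
  have hopen : ∀ O : Set Phase, IsOpen O → volume (phaseFlow E T ⁻¹' O) ≤ volume O := by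
    intro O hO
    let ψ : ℕ → Phase → Phase := fun n => (symplecticStep E (T / (n + 1 : ℕ)))^[n + 1]
    have hψ : ∀ n, MeasurePreserving (ψ n) volume volume := fun n =>
      (measurePreserving_symplecticStep h _).iterate _
    calc volume (phaseFlow E T ⁻¹' O) = ∫⁻ z, (phaseFlow E T ⁻¹' O).indicator 1 z := by
          rw [lintegral_indicator_one (hO.measurableSet.preimage hcont.measurable)]
      _ ≤ ∫⁻ z, liminf (fun n => (ψ n ⁻¹' O).indicator (1 : Phase → ℝ≥0∞) z) atTop := by
          refine lintegral_mono fun z => ?_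
          by_cases hz : phaseFlow E T z ∈ O
          · rw [indicator_of_mem (show z ∈ phaseFlow E T ⁻¹' O from hz)]
            refine le_liminf_of_le (by isBoundedDefault) ?_
            filter_upwards [(tendsto_iterate_symplecticStep h T z).eventually (hO.mem_nhds hz)] with n hn
            rw [indicator_of_mem (show z ∈ ψ n ⁻¹' O from hn)]
          · rw [indicator_of_notMem (show z ∉ phaseFlow E T ⁻¹' O from hz)]
            exact bot_le
      _ ≤ liminf (fun n => ∫⁻ z, (ψ n ⁻¹' O).indicator (1 : Phase → ℝ≥0∞) z) atTop :=
          lintegral_liminf_le fun n => measurable_one.indicator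
            (hO.measurableSet.preimage (hψ n).measurable)
      _ = liminf (fun _ : ℕ => volume O) atTop := by
          congr 1; funext n
          rw [lintegral_indicator_one (hO.measurableSet.preimage (hψ n).measurable),
            (hψ n).measure_preimage hO.measurableSet.nullMeasurableSet]
      _ = volume O := by simp
  refine Measure.le_iff.2 fun A hA => ?_
  rw [Measure.map_apply hcont.measurable hA, A.measure_eq_iInf_isOpen volume]
  refine le_iInf₂ fun O hAO => le_iInf fun hO => ?_
  exact (measure_mono (preimage_mono hAO)).trans (hopen O hO)

theorem measurePreserving_flow (T : ℝ) : MeasurePreserving (phaseFlow E T) volume volume := by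
  have hc : ∀ T, Measurable (phaseFlow E T) := fun T =>
    (continuous_flow_comp h continuous_const continuous_id).measurable
  -- The opposite inequality is the same bound for the inverse flow.
  refine ⟨hc T, le_antisymm (map_flow_le h T) ?_⟩
  calc (volume : Measure Phase) = Measure.map (phaseFlow E T) (Measure.map (phaseFlow E (-T)) volume) := by
        rw [Measure.map_map (hc T) (hc _)]
        have : phaseFlow E T ∘ phaseFlow E (-T) = id := by funext z; exact flow_flow_neg h T z
        rw [this, Measure.map_id]
    _ ≤ _ := Measure.map_mono (map_flow_le h (-T)) (hc T)

end Liouville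

/-! ### Exit from the domain along characteristics -/

/-- The characteristic starting at `z` stays in `Ω` during `[0, τ)` and is on `Γ₊` at time `τ`. -/
def ExitsAt (Ω : Set R3) (E : R3 → R3) (z : Phase) (τ : ℝ) : Prop :=
  0 < τ ∧ (∀ s ∈ Ico 0 τ, (phaseFlow E s z).1 ∈ Ω) ∧ phaseFlow E τ z ∈ outgoing Ω

/-- The set of points of phase space which exit `Ω` through `Γ₊`. -/
def exitSet (Ω : Set R3) (E : R3 → R3) : Set Phase := {z | ∃ τ, ExitsAt Ω E z τ}

open Classical in
/-- The exit time on `exitSet Ω E`; it is `0` elsewhere. -/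
noncomputable def exitTime (Ω : Set R3) (E : R3 → R3) (z : Phase) : ℝ :=
  if h : ∃ τ, ExitsAt Ω E z τ then h.choose else 0

/-- The exit point on `exitSet Ω E`. -/
noncomputable def exitPoint (Ω : Set R3) (E : R3 → R3) (z : Phase) : Phase :=
  phaseFlow E (exitTime Ω E z) z

section Exit
variable {Ω : Set R3} {E : R3 → R3} {K : ℝ≥0} {M : ℝ} (hΩo : IsOpen Ω) (hΩc : Convex ℝ Ω)
  (hΩs : HasSmoothBoundary Ω) (h : IsForceField E K M)

include hΩo in
lemma notMem_of_mem_frontier {x : R3} (hx : x ∈ frontier Ω) : x ∉ Ω := by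
  rw [hΩo.frontier_eq] at hx
  exact hx.2

include hΩo in
lemma ExitsAt.unique {z : Phase} {τ τ' : ℝ} (hz : ExitsAt Ω E z τ) (hz' : ExitsAt Ω E z τ') :
    τ = τ' := by
  rcases lt_trichotomy τ τ' with hlt | heq | hlt
  · exact absurd (hz'.2.1 τ ⟨hz.1.le, hlt⟩) (notMem_of_mem_frontier hΩo hz.2.2.1)
  · exact heq
  · exact absurd (hz.2.1 τ' ⟨hz'.1.le, hlt⟩) (notMem_of_mem_frontier hΩo hz'.2.2.1)

lemma exitsAt_exitTime {z : Phase} (hz : z ∈ exitSet Ω E) : ExitsAt Ω E z (exitTime Ω E z) := by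
  rw [exitTime, dif_pos (show ∃ τ, ExitsAt Ω E z τ from hz)]
  exact Exists.choose_spec hz

include hΩo in
lemma ExitsAt.exitTime_eq {z : Phase} {τ : ℝ} (hz : ExitsAt Ω E z τ) : exitTime Ω E z = τ :=
  (exitsAt_exitTime ⟨τ, hz⟩).unique hΩo hz

include h in
lemma ExitsAt.mem {z : Phase} {τ : ℝ} (hz : ExitsAt Ω E z τ) : z.1 ∈ Ω := by
  simpa [flow_zero h] using hz.2.1 0 ⟨le_rfl, hz.1⟩

include h in
lemma eventually_forall_flow {z₀ : Phase} {P : Phase → Prop} {a b : ℝ}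
    (hP : ∀ s ∈ Icc a b, ∀ᶠ y in 𝓝 (phaseFlow E s z₀), P y) :
    ∀ᶠ z in 𝓝 z₀, ∀ s ∈ Icc a b, P (phaseFlow E s z) := by
  refine isCompact_Icc.eventually_forall_of_forall_eventually (P := fun z s => P (phaseFlow E s z))
    fun s hs => ?_
  have hc : Continuous fun q : Phase × ℝ => phaseFlow E q.2 q.1 :=
    continuous_flow_comp h continuous_snd continuous_fst
  exact (hc.tendsto (z₀, s)).eventually (hP s hs)

include hΩo hΩc hΩs h in
-- At a transversal exit the derivative of `ρ` along the characteristic is positive, and it stays so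
-- for nearby characteristics during a short window around `τ₀`. So each of them crosses the
-- boundary exactly once in the window, is outside `closure Ω` from then until its end `L`, and is
-- in `Ω` before the window by compactness.
theorem ExitsAt.exists_tube {z₀ : Phase} {τ₀ δ : ℝ} (hz : ExitsAt Ω E z₀ τ₀) (hδ : 0 < δ) :
    ∃ L, τ₀ < L ∧ L < τ₀ + δ ∧ ∀ᶠ z in 𝓝 z₀, ∃ τ, τ₀ - δ < τ ∧ τ < L ∧ ExitsAt Ω E z τ ∧
      ∀ s ∈ Ioc τ L, (phaseFlow E s z).1 ∉ closure Ω := by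
  obtain ⟨hτ₀, hin, hfr, hpos⟩ := hz
  obtain ⟨ρ, hρ⟩ := hΩs _ hfr
  have hρc : Continuous ρ := hρ.smooth.continuous
  have hgc := continuous_gradient_of_contDiff hρ.smooth
  rw [outerNormal_eq hΩo hΩc hΩs hfr hρ, inner_smul_left] at hpos
  replace hpos : 0 < inner ℝ (gradient ρ (phaseFlow E τ₀ z₀).1) (phaseFlow E τ₀ z₀).2 :=
    pos_of_mul_pos_right hpos (by simp)
  let P : Phase → Prop := fun y => 0 < inner ℝ (gradient ρ y.1) y.2 ∧ (y.1 ∈ Ω ↔ ρ y.1 < 0) ∧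
    (0 < ρ y.1 → y.1 ∉ closure Ω) ∧ (y.1 ∈ frontier Ω → IsLocalDefiningFunction Ω y.1 ρ)
  have hP : ∀ᶠ y in 𝓝 (phaseFlow E τ₀ z₀), P y := by
    have hf := continuous_fst.tendsto (phaseFlow E τ₀ z₀)
    have hi : Continuous fun y : Phase => inner ℝ (gradient ρ y.1) y.2 :=
      (hgc.comp continuous_fst).inner continuous_snd
    exact (hi.continuousAt.eventually (lt_mem_nhds hpos)).and ((hf.eventually hρ.mem_iff).and
      ((hf.eventually hρ.eventually_notMem_closure).and (hf.eventually hρ.eventually_frontier)))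
  have hcz : ∀ z, Continuous fun s => phaseFlow E s z := fun z =>
    continuous_flow_comp h continuous_id continuous_const
  obtain ⟨ε₀, hε₀, hball⟩ := Metric.eventually_nhds_iff.1
    (((hcz z₀).tendsto τ₀).eventually hP.eventually_nhds)
  let ε := min (ε₀ / 2) (min (δ / 2) (τ₀ / 2))
  have hε : 0 < ε := by positivity
  have hε1 : ε < ε₀ := (min_le_left _ _).trans_lt (by linarith)
  have hε2 : ε < δ := ((min_le_right _ _).trans (min_le_left _ _)).trans_lt (by linarith)
  have hε3 : ε < τ₀ := ((min_le_right _ _).trans (min_le_right _ _)).trans_lt (by linarith)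
  have hN1 : ∀ᶠ z in 𝓝 z₀, ∀ s ∈ Icc (τ₀ - ε) (τ₀ + ε), P (phaseFlow E s z) :=
    eventually_forall_flow h fun s hs => hball (by
      rw [Real.dist_eq, abs_lt]; exact ⟨by linarith [hs.1], by linarith [hs.2]⟩)
  have hN2 : ∀ᶠ z in 𝓝 z₀, ∀ s ∈ Icc 0 (τ₀ - ε), (phaseFlow E s z).1 ∈ Ω :=
    eventually_forall_flow h (P := fun y => y.1 ∈ Ω) fun s hs =>
      continuous_fst.continuousAt.eventually (hΩo.mem_nhds (hin s ⟨hs.1, by linarith [hs.2]⟩))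
  have hmono : ∀ z, (∀ s ∈ Icc (τ₀ - ε) (τ₀ + ε), P (phaseFlow E s z)) →
      StrictMonoOn (fun s => ρ (phaseFlow E s z).1) (Icc (τ₀ - ε) (τ₀ + ε)) := by
    intro z hz
    have hd : ∀ s, HasDerivAt (fun s => ρ (phaseFlow E s z).1)
        (inner ℝ (gradient ρ (phaseFlow E s z).1) (phaseFlow E s z).2) s := fun s =>
      (hρ.hasFDerivAt _).comp_hasDerivAt s (hasDerivAt_flow_fst h z s)
    refine strictMonoOn_of_deriv_pos (convex_Icc _ _)
      (fun s _ => (hd s).continuousAt.continuousWithinAt) fun s hs => ?_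
    rw [(hd s).deriv]
    exact (hz s (interior_subset hs)).1
  have hend : 0 < ρ (phaseFlow E (τ₀ + ε) z₀).1 := by
    have := hmono z₀ hN1.self_of_nhds ⟨by linarith, by linarith⟩ ⟨by linarith, le_rfl⟩
      (show τ₀ < τ₀ + ε by linarith)
    simpa [hρ.zero] using this
  have hN3 : ∀ᶠ z in 𝓝 z₀, 0 < ρ (phaseFlow E (τ₀ + ε) z).1 := by
    have hc : Continuous fun z => ρ (phaseFlow E (τ₀ + ε) z).1 :=
      hρc.comp (continuous_fst.comp (continuous_flow_comp h continuous_const continuous_id))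
    exact hc.continuousAt.eventually (lt_mem_nhds hend)
  refine ⟨τ₀ + ε, by linarith, by linarith, ?_⟩
  filter_upwards [hN1, hN2, hN3] with z h1 h2 h3
  have hm := hmono z h1
  have hc : Continuous fun s => ρ (phaseFlow E s z).1 := hρc.comp (continuous_fst.comp (hcz z))
  have hleft : ρ (phaseFlow E (τ₀ - ε) z).1 < 0 :=
    (h1 _ ⟨le_rfl, by linarith⟩).2.1.1 (h2 _ ⟨by linarith, le_rfl⟩)
  obtain ⟨τ, hτ, hτ0⟩ := intermediate_value_Ioo (show τ₀ - ε ≤ τ₀ + ε by linarith) hc.continuousOn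
    (show (0 : ℝ) ∈ Ioo _ _ from ⟨hleft, h3⟩)
  simp only at hτ0
  have hτI := Ioo_subset_Icc_self hτ
  have hin' : ∀ s ∈ Ico 0 τ, (phaseFlow E s z).1 ∈ Ω := by
    intro s hs
    rcases le_total s (τ₀ - ε) with hs' | hs'
    · exact h2 s ⟨hs.1, hs'⟩
    · have hsI : s ∈ Icc (τ₀ - ε) (τ₀ + ε) := ⟨hs', by linarith [hs.2, hτ.2]⟩
      refine (h1 s hsI).2.1.2 ?_
      have := hm hsI hτI hs.2
      simp only [hτ0] at this
      exact this
  have hτfr : (phaseFlow E τ z).1 ∈ frontier Ω := by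
    rw [hΩo.frontier_eq]
    refine ⟨?_, fun hmem => ?_⟩
    · have ht : Tendsto (fun s => (phaseFlow E s z).1) (𝓝[<] τ) (𝓝 (phaseFlow E τ z).1) :=
        ((continuous_fst.comp (hcz z)).tendsto τ).mono_left nhdsWithin_le_nhds
      refine mem_closure_of_tendsto ht ?_
      filter_upwards [Ioo_mem_nhdsLT (show 0 < τ by linarith [hτ.1])] with s hs
      exact hin' s ⟨hs.1.le, hs.2⟩
    · have := (h1 τ hτI).2.1.1 hmem
      linarith
  refine ⟨τ, by linarith [hτ.1], hτ.2, ⟨by linarith [hτ.1], hin', hτfr, ?_⟩, fun s hs => ?_⟩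
  · have hρτ := (h1 τ hτI).2.2.2 hτfr
    rw [outerNormal_eq hΩo hΩc hΩs hτfr hρτ, inner_smul_left]
    exact mul_pos (by simpa using hρτ.gradient_ne_zero) (h1 τ hτI).1
  · have hsI : s ∈ Icc (τ₀ - ε) (τ₀ + ε) := ⟨by linarith [hs.1, hτ.1], hs.2⟩
    refine (h1 s hsI).2.2.1 ?_
    have := hm hτI hsI hs.1
    simp only [hτ0] at this
    exact this

include hΩo hΩc hΩs h in
lemma isOpen_exitSet : IsOpen (exitSet Ω E) := by
  rw [isOpen_iff_mem_nhds]
  rintro z ⟨τ, hz⟩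
  obtain ⟨L, -, -, hL⟩ := hz.exists_tube hΩo hΩc hΩs h one_pos
  filter_upwards [hL] with w hw
  obtain ⟨τ', -, -, hw, -⟩ := hw
  exact ⟨τ', hw⟩

include hΩo hΩc hΩs h in
lemma continuousOn_exitTime : ContinuousOn (exitTime Ω E) (exitSet Ω E) := by
  intro z hz
  refine ContinuousAt.continuousWithinAt (Metric.tendsto_nhds.2 fun δ hδ => ?_)
  obtain ⟨L, -, hLδ, hL⟩ := (exitsAt_exitTime hz).exists_tube hΩo hΩc hΩs h hδ
  filter_upwards [hL] with w hw
  obtain ⟨τ', h1, h2, hw, -⟩ := hw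
  rw [hw.exitTime_eq hΩo, Real.dist_eq, abs_lt]
  exact ⟨by linarith, by linarith⟩

include hΩo hΩc hΩs h in
lemma measurable_exitTime : Measurable (exitTime Ω E) := by
  classical
  have h1 : exitTime Ω E = (exitSet Ω E).piecewise (exitTime Ω E) (fun _ => 0) := by
    funext z
    by_cases hz : z ∈ exitSet Ω E
    · rw [piecewise_eq_of_mem _ _ _ hz]
    · rw [piecewise_eq_of_notMem _ _ _ hz, exitTime, dif_neg (show ¬∃ τ, ExitsAt Ω E z τ from hz)]
  rw [h1]
  exact (continuousOn_exitTime hΩo hΩc hΩs h).measurable_piecewise continuousOn_const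
    (isOpen_exitSet hΩo hΩc hΩs h).measurableSet

include hΩo hΩc hΩs h in
lemma measurable_exitPoint : Measurable (exitPoint Ω E) :=
  (continuous_flow h).measurable.comp ((measurable_exitTime hΩo hΩc hΩs h).prodMk measurable_id)

/-- Pairs `(z, s)` of a point on `Γ₊` and a time `s > 0` such that the backward characteristic
starting at `z` stays in `Ω` during `(0, s]`. -/
def backSet (Ω : Set R3) (E : R3 → R3) : Set (Phase × ℝ) :=
  {p | ExitsAt Ω E (phaseFlow E (-p.2) p.1) p.2}

include hΩo hΩc hΩs h in
lemma measurableSet_backSet : MeasurableSet (backSet Ω E) := by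
  have hf : Measurable fun p : Phase × ℝ => phaseFlow E (-p.2) p.1 :=
    (continuous_flow_comp h continuous_snd.neg continuous_fst).measurable
  have h1 : backSet Ω E = (fun p : Phase × ℝ => phaseFlow E (-p.2) p.1) ⁻¹' exitSet Ω E ∩
      {p : Phase × ℝ | exitTime Ω E (phaseFlow E (-p.2) p.1) = p.2} := by
    ext p
    constructor
    · intro hp
      exact ⟨⟨_, hp⟩, ExitsAt.exitTime_eq hΩo hp⟩
    · rintro ⟨hp1, hp2⟩
      have h3 := exitsAt_exitTime hp1
      rw [show exitTime Ω E (phaseFlow E (-p.2) p.1) = p.2 from hp2] at h3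
      exact h3
  rw [h1]
  exact (hf (isOpen_exitSet hΩo hΩc hΩs h).measurableSet).inter
    (measurableSet_eq_fun ((measurable_exitTime hΩo hΩc hΩs h).comp hf) measurable_snd)

include h in
lemma mem_backSet_iff {z : Phase} {s : ℝ} : (z, s) ∈ backSet Ω E ↔
    z ∈ outgoing Ω ∧ 0 < s ∧ ∀ r ∈ Ioc 0 s, (phaseFlow E (-r) z).1 ∈ Ω := by
  change ExitsAt Ω E (phaseFlow E (-s) z) s ↔ _
  rw [ExitsAt, flow_flow_neg h]
  refine ⟨fun ⟨h1, h2, h3⟩ => ⟨h3, h1, fun r hr => ?_⟩, fun ⟨h3, h1, h2⟩ => ⟨h1, fun r hr => ?_, h3⟩⟩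
  · have := h2 (s - r) ⟨by linarith [hr.2], by linarith [hr.1]⟩
    rwa [← flow_add h, show s - r + -s = -r by ring] at this
  · rw [← flow_add h, show r + -s = -(s - r) by ring]
    exact h2 _ ⟨by linarith [hr.2], by linarith [hr.1]⟩

end Exit

/-! ### Almost every characteristic leaves the domain transversally -/

/-- The points of `Ω` at distance at most `ε` from a supporting plane. -/
def supportShell (Ω : Set R3) (ε : ℝ) : Set R3 :=
  {x | x ∈ Ω ∧ ∃ y ∈ frontier Ω, -ε ≤ inner ℝ (outerNormal Ω y) (x - y)}

section Null
variable {Ω : Set R3} {E : R3 → R3} {K : ℝ≥0} {M : ℝ} (hΩo : IsOpen Ω) (hΩc : Convex ℝ Ω)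
  (hΩs : HasSmoothBoundary Ω) (h : IsForceField E K M)

include hΩo hΩc hΩs in
-- The ball of radius `ρ` about `x₀` lies in every supporting half-space, so `x₀` has distance more
-- than `ρ` from each supporting plane. A point of the copy of `Ω` contracted by `1 - θ` towards
-- `x₀` then has distance more than `θρ`.
lemma supportShell_subset {x₀ : R3} {ρ θ ε : ℝ} (hρ : 0 < ρ) (hball : Metric.closedBall x₀ ρ ⊆ Ω)
    (hθ : 0 < θ) (hθ1 : θ < 1) (hε : ε ≤ θ * ρ) :
    supportShell Ω ε ⊆ Ω \ (AffineMap.homothety x₀ (1 - θ) '' Ω) := by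
  rintro x ⟨hx, y, hy, hxy⟩
  refine ⟨hx, ?_⟩
  rintro ⟨w, hw, rfl⟩
  have hn := norm_outerNormal hΩo hΩc hΩs hy
  set n := outerNormal Ω y
  have h1 : inner ℝ n (x₀ + ρ • n - y) < 0 := inner_outerNormal_neg hΩo hΩc hΩs hy (hball (by
    simp [norm_smul, hn, abs_of_pos hρ]))
  have h2 : inner ℝ n (w - y) < 0 := inner_outerNormal_neg hΩo hΩc hΩs hy hw
  have h3 : inner ℝ n (x₀ + ρ • n - y) = inner ℝ n (x₀ - y) + ρ := by
    rw [show x₀ + ρ • n - y = (x₀ - y) + ρ • n by abel, inner_add_right, inner_smul_right,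
      real_inner_self_eq_norm_sq, hn]
    ring
  have h4 : AffineMap.homothety x₀ (1 - θ) w - y = θ • (x₀ - y) + (1 - θ) • (w - y) := by
    rw [AffineMap.homothety_apply]
    simp only [vsub_eq_sub, vadd_eq_add]
    module
  rw [h4, inner_add_right, inner_smul_right, inner_smul_right] at hxy
  nlinarith

include hΩo hΩc hΩs in
-- The set `S` is what remains of `Ω` after removing its contraction by `1 - ε/ρ`; Bernoulli's
-- inequality `(1 - θ)³ ≥ 1 - 3θ` shows that its volume is of order `ε`.
lemma exists_shell_superset (hΩb : Bornology.IsBounded Ω) (hΩn : Ω.Nonempty) :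
    ∃ C ρ : ℝ, 0 ≤ C ∧ 0 < ρ ∧ ∀ ε, 0 < ε → ε < ρ → ∃ S, MeasurableSet S ∧
      supportShell Ω ε ⊆ S ∧ volume S ≤ ENNReal.ofReal (C * ε) := by
  obtain ⟨x₀, hx₀⟩ := hΩn
  obtain ⟨ρ, hρ, hball⟩ := Metric.nhds_basis_closedBall.mem_iff.1 (hΩo.mem_nhds hx₀)
  have hfin : volume Ω ≠ ⊤ := hΩb.measure_lt_top.ne
  refine ⟨3 * volume.real Ω / ρ, ρ, by positivity, hρ, fun ε hε hερ => ?_⟩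
  have hθ : 0 < ε / ρ := by positivity
  have hθ1 : ε / ρ < 1 := (div_lt_one hρ).2 hερ
  refine ⟨Ω \ (AffineMap.homothety x₀ (1 - ε / ρ) '' Ω), ?_,
    supportShell_subset hΩo hΩc hΩs hρ hball hθ hθ1 (by field_simp; exact le_rfl), ?_⟩
  · exact hΩo.measurableSet.diff
      ((AffineMap.homothety_isOpenMap x₀ (1 - ε / ρ) (by linarith)) _ hΩo).measurableSet
  · have hsub : AffineMap.homothety x₀ (1 - ε / ρ) '' Ω ⊆ Ω := by
      rintro _ ⟨w, hw, rfl⟩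
      rw [AffineMap.homothety_eq_lineMap]
      exact hΩc.lineMap_mem hx₀ hw ⟨by linarith, by linarith⟩
    have hvol : volume (AffineMap.homothety x₀ (1 - ε / ρ) '' Ω) =
        ENNReal.ofReal ((1 - ε / ρ) ^ 3) * volume Ω := by
      rw [Measure.addHaar_image_homothety, abs_of_nonneg (by
        simp only [finrank_euclideanSpace, Fintype.card_fin]; exact pow_nonneg (by linarith) _)]
      simp
    rw [measure_sdiff hsub ((AffineMap.homothety_isOpenMap x₀ (1 - ε / ρ) (by linarith)) _
      hΩo).measurableSet.nullMeasurableSet (measure_ne_top_of_subset hsub hfin), hvol]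
    rw [tsub_le_iff_right, ← ofReal_measureReal hfin, ← ENNReal.ofReal_mul (by
      exact pow_nonneg (by linarith) _), ← ENNReal.ofReal_add (by positivity)
      (mul_nonneg (pow_nonneg (by linarith) _) measureReal_nonneg)]
    refine ENNReal.ofReal_le_ofReal ?_
    have hb := one_add_mul_le_pow (a := -(ε / ρ)) (by linarith) 3
    rw [← sub_eq_add_neg] at hb
    push_cast at hb
    have h5 : 3 * volume.real Ω / ρ * ε = 3 * (ε / ρ) * volume.real Ω := by ring
    rw [h5]
    nlinarith [measureReal_nonneg (μ := (volume : Measure R3)) (s := Ω)]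

include hΩo hΩc hΩs h in
-- The sign at the first exit comes from convexity: the signed distance to the supporting plane at
-- the exit point is negative before `τ` and zero at `τ`, so its derivative there is not negative.
lemma exists_firstExit {z : Phase} (hz : z.1 ∈ Ω) {s₀ : ℝ} (hs₀ : 0 ≤ s₀)
    (hout : (phaseFlow E s₀ z).1 ∉ Ω) :
    ∃ τ, 0 < τ ∧ τ ≤ s₀ ∧ (∀ s ∈ Ico 0 τ, (phaseFlow E s z).1 ∈ Ω) ∧
      (phaseFlow E τ z).1 ∈ frontier Ω ∧
      0 ≤ inner ℝ (outerNormal Ω (phaseFlow E τ z).1) (phaseFlow E τ z).2 := by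
  have hc : Continuous fun s => (phaseFlow E s z).1 :=
    continuous_fst.comp (continuous_flow_comp h continuous_id continuous_const)
  obtain ⟨τ, ⟨hτI, hτ⟩, hmin⟩ := (isCompact_Icc.inter_right
    ((hΩo.preimage hc).isClosed_compl)).exists_isLeast (s := Icc 0 s₀ ∩ _) ⟨s₀, ⟨hs₀, le_rfl⟩, hout⟩
  have hτ0 : 0 < τ := by
    refine lt_of_le_of_ne hτI.1 fun h0 => hτ ?_
    change (phaseFlow E τ z).1 ∈ Ω
    rwa [← h0, flow_zero h]
  have hin : ∀ s ∈ Ico 0 τ, (phaseFlow E s z).1 ∈ Ω := by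
    intro s hs
    by_contra hns
    exact absurd (hmin ⟨⟨hs.1, hs.2.le.trans hτI.2⟩, hns⟩) (not_le.2 hs.2)
  have hev : ∀ᶠ s in 𝓝[<] τ, (phaseFlow E s z).1 ∈ Ω := by
    filter_upwards [Ioo_mem_nhdsLT hτ0] with s hs using hin s ⟨hs.1.le, hs.2⟩
  have hfr : (phaseFlow E τ z).1 ∈ frontier Ω := by
    rw [hΩo.frontier_eq]
    exact ⟨mem_closure_of_tendsto ((hc.tendsto τ).mono_left nhdsWithin_le_nhds) hev, hτ⟩
  refine ⟨τ, hτ0, hτI.2, hin, hfr, ?_⟩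
  set n := outerNormal Ω (phaseFlow E τ z).1
  have hd : HasDerivAt (fun s => inner ℝ n ((phaseFlow E s z).1 - (phaseFlow E τ z).1))
      (inner ℝ n (phaseFlow E τ z).2) τ := by
    have := (hasDerivAt_const τ n).inner ℝ ((hasDerivAt_flow_fst h z τ).sub_const (phaseFlow E τ z).1)
    simpa using this
  rw [hasDerivAt_iff_tendsto_slope] at hd
  refine ge_of_tendsto (hd.mono_left (nhdsLT_le_nhdsNE τ)) ?_
  filter_upwards [hev, self_mem_nhdsWithin] with s hs hsτ
  rw [slope_def_field, sub_self, inner_zero_right, sub_zero]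
  exact div_nonneg_of_nonpos (inner_outerNormal_neg hΩo hΩc hΩs hfr hs).le (sub_nonpos.2 (le_of_lt hsτ))

include hΩo hΩc hΩs h in
-- If the velocity is tangential at time `τ`, the characteristic departs from the supporting plane
-- only quadratically when followed back. The factor is `M + 1` instead of `M` so that the thickness
-- of the shell is positive even for `M = 0`.
lemma mem_supportShell_of_grazing {z : Phase} (hz : z.1 ∈ Ω) {τ r : ℝ} (hτ : 0 ≤ τ) (hτr : τ ≤ r)
    (hfr : (phaseFlow E τ z).1 ∈ frontier Ω)
    (h0 : inner ℝ (outerNormal Ω (phaseFlow E τ z).1) (phaseFlow E τ z).2 = 0) :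
    z.1 ∈ supportShell Ω ((M + 1) * r ^ 2) := by
  refine ⟨hz, _, hfr, ?_⟩
  have h1 := norm_flow_fst_sub_le h (-τ) (phaseFlow E τ z)
  rw [flow_neg_flow h] at h1
  set y := phaseFlow E τ z
  have h2 := abs_real_inner_le_norm (outerNormal Ω y.1) (z.1 - y.1 - -τ • y.2)
  rw [inner_sub_right, inner_smul_right, h0, norm_outerNormal hΩo hΩc hΩs hfr] at h2
  have h3 := (abs_le.1 h2).1
  have h4 : M * (-τ) ^ 2 ≤ (M + 1) * r ^ 2 := by
    have := pow_le_pow_left₀ hτ hτr 2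
    have hM := h.bound_nonneg
    nlinarith
  linarith

/-- The points of `Ω × ℝ³` with speed at most `m` which first leave `Ω` tangentially, before
time `m`. -/
def grazingSet (Ω : Set R3) (E : R3 → R3) (m : ℝ) : Set Phase :=
  {z | ‖z.2‖ ≤ m ∧ ∃ τ, 0 < τ ∧ τ ≤ m ∧ (∀ s ∈ Ico 0 τ, (phaseFlow E s z).1 ∈ Ω) ∧
    (phaseFlow E τ z).1 ∈ frontier Ω ∧
    inner ℝ (outerNormal Ω (phaseFlow E τ z).1) (phaseFlow E τ z).2 = 0}

include hΩo hΩc hΩs h in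
lemma grazingSet_subset {m : ℝ} (hm : 0 < m) {n : ℕ} (hn : 0 < n) {S : Set R3}
    (hS : supportShell Ω ((M + 1) * (m / n) ^ 2) ⊆ S) :
    grazingSet Ω E m ⊆ ⋃ j ∈ Finset.range n,
      phaseFlow E (j * (m / n)) ⁻¹' (S ×ˢ Metric.closedBall 0 (m + M * m)) := by
  rintro z ⟨hzm, τ, hτ, hτm, hin, hfr, h0⟩
  have hn' : (0 : ℝ) < n := by exact_mod_cast hn
  set r := m / n
  have hr : 0 < r := by positivity
  have hnr : n * r = m := mul_div_cancel₀ _ hn'.ne'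
  -- With the ceiling one has `j r < τ ≤ (j + 1) r`; the strict inequality guarantees that the point
  -- at time `j r` is still in `Ω`.
  obtain ⟨j, hj⟩ : ∃ j : ℕ, ⌈τ / r⌉₊ = j + 1 := ⟨⌈τ / r⌉₊ - 1, by
    have : 0 < ⌈τ / r⌉₊ := Nat.ceil_pos.2 (by positivity)
    omega⟩
  have h1 : τ ≤ (j + 1) * r := by
    have := Nat.le_ceil (τ / r)
    rw [hj, div_le_iff₀ hr] at this
    exact_mod_cast this
  have h2 : j * r < τ := by
    have := (Nat.lt_ceil (n := j) (a := τ / r)).1 (by omega)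
    rwa [lt_div_iff₀ hr] at this
  have hjn : j < n := by
    have : (j : ℝ) * r < n * r := by rw [hnr]; linarith
    exact_mod_cast lt_of_mul_lt_mul_right this hr.le
  have hj0 : (0 : ℝ) ≤ j * r := by positivity
  simp only [mem_iUnion, Finset.mem_range]
  refine ⟨j, hjn, ?_, ?_⟩
  · refine hS (mem_supportShell_of_grazing (τ := τ - j * r) hΩo hΩc hΩs h (hin _ ⟨hj0, h2⟩)
      (by linarith) (by linarith) ?_ ?_)
    · rw [← flow_add h, sub_add_cancel]; exact hfr
    · rw [← flow_add h, sub_add_cancel]; exact h0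
  · rw [mem_closedBall_zero_iff]
    have h3 := norm_flow_snd_sub_le h (j * r) z
    rw [abs_of_nonneg hj0] at h3
    have h4 := norm_sub_norm_le (phaseFlow E (j * r) z).2 z.2
    have h5 : M * (j * r) ≤ M * m := mul_le_mul_of_nonneg_left (by linarith) h.bound_nonneg
    linarith

include hΩo hΩc hΩs h in
-- Divide `[0, m]` into `n` steps. A point that grazes during step `j` is carried by the flow at the
-- beginning of this step into a shell of thickness `O(n⁻²)`. By Liouville's theorem each step
-- contributes volume `O(n⁻²)`, so the total is `O(n⁻¹)` for every large `n`.
lemma volume_grazingSet (hΩb : Bornology.IsBounded Ω) (hΩn : Ω.Nonempty) {m : ℝ} (hm : 0 < m) :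
    volume (grazingSet Ω E m) = 0 := by
  obtain ⟨C, ρ, hC, hρ, hS⟩ := exists_shell_superset hΩo hΩc hΩs hΩb hΩn
  have hM := h.bound_nonneg
  set B : Set R3 := Metric.closedBall 0 (m + M * m)
  have hB : volume B ≠ ⊤ := Metric.isBounded_closedBall.measure_lt_top.ne
  have key : ∀ᶠ n : ℕ in atTop, volume (grazingSet Ω E m) ≤
      ENNReal.ofReal (C * (M + 1) * m ^ 2 * volume.real B * (n : ℝ)⁻¹) := by
    have hlim : Tendsto (fun n : ℕ => (M + 1) * (m / n) ^ 2) atTop (𝓝 0) := by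
      have := ((tendsto_const_div_atTop_nhds_zero_nat m).pow 2).const_mul (M + 1)
      simpa using this
    filter_upwards [hlim.eventually (gt_mem_nhds hρ), eventually_gt_atTop 0] with n hn hn0
    have hn' : (0 : ℝ) < n := by exact_mod_cast hn0
    obtain ⟨S, hSm, hsub, hSv⟩ := hS _ (by positivity) hn
    refine (measure_mono (grazingSet_subset hΩo hΩc hΩs h hm hn0 hsub)).trans ?_
    refine (measure_biUnion_finset_le _ _).trans ?_
    have h1 : ∀ j ∈ Finset.range n, volume (phaseFlow E (j * (m / n)) ⁻¹' (S ×ˢ B)) ≤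
        ENNReal.ofReal (C * ((M + 1) * (m / n) ^ 2) * volume.real B) := by
      intro j _
      rw [(measurePreserving_flow h _).measure_preimage
        (hSm.prod measurableSet_closedBall).nullMeasurableSet, Measure.volume_eq_prod,
        Measure.prod_prod, ENNReal.ofReal_mul (by positivity), ofReal_measureReal hB]
      gcongr
    refine (Finset.sum_le_sum h1).trans ?_
    rw [Finset.sum_const, Finset.card_range, nsmul_eq_mul, ← ENNReal.ofReal_natCast,
      ← ENNReal.ofReal_mul (by positivity)]
    refine ENNReal.ofReal_le_ofReal (le_of_eq ?_)
    field_simp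
  have hlim : Tendsto (fun n : ℕ => ENNReal.ofReal (C * (M + 1) * m ^ 2 * volume.real B * (n : ℝ)⁻¹))
      atTop (𝓝 0) := by
    have := ENNReal.tendsto_ofReal ((tendsto_inv_atTop_nhds_zero_nat (𝕜 := ℝ)).const_mul
      (C * (M + 1) * m ^ 2 * volume.real B))
    simpa using this
  exact le_antisymm (ge_of_tendsto hlim key) bot_le

lemma ae_ne_zero_coord : ∀ᵐ v : R3, v 0 ≠ 0 := by
  let S : Submodule ℝ R3 := LinearMap.ker (EuclideanSpace.proj (𝕜 := ℝ) (0 : Fin 3)).toLinearMap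
  have hS : S ≠ ⊤ := by
    intro htop
    have : (EuclideanSpace.single (0 : Fin 3) (1 : ℝ)) ∈ S := htop ▸ Submodule.mem_top
    simp [S] at this
  have h1 := Measure.addHaar_submodule (volume : Measure R3) S hS
  rw [ae_iff]
  refine measure_mono_null (fun v hv => ?_) h1
  simpa [S] using hv

include hΩo hΩc hΩs h in
-- Almost every point has `v₁ ≠ 0`. As `x₁` moves with the constant speed `v₁`, the characteristic
-- leaves the bounded set `Ω` in finite time, and tangential first exits form a null set.
theorem ae_mem_exitSet (hΩb : Bornology.IsBounded Ω) (hΩn : Ω.Nonempty) :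
    ∀ᵐ z ∂(interiorMeasure Ω), z ∈ exitSet Ω E := by
  have h1 : ∀ᵐ z : Phase, ∀ m : ℕ, z ∉ grazingSet Ω E (m + 1) :=
    ae_all_iff.2 fun m => measure_eq_zero_iff_ae_notMem.1
      (volume_grazingSet hΩo hΩc hΩs h hΩb hΩn (by positivity))
  have h2 : ∀ᵐ z : Phase, z.2 0 ≠ 0 :=
    Measure.quasiMeasurePreserving_snd.ae ae_ne_zero_coord
  rw [interiorMeasure, ae_restrict_iff' (hΩo.measurableSet.prod MeasurableSet.univ)]
  filter_upwards [h1, h2] with z hz1 hz2 hz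
  obtain ⟨R, hR⟩ := hΩb.exists_norm_le
  have hR0 : 0 ≤ R := (norm_nonneg _).trans (hR _ hz.1)
  have hout : (phaseFlow E ((2 * R + 1) / |z.2 0|) z).1 ∉ Ω := by
    intro hmem
    have h3 := (PiLp.norm_apply_le _ 0).trans (hR _ hmem)
    have h4 := (PiLp.norm_apply_le _ 0).trans (hR _ hz.1)
    rw [flow_fst_zero h, Real.norm_eq_abs] at h3
    rw [Real.norm_eq_abs] at h4
    have h5 : |(2 * R + 1) / |z.2 0| * z.2 0| = 2 * R + 1 := by
      rw [abs_mul, abs_div, abs_abs, div_mul_cancel₀ _ (abs_ne_zero.2 hz2), abs_of_pos (by linarith)]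
    have h6 := abs_sub_abs_le_abs_sub ((2 * R + 1) / |z.2 0| * z.2 0) (-(z.1 0))
    rw [abs_neg, sub_neg_eq_add, h5, add_comm (_ / _ * _)] at h6
    linarith
  obtain ⟨τ, hτ, -, hin, hfr, hpos⟩ := exists_firstExit hΩo hΩc hΩs h hz.1 (by positivity) hout
  rcases hpos.eq_or_lt with heq | hlt
  · obtain ⟨m, hm⟩ := exists_nat_ge (max τ ‖z.2‖)
    exact absurd ⟨by linarith [le_max_right τ ‖z.2‖], τ, hτ, by linarith [le_max_left τ ‖z.2‖],
      hin, hfr, heq.symm⟩ (hz1 m)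
  · exact ⟨τ, hτ, hin, hfr, hlt⟩

end Null

/-! ### Mollification of functions that are differentiable along the flow -/

section Mollify
variable {G : Type*} [NormedAddCommGroup G] [NormedSpace ℝ G] [FiniteDimensional ℝ G]
  [MeasurableSpace G] [BorelSpace G] {μ : Measure G} [μ.IsAddHaarMeasure]

/-- The convolution of `η` with a normalized bump function. -/
noncomputable def mollify (μ : Measure G) (φ : ContDiffBump (0 : G)) (η : G → ℝ) : G → ℝ :=
  convolution (φ.normed μ) η (ContinuousLinearMap.lsmul ℝ ℝ) μ

lemma contDiff_mollify (φ : ContDiffBump (0 : G)) {η : G → ℝ} (hη : Continuous η) :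
    ContDiff ℝ ∞ (mollify μ φ η) :=
  φ.hasCompactSupport_normed.contDiff_convolution_left _ φ.contDiff_normed hη.locallyIntegrable

lemma abs_mollify_sub_le (φ : ContDiffBump (0 : G)) {η : G → ℝ} (hη : Continuous η) {p : G}
    {c ε : ℝ} (hε : 0 ≤ ε) (H : ∀ y ∈ Metric.ball p φ.rOut, |η y - c| ≤ ε) :
    |mollify μ φ η p - c| ≤ ε :=
  dist_convolution_le hε φ.support_normed_eq.subset φ.nonneg_normed φ.integral_normed
    hη.aestronglyMeasurable H

lemma mollify_add_sub (φ : ContDiffBump (0 : G)) {η : G → ℝ} (hη : Continuous η) (p k : G) :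
    mollify μ φ η (p + k) - mollify μ φ η p = mollify μ φ (fun y => η (y + k) - η y) p := by
  have hint : ∀ q, Integrable (fun t => φ.normed μ t * η (q - t)) μ := fun q =>
    (φ.continuous_normed.mul (hη.comp (by fun_prop))).integrable_of_hasCompactSupport
      φ.hasCompactSupport_normed.mul_right
  simp only [mollify, convolution, ContinuousLinearMap.lsmul_apply, smul_eq_mul]
  rw [← integral_sub (hint _) (hint _)]
  congr 1; funext t
  rw [mul_sub, sub_add_eq_add_sub]

lemma abs_mollify_add_sub_le (φ : ContDiffBump (0 : G)) {η : G → ℝ} (hη : Continuous η) {p k : G}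
    {c ε : ℝ} (hε : 0 ≤ ε) (H : ∀ y ∈ Metric.ball p φ.rOut, |η (y + k) - η y - c| ≤ ε) :
    |mollify μ φ η (p + k) - mollify μ φ η p - c| ≤ ε := by
  rw [mollify_add_sub φ hη]
  exact abs_mollify_sub_le φ (by fun_prop) hε H

lemma lipschitzWith_mollify (φ : ContDiffBump (0 : G)) {η : G → ℝ} {C : ℝ≥0}
    (hη : LipschitzWith C η) : LipschitzWith C (mollify μ φ η) := by
  refine LipschitzWith.of_dist_le_mul fun p q => ?_
  have h1 := abs_mollify_add_sub_le (μ := μ) φ hη.continuous (p := q) (k := p - q) (c := 0)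
    (ε := C * dist p q) (by positivity) fun y _ => by
      rw [sub_zero]
      refine (hη.dist_le_mul (y + (p - q)) y).trans (le_of_eq ?_)
      rw [dist_eq_norm, dist_eq_norm, add_sub_cancel_left]
  rwa [sub_zero, add_sub_cancel] at h1

lemma support_mollify_subset (φ : ContDiffBump (0 : G)) {η : G → ℝ} (hη : Continuous η) :
    Function.support (mollify μ φ η) ⊆ Metric.cthickening φ.rOut (tsupport η) := by
  intro p hp
  by_contra hcon
  refine hp ?_
  have := abs_mollify_sub_le (μ := μ) φ hη (p := p) (c := 0) le_rfl fun y hy => by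
    have hy0 : η y = 0 := by
      by_contra hne
      refine hcon (Metric.mem_cthickening_of_dist_le p y _ _ (subset_tsupport η hne) ?_)
      rw [dist_comm]; exact (Metric.mem_ball.1 hy).le
    simp [hy0]
  simpa using this

end Mollify

instance isAddHaarMeasure_volume_phase : (volume : Measure Phase).IsAddHaarMeasure :=
  inferInstanceAs ((volume : Measure R3).prod (volume : Measure R3)).IsAddHaarMeasure

instance isAddHaarMeasure_volume_spacetime : (volume : Measure (ℝ × Phase)).IsAddHaarMeasure :=
  Measure.prod.instIsAddHaarMeasure _ _

/-- The flow in space-time. -/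
noncomputable def spacetimeFlow (E : R3 → R3) (s : ℝ) (p : ℝ × Phase) : ℝ × Phase :=
  (p.1 + s, phaseFlow E s p.2)

/-- The transport field in space-time. -/
def spacetimeField (E : R3 → R3) (p : ℝ × Phase) : ℝ × Phase := (1, phaseField E p.2)

/-! ### The space-time flow, and smooth approximation of Lipschitz test functions. -/

section STFlow
variable {E : R3 → R3} {K : ℝ≥0} {M : ℝ} (h : IsForceField E K M)
include h

lemma spacetimeFlow_zero (p : ℝ × Phase) : spacetimeFlow E 0 p = p := by
  simp [spacetimeFlow, flow_zero h]

lemma spacetimeFlow_add (s t : ℝ) (p : ℝ × Phase) :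
    spacetimeFlow E (s + t) p = spacetimeFlow E s (spacetimeFlow E t p) := by
  simp only [spacetimeFlow, flow_add h, Prod.mk.injEq, and_true]; ring

lemma spacetimeFlow_flow_neg (s : ℝ) (p : ℝ × Phase) :
    spacetimeFlow E s (spacetimeFlow E (-s) p) = p := by
  rw [← spacetimeFlow_add h, add_neg_cancel, spacetimeFlow_zero h]

lemma spacetimeFlow_neg_flow (s : ℝ) (p : ℝ × Phase) :
    spacetimeFlow E (-s) (spacetimeFlow E s p) = p := by
  rw [← spacetimeFlow_add h, neg_add_cancel, spacetimeFlow_zero h]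

lemma hasDerivAt_spacetimeFlow (p : ℝ × Phase) (s : ℝ) :
    HasDerivAt (fun r => spacetimeFlow E r p) (spacetimeField E (spacetimeFlow E s p)) s :=
  ((hasDerivAt_id s).const_add p.1).prodMk (hasDerivAt_flow h p.2 s)

lemma continuous_spacetimeFlow : Continuous (fun q : ℝ × (ℝ × Phase) => spacetimeFlow E q.1 q.2) :=
  (continuous_snd.fst.add continuous_fst).prodMk (continuous_flow_comp h continuous_fst
    continuous_snd.snd)

lemma continuous_spacetimeFlow_comp {X : Type*} [TopologicalSpace X] {f : X → ℝ}
    {g : X → ℝ × Phase} (hf : Continuous f) (hg : Continuous g) :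
    Continuous fun x => spacetimeFlow E (f x) (g x) :=
  (continuous_spacetimeFlow h).comp (hf.prodMk hg)

lemma continuous_spacetimeField : Continuous (spacetimeField E) :=
  continuous_const.prodMk (h.lipschitz_phaseField.continuous.comp continuous_snd)

lemma dist_spacetimeFlow_le (s : ℝ) (p q : ℝ × Phase) :
    dist (spacetimeFlow E s p) (spacetimeFlow E s q) ≤
      dist p q * Real.exp ((max 1 K : ℝ≥0) * |s|) := by
  have h1 : 1 ≤ Real.exp ((max 1 K : ℝ≥0) * |s|) := Real.one_le_exp (by positivity)
  rw [Prod.dist_eq (x := spacetimeFlow E s p)]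
  refine max_le ?_ ((dist_flow_le h s p.2 q.2).trans
    (mul_le_mul_of_nonneg_right (le_max_right _ _) (by positivity)))
  simp only [spacetimeFlow, dist_add_right]
  exact (le_max_left _ _).trans (le_mul_of_one_le_right (by positivity) h1)

lemma measurePreserving_spacetimeFlow (s : ℝ) :
    MeasurePreserving (spacetimeFlow E s) volume volume :=
  (measurePreserving_add_right volume s).prod (measurePreserving_flow h s)

/-- If `η` is Lipschitz with continuous derivative `ζ` along the flow, then the difference quotients
of `η` in the direction of the field are uniformly close to `ζ`. -/
lemma eventually_abs_sub_sub_le {η ζ : ℝ × Phase → ℝ} {C : ℝ≥0} (hη : LipschitzWith C η)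
    (hζ : Continuous ζ) (hd : ∀ p, HasDerivAt (fun s => η (spacetimeFlow E s p)) (ζ p) 0)
    (p : ℝ × Phase) {δ : ℝ} (hδ : 0 < δ) :
    ∃ ε > 0, ∀ y ∈ Metric.ball p ε, ∀ s : ℝ, |s| < ε →
      |η (y + s • spacetimeField E p) - η y - s * ζ p| ≤ δ * |s| := by
  have hd' : ∀ y r, HasDerivAt (fun s => η (spacetimeFlow E s y)) (ζ (spacetimeFlow E r y)) r := by
    intro y r
    have h1 := HasDerivAt.comp_sub_const (x := r) (a := r)
      (f := fun s => η (spacetimeFlow E s (spacetimeFlow E r y)))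
      (by rw [sub_self]; exact hd (spacetimeFlow E r y))
    refine h1.congr_of_eventuallyEq (Eventually.of_forall fun s => ?_)
    simp only [← spacetimeFlow_add h, sub_add_cancel]
  -- One share `δ'` is spent on `ζ` along the flow, and `C δ'` on replacing the curved path by the
  -- straight one, through the Lipschitz constant of `η`.
  let δ' := δ / (C + 1)
  have hδ' : 0 < δ' := by positivity
  have hcf := continuous_spacetimeFlow h
  have h1 : ∀ᶠ q : ℝ × (ℝ × Phase) in 𝓝 (0, p), ‖ζ (spacetimeFlow E q.1 q.2) - ζ p‖ ≤ δ' := by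
    have hc : Continuous fun q : ℝ × (ℝ × Phase) => ‖ζ (spacetimeFlow E q.1 q.2) - ζ p‖ :=
      ((hζ.comp hcf).sub continuous_const).norm
    filter_upwards [(hc.tendsto' (0, p) 0 (by simp [spacetimeFlow_zero h])).eventually
      (gt_mem_nhds hδ')] with q hq using le_of_lt hq
  have h2 : ∀ᶠ q : ℝ × (ℝ × Phase) in 𝓝 (0, p),
      ‖spacetimeField E p - spacetimeField E (spacetimeFlow E q.1 q.2)‖ ≤ δ' := by
    have hc : Continuous fun q : ℝ × (ℝ × Phase) =>
        ‖spacetimeField E p - spacetimeField E (spacetimeFlow E q.1 q.2)‖ :=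
      (continuous_const.sub ((continuous_spacetimeField h).comp hcf)).norm
    filter_upwards [(hc.tendsto' (0, p) 0 (by simp [spacetimeFlow_zero h])).eventually
      (gt_mem_nhds hδ')] with q hq using le_of_lt hq
  obtain ⟨ε, hε, hball⟩ := Metric.eventually_nhds_iff.1 (h1.and h2)
  refine ⟨ε, hε, fun y hy s hs => ?_⟩
  have hq : ∀ r ∈ uIcc 0 s, dist ((r, y) : ℝ × (ℝ × Phase)) (0, p) < ε := by
    intro r hr
    rw [Prod.dist_eq]
    refine max_lt ?_ hy
    have hr' : |r| ≤ |s| := by simpa using abs_sub_left_of_mem_uIcc hr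
    simpa using hr'.trans_lt hs
  have e1 := (convex_uIcc (0 : ℝ) s).norm_image_sub_le_of_norm_hasDerivWithin_le
    (f := fun r => η (spacetimeFlow E r y) - r * ζ p)
    (f' := fun r => ζ (spacetimeFlow E r y) - ζ p) (x := 0) (y := s) (C := δ')
    (fun r _ => (((hd' y r).sub ((hasDerivAt_id r).mul_const (ζ p))).congr_deriv
      (by simp)).hasDerivWithinAt) (fun r hr => (hball (hq r hr)).1) left_mem_uIcc right_mem_uIcc
  have e2 := (convex_uIcc (0 : ℝ) s).norm_image_sub_le_of_norm_hasDerivWithin_le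
    (f := fun r => y + r • spacetimeField E p - spacetimeFlow E r y)
    (f' := fun r => spacetimeField E p - spacetimeField E (spacetimeFlow E r y)) (x := 0) (y := s)
    (C := δ') (fun r _ => (((((hasDerivAt_id r).smul_const _).const_add y).sub
      (hasDerivAt_spacetimeFlow h y r)).congr_deriv (by rw [one_smul])).hasDerivWithinAt)
    (fun r hr => (hball (hq r hr)).2) left_mem_uIcc right_mem_uIcc
  simp only [spacetimeFlow_zero h, zero_smul, add_zero, sub_self, sub_zero, zero_mul,
    Real.norm_eq_abs] at e1 e2
  have e3 := hη.dist_le_mul (y + s • spacetimeField E p) (spacetimeFlow E s y)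
  rw [dist_eq_norm, dist_eq_norm, Real.norm_eq_abs] at e3
  have e4 := e3.trans (mul_le_mul_of_nonneg_left e2 C.2)
  have e5 : δ * |s| = C * (δ' * |s|) + δ' * |s| := by
    have : δ = (C + 1) * δ' := by simp only [δ']; field_simp
    rw [this]; ring
  rw [e5]
  calc |η (y + s • spacetimeField E p) - η y - s * ζ p|
      = |(η (y + s • spacetimeField E p) - η (spacetimeFlow E s y)) +
        (η (spacetimeFlow E s y) - s * ζ p - η y)| := by congr 1; ring
    _ ≤ _ := (abs_add_le _ _).trans (add_le_add e4 e1)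

/-- A function built by integration along the flow is Lipschitz and differentiable along the flow,
but need not be `C¹`. Its mollification at `p`, differentiated in the fixed direction of the field
at `p`, is a limit of averages of difference quotients of `η` near `p` in that direction, and these
are uniformly close to `ζ p`. The Lipschitz constant gives the uniform bounds for dominated
convergence. -/
theorem exists_smooth_approx {η ζ : ℝ × Phase → ℝ} {C : ℝ≥0} (hη : LipschitzWith C η)
    (hηc : HasCompactSupport η) (hζ : Continuous ζ)
    (hd : ∀ p, HasDerivAt (fun s => η (spacetimeFlow E s p)) (ζ p) 0) {O : Set (ℝ × Phase)}
    (hO : IsOpen O) (hsub : tsupport η ⊆ O) :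
    ∃ (g : ℕ → ℝ × Phase → ℝ) (S : Set (ℝ × Phase)) (B : ℝ), IsCompact S ∧ S ⊆ O ∧
      (∀ n, ContDiff ℝ 1 (g n)) ∧ (∀ n, tsupport (g n) ⊆ S) ∧ (∀ n p, |g n p| ≤ B) ∧
      (∀ n p, |transport E (g n) p| ≤ B) ∧ (∀ p, Tendsto (fun n => g n p) atTop (𝓝 (η p))) ∧
      ∀ p, Tendsto (fun n => transport E (g n) p) atTop (𝓝 (ζ p)) := by
  obtain ⟨δ, hδ, hδO⟩ := hηc.isCompact.exists_cthickening_subset_open hO hsub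
  have hSc : IsCompact (Metric.cthickening δ (tsupport η)) := hηc.isCompact.cthickening
  let φ : ℕ → ContDiffBump (0 : ℝ × Phase) := fun n =>
    ⟨δ / (n + 1) / 2, δ / (n + 1), by positivity, half_lt_self (by positivity)⟩
  have hrle : ∀ n, (φ n).rOut ≤ δ := fun n =>
    div_le_self hδ.le (by linarith [Nat.cast_nonneg (α := ℝ) n])
  have hr0 : Tendsto (fun n => (φ n).rOut) atTop (𝓝 0) := by
    have := (tendsto_one_div_add_atTop_nhds_zero_nat (𝕜 := ℝ)).const_mul δ
    simpa [φ, div_eq_mul_inv] using this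
  let g : ℕ → ℝ × Phase → ℝ := fun n => mollify volume (φ n) η
  have hηcont := hη.continuous
  have hgs : ∀ n, ContDiff ℝ ∞ (g n) := fun n => contDiff_mollify (φ n) hηcont
  have hgS : ∀ n, tsupport (g n) ⊆ Metric.cthickening δ (tsupport η) := fun n =>
    closure_minimal ((support_mollify_subset (φ n) hηcont).trans
      (Metric.cthickening_mono (hrle n) _)) Metric.isClosed_cthickening
  obtain ⟨B₁, hB₁⟩ := hηcont.bounded_above_of_compact_support hηc
  obtain ⟨B₂, hB₂⟩ := hSc.exists_bound_of_continuousOn (continuous_spacetimeField h).continuousOn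
  have hB₂0 : 0 ≤ |B₂| := abs_nonneg _
  have hB₁0 : 0 ≤ B₁ := (norm_nonneg _).trans (hB₁ 0)
  refine ⟨g, _, B₁ + C * |B₂|, hSc, hδO, fun n => (hgs n).of_le (by exact_mod_cast le_top), hgS,
    fun n p => ?_, fun n p => ?_, fun p => ?_, fun p => ?_⟩
  · have h1 := abs_mollify_sub_le (μ := volume) (φ n) hηcont (p := p) (c := 0) (ε := B₁) hB₁0
      fun y _ => by rw [sub_zero]; exact hB₁ y
    rw [sub_zero] at h1
    have : 0 ≤ C * |B₂| := by positivity
    linarith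
  · by_cases hp : p ∈ Metric.cthickening δ (tsupport η)
    · have h1 := (fderiv ℝ (g n) p).le_opNorm (spacetimeField E p)
      have h2 := norm_fderiv_le_of_lipschitz ℝ (x₀ := p) (lipschitzWith_mollify (μ := volume) (φ n) hη)
      have h3 : ‖fderiv ℝ (g n) p‖ * ‖spacetimeField E p‖ ≤ C * |B₂| :=
        mul_le_mul h2 ((hB₂ p hp).trans (le_abs_self _)) (norm_nonneg _) C.2
      exact (h1.trans h3).trans (by linarith)
    · have h1 : fderiv ℝ (g n) p = 0 := by
        have : p ∉ tsupport (fderiv ℝ (g n)) := fun hmem => hp (hgS n (tsupport_fderiv_subset ℝ hmem))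
        exact image_eq_zero_of_notMem_tsupport this
      simp only [transport, h1, zero_apply, abs_zero]
      positivity
  · rw [Metric.tendsto_atTop]
    intro ε hε
    obtain ⟨r, hr, hball⟩ := Metric.continuousAt_iff.1 (hηcont.continuousAt (x := p)) (ε / 2) (half_pos hε)
    obtain ⟨N, hN⟩ := eventually_atTop.1 (hr0.eventually (gt_mem_nhds hr))
    refine ⟨N, fun n hn => ?_⟩
    have h1 := abs_mollify_sub_le (μ := volume) (φ n) hηcont (p := p) (c := η p) (half_pos hε).le
      fun y hy => (hball (lt_trans hy (hN n hn))).le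
    exact lt_of_le_of_lt h1 (by linarith)
  · rw [Metric.tendsto_atTop]
    intro δ' hδ'
    obtain ⟨r, hr, hball⟩ := eventually_abs_sub_sub_le h hη hζ hd p (half_pos hδ')
    obtain ⟨N, hN⟩ := eventually_atTop.1 (hr0.eventually (gt_mem_nhds hr))
    refine ⟨N, fun n hn => ?_⟩
    have hdiff : HasFDerivAt (g n) (fderiv ℝ (g n) p) (p + (0 : ℝ) • spacetimeField E p) := by
      rw [zero_smul, add_zero]
      exact ((hgs n).differentiable (by simp) p).hasFDerivAt
    have h1 : HasDerivAt (fun s : ℝ => g n (p + s • spacetimeField E p) - s * ζ p)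
        (transport E (g n) p - ζ p) 0 := by
      have h2 : HasDerivAt (fun s : ℝ => p + s • spacetimeField E p) (spacetimeField E p) 0 :=
        (((hasDerivAt_id (0 : ℝ)).smul_const _).const_add p).congr_deriv (by rw [one_smul])
      exact ((hdiff.comp_hasDerivAt (0 : ℝ) h2).sub ((hasDerivAt_id (0 : ℝ)).mul_const (ζ p))).congr_deriv
        (by rw [one_mul]; rfl)
    have h3 := h1.le_of_lip' (half_pos hδ').le (by
      filter_upwards [Metric.ball_mem_nhds (0 : ℝ) hr] with s hs
      have hs' : |s| < r := by simpa using hs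
      have h4 := abs_mollify_add_sub_le (μ := volume) (φ n) hηcont (p := p)
        (k := s • spacetimeField E p) (c := s * ζ p) (ε := δ' / 2 * |s|) (by positivity)
        fun y hy => hball y (Metric.ball_subset_ball (hN n hn).le hy) s hs'
      simp only [zero_smul, add_zero, zero_mul, sub_zero, Real.norm_eq_abs]
      rw [sub_right_comm]
      exact h4)
    exact lt_of_le_of_lt h3 (by linarith)

end STFlow

/-! ### Weak transport identities -/

instance sfinite_boundaryMeasure {Ω : Set R3} [IsFiniteMeasure (surfaceMeasure Ω)] :
    SFinite (boundaryMeasure Ω) :=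
  inferInstanceAs (SFinite (((surfaceMeasure Ω).prod (volume : Measure R3)).withDensity _))

instance sfinite_sigmaOut {Ω : Set R3} [IsFiniteMeasure (surfaceMeasure Ω)] :
    SFinite (sigmaOut Ω) := inferInstanceAs (SFinite ((boundaryMeasure Ω).restrict _))

instance sfinite_sigmaIn {Ω : Set R3} [IsFiniteMeasure (surfaceMeasure Ω)] :
    SFinite (sigmaIn Ω) := inferInstanceAs (SFinite ((boundaryMeasure Ω).restrict _))

instance sfinite_interiorMeasure {Ω : Set R3} : SFinite (interiorMeasure Ω) :=
  inferInstanceAs (SFinite (volume.restrict _))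

instance isFiniteMeasureOnCompacts_interiorMeasure {Ω : Set R3} :
    IsFiniteMeasureOnCompacts (interiorMeasure Ω) :=
  ⟨fun _ hK => (Measure.restrict_apply_le _ _).trans_lt hK.measure_lt_top⟩

/-! ### Measurability of the outgoing and incoming boundaries. -/

section MeasurableBoundary
variable {Ω : Set R3} (hΩo : IsOpen Ω) (hΩc : Convex ℝ Ω) (hΩs : HasSmoothBoundary Ω)
include hΩo hΩc hΩs

lemma measurable_indicator_outerNormal : Measurable ((frontier Ω).indicator (outerNormal Ω)) := by
  classical
  rw [← piecewise_eq_indicator]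
  exact (continuousOn_outerNormal hΩo hΩc hΩs).measurable_piecewise continuousOn_const
    isClosed_frontier.measurableSet

lemma measurableSet_outgoing : MeasurableSet (outgoing Ω) := by
  have h1 : outgoing Ω = {z : Phase | z.1 ∈ frontier Ω} ∩
      {z : Phase | 0 < inner ℝ ((frontier Ω).indicator (outerNormal Ω) z.1) z.2} := by
    ext z
    refine and_congr_right fun hz => ?_
    simp only [mem_ofPred_eq]
    rw [indicator_of_mem (show z.1 ∈ frontier Ω from hz)]
  rw [h1]
  exact (measurable_fst isClosed_frontier.measurableSet).inter (measurableSet_lt measurable_const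
    (((measurable_indicator_outerNormal hΩo hΩc hΩs).comp measurable_fst).inner measurable_snd))

lemma measurableSet_incoming : MeasurableSet (incoming Ω) := by
  have h1 : incoming Ω = {z : Phase | z.1 ∈ frontier Ω} ∩
      {z : Phase | inner ℝ ((frontier Ω).indicator (outerNormal Ω) z.1) z.2 < 0} := by
    ext z
    refine and_congr_right fun hz => ?_
    simp only [mem_ofPred_eq]
    rw [indicator_of_mem (show z.1 ∈ frontier Ω from hz)]
  rw [h1]
  exact (measurable_fst isClosed_frontier.measurableSet).inter (measurableSet_lt
    (((measurable_indicator_outerNormal hΩo hΩc hΩs).comp measurable_fst).inner measurable_snd)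
    measurable_const)

end MeasurableBoundary

/-- `u` solves `∂ₜu + v · ∇ₓu + E · ∇ᵥu = F` weakly in `J × Ω × ℝ³`, with trace `γ`. -/
structure IsWeakTriple (Ω : Set R3) (E : R3 → R3) (J : Set ℝ) (u F γ : ℝ × Phase → ℝ) : Prop where
  locallyIntegrable : LocallyIntegrable u ((volume : Measure ℝ).prod (interiorMeasure Ω))
  locallyIntegrable_source : LocallyIntegrable F ((volume : Measure ℝ).prod (interiorMeasure Ω))
  locallyIntegrable_trace : LocallyIntegrable γ ((volume : Measure ℝ).prod (boundaryMeasure Ω))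
  weak : ∀ η : ℝ × Phase → ℝ, ContDiff ℝ 1 η → HasCompactSupport η → tsupport η ⊆ J ×ˢ univ →
    (∫ p, u p * transport E η p ∂((volume : Measure ℝ).prod (interiorMeasure Ω))) +
      (∫ p, F p * η p ∂((volume : Measure ℝ).prod (interiorMeasure Ω))) =
    (∫ p, γ p * η p ∂((volume : Measure ℝ).prod (sigmaOut Ω))) -
      ∫ p, γ p * η p ∂((volume : Measure ℝ).prod (sigmaIn Ω))

lemma LocallyIntegrable.mono_measure' {X : Type*} [MeasurableSpace X] [TopologicalSpace X]
    {f : X → ℝ} {μ ν : Measure X} (hf : LocallyIntegrable f μ) (hν : ν ≤ μ) :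
    LocallyIntegrable f ν := fun x =>
  let ⟨s, hs, hfs⟩ := hf x
  ⟨s, hs, IntegrableOn.mono_measure hfs hν⟩

lemma prod_sigmaOut_le {Ω : Set R3} [IsFiniteMeasure (surfaceMeasure Ω)] :
    (volume : Measure ℝ).prod (sigmaOut Ω) ≤ (volume : Measure ℝ).prod (boundaryMeasure Ω) :=
  Measure.prod_mono le_rfl Measure.restrict_le_self

lemma prod_sigmaIn_le {Ω : Set R3} [IsFiniteMeasure (surfaceMeasure Ω)] :
    (volume : Measure ℝ).prod (sigmaIn Ω) ≤ (volume : Measure ℝ).prod (boundaryMeasure Ω) :=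
  Measure.prod_mono le_rfl Measure.restrict_le_self

lemma tendsto_integral_mul_of_bounded {X : Type*} [MeasurableSpace X] [TopologicalSpace X]
    [T2Space X] [OpensMeasurableSpace X] {μ : Measure X} {f g : X → ℝ} {G : ℕ → X → ℝ}
    (hf : LocallyIntegrable f μ) {S : Set X} (hS : IsCompact S) {B : ℝ}
    (hGm : ∀ n, AEStronglyMeasurable (G n) μ) (hGS : ∀ n, ∀ x ∉ S, G n x = 0)
    (hGB : ∀ n x, |G n x| ≤ B) (hlim : ∀ x, Tendsto (fun n => G n x) atTop (𝓝 (g x))) :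
    Tendsto (fun n => ∫ x, f x * G n x ∂μ) atTop (𝓝 (∫ x, f x * g x ∂μ)) := by
  have hfS : IntegrableOn f S μ := hf.integrableOn_isCompact hS
  have hgS : ∀ x ∉ S, g x = 0 := fun x hx =>
    tendsto_nhds_unique (hlim x) (by simp only [hGS _ x hx]; exact tendsto_const_nhds)
  have hr : ∀ G : X → ℝ, (∀ x ∉ S, G x = 0) → ∫ x, f x * G x ∂μ = ∫ x in S, f x * G x ∂μ :=
    fun G hG => (setIntegral_eq_integral_of_forall_compl_eq_zero
      (fun x hx => by rw [hG x hx, mul_zero])).symm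
  rw [hr g hgS]
  simp_rw [fun n => hr (G n) (hGS n)]
  refine tendsto_integral_of_dominated_convergence (fun x => |f x| * B)
    (fun n => hfS.aestronglyMeasurable.mul (hGm n).restrict) (hfS.abs.mul_const B)
    (fun n => Eventually.of_forall fun x => ?_)
    (Eventually.of_forall fun x => (hlim x).const_mul _)
  rw [norm_mul, Real.norm_eq_abs, Real.norm_eq_abs]
  exact mul_le_mul_of_nonneg_left (hGB n x) (abs_nonneg _)

/-! ### Averages along the flow as test functions, and the identity in a tube. -/

section Triple
variable {Ω : Set R3} {E : R3 → R3} {K : ℝ≥0} {M : ℝ} {J : Set ℝ} {u F γ : ℝ × Phase → ℝ}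
  (h : IsForceField E K M)

include h in
lemma continuous_transport {g : ℝ × Phase → ℝ} (hg : ContDiff ℝ 1 g) : Continuous (transport E g) :=
  (hg.continuous_fderiv one_ne_zero).clm_apply (continuous_spacetimeField h)

lemma transport_eq_zero_of_notMem {g : ℝ × Phase → ℝ} {p : ℝ × Phase} (hp : p ∉ tsupport g) :
    transport E g p = 0 := by
  have h1 : fderiv ℝ g p = 0 :=
    image_eq_zero_of_notMem_tsupport fun hmem => hp (tsupport_fderiv_subset ℝ hmem)
  rw [transport, h1, zero_apply]

include h in
theorem IsWeakTriple.weak_lipschitz [IsFiniteMeasure (surfaceMeasure Ω)]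
    (ht : IsWeakTriple Ω E J u F γ) (hJ : IsOpen J) {η ζ : ℝ × Phase → ℝ} {C : ℝ≥0}
    (hη : LipschitzWith C η) (hηc : HasCompactSupport η) (hζ : Continuous ζ)
    (hd : ∀ p, HasDerivAt (fun s => η (spacetimeFlow E s p)) (ζ p) 0)
    (hsub : tsupport η ⊆ J ×ˢ univ) :
    (∫ p, u p * ζ p ∂((volume : Measure ℝ).prod (interiorMeasure Ω))) +
      (∫ p, F p * η p ∂((volume : Measure ℝ).prod (interiorMeasure Ω))) =
    (∫ p, γ p * η p ∂((volume : Measure ℝ).prod (sigmaOut Ω))) -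
      ∫ p, γ p * η p ∂((volume : Measure ℝ).prod (sigmaIn Ω)) := by
  obtain ⟨g, S, B, hS, hSO, hg1, hgS, hgB, htB, hgl, htl⟩ :=
    exists_smooth_approx h hη hηc hζ hd (hJ.prod isOpen_univ) hsub
  have h0 : ∀ n, ∀ p ∉ S, g n p = 0 := fun n p hp =>
    image_eq_zero_of_notMem_tsupport fun hmem => hp (hgS n hmem)
  have h1 : ∀ n, ∀ p ∉ S, transport E (g n) p = 0 := fun n p hp =>
    transport_eq_zero_of_notMem fun hmem => hp (hgS n hmem)
  have m1 : ∀ (μ : Measure (ℝ × Phase)) n, AEStronglyMeasurable (g n) μ := fun μ n =>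
    (hg1 n).continuous.aestronglyMeasurable
  have L1 := tendsto_integral_mul_of_bounded ht.locallyIntegrable hS
    (fun n => (continuous_transport h (hg1 n)).aestronglyMeasurable) h1 htB htl
  have L2 := tendsto_integral_mul_of_bounded ht.locallyIntegrable_source hS (m1 _) h0 hgB hgl
  have L3 := tendsto_integral_mul_of_bounded
    (LocallyIntegrable.mono_measure' ht.locallyIntegrable_trace prod_sigmaOut_le) hS (m1 _) h0 hgB hgl
  have L4 := tendsto_integral_mul_of_bounded
    (LocallyIntegrable.mono_measure' ht.locallyIntegrable_trace prod_sigmaIn_le) hS (m1 _) h0 hgB hgl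
  refine tendsto_nhds_unique (L1.add L2) ((L3.sub L4).congr fun n => ?_)
  exact (ht.weak (g n) (hg1 n) (hS.of_isClosed_subset (isClosed_tsupport _) (hgS n))
    ((hgS n).trans hSO)).symm

/-- The integral of `a` along the backward flow during time `L`. -/
noncomputable def backAverage (E : R3 → R3) (L : ℝ) (a : ℝ × Phase → ℝ) (p : ℝ × Phase) : ℝ :=
  ∫ s in (0 : ℝ)..L, a (spacetimeFlow E (-s) p)

include h in
lemma lipschitzWith_backAverage {a : ℝ × Phase → ℝ} {C : ℝ≥0} (ha : LipschitzWith C a) {L : ℝ}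
    (hL : 0 ≤ L) : LipschitzWith (C * (Real.exp ((max 1 K : ℝ≥0) * L) * L).toNNReal)
      (backAverage E L a) := by
  refine LipschitzWith.of_dist_le_mul fun p q => ?_
  have hc : ∀ p, Continuous fun s => a (spacetimeFlow E (-s) p) := fun p =>
    ha.continuous.comp (continuous_spacetimeFlow_comp h continuous_neg continuous_const)
  rw [dist_eq_norm, backAverage, backAverage, ← intervalIntegral.integral_sub
    ((hc p).intervalIntegrable _ _) ((hc q).intervalIntegrable _ _)]
  have h1 := intervalIntegral.norm_integral_le_of_norm_le_const (a := 0) (b := L)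
    (f := fun s => a (spacetimeFlow E (-s) p) - a (spacetimeFlow E (-s) q))
    (C := C * (dist p q * Real.exp ((max 1 K : ℝ≥0) * L))) fun s hs => by
      rw [uIoc_of_le hL] at hs
      rw [← dist_eq_norm]
      refine (ha.dist_le_mul _ _).trans (mul_le_mul_of_nonneg_left ?_ C.2)
      refine (dist_spacetimeFlow_le h _ _ _).trans (mul_le_mul_of_nonneg_left ?_ dist_nonneg)
      rw [abs_neg, abs_of_pos hs.1]
      exact Real.exp_le_exp.2 (mul_le_mul_of_nonneg_left hs.2 (NNReal.coe_nonneg _))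
  refine h1.trans (le_of_eq ?_)
  rw [sub_zero, abs_of_nonneg hL, NNReal.coe_mul, Real.coe_toNNReal _ (by positivity)]
  ring

include h in
-- Moving along the flow shifts the window of integration: the average at the point reached after
-- time `r` is the integral of `a` along the orbit over `[r - L, r]`.
lemma hasDerivAt_backAverage {a : ℝ × Phase → ℝ} (ha : Continuous a) (L : ℝ) (p : ℝ × Phase) :
    HasDerivAt (fun r => backAverage E L a (spacetimeFlow E r p))
      (a p - a (spacetimeFlow E (-L) p)) 0 := by
  have hc : Continuous fun s => a (spacetimeFlow E s p) :=
    ha.comp (continuous_spacetimeFlow_comp h continuous_id continuous_const)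
  have h1 : (fun r => backAverage E L a (spacetimeFlow E r p)) = fun r =>
      (∫ s in (0 : ℝ)..r, a (spacetimeFlow E s p)) - ∫ s in (0 : ℝ)..(r - L), a (spacetimeFlow E s p) := by
    funext r
    rw [intervalIntegral.integral_interval_sub_left (hc.intervalIntegrable _ _)
      (hc.intervalIntegrable _ _)]
    have := intervalIntegral.integral_comp_sub_left (a := 0) (b := L)
      (fun s => a (spacetimeFlow E s p)) r
    rw [sub_zero] at this
    rw [← this, backAverage]
    refine intervalIntegral.integral_congr fun s _ => ?_
    simp only [← spacetimeFlow_add h, neg_add_eq_sub]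
  rw [h1]
  have d1 := (hc.integral_hasStrictDerivAt 0 0).hasDerivAt
  have d2 := HasDerivAt.comp_sub_const (x := (0 : ℝ)) (a := L)
    (hc.integral_hasStrictDerivAt 0 (0 - L)).hasDerivAt
  refine (d1.sub d2).congr_deriv ?_
  rw [spacetimeFlow_zero h, zero_sub]

include h in
lemma exists_of_backAverage_ne_zero {a : ℝ × Phase → ℝ} {L : ℝ} (hL : 0 ≤ L) {p : ℝ × Phase}
    (hp : backAverage E L a p ≠ 0) : ∃ s ∈ Icc 0 L, ∃ q, a q ≠ 0 ∧ p = spacetimeFlow E s q := by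
  by_contra! hcon
  refine hp ?_
  rw [backAverage]
  have : ∀ s ∈ uIcc 0 L, a (spacetimeFlow E (-s) p) = (fun _ => (0 : ℝ)) s := by
    intro s hs
    rw [uIcc_of_le hL] at hs
    by_contra hne
    exact hcon s hs _ hne (spacetimeFlow_flow_neg h s p).symm
  rw [intervalIntegral.integral_congr this]
  simp

include h in
lemma isCompact_image_flow {S : Set (ℝ × Phase)} (hS : IsCompact S) (L : ℝ) :
    IsCompact ((fun q : ℝ × (ℝ × Phase) => spacetimeFlow E q.1 q.2) '' (Icc 0 L ×ˢ S)) :=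
  (isCompact_Icc.prod hS).image (continuous_spacetimeFlow h)

include h in
lemma tsupport_backAverage_subset {a : ℝ × Phase → ℝ} {L : ℝ} (hL : 0 ≤ L)
    (hac : HasCompactSupport a) : tsupport (backAverage E L a) ⊆
      (fun q : ℝ × (ℝ × Phase) => spacetimeFlow E q.1 q.2) '' (Icc 0 L ×ˢ tsupport a) := by
  refine closure_minimal (fun p hp => ?_) (isCompact_image_flow h hac.isCompact L).isClosed
  obtain ⟨s, hs, q, hq, rfl⟩ := exists_of_backAverage_ne_zero h hL hp
  exact ⟨(s, q), ⟨hs, subset_tsupport a hq⟩, rfl⟩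

/-- All characteristics starting in `B` exit through `Γ₊` before time `L`, and then stay away from
the closure of `Ω` until time `L`. -/
def IsTube (Ω : Set R3) (E : R3 → R3) (L : ℝ) (B : Set Phase) : Prop :=
  ∀ z ∈ B, ∃ τ, τ < L ∧ ExitsAt Ω E z τ ∧ ∀ s ∈ Ioc τ L, (phaseFlow E s z).1 ∉ closure Ω

include h in
-- The test function is the backward average of `a`, with derivative `a - a ∘ (flow by -L)` along
-- the flow. The second term vanishes over `Ω`, because characteristics starting in the support of
-- `a` are outside `closure Ω` at time `L`. The test function vanishes on `Γ₋`, because up to time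
-- `L` they meet the boundary only at their exit, on `Γ₊`.
theorem IsWeakTriple.tube_identity [IsFiniteMeasure (surfaceMeasure Ω)] (hΩo : IsOpen Ω)
    (hΩc : Convex ℝ Ω) (hΩs : HasSmoothBoundary Ω)
    (ht : IsWeakTriple Ω E J u F γ) (hJ : IsOpen J) {a : ℝ × Phase → ℝ} {C : ℝ≥0}
    (ha : LipschitzWith C a) (hac : HasCompactSupport a) {L : ℝ} (hL : 0 < L) {B : Set Phase}
    (hB : IsTube Ω E L B) {J' : Set ℝ} (hJ' : ∀ t ∈ J', ∀ s ∈ Icc 0 L, t + s ∈ J)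
    (hsub : tsupport a ⊆ J' ×ˢ B) :
    (∫ p, u p * a p ∂((volume : Measure ℝ).prod (interiorMeasure Ω))) +
      (∫ p, F p * backAverage E L a p ∂((volume : Measure ℝ).prod (interiorMeasure Ω))) =
    ∫ p, γ p * backAverage E L a p ∂((volume : Measure ℝ).prod (sigmaOut Ω)) := by
  have hcomp : HasCompactSupport (backAverage E L a) :=
    (isCompact_image_flow h hac.isCompact L).of_isClosed_subset (isClosed_tsupport _)
      (tsupport_backAverage_subset h hL.le hac)
  have hid := ht.weak_lipschitz h hJ (lipschitzWith_backAverage h ha hL.le) hcomp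
    (ζ := fun p => a p - a (spacetimeFlow E (-L) p))
    (ha.continuous.sub (ha.continuous.comp (continuous_spacetimeFlow_comp h continuous_const
      continuous_id))) (hasDerivAt_backAverage h ha.continuous L) (by
      refine (tsupport_backAverage_subset h hL.le hac).trans ?_
      rintro _ ⟨⟨s, q⟩, ⟨hs, hq⟩, rfl⟩
      exact ⟨hJ' _ (hsub hq).1 s hs, mem_univ _⟩)
  have hin : ∫ p, γ p * backAverage E L a p ∂((volume : Measure ℝ).prod (sigmaIn Ω)) = 0 := by
    refine integral_eq_zero_of_ae ?_
    have hmem : ∀ᵐ p ∂((volume : Measure ℝ).prod (sigmaIn Ω)), p.2 ∈ incoming Ω :=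
      Measure.quasiMeasurePreserving_snd.ae (ae_restrict_mem (measurableSet_incoming hΩo hΩc hΩs))
    filter_upwards [hmem] with p hp
    have : backAverage E L a p = 0 := by
      by_contra hne
      obtain ⟨s, hs, q, hq, rfl⟩ := exists_of_backAverage_ne_zero h hL.le hne
      obtain ⟨τ, hτL, hτ, hout⟩ := hB _ (hsub (subset_tsupport a hq)).2
      have hp' : phaseFlow E s q.2 ∈ incoming Ω := hp
      rcases lt_trichotomy s τ with hlt | heq | hlt
      · exact notMem_of_mem_frontier hΩo hp'.1 (hτ.2.1 s ⟨hs.1, hlt⟩)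
      · subst heq
        exact absurd hp'.2 (not_lt.2 hτ.2.2.2.le)
      · exact hout s ⟨hlt, hs.2⟩ (frontier_subset_closure hp'.1)
    rw [this, mul_zero]; rfl
  have hint : ∫ p, u p * (a p - a (spacetimeFlow E (-L) p))
      ∂((volume : Measure ℝ).prod (interiorMeasure Ω)) =
      ∫ p, u p * a p ∂((volume : Measure ℝ).prod (interiorMeasure Ω)) := by
    refine integral_congr_ae ?_
    have hmem : ∀ᵐ p ∂((volume : Measure ℝ).prod (interiorMeasure Ω)), p.2.1 ∈ Ω := by
      have : ∀ᵐ z ∂(interiorMeasure Ω), z.1 ∈ Ω := by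
        filter_upwards [ae_restrict_mem (hΩo.measurableSet.prod MeasurableSet.univ)] with z hz
          using hz.1
      exact Measure.quasiMeasurePreserving_snd.ae this
    filter_upwards [hmem] with p hp
    have : a (spacetimeFlow E (-L) p) = 0 := by
      by_contra hne
      obtain ⟨τ, hτL, hτ, hout⟩ := hB _ (hsub (subset_tsupport a hne)).2
      have := hout L ⟨hτL, le_rfl⟩
      simp only [spacetimeFlow, flow_flow_neg h] at this
      exact this (subset_closure hp)
    rw [this, sub_zero]
  rw [hin, sub_zero, hint] at hid
  exact hid

end Triple

/-! ### The constant solution -/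

lemma integral_fderiv_eq_zero {V : Type*} [NormedAddCommGroup V] [NormedSpace ℝ V]
    [FiniteDimensional ℝ V] [MeasurableSpace V] [BorelSpace V] (μ : Measure V) [μ.IsAddHaarMeasure]
    {g : V → ℝ} (hg : ContDiff ℝ 1 g) (hgc : HasCompactSupport g) (w : V) :
    ∫ x, fderiv ℝ g x w ∂μ = 0 := by
  have hd : HasCompactSupport fun x => fderiv ℝ g x w :=
    (hgc.fderiv (𝕜 := ℝ)).comp_left (g := fun l : V →L[ℝ] ℝ => l w) rfl
  have hc : Continuous fun x => fderiv ℝ g x w :=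
    (hg.continuous_fderiv one_ne_zero).clm_apply continuous_const
  have h1 := integral_mul_fderiv_eq_neg_fderiv_mul_of_integrable (μ := μ) (f := fun _ : V => (1 : ℝ))
    (g := g) (v := w) (by simp) (by simpa using hc.integrable_of_hasCompactSupport hd)
    (by simpa using hg.continuous.integrable_of_hasCompactSupport hgc) (fun x _ => by fun_prop)
    (fun x _ => hg.differentiable one_ne_zero x)
  simpa using h1

section BoundaryMeasure
variable {Ω : Set R3} (hΩo : IsOpen Ω) (hΩc : Convex ℝ Ω) (hΩs : HasSmoothBoundary Ω)

lemma ae_mem_frontier [IsFiniteMeasure (surfaceMeasure Ω)] :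
    ∀ᵐ z ∂((surfaceMeasure Ω).prod (volume : Measure R3)), z.1 ∈ frontier Ω :=
  Measure.quasiMeasurePreserving_fst.ae (ae_restrict_mem isClosed_frontier.measurableSet)

include hΩo hΩc hΩs in
lemma aemeasurable_inner_outerNormal [IsFiniteMeasure (surfaceMeasure Ω)] :
    AEMeasurable (fun z : Phase => inner ℝ (outerNormal Ω z.1) z.2)
      ((surfaceMeasure Ω).prod (volume : Measure R3)) := by
  refine ⟨fun z => inner ℝ ((frontier Ω).indicator (outerNormal Ω) z.1) z.2,
    ((measurable_indicator_outerNormal hΩo hΩc hΩs).comp measurable_fst).inner measurable_snd, ?_⟩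
  filter_upwards [ae_mem_frontier (Ω := Ω)] with z hz
  rw [indicator_of_mem hz]

include hΩo hΩc hΩs in
lemma abs_inner_outerNormal_le {z : Phase} (hz : z.1 ∈ frontier Ω) :
    |inner ℝ (outerNormal Ω z.1) z.2| ≤ ‖z.2‖ := by
  have := abs_real_inner_le_norm (outerNormal Ω z.1) z.2
  rwa [norm_outerNormal hΩo hΩc hΩs hz, one_mul] at this

include hΩo hΩc hΩs in
lemma isFiniteMeasureOnCompacts_boundaryMeasure [IsFiniteMeasure (surfaceMeasure Ω)] :
    IsFiniteMeasureOnCompacts (boundaryMeasure Ω) := by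
  refine ⟨fun S hS => ?_⟩
  obtain ⟨R, hR⟩ := hS.isBounded.exists_norm_le
  have hν : boundaryMeasure Ω = ((surfaceMeasure Ω).prod (volume : Measure R3)).withDensity
    (fun z => ENNReal.ofReal |inner ℝ (outerNormal Ω z.1) z.2|) := rfl
  rw [hν, withDensity_apply _ hS.measurableSet]
  refine (setLIntegral_mono_ae' (g := fun _ => ENNReal.ofReal R) hS.measurableSet ?_).trans_lt ?_
  · filter_upwards [ae_mem_frontier (Ω := Ω)] with z hz hzS
    exact ENNReal.ofReal_le_ofReal ((abs_inner_outerNormal_le hΩo hΩc hΩs hz).trans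
      ((norm_snd_le z).trans (hR z hzS)))
  · rw [setLIntegral_const]
    exact ENNReal.mul_lt_top ENNReal.ofReal_lt_top hS.measure_lt_top

include hΩo hΩc hΩs in
lemma integral_sigmaOut_sub_sigmaIn [IsFiniteMeasure (surfaceMeasure Ω)] {f : Phase → ℝ}
    (hf : Integrable (fun z : Phase => f z * inner ℝ (outerNormal Ω z.1) z.2)
      ((surfaceMeasure Ω).prod (volume : Measure R3))) :
    (∫ z, f z ∂(sigmaOut Ω)) - ∫ z, f z ∂(sigmaIn Ω) =
      ∫ z, f z * inner ℝ (outerNormal Ω z.1) z.2 ∂((surfaceMeasure Ω).prod (volume : Measure R3)) := by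
  set ν := (surfaceMeasure Ω).prod (volume : Measure R3)
  have hden : AEMeasurable (fun z : Phase => ENNReal.ofReal |inner ℝ (outerNormal Ω z.1) z.2|) ν :=
    (measurable_id.abs.comp_aemeasurable
      (aemeasurable_inner_outerNormal hΩo hΩc hΩs)).ennreal_ofReal
  have hmo := measurableSet_outgoing hΩo hΩc hΩs
  have hmi := measurableSet_incoming hΩo hΩc hΩs
  have e : ∀ S, MeasurableSet S → ∫ z in S, f z ∂(boundaryMeasure Ω) =
      ∫ z in S, |inner ℝ (outerNormal Ω z.1) z.2| * f z ∂ν := by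
    intro S hS
    rw [show boundaryMeasure Ω = ν.withDensity
      (fun z => ENNReal.ofReal |inner ℝ (outerNormal Ω z.1) z.2|) from rfl,
      setIntegral_withDensity_eq_setIntegral_toReal_smul₀ hden.restrict
        (Eventually.of_forall fun _ => ENNReal.ofReal_lt_top) f hS]
    simp only [ENNReal.toReal_ofReal (abs_nonneg _), smul_eq_mul]
  have e1 : ∫ z, f z ∂(sigmaOut Ω) = ∫ z in outgoing Ω, f z * inner ℝ (outerNormal Ω z.1) z.2 ∂ν := by
    rw [sigmaOut, e _ hmo]
    refine setIntegral_congr_fun hmo fun z hz => ?_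
    simp only [abs_of_pos hz.2, mul_comm]
  have e2 : ∫ z, f z ∂(sigmaIn Ω) = -∫ z in incoming Ω, f z * inner ℝ (outerNormal Ω z.1) z.2 ∂ν := by
    rw [sigmaIn, e _ hmi, ← integral_neg]
    refine setIntegral_congr_fun hmi fun z hz => ?_
    simp only [abs_of_neg hz.2]; ring
  have hdisj : Disjoint (outgoing Ω) (incoming Ω) :=
    Set.disjoint_left.2 fun z hz hz' => lt_asymm hz.2 hz'.2
  rw [e1, e2, sub_neg_eq_add, ← setIntegral_union hdisj hmi hf.integrableOn hf.integrableOn]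
  refine setIntegral_eq_integral_of_ae_compl_eq_zero ?_
  filter_upwards [ae_mem_frontier (Ω := Ω)] with z hz hnot
  have : inner ℝ (outerNormal Ω z.1) z.2 = 0 := by
    by_contra hne
    rcases lt_or_gt_of_ne hne with hlt | hgt
    · exact hnot (Or.inr ⟨hz, hlt⟩)
    · exact hnot (Or.inl ⟨hz, hgt⟩)
  rw [this, mul_zero]

lemma integrable_of_bounded_of_compact {X : Type*} [MeasurableSpace X] [TopologicalSpace X]
    [T2Space X] [OpensMeasurableSpace X] {μ : Measure X} [IsFiniteMeasureOnCompacts μ] {f : X → ℝ}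
    (hf : AEStronglyMeasurable f μ) {S : Set X} (hS : IsCompact S) (h0 : ∀ x ∉ S, f x = 0) {B : ℝ}
    (hB : ∀ᵐ x ∂μ, x ∈ S → |f x| ≤ B) : Integrable f μ := by
  have h1 : IntegrableOn f S μ := by
    refine Measure.integrableOn_of_bounded (M := B) hS.measure_lt_top.ne hf ?_
    rw [ae_restrict_iff' hS.measurableSet]
    exact hB
  exact h1.integrable_of_forall_notMem_eq_zero h0

include hΩo hΩc hΩs in
/-- The divergence theorem in phase space, for the divergence-free field `(v, E(x))`. -/
theorem phase_gaussGreen [IsFiniteMeasure (surfaceMeasure Ω)] {lam : R3 → ℝ} (hlm : Measurable lam)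
    {b : ℝ} (hlb : ∀ x, |lam x| ≤ b)
    (hgg : ∀ f : R3 → ℝ, ContDiff ℝ 1 f → HasCompactSupport f → ∀ v,
      ∫ x in Ω, fderiv ℝ f x v = ∫ y, f y * (lam y * inner ℝ (outerNormal Ω y) v) ∂(surfaceMeasure Ω))
    {E : R3 → R3} (hE : Continuous E) {g : Phase → ℝ} (hg : ContDiff ℝ 1 g)
    (hgc : HasCompactSupport g) :
    ∫ z, fderiv ℝ g z (phaseField E z) ∂(interiorMeasure Ω) =
      (∫ z, lam z.1 * g z ∂(sigmaOut Ω)) - ∫ z, lam z.1 * g z ∂(sigmaIn Ω) := by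
  have hμ : interiorMeasure Ω = (volume.restrict Ω).prod (volume : Measure R3) := by
    rw [interiorMeasure, Measure.volume_eq_prod, ← Measure.prod_restrict, Measure.restrict_univ]
  have hgd := hg.differentiable one_ne_zero
  have hfd : HasCompactSupport (fderiv ℝ g) := hgc.fderiv (𝕜 := ℝ)
  have hint : ∀ X : Phase → Phase, Continuous X →
      Integrable (fun z => fderiv ℝ g z (X z)) ((volume.restrict Ω).prod (volume : Measure R3)) := by
    intro X hX
    rw [← hμ]
    exact ((hg.continuous_fderiv one_ne_zero).clm_apply hX).integrable_of_hasCompactSupport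
      (hfd.mono fun z hz hz' => hz (by simp only [hz', zero_apply]))
  have hx : ∀ v, HasCompactSupport fun x => g (x, v) := fun v =>
    hgc.comp_isClosedEmbedding (Topology.IsClosedEmbedding.of_continuous_injective_isClosedMap
      (by fun_prop) (fun _ _ hxy => (Prod.mk.inj hxy).1) (isClosedMap_prodMk_right (y := v)))
  have hv : ∀ x, HasCompactSupport fun v => g (x, v) := fun x =>
    hgc.comp_isClosedEmbedding (Topology.IsClosedEmbedding.of_continuous_injective_isClosedMap
      (by fun_prop) (fun _ _ hxy => (Prod.mk.inj hxy).2) (isClosedMap_prodMk_left (x := x)))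
  -- For fixed `x` the vector `E x` does not depend on `v`, so this is the integral over all
  -- velocities of a derivative with compact support. The position part is the Gauss–Green formula
  -- for each fixed `v`.
  have e1 : ∫ z, fderiv ℝ g z (0, E z.1) ∂((volume.restrict Ω).prod (volume : Measure R3)) = 0 := by
    rw [integral_prod _ (hint _ (by fun_prop))]
    refine integral_eq_zero_of_ae (Eventually.of_forall fun x => ?_)
    have h1 := integral_fderiv_eq_zero volume (g := fun v => g (x, v)) (by fun_prop) (hv x) (E x)
    rw [Pi.zero_apply, ← h1]
    refine integral_congr_ae (Eventually.of_forall fun v => ?_)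
    have h2 : HasFDerivAt (fun v => g (x, v)) ((fderiv ℝ g (x, v)).comp (ContinuousLinearMap.inr ℝ R3 R3)) v :=
      (hgd (x, v)).hasFDerivAt.comp v (hasFDerivAt_prodMk_right x v)
    simp [h2.fderiv]
  have hw : Integrable (fun z : Phase => lam z.1 * g z * inner ℝ (outerNormal Ω z.1) z.2)
      ((surfaceMeasure Ω).prod (volume : Measure R3)) := by
    obtain ⟨R, hR⟩ := hgc.isCompact.isBounded.exists_norm_le
    obtain ⟨B, hB⟩ := hg.continuous.bounded_above_of_compact_support hgc
    refine integrable_of_bounded_of_compact (S := tsupport g) (B := b * B * R)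
      (((hlm.comp measurable_fst).mul hg.continuous.measurable).aestronglyMeasurable.mul
        (aemeasurable_inner_outerNormal hΩo hΩc hΩs).aestronglyMeasurable) hgc.isCompact
      (fun z hz => by rw [image_eq_zero_of_notMem_tsupport hz, mul_zero, zero_mul]) ?_
    filter_upwards [ae_mem_frontier (Ω := Ω)] with z hz hzS
    have hb0 : 0 ≤ b := (abs_nonneg _).trans (hlb 0)
    have hB0 : 0 ≤ B := (norm_nonneg _).trans (hB z)
    rw [abs_mul, abs_mul]
    exact mul_le_mul (mul_le_mul (hlb _) (hB z) (abs_nonneg _) hb0)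
      ((abs_inner_outerNormal_le hΩo hΩc hΩs hz).trans ((norm_snd_le z).trans (hR z hzS)))
      (abs_nonneg _) (by positivity)
  have e2 : ∫ z, fderiv ℝ g z (z.2, 0) ∂((volume.restrict Ω).prod (volume : Measure R3)) =
      ∫ z, lam z.1 * g z * inner ℝ (outerNormal Ω z.1) z.2
        ∂((surfaceMeasure Ω).prod (volume : Measure R3)) := by
    rw [integral_prod_symm _ (hint _ (by fun_prop)), integral_prod_symm _ hw]
    refine integral_congr_ae (Eventually.of_forall fun v => ?_)
    have h1 := hgg (fun x => g (x, v)) (by fun_prop) (hx v) v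
    have h3 : ∀ x, fderiv ℝ (fun x => g (x, v)) x v = fderiv ℝ g (x, v) (v, 0) := by
      intro x
      have h2 : HasFDerivAt (fun x => g (x, v)) ((fderiv ℝ g (x, v)).comp (ContinuousLinearMap.inl ℝ R3 R3)) x :=
        (hgd (x, v)).hasFDerivAt.comp x (hasFDerivAt_prodMk_left x v)
      simp [h2.fderiv]
    simp only [h3] at h1
    simp only [h1]
    refine integral_congr_ae (Eventually.of_forall fun x => ?_)
    simp only; ring
  rw [integral_sigmaOut_sub_sigmaIn hΩo hΩc hΩs hw, ← e2, hμ, ← add_zero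
    (∫ z, fderiv ℝ g z (z.2, 0) ∂((volume.restrict Ω).prod (volume : Measure R3))), ← e1,
    ← integral_add (hint _ (by fun_prop)) (hint _ (by fun_prop))]
  refine integral_congr_ae (Eventually.of_forall fun z => ?_)
  simp only [← map_add, phaseField, Prod.mk_add_mk, add_zero, zero_add]

include hΩo hΩc hΩs in
-- The constant solution serves as a reference: its trace in the weak formulation is `lam`, so that
-- a boundary value of a general solution is its trace divided by `lam`.
theorem isWeakTriple_one [IsFiniteMeasure (surfaceMeasure Ω)] {lam : R3 → ℝ} (hlm : Measurable lam)
    {b : ℝ} (hlb : ∀ x, |lam x| ≤ b)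
    (hgg : ∀ f : R3 → ℝ, ContDiff ℝ 1 f → HasCompactSupport f → ∀ v,
      ∫ x in Ω, fderiv ℝ f x v = ∫ y, f y * (lam y * inner ℝ (outerNormal Ω y) v) ∂(surfaceMeasure Ω))
    {E : R3 → R3} (hE : Continuous E) :
    IsWeakTriple Ω E univ (fun _ => 1) (fun _ => 0) (fun p => lam p.2.1) := by
  have := isFiniteMeasureOnCompacts_boundaryMeasure hΩo hΩc hΩs
  have hlm' : Measurable fun p : ℝ × Phase => lam p.2.1 :=
    hlm.comp (measurable_fst.comp measurable_snd)
  refine ⟨locallyIntegrable_const 1, locallyIntegrable_const 0, fun p => ?_, fun η hη hηc _ => ?_⟩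
  · exact ⟨Metric.closedBall p 1, Metric.closedBall_mem_nhds p one_pos,
      Measure.integrableOn_of_bounded (M := b) (isCompact_closedBall p 1).measure_lt_top.ne
      hlm'.aestronglyMeasurable (Eventually.of_forall fun q => hlb _)⟩
  have hηd := hη.differentiable one_ne_zero
  have hfd : HasCompactSupport (fderiv ℝ η) := hηc.fderiv (𝕜 := ℝ)
  have hint : ∀ X : ℝ × Phase → ℝ × Phase, Continuous X →
      Integrable (fun p => fderiv ℝ η p (X p)) ((volume : Measure ℝ).prod (interiorMeasure Ω)) :=
    fun X hX => ((hη.continuous_fderiv one_ne_zero).clm_apply hX).integrable_of_hasCompactSupport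
      (hfd.mono fun z hz hz' => hz (by simp only [hz', zero_apply]))
  have hz : ∀ z : Phase, HasCompactSupport fun t : ℝ => η (t, z) := fun z =>
    hηc.comp_isClosedEmbedding (Topology.IsClosedEmbedding.of_continuous_injective_isClosedMap
      (by fun_prop) (fun _ _ hxy => (Prod.mk.inj hxy).1) (isClosedMap_prodMk_right (y := z)))
  have ht : ∀ t : ℝ, HasCompactSupport fun z : Phase => η (t, z) := fun t =>
    hηc.comp_isClosedEmbedding (Topology.IsClosedEmbedding.of_continuous_injective_isClosedMap
      (by fun_prop) (fun _ _ hxy => (Prod.mk.inj hxy).2) (isClosedMap_prodMk_left (x := t)))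
  have hX : Continuous fun p : ℝ × Phase => ((0 : ℝ), phaseField E p.2) := by
    unfold phaseField; fun_prop
  have e1 : ∫ p, fderiv ℝ η p (1, 0) ∂((volume : Measure ℝ).prod (interiorMeasure Ω)) = 0 := by
    rw [integral_prod_symm _ (hint _ continuous_const)]
    refine integral_eq_zero_of_ae (Eventually.of_forall fun z => ?_)
    have h1 := integral_fderiv_eq_zero volume (g := fun t => η (t, z)) (by fun_prop) (hz z) 1
    rw [Pi.zero_apply, ← h1]
    refine integral_congr_ae (Eventually.of_forall fun t => ?_)
    have h2 : HasFDerivAt (fun t => η (t, z))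
        ((fderiv ℝ η (t, z)).comp (ContinuousLinearMap.inl ℝ ℝ Phase)) t :=
      (hηd (t, z)).hasFDerivAt.comp t (hasFDerivAt_prodMk_left t z)
    simp [h2.fderiv]
  have e2 : ∀ t, ∫ z, fderiv ℝ η (t, z) (0, phaseField E z) ∂(interiorMeasure Ω) =
      (∫ z, lam z.1 * η (t, z) ∂(sigmaOut Ω)) - ∫ z, lam z.1 * η (t, z) ∂(sigmaIn Ω) := by
    intro t
    rw [← phase_gaussGreen hΩo hΩc hΩs hlm hlb hgg hE (g := fun z => η (t, z)) (by fun_prop) (ht t)]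
    refine integral_congr_ae (Eventually.of_forall fun z => ?_)
    have h2 : HasFDerivAt (fun z => η (t, z))
        ((fderiv ℝ η (t, z)).comp (ContinuousLinearMap.inr ℝ ℝ Phase)) z :=
      (hηd (t, z)).hasFDerivAt.comp z (hasFDerivAt_prodMk_right t z)
    simp [h2.fderiv]
  obtain ⟨B, hB⟩ := hη.continuous.bounded_above_of_compact_support hηc
  have hbd : Integrable (fun p : ℝ × Phase => lam p.2.1 * η p)
      ((volume : Measure ℝ).prod (boundaryMeasure Ω)) := by
    refine integrable_of_bounded_of_compact (S := tsupport η) (B := b * B)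
      (hlm'.mul hη.continuous.measurable).aestronglyMeasurable hηc.isCompact
      (fun p hp => by rw [image_eq_zero_of_notMem_tsupport hp, mul_zero])
      (Eventually.of_forall fun p _ => ?_)
    rw [abs_mul]
    exact mul_le_mul (hlb _) (hB p) (abs_nonneg _) ((abs_nonneg _).trans (hlb 0))
  have ho := hbd.mono_measure prod_sigmaOut_le
  have hi := hbd.mono_measure prod_sigmaIn_le
  have e3 : ∫ p, fderiv ℝ η p (0, phaseField E p.2)
      ∂((volume : Measure ℝ).prod (interiorMeasure Ω)) =
      (∫ p, lam p.2.1 * η p ∂((volume : Measure ℝ).prod (sigmaOut Ω))) -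
        ∫ p, lam p.2.1 * η p ∂((volume : Measure ℝ).prod (sigmaIn Ω)) := by
    rw [integral_prod _ (hint _ hX), integral_prod _ ho, integral_prod _ hi,
      ← integral_sub ho.integral_prod_left hi.integral_prod_left]
    exact integral_congr_ae (Eventually.of_forall e2)
  have e4 := integral_add (hint (fun _ => (1, 0)) continuous_const) (hint _ hX)
  rw [e1, zero_add] at e4
  rw [← e3, ← e4]
  simp only [zero_mul, integral_zero, add_zero, one_mul]
  refine integral_congr_ae (Eventually.of_forall fun p => ?_)
  simp only [← map_add, transport, phaseField, Prod.mk_add_mk, add_zero, zero_add]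

end BoundaryMeasure

/-! ### Coordinates along characteristics -/

/-- The measure `λ dσ` on `Γ₊`. -/
noncomputable def outMeasure (Ω : Set R3) (lam : R3 → ℝ) : Measure Phase :=
  (sigmaOut Ω).withDensity fun z => ENNReal.ofReal (lam z.1)

/-- The measure `λ dσ ds` on `backSet Ω E`. -/
noncomputable def backMeasure (Ω : Set R3) (E : R3 → R3) (lam : R3 → ℝ) : Measure (Phase × ℝ) :=
  ((outMeasure Ω lam).prod volume).restrict (backSet Ω E)

instance sfinite_outMeasure {Ω : Set R3} {lam : R3 → ℝ} [IsFiniteMeasure (surfaceMeasure Ω)] :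
    SFinite (outMeasure Ω lam) := inferInstanceAs (SFinite ((sigmaOut Ω).withDensity _))

instance sfinite_backMeasure {Ω : Set R3} {E : R3 → R3} {lam : R3 → ℝ}
    [IsFiniteMeasure (surfaceMeasure Ω)] : SFinite (backMeasure Ω E lam) :=
  inferInstanceAs (SFinite (((outMeasure Ω lam).prod volume).restrict _))

/-- Lipschitz functions with support in the open set `O` which increase to its indicator. -/
noncomputable def lipIndicator {X : Type*} [PseudoMetricSpace X] (O : Set X) (n : ℕ) (x : X) : ℝ :=
  min 1 (n * Metric.infDist x Oᶜ)

section LipIndicator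
variable {X : Type*} [PseudoMetricSpace X] {O : Set X}

lemma lipschitzWith_lipIndicator (n : ℕ) : LipschitzWith n (lipIndicator O n) := by
  have h1 : LipschitzWith (n * 1) fun x => (n : ℝ) * Metric.infDist x Oᶜ := by
    have := (lipschitzWith_smul (n : ℝ)).comp (Metric.lipschitz_infDist_pt Oᶜ)
    simpa [Function.comp_def] using this
  rw [mul_one] at h1
  exact h1.const_min 1

lemma lipIndicator_nonneg (n : ℕ) (x : X) : 0 ≤ lipIndicator O n x :=
  le_min zero_le_one (mul_nonneg n.cast_nonneg Metric.infDist_nonneg)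

lemma lipIndicator_eq_zero {n : ℕ} {x : X} (hx : x ∉ O) : lipIndicator O n x = 0 := by
  rw [lipIndicator, Metric.infDist_zero_of_mem (show x ∈ Oᶜ from hx), mul_zero]
  simp

lemma tsupport_lipIndicator_subset (n : ℕ) : tsupport (lipIndicator O n) ⊆ closure O :=
  closure_mono fun _ hx => by_contra fun hne => hx (lipIndicator_eq_zero hne)

lemma monotone_ofReal_lipIndicator (x : X) :
    Monotone fun n => ENNReal.ofReal (lipIndicator O n x) := fun m n hmn =>
  ENNReal.ofReal_le_ofReal (min_le_min le_rfl
    (mul_le_mul_of_nonneg_right (by exact_mod_cast hmn) Metric.infDist_nonneg))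

lemma tendsto_ofReal_lipIndicator (hO : IsOpen O) (hne : Oᶜ.Nonempty) (x : X) :
    Tendsto (fun n => ENNReal.ofReal (lipIndicator O n x)) atTop
      (𝓝 (O.indicator 1 x)) := by
  by_cases hx : x ∈ O
  · rw [indicator_of_mem hx]
    have hpos : 0 < Metric.infDist x Oᶜ :=
      (hO.isClosed_compl.notMem_iff_infDist_pos hne).1 (not_not.2 hx)
    refine tendsto_const_nhds.congr' ?_
    obtain ⟨N, hN⟩ := exists_nat_ge (1 / Metric.infDist x Oᶜ)
    filter_upwards [eventually_ge_atTop N] with n hn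
    have h1 : 1 ≤ n * Metric.infDist x Oᶜ := by
      rw [← div_le_iff₀ hpos]
      exact hN.trans (by exact_mod_cast hn)
    rw [lipIndicator, min_eq_left h1]
    simp
  · rw [indicator_of_notMem hx]
    simp only [lipIndicator_eq_zero hx, ENNReal.ofReal_zero]
    exact tendsto_const_nhds

end LipIndicator

section Coordinates
variable {Ω : Set R3} {E : R3 → R3} {K : ℝ≥0} {M : ℝ} (hΩo : IsOpen Ω) (hΩc : Convex ℝ Ω)
  (hΩs : HasSmoothBoundary Ω) (h : IsForceField E K M) {lam : R3 → ℝ} (hlm : Measurable lam)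
  (hl0 : ∀ x, 0 < lam x)
  (ht : IsWeakTriple Ω E univ (fun _ => 1) (fun _ => 0) (fun p => lam p.2.1))

include hΩo hΩc hΩs h hlm hl0 ht

/-- This is the tube identity for the constant solution, whose trace is `lam` and whose source is
zero: an integral over the domain becomes one over `Γ₊` and the backward time. -/
lemma lintegral_tube_lipschitz [IsFiniteMeasure (surfaceMeasure Ω)] {a : ℝ × Phase → ℝ} {C : ℝ≥0}
    (ha : LipschitzWith C a) (hac : HasCompactSupport a) (ha0 : ∀ p, 0 ≤ a p) {L : ℝ} (hL : 0 < L)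
    {B : Set Phase} (hB : IsTube Ω E L B) (hsub : tsupport a ⊆ univ ×ˢ B) :
    ∫⁻ p, ENNReal.ofReal (a p) ∂((volume : Measure ℝ).prod (interiorMeasure Ω)) =
      ∫⁻ p, (∫⁻ s in Ioc 0 L, ENNReal.ofReal (a (spacetimeFlow E (-s) p)))
        ∂((volume : Measure ℝ).prod (outMeasure Ω lam)) := by
  have hid := ht.tube_identity h hΩo hΩc hΩs isOpen_univ ha hac hL hB (J' := univ)
    (fun _ _ _ _ => mem_univ _) hsub
  simp only [one_mul, zero_mul, integral_zero, add_zero] at hid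
  have hlm' : Measurable fun p : ℝ × Phase => lam p.2.1 :=
    hlm.comp (measurable_fst.comp measurable_snd)
  have hc : ∀ p, Continuous fun s => a (spacetimeFlow E (-s) p) := fun p =>
    ha.continuous.comp (continuous_spacetimeFlow_comp h continuous_neg continuous_const)
  have hbc := (lipschitzWith_backAverage h ha hL.le).continuous
  have hb0 : ∀ p, 0 ≤ backAverage E L a p := fun p =>
    intervalIntegral.integral_nonneg hL.le fun s _ => ha0 _
  have hbcomp : HasCompactSupport (backAverage E L a) :=
    (isCompact_image_flow h hac.isCompact L).of_isClosed_subset (isClosed_tsupport _)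
      (tsupport_backAverage_subset h hL.le hac)
  have hbd : ∀ p, ENNReal.ofReal (backAverage E L a p) =
      ∫⁻ s in Ioc 0 L, ENNReal.ofReal (a (spacetimeFlow E (-s) p)) := by
    intro p
    rw [backAverage, intervalIntegral.integral_of_le hL.le, ofReal_integral_eq_lintegral_ofReal]
    · exact ((hc p).intervalIntegrable 0 L).1
    · exact Eventually.of_forall fun s => ha0 _
  have hint : Integrable (fun p : ℝ × Phase => lam p.2.1 * backAverage E L a p)
      ((volume : Measure ℝ).prod (sigmaOut Ω)) := by
    have hloc := LocallyIntegrable.mono_measure' ht.locallyIntegrable_trace prod_sigmaOut_le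
    have h1 := (hloc.integrableOn_isCompact hbcomp.isCompact).mul_continuousOn hbc.continuousOn
      hbcomp.isCompact
    exact h1.integrable_of_forall_notMem_eq_zero fun p hp => by
      rw [image_eq_zero_of_notMem_tsupport hp, mul_zero]
  have hout : (volume : Measure ℝ).prod (outMeasure Ω lam) =
      ((volume : Measure ℝ).prod (sigmaOut Ω)).withDensity fun p => ENNReal.ofReal (lam p.2.1) :=
    prod_withDensity_right (hlm.comp measurable_fst).ennreal_ofReal
  simp_rw [← hbd]
  rw [hout, lintegral_withDensity_eq_lintegral_mul _ hlm'.ennreal_ofReal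
    hbc.measurable.ennreal_ofReal, ← ofReal_integral_eq_lintegral_ofReal
    (ha.continuous.integrable_of_hasCompactSupport hac) (Eventually.of_forall ha0), hid,
    ofReal_integral_eq_lintegral_ofReal hint
    (Eventually.of_forall fun p => mul_nonneg (hl0 _).le (hb0 p))]
  refine lintegral_congr fun p => ?_
  rw [ENNReal.ofReal_mul (hl0 _).le]
  rfl

lemma lintegral_tube_open [IsFiniteMeasure (surfaceMeasure Ω)] {O : Set (ℝ × Phase)} (hO : IsOpen O)
    (hOc : IsCompact (closure O)) (hne : Oᶜ.Nonempty) {L : ℝ} (hL : 0 < L)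
    {B : Set Phase} (hB : IsTube Ω E L B) (hsub : closure O ⊆ univ ×ˢ B) :
    ∫⁻ p, O.indicator 1 p ∂((volume : Measure ℝ).prod (interiorMeasure Ω)) =
      ∫⁻ p, (∫⁻ s in Ioc 0 L, O.indicator 1 (spacetimeFlow E (-s) p))
        ∂((volume : Measure ℝ).prod (outMeasure Ω lam)) := by
  have hm : ∀ n, Measurable fun p : ℝ × Phase => ENNReal.ofReal (lipIndicator O n p) := fun n =>
    (lipschitzWith_lipIndicator n).continuous.measurable.ennreal_ofReal
  have hf : Measurable fun q : (ℝ × Phase) × ℝ => spacetimeFlow E (-q.2) q.1 :=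
    (continuous_spacetimeFlow_comp h continuous_snd.neg continuous_fst).measurable
  have hm2 : ∀ n, Measurable fun p : ℝ × Phase =>
      ∫⁻ s in Ioc 0 L, ENNReal.ofReal (lipIndicator O n (spacetimeFlow E (-s) p)) := fun n =>
    Measurable.lintegral_prod_right' (f := fun q : (ℝ × Phase) × ℝ =>
      ENNReal.ofReal (lipIndicator O n (spacetimeFlow E (-q.2) q.1))) ((hm n).comp hf)
  have L1 := lintegral_tendsto_of_tendsto_of_monotone
    (μ := (volume : Measure ℝ).prod (interiorMeasure Ω)) (fun n => (hm n).aemeasurable)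
    (Eventually.of_forall monotone_ofReal_lipIndicator)
    (Eventually.of_forall (tendsto_ofReal_lipIndicator hO hne))
  have L2 := lintegral_tendsto_of_tendsto_of_monotone
    (μ := (volume : Measure ℝ).prod (outMeasure Ω lam)) (fun n => (hm2 n).aemeasurable)
    (F := fun p => ∫⁻ s in Ioc 0 L, O.indicator 1 (spacetimeFlow E (-s) p))
    (Eventually.of_forall fun p m n hmn =>
      lintegral_mono fun s => monotone_ofReal_lipIndicator _ hmn)
    (Eventually.of_forall fun p => lintegral_tendsto_of_tendsto_of_monotone
      (fun n => ((hm n).comp (hf.comp measurable_prodMk_left)).aemeasurable)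
      (Eventually.of_forall fun s => monotone_ofReal_lipIndicator _)
      (Eventually.of_forall fun s => tendsto_ofReal_lipIndicator hO hne _))
  refine tendsto_nhds_unique L1 (L2.congr fun n => ?_)
  exact (lintegral_tube_lipschitz hΩo hΩc hΩs h hlm hl0 ht (lipschitzWith_lipIndicator n)
    (hOc.of_isClosed_subset (isClosed_tsupport _) (tsupport_lipIndicator_subset n))
    (lipIndicator_nonneg n) hL hB ((tsupport_lipIndicator_subset n).trans hsub)).symm

lemma measure_tube_open [IsFiniteMeasure (surfaceMeasure Ω)] {O : Set Phase} (hO : IsOpen O)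
    (hOc : IsCompact (closure O)) {L : ℝ} (hL : 0 < L)
    {B : Set Phase} (hB : IsTube Ω E L B) (hsub : closure O ⊆ B) :
    interiorMeasure Ω O =
      Measure.map (fun q : Phase × ℝ => phaseFlow E (-q.2) q.1) (backMeasure Ω E lam) O := by
  have hf : Measurable fun q : Phase × ℝ => phaseFlow E (-q.2) q.1 :=
    (continuous_flow_comp h continuous_snd.neg continuous_fst).measurable
  -- The product with a time interval of length one removes the time variable, since the flux
  -- measure is invariant under shifts of time.
  have hopen : IsOpen (Ioo (0 : ℝ) 1 ×ˢ O) := isOpen_Ioo.prod hO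
  have h1 := lintegral_tube_open hΩo hΩc hΩs h hlm hl0 ht hopen
    (by rw [closure_prod_eq]; exact (isCompact_Icc.of_isClosed_subset isClosed_closure
      (closure_minimal Ioo_subset_Icc_self isClosed_Icc)).prod hOc)
    ⟨(2, 0), fun hmem => absurd hmem.1.2 (by norm_num)⟩ hL hB
    (by rw [closure_prod_eq]; exact prod_mono (subset_univ _) hsub)
  rw [lintegral_indicator_one hopen.measurableSet, Measure.prod_prod, Real.volume_Ioo] at h1
  simp only [sub_zero, ENNReal.ofReal_one, one_mul] at h1
  have hm : Measurable fun q : (ℝ × Phase) × ℝ =>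
      (Ioo (0 : ℝ) 1 ×ˢ O).indicator (1 : ℝ × Phase → ℝ≥0∞) (spacetimeFlow E (-q.2) q.1) :=
    (measurable_one.indicator hopen.measurableSet).comp
      (continuous_spacetimeFlow_comp h continuous_snd.neg continuous_fst).measurable
  rw [h1, lintegral_prod_symm _ (Measurable.lintegral_prod_right' hm).aemeasurable,
    Measure.map_apply hf hO.measurableSet, backMeasure, Measure.restrict_apply
    (hf hO.measurableSet), Measure.prod_apply ((hf hO.measurableSet).inter
    (measurableSet_backSet hΩo hΩc hΩs h))]
  have hae : ∀ᵐ z ∂(outMeasure Ω lam), z ∈ outgoing Ω :=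
    (withDensity_absolutelyContinuous _ _).ae_le
      (ae_restrict_mem (measurableSet_outgoing hΩo hΩc hΩs))
  refine lintegral_congr_ae ?_
  filter_upwards [hae] with z hz
  have hsw : ∫⁻ t : ℝ, ∫⁻ s in Ioc 0 L, (Ioo (0 : ℝ) 1 ×ˢ O).indicator (1 : ℝ × Phase → ℝ≥0∞)
      (spacetimeFlow E (-s) (t, z)) =
      ∫⁻ s in Ioc 0 L, ∫⁻ t : ℝ, (Ioo (0 : ℝ) 1 ×ˢ O).indicator (1 : ℝ × Phase → ℝ≥0∞)
      (spacetimeFlow E (-s) (t, z)) := by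
    refine lintegral_lintegral_swap (Measurable.aemeasurable ?_)
    exact hm.comp ((measurable_fst.prodMk measurable_const).prodMk measurable_snd)
  have hfz : Measurable fun s : ℝ => phaseFlow E (-s) z :=
    hf.comp measurable_prodMk_left
  have hinner : ∀ s, ∫⁻ t : ℝ, (Ioo (0 : ℝ) 1 ×ˢ O).indicator (1 : ℝ × Phase → ℝ≥0∞)
      (spacetimeFlow E (-s) (t, z)) =
      ((fun s : ℝ => phaseFlow E (-s) z) ⁻¹' O).indicator 1 s := by
    intro s
    have e : ∀ t : ℝ, (Ioo (0 : ℝ) 1 ×ˢ O).indicator (1 : ℝ × Phase → ℝ≥0∞)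
        (spacetimeFlow E (-s) (t, z)) = (Ioo (0 : ℝ) 1).indicator 1 (t + -s) *
        ((fun s : ℝ => phaseFlow E (-s) z) ⁻¹' O).indicator 1 s := by
      intro t
      simp only [spacetimeFlow, indicator_apply, Pi.one_apply]
      by_cases h1 : t + -s ∈ Ioo (0 : ℝ) 1 <;> by_cases h2 : phaseFlow E (-s) z ∈ O <;> simp [h1, h2]
    simp_rw [e]
    have hmt : Measurable fun t : ℝ => (Ioo (0 : ℝ) 1).indicator (1 : ℝ → ℝ≥0∞) (t + -s) :=
      (measurable_one.indicator measurableSet_Ioo).comp (measurable_id.add_const (-s))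
    rw [lintegral_mul_const _ hmt,
      lintegral_add_right_eq_self (fun t => (Ioo (0 : ℝ) 1).indicator (1 : ℝ → ℝ≥0∞) t) (-s),
      lintegral_indicator_one measurableSet_Ioo]
    simp
  rw [hsw]
  simp_rw [hinner]
  rw [lintegral_indicator_one (hfz hO.measurableSet), Measure.restrict_apply (hfz hO.measurableSet)]
  congr 1
  -- For `z ∈ Γ₊` whose backward orbit meets `O` after time `s`, the conditions `0 < s ≤ L` and `(z,
  -- s) ∈ backSet Ω E` are equivalent: during `(0, L]` the tube allows only one contact with the
  -- boundary, at the exit time.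
  ext s
  constructor
  · rintro ⟨hs1, hs2⟩
    refine ⟨hs1, ?_⟩
    obtain ⟨τ, hτL, hτ, hout⟩ := hB _ (hsub (subset_closure hs1))
    change ExitsAt Ω E (phaseFlow E (-s) z) s
    have hflow : phaseFlow E s (phaseFlow E (-s) z) = z := flow_flow_neg h s z
    rcases lt_trichotomy s τ with hlt | heq | hlt
    · have := hτ.2.1 s ⟨hs2.1.le, hlt⟩
      rw [hflow] at this
      exact absurd this (notMem_of_mem_frontier hΩo hz.1)
    · rw [heq] at hτ ⊢; exact hτ
    · have := hout s ⟨hlt, hs2.2⟩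
      rw [hflow] at this
      exact absurd (frontier_subset_closure hz.1) this
  · rintro ⟨hs1, hs2⟩
    refine ⟨hs1, ?_⟩
    obtain ⟨τ, hτL, hτ, hout⟩ := hB _ (hsub (subset_closure hs1))
    have hs2' : ExitsAt Ω E (phaseFlow E (-s) z) s := hs2
    have := hs2'.unique hΩo hτ
    exact ⟨hs2'.1, by linarith⟩

omit hlm hl0 ht in
/-- Every point of the exit set has a tubular neighbourhood. -/
lemma exists_tube_closedBall {z : Phase} (hz : z ∈ exitSet Ω E) {δ : ℝ} (hδ : 0 < δ) :
    ∃ L r, exitTime Ω E z < L ∧ L < exitTime Ω E z + δ ∧ 0 < r ∧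
      IsTube Ω E L (Metric.closedBall z r) := by
  obtain ⟨L, hL1, hL2, hev⟩ := (exitsAt_exitTime hz).exists_tube hΩo hΩc hΩs h hδ
  obtain ⟨r, hr, hball⟩ := Metric.nhds_basis_closedBall.mem_iff.1 hev
  refine ⟨L, r, hL1, hL2, hr, fun w hw => ?_⟩
  obtain ⟨τ, -, h2, h3, h4⟩ := hball hw
  exact ⟨τ, h2, h3, h4⟩

/-- The two measures agree on open subsets of tubular balls, hence on these balls. Countably many
balls cover the exit set, and both measures are carried by it: the image measure by construction,
the interior measure because almost every point exits. -/
theorem map_backMeasure [IsFiniteMeasure (surfaceMeasure Ω)] (hΩb : Bornology.IsBounded Ω)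
    (hΩn : Ω.Nonempty) :
    Measure.map (fun q : Phase × ℝ => phaseFlow E (-q.2) q.1) (backMeasure Ω E lam) =
      interiorMeasure Ω := by
  have hf : Measurable fun q : Phase × ℝ => phaseFlow E (-q.2) q.1 :=
    (continuous_flow_comp h continuous_snd.neg continuous_fst).measurable
  set μ₂ := Measure.map (fun q : Phase × ℝ => phaseFlow E (-q.2) q.1) (backMeasure Ω E lam)
  have hex : ∀ z : exitSet Ω E, ∃ L r, 0 < L ∧ 0 < r ∧ IsTube Ω E L (Metric.closedBall z.1 r) := by
    intro z
    obtain ⟨L, r, hL, -, hr, hT⟩ := exists_tube_closedBall hΩo hΩc hΩs h z.2 one_pos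
    exact ⟨L, r, (exitsAt_exitTime z.2).1.trans hL, hr, hT⟩
  choose L r hL hr hT using hex
  have hloc : ∀ z : exitSet Ω E, μ₂.restrict (Metric.ball z.1 (r z)) =
      (interiorMeasure Ω).restrict (Metric.ball z.1 (r z)) := by
    intro z
    have hcl : closure (Metric.ball z.1 (r z)) ⊆ Metric.closedBall z.1 (r z) :=
      Metric.closure_ball_subset_closedBall
    have hcpt : ∀ O ⊆ Metric.ball z.1 (r z), IsCompact (closure O) := fun O hO =>
      (isCompact_closedBall z.1 (r z)).of_isClosed_subset isClosed_closure
        ((closure_mono hO).trans hcl)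
    have heq : ∀ O, IsOpen O → O ⊆ Metric.ball z.1 (r z) → μ₂ O = interiorMeasure Ω O :=
      fun O hO hsub => (measure_tube_open hΩo hΩc hΩs h hlm hl0 ht hO (hcpt O hsub) (hL z) (hT z)
        ((closure_mono hsub).trans hcl)).symm
    have hfin : IsFiniteMeasure (μ₂.restrict (Metric.ball z.1 (r z))) := by
      refine ⟨?_⟩
      rw [Measure.restrict_apply_univ, heq _ Metric.isOpen_ball subset_rfl]
      exact (measure_mono subset_closure).trans_lt (hcpt _ subset_rfl).measure_lt_top
    refine ext_of_generate_finite {O | IsOpen O} BorelSpace.measurable_eq isPiSystem_isOpen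
      (fun O hO => ?_) ?_
    · have hO' : IsOpen O := hO
      rw [Measure.restrict_apply hO'.measurableSet, Measure.restrict_apply hO'.measurableSet]
      exact heq _ (hO'.inter Metric.isOpen_ball) inter_subset_right
    · rw [Measure.restrict_apply_univ, Measure.restrict_apply_univ]
      exact heq _ Metric.isOpen_ball subset_rfl
  obtain ⟨S, hS, hSU⟩ := TopologicalSpace.isOpen_iUnion_countable
    (fun z : exitSet Ω E => Metric.ball z.1 (r z)) fun _ => Metric.isOpen_ball
  have hcover : exitSet Ω E ⊆ ⋃ z ∈ S, Metric.ball z.1 (r z) := by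
    rw [hSU]
    exact fun z hz => mem_iUnion.2 ⟨⟨z, hz⟩, Metric.mem_ball_self (hr _)⟩
  have h1 := Measure.restrict_congr_mono hcover
    ((Measure.restrict_biUnion_congr hS).2 fun z _ => hloc z)
  have h2 : (interiorMeasure Ω).restrict (exitSet Ω E) = interiorMeasure Ω :=
    Measure.restrict_eq_self_of_ae_mem (ae_mem_exitSet hΩo hΩc hΩs h hΩb hΩn)
  have h3 : μ₂.restrict (exitSet Ω E) = μ₂ := by
    refine Measure.restrict_eq_self_of_ae_mem ?_
    refine (ae_map_iff hf.aemeasurable (p := fun z => z ∈ exitSet Ω E)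
      (isOpen_exitSet hΩo hΩc hΩs h).measurableSet).2 ?_
    filter_upwards [ae_restrict_mem (measurableSet_backSet hΩo hΩc hΩs h)] with q hq
    exact ⟨_, hq⟩
  rw [← h3, h1, h2]

end Coordinates

/-! ### Integration along characteristics -/

lemma prod_interiorMeasure (Ω : Set R3) : (volume : Measure ℝ).prod (interiorMeasure Ω) =
    (volume : Measure (ℝ × Phase)).restrict (univ ×ˢ (Ω ×ˢ univ)) := by
  rw [interiorMeasure, ← Measure.restrict_univ (μ := (volume : Measure ℝ)), Measure.prod_restrict]
  rfl

section FlowIntegral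
variable {E : R3 → R3} {K : ℝ≥0} {M : ℝ} (h : IsForceField E K M)
include h

lemma measurePreserving_spacetimeFlow_skew (L : ℝ) :
    MeasurePreserving (fun q : ℝ × (ℝ × Phase) => (q.1, spacetimeFlow E q.1 q.2))
      (((volume : Measure ℝ).restrict (Ioc 0 L)).prod volume)
      (((volume : Measure ℝ).restrict (Ioc 0 L)).prod volume) :=
  (MeasurePreserving.id _).skew_product (g := fun s p => spacetimeFlow E s p)
    (continuous_spacetimeFlow h).measurable
    (Eventually.of_forall fun s => (measurePreserving_spacetimeFlow h s).map_eq)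

variable {f b : ℝ × Phase → ℝ} {S : Set (ℝ × Phase)} {B L : ℝ}

lemma integrable_mul_flow (hfm : Measurable f) (hf : LocallyIntegrable f volume)
    (hbm : Measurable b) (hS : IsCompact S) (hbS : ∀ p ∉ S, b p = 0) (hbB : ∀ p, |b p| ≤ B) :
    Integrable (fun q : ℝ × (ℝ × Phase) => f q.2 * b (spacetimeFlow E (-q.1) q.2))
      (((volume : Measure ℝ).restrict (Ioc 0 L)).prod volume) := by
  set S' := (fun q : ℝ × (ℝ × Phase) => spacetimeFlow E q.1 q.2) '' (Icc 0 L ×ˢ S)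
  have hS' : IsCompact S' := isCompact_image_flow h hS L
  have h1 : Integrable (S'.indicator f) volume :=
    (integrable_indicator_iff hS'.measurableSet).2 (hf.integrableOn_isCompact hS')
  have h2 : Integrable (fun q : ℝ × (ℝ × Phase) => S'.indicator f q.2)
      (((volume : Measure ℝ).restrict (Ioc 0 L)).prod volume) := h1.comp_snd _
  have hmem : ∀ᵐ q ∂(((volume : Measure ℝ).restrict (Ioc 0 L)).prod (volume : Measure (ℝ × Phase))),
      q.1 ∈ Ioc 0 L := Measure.quasiMeasurePreserving_fst.ae (ae_restrict_mem measurableSet_Ioc)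
  refine (h2.norm.mul_const B).mono' ?_ ?_
  · exact ((hfm.comp measurable_snd).mul (hbm.comp (continuous_spacetimeFlow_comp h
      continuous_fst.neg continuous_snd).measurable)).aestronglyMeasurable
  · filter_upwards [hmem] with q hq
    have hB : 0 ≤ B := (abs_nonneg _).trans (hbB q.2)
    by_cases hqS : spacetimeFlow E (-q.1) q.2 ∈ S
    · have : q.2 ∈ S' := ⟨(q.1, spacetimeFlow E (-q.1) q.2), ⟨⟨hq.1.le, hq.2⟩, hqS⟩,
        spacetimeFlow_flow_neg h q.1 q.2⟩
      rw [indicator_of_mem this, norm_mul]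
      exact mul_le_mul_of_nonneg_left (hbB _) (norm_nonneg _)
    · rw [hbS _ hqS, mul_zero, norm_zero]
      positivity

lemma integrable_flow_mul (hfm : Measurable f) (hf : LocallyIntegrable f volume)
    (hbm : Measurable b) (hS : IsCompact S) (hbS : ∀ p ∉ S, b p = 0) (hbB : ∀ p, |b p| ≤ B) :
    Integrable (fun q : ℝ × (ℝ × Phase) => f (spacetimeFlow E q.1 q.2) * b q.2)
      (((volume : Measure ℝ).restrict (Ioc 0 L)).prod volume) := by
  have h1 := integrable_mul_flow h hfm hf hbm hS hbS hbB (L := L)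
  refine (((measurePreserving_spacetimeFlow_skew h L).integrable_comp
    h1.aestronglyMeasurable).2 h1).congr (Eventually.of_forall fun q => ?_)
  simp only [Function.comp_def, spacetimeFlow_neg_flow h]

lemma integrable_mul_flowIntegral (hfm : Measurable f) (hf : LocallyIntegrable f volume)
    (hbm : Measurable b) (hS : IsCompact S) (hbS : ∀ p ∉ S, b p = 0) (hbB : ∀ p, |b p| ≤ B)
    (hL : 0 ≤ L) :
    Integrable (fun p => b p * ∫ s in (0 : ℝ)..L, f (spacetimeFlow E s p)) volume := by
  refine (integrable_flow_mul h hfm hf hbm hS hbS hbB (L := L)).integral_prod_right.congr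
    (Eventually.of_forall fun p => ?_)
  simp only [integral_mul_const]
  rw [mul_comm, intervalIntegral.integral_of_le hL]

/-- The backward average and the forward integral along the flow are adjoint, by Fubini and the
invariance of Lebesgue measure under the space-time flow. -/
lemma integral_mul_backAverage (hfm : Measurable f) (hf : LocallyIntegrable f volume)
    (hbm : Measurable b) (hS : IsCompact S) (hbS : ∀ p ∉ S, b p = 0) (hbB : ∀ p, |b p| ≤ B)
    (hL : 0 ≤ L) :
    ∫ p, f p * backAverage E L b p = ∫ p, b p * ∫ s in (0 : ℝ)..L, f (spacetimeFlow E s p) := by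
  have i1 := integrable_mul_flow h hfm hf hbm hS hbS hbB (L := L)
  have i2 := integrable_flow_mul h hfm hf hbm hS hbS hbB (L := L)
  have e1 : ∫ p, f p * backAverage E L b p = ∫ q : ℝ × (ℝ × Phase),
      f q.2 * b (spacetimeFlow E (-q.1) q.2)
      ∂(((volume : Measure ℝ).restrict (Ioc 0 L)).prod volume) := by
    rw [integral_prod_symm _ i1]
    refine integral_congr_ae (Eventually.of_forall fun p => ?_)
    simp only [integral_const_mul]
    rw [backAverage, intervalIntegral.integral_of_le hL]
  have e2 : ∫ p, b p * ∫ s in (0 : ℝ)..L, f (spacetimeFlow E s p) = ∫ q : ℝ × (ℝ × Phase),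
      f (spacetimeFlow E q.1 q.2) * b q.2
      ∂(((volume : Measure ℝ).restrict (Ioc 0 L)).prod volume) := by
    rw [integral_prod_symm _ i2]
    refine integral_congr_ae (Eventually.of_forall fun p => ?_)
    simp only [integral_mul_const]
    rw [mul_comm, intervalIntegral.integral_of_le hL]
  rw [e1, e2]
  have hmp := measurePreserving_spacetimeFlow_skew h L
  have h3 := integral_map hmp.measurable.aemeasurable
    (f := fun q : ℝ × (ℝ × Phase) => f q.2 * b (spacetimeFlow E (-q.1) q.2))
    (by rw [hmp.map_eq]; exact i1.aestronglyMeasurable)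
  rw [hmp.map_eq] at h3
  rw [h3]
  simp only [spacetimeFlow_neg_flow h]

end FlowIntegral

/-! ### Space-time coordinates along characteristics -/

/-- A bounded convex smooth domain with a force field, and a density `lam` of the flux measure with
respect to `boundaryMeasure Ω`. -/
structure TransportGeometry (Ω : Set R3) (E : R3 → R3) (K : ℝ≥0) (M : ℝ) (lam : R3 → ℝ)
    (a b : ℝ) : Prop where
  isOpen : IsOpen Ω
  convex : Convex ℝ Ω
  smooth : HasSmoothBoundary Ω
  bounded : Bornology.IsBounded Ω
  nonempty : Ω.Nonempty
  field : IsForceField E K M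
  measurable_density : Measurable lam
  lower_pos : 0 < a
  lower : ∀ x, a ≤ lam x
  upper : ∀ x, lam x ≤ b
  triple : IsWeakTriple Ω E univ (fun _ => 1) (fun _ => 0) (fun p => lam p.2.1)

/-- The measure `dt λ dσ ds`, restricted to the points whose backward characteristic stays in `Ω`
up to time `s`. -/
noncomputable def backCylinder (Ω : Set R3) (E : R3 → R3) (lam : R3 → ℝ) :
    Measure ((ℝ × Phase) × ℝ) :=
  (((volume : Measure ℝ).prod (outMeasure Ω lam)).prod volume).restrict
    {q | (q.1.2, q.2) ∈ backSet Ω E}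

section Geometry
variable {Ω : Set R3} {E : R3 → R3} {K : ℝ≥0} {M : ℝ} {lam : R3 → ℝ} {a b : ℝ}
  [IsFiniteMeasure (surfaceMeasure Ω)] (G : TransportGeometry Ω E K M lam a b)
include G

omit [IsFiniteMeasure (surfaceMeasure Ω)] in
lemma TransportGeometry.density_pos (x : R3) : 0 < lam x := G.lower_pos.trans_le (G.lower x)

omit [IsFiniteMeasure (surfaceMeasure Ω)] in
lemma TransportGeometry.measurableSet_backSet' :
    MeasurableSet {q : (ℝ × Phase) × ℝ | (q.1.2, q.2) ∈ backSet Ω E} :=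
  (show Measurable fun q : (ℝ × Phase) × ℝ => (q.1.2, q.2) by fun_prop)
    (measurableSet_backSet G.isOpen G.convex G.smooth G.field)

/-- The change of variables in phase space, combined with the shear `t ↦ t - s` in time. -/
theorem TransportGeometry.measurePreserving_back :
    MeasurePreserving (fun q : (ℝ × Phase) × ℝ => spacetimeFlow E (-q.2) q.1)
      (backCylinder Ω E lam) ((volume : Measure ℝ).prod (interiorMeasure Ω)) := by
  have hb := measurableSet_backSet G.isOpen G.convex G.smooth G.field
  have h1 : MeasurePreserving (MeasurableEquiv.prodAssoc : (ℝ × Phase) × ℝ ≃ᵐ ℝ × (Phase × ℝ))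
      (backCylinder Ω E lam) ((volume : Measure ℝ).prod (backMeasure Ω E lam)) := by
    have := (measurePreserving_prodAssoc (volume : Measure ℝ) (outMeasure Ω lam)
      (volume : Measure ℝ)).restrict_preimage (s := univ ×ˢ backSet Ω E) (MeasurableSet.univ.prod hb)
    rw [← Measure.prod_restrict, Measure.restrict_univ] at this
    have e : (MeasurableEquiv.prodAssoc : (ℝ × Phase) × ℝ ≃ᵐ ℝ × (Phase × ℝ)) ⁻¹'
        (univ ×ˢ backSet Ω E) = {q | (q.1.2, q.2) ∈ backSet Ω E} := by
      ext q
      exact ⟨fun hq => hq.2, fun hq => ⟨mem_univ _, hq⟩⟩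
    rw [e] at this
    exact this
  have h2 : MeasurePreserving (fun q : (Phase × ℝ) × ℝ => (phaseFlow E (-q.1.2) q.1.1, q.2 + -q.1.2))
      ((backMeasure Ω E lam).prod volume) ((interiorMeasure Ω).prod volume) := by
    refine MeasurePreserving.skew_product (f := fun q : Phase × ℝ => phaseFlow E (-q.2) q.1)
      (g := fun q t => t + -q.2) ⟨(continuous_flow_comp G.field continuous_snd.neg
        continuous_fst).measurable, map_backMeasure G.isOpen G.convex G.smooth G.field
        G.measurable_density G.density_pos G.triple G.bounded G.nonempty⟩ ?_ ?_
    · exact measurable_snd.add measurable_fst.snd.neg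
    · exact Eventually.of_forall fun q => (measurePreserving_add_right volume (-q.2)).map_eq
  exact (Measure.measurePreserving_swap.comp h2).comp (Measure.measurePreserving_swap.comp h1)

omit [IsFiniteMeasure (surfaceMeasure Ω)] in
lemma TransportGeometry.ae_backCylinder {P : (ℝ × Phase) × ℝ → Prop}
    (hP : ∀ᵐ q ∂(backCylinder Ω E lam), P q) :
    ∀ᵐ p ∂((volume : Measure ℝ).prod (outMeasure Ω lam)), ∀ᵐ s,
      (p.2, s) ∈ backSet Ω E → P (p, s) := by
  rw [backCylinder, ae_restrict_iff' G.measurableSet_backSet'] at hP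
  exact Measure.ae_ae_of_ae_prod hP

end Geometry

/-! ### Representation along characteristics -/

/-- Time and point at which the characteristic starting at `p` leaves the domain. -/
noncomputable def exitMap (Ω : Set R3) (E : R3 → R3) (p : ℝ × Phase) : ℝ × Phase :=
  (p.1 + exitTime Ω E p.2, exitPoint Ω E p.2)

section Geometry
variable {Ω : Set R3} {E : R3 → R3} {K : ℝ≥0} {M : ℝ} {lam : R3 → ℝ} {a b : ℝ}

lemma TransportGeometry.exitMap_back (G : TransportGeometry Ω E K M lam a b) {p : ℝ × Phase} {s : ℝ}
    (hs : (p.2, s) ∈ backSet Ω E) : exitMap Ω E (spacetimeFlow E (-s) p) = p := by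
  have h1 : exitTime Ω E (phaseFlow E (-s) p.2) = s := ExitsAt.exitTime_eq G.isOpen hs
  simp only [exitMap, spacetimeFlow, exitPoint, h1, flow_flow_neg G.field]
  simp

lemma TransportGeometry.measurable_exitMap (G : TransportGeometry Ω E K M lam a b) :
    Measurable (exitMap Ω E) :=
  (measurable_fst.add ((measurable_exitTime G.isOpen G.convex G.smooth G.field).comp
    measurable_snd)).prodMk ((measurable_exitPoint G.isOpen G.convex G.smooth G.field).comp
    measurable_snd)

variable [IsFiniteMeasure (surfaceMeasure Ω)] (G : TransportGeometry Ω E K M lam a b)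
include G

lemma TransportGeometry.prod_outMeasure {ϑ : Measure ℝ} : ϑ.prod (outMeasure Ω lam) =
    (ϑ.prod (sigmaOut Ω)).withDensity fun p => ENNReal.ofReal (lam p.2.1) :=
  prod_withDensity_right (G.measurable_density.comp measurable_fst).ennreal_ofReal

lemma TransportGeometry.integral_outMeasure {ϑ : Measure ℝ} (f : ℝ × Phase → ℝ) :
    ∫ p, f p ∂(ϑ.prod (outMeasure Ω lam)) =
      ∫ p, lam p.2.1 * f p ∂(ϑ.prod (sigmaOut Ω)) := by
  have hm : Measurable fun p : ℝ × Phase => ENNReal.ofReal (lam p.2.1) :=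
    (G.measurable_density.comp (measurable_fst.comp measurable_snd)).ennreal_ofReal
  rw [G.prod_outMeasure, integral_withDensity_eq_integral_toReal_smul hm
    (Eventually.of_forall fun _ => ENNReal.ofReal_lt_top)]
  simp only [ENNReal.toReal_ofReal (G.density_pos _).le, smul_eq_mul]

lemma TransportGeometry.integrable_outMeasure_iff {ϑ : Measure ℝ} {f : ℝ × Phase → ℝ} :
    Integrable f (ϑ.prod (outMeasure Ω lam)) ↔
      Integrable (fun p => lam p.2.1 * f p) (ϑ.prod (sigmaOut Ω)) := by
  have hm : Measurable fun p : ℝ × Phase => ENNReal.ofReal (lam p.2.1) :=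
    (G.measurable_density.comp (measurable_fst.comp measurable_snd)).ennreal_ofReal
  rw [G.prod_outMeasure, integrable_withDensity_iff_integrable_smul' hm
    (Eventually.of_forall fun _ => ENNReal.ofReal_lt_top)]
  simp only [ENNReal.toReal_ofReal (G.density_pos _).le, smul_eq_mul]

omit [IsFiniteMeasure (surfaceMeasure Ω)] in
lemma TransportGeometry.ae_mem_outgoing :
    ∀ᵐ p ∂((volume : Measure ℝ).prod (outMeasure Ω lam)), p.2 ∈ outgoing Ω :=
  Measure.quasiMeasurePreserving_snd.ae ((withDensity_absolutelyContinuous _ _).ae_le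
    (ae_restrict_mem (measurableSet_outgoing G.isOpen G.convex G.smooth)))

variable {g β : ℝ × Phase → ℝ} {S : Set (ℝ × Phase)} {B : Set Phase} {c L : ℝ}

omit [IsFiniteMeasure (surfaceMeasure Ω)] in
lemma TransportGeometry.integrable_trace_mul (hgm : Measurable g)
    (hg : ∀ S, IsCompact S → IntegrableOn g S ((volume : Measure ℝ).prod (outMeasure Ω lam)))
    (hbm : Measurable β) (hS : IsCompact S) (hbS : ∀ p ∉ S, β p = 0) (hbB : ∀ p, |β p| ≤ c) :
    Integrable (fun q : (ℝ × Phase) × ℝ => g q.1 * β (spacetimeFlow E (-q.2) q.1))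
      (((volume : Measure ℝ).prod (outMeasure Ω lam)).prod
        ((volume : Measure ℝ).restrict (Ioc 0 L))) := by
  have h := G.field
  set S' := (fun q : ℝ × (ℝ × Phase) => spacetimeFlow E q.1 q.2) '' (Icc 0 L ×ˢ S)
  have hS' : IsCompact S' := isCompact_image_flow h hS L
  have h1 : Integrable (S'.indicator g) ((volume : Measure ℝ).prod (outMeasure Ω lam)) :=
    (integrable_indicator_iff hS'.measurableSet).2 (hg _ hS')
  have h2 : Integrable (fun q : (ℝ × Phase) × ℝ => S'.indicator g q.1)
      (((volume : Measure ℝ).prod (outMeasure Ω lam)).prod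
        ((volume : Measure ℝ).restrict (Ioc 0 L))) := h1.comp_fst _
  have hmem : ∀ᵐ q ∂(((volume : Measure ℝ).prod (outMeasure Ω lam)).prod
      ((volume : Measure ℝ).restrict (Ioc 0 L))), q.2 ∈ Ioc 0 L :=
    Measure.quasiMeasurePreserving_snd.ae (ae_restrict_mem measurableSet_Ioc)
  refine (h2.norm.mul_const c).mono' ?_ ?_
  · exact ((hgm.comp measurable_fst).mul (hbm.comp (continuous_spacetimeFlow_comp h
      continuous_snd.neg continuous_fst).measurable)).aestronglyMeasurable
  · filter_upwards [hmem] with q hq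
    have hB : 0 ≤ c := (abs_nonneg _).trans (hbB q.1)
    by_cases hqS : spacetimeFlow E (-q.2) q.1 ∈ S
    · have : q.1 ∈ S' := ⟨(q.2, spacetimeFlow E (-q.2) q.1), ⟨⟨hq.1.le, hq.2⟩, hqS⟩,
        spacetimeFlow_flow_neg h q.2 q.1⟩
      rw [indicator_of_mem this, norm_mul]
      exact mul_le_mul_of_nonneg_left (hbB _) (norm_nonneg _)
    · rw [hbS _ hqS, mul_zero, norm_zero]
      positivity

omit [IsFiniteMeasure (surfaceMeasure Ω)] in
/-- In a tube, integration over `[0, L]` is integration over `backSet Ω E`. -/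
lemma TransportGeometry.indicator_tube_ae_eq (hB : IsTube Ω E L B) (hbB : ∀ p, β p ≠ 0 → p.2 ∈ B) :
    (univ ×ˢ Ioc 0 L : Set ((ℝ × Phase) × ℝ)).indicator
        (fun q : (ℝ × Phase) × ℝ => g q.1 * β (spacetimeFlow E (-q.2) q.1))
      =ᵐ[((volume : Measure ℝ).prod (outMeasure Ω lam)).prod volume]
    {q : (ℝ × Phase) × ℝ | (q.1.2, q.2) ∈ backSet Ω E}.indicator
        (fun q => β (spacetimeFlow E (-q.2) q.1) * g (exitMap Ω E (spacetimeFlow E (-q.2) q.1))) := by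
  have h := G.field
  have hmem : ∀ᵐ q ∂(((volume : Measure ℝ).prod (outMeasure Ω lam)).prod (volume : Measure ℝ)),
      q.1.2 ∈ outgoing Ω := Measure.quasiMeasurePreserving_fst.ae G.ae_mem_outgoing
  filter_upwards [hmem] with q hq
  by_cases hne : β (spacetimeFlow E (-q.2) q.1) = 0
  · simp [indicator, hne]
  obtain ⟨τ, hτL, hτ, hout⟩ := hB _ (hbB _ hne)
  have hflow : phaseFlow E q.2 (spacetimeFlow E (-q.2) q.1).2 = q.1.2 := flow_flow_neg h _ _
  by_cases hq2 : (q.1.2, q.2) ∈ backSet Ω E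
  · have hs : q.2 = τ := ExitsAt.unique G.isOpen hq2 hτ
    rw [indicator_of_mem (show q ∈ univ ×ˢ Ioc 0 L from ⟨mem_univ _, hs ▸ hτ.1, by linarith⟩),
      indicator_of_mem (show q ∈ {q : (ℝ × Phase) × ℝ | (q.1.2, q.2) ∈ backSet Ω E} from hq2),
      G.exitMap_back hq2, mul_comm]
  · rw [indicator_of_notMem (show q ∉ {q : (ℝ × Phase) × ℝ | (q.1.2, q.2) ∈ backSet Ω E} from hq2),
      indicator_of_notMem]
    rintro ⟨-, hq0, hqL⟩
    refine hq2 ?_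
    rcases lt_trichotomy q.2 τ with hlt | heq | hlt
    · have := hτ.2.1 q.2 ⟨hq0.le, hlt⟩
      rw [hflow] at this
      exact absurd this (notMem_of_mem_frontier G.isOpen hq.1)
    · show ExitsAt Ω E (phaseFlow E (-q.2) q.1.2) q.2
      exact heq ▸ hτ
    · have := hout q.2 ⟨hlt, hqL⟩
      rw [hflow] at this
      exact absurd (frontier_subset_closure hq.1) this

lemma TransportGeometry.integrable_mul_exit (hgm : Measurable g)
    (hg : ∀ S, IsCompact S → IntegrableOn g S ((volume : Measure ℝ).prod (outMeasure Ω lam)))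
    (hbm : Measurable β) (hS : IsCompact S) (hbS : ∀ p ∉ S, β p = 0) (hbc : ∀ p, |β p| ≤ c)
    (hB : IsTube Ω E L B) (hbB : ∀ p, β p ≠ 0 → p.2 ∈ B) (hL : 0 ≤ L) :
    Integrable (fun p => β p * g (exitMap Ω E p))
        ((volume : Measure ℝ).prod (interiorMeasure Ω)) ∧
      ∫ p, g p * backAverage E L β p ∂((volume : Measure ℝ).prod (outMeasure Ω lam)) =
        ∫ p, β p * g (exitMap Ω E p) ∂((volume : Measure ℝ).prod (interiorMeasure Ω)) := by
  have h := G.field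
  have i1 := G.integrable_trace_mul hgm hg hbm hS hbS hbc (L := L)
  have hμ : ((volume : Measure ℝ).prod (outMeasure Ω lam)).prod
      ((volume : Measure ℝ).restrict (Ioc 0 L)) =
      (((volume : Measure ℝ).prod (outMeasure Ω lam)).prod volume).restrict (univ ×ˢ Ioc 0 L) := by
    rw [← Measure.prod_restrict, Measure.restrict_univ]
  have hms : MeasurableSet (univ ×ˢ Ioc 0 L : Set ((ℝ × Phase) × ℝ)) :=
    MeasurableSet.univ.prod measurableSet_Ioc
  have hind := G.indicator_tube_ae_eq (g := g) hB hbB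
  have hmp := G.measurePreserving_back
  have hsm : AEStronglyMeasurable (fun p => β p * g (exitMap Ω E p))
      ((volume : Measure ℝ).prod (interiorMeasure Ω)) :=
    (hbm.mul (hgm.comp G.measurable_exitMap)).aestronglyMeasurable
  constructor
  · rw [← hmp.integrable_comp hsm, backCylinder]
    refine (integrable_indicator_iff G.measurableSet_backSet').1 (Integrable.congr ?_ hind)
    rw [hμ] at i1
    exact (integrable_indicator_iff hms).2 i1
  · have e1 : ∫ p, g p * backAverage E L β p ∂((volume : Measure ℝ).prod (outMeasure Ω lam)) =
        ∫ q : (ℝ × Phase) × ℝ, g q.1 * β (spacetimeFlow E (-q.2) q.1)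
        ∂(((volume : Measure ℝ).prod (outMeasure Ω lam)).prod
        ((volume : Measure ℝ).restrict (Ioc 0 L))) := by
      rw [integral_prod _ i1]
      refine integral_congr_ae (Eventually.of_forall fun p => ?_)
      simp only [integral_const_mul]
      rw [backAverage, intervalIntegral.integral_of_le hL]
    have e2 := integral_map hmp.measurable.aemeasurable (f := fun p => β p * g (exitMap Ω E p))
      (by rw [hmp.map_eq]; exact hsm)
    rw [hmp.map_eq] at e2
    rw [e1, e2, hμ, ← integral_indicator hms, integral_congr_ae hind,
      integral_indicator G.measurableSet_backSet', backCylinder]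

omit [IsFiniteMeasure (surfaceMeasure Ω)] in
/-- In a tube, the integral over `[0, L]` inside the domain is the integral up to the exit time. -/
lemma TransportGeometry.integral_tube {F : ℝ × Phase → ℝ} (hB : IsTube Ω E L B) {p : ℝ × Phase}
    (hp : p.2 ∈ B) :
    ∫ s in (0 : ℝ)..L, (univ ×ˢ (Ω ×ˢ univ) : Set (ℝ × Phase)).indicator F (spacetimeFlow E s p) =
      ∫ s in (0 : ℝ)..exitTime Ω E p.2, F (spacetimeFlow E s p) := by
  obtain ⟨τ, hτL, hτ, hout⟩ := hB _ hp
  rw [hτ.exitTime_eq G.isOpen, intervalIntegral.integral_of_le (hτ.1.trans hτL).le,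
    intervalIntegral.integral_of_le hτ.1.le, integral_Ioc_eq_integral_Ioo (x := 0) (y := τ)]
  have e : Ioc 0 L ∩ Ioo 0 τ = Ioo 0 τ :=
    inter_eq_right.2 fun s hs => ⟨hs.1, hs.2.le.trans hτL.le⟩
  rw [← e, ← setIntegral_indicator measurableSet_Ioo]
  refine setIntegral_congr_fun measurableSet_Ioc fun s hs => ?_
  by_cases hsτ : s < τ
  · rw [indicator_of_mem (show s ∈ Ioo 0 τ from ⟨hs.1, hsτ⟩), indicator_of_mem]
    exact ⟨mem_univ _, hτ.2.1 s ⟨hs.1.le, hsτ⟩, mem_univ _⟩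
  · rw [indicator_of_notMem (fun hmem : s ∈ Ioo 0 τ => hsτ hmem.2), indicator_of_notMem]
    rintro ⟨-, hmem, -⟩
    rcases (not_lt.1 hsτ).lt_or_eq with hlt | heq
    · exact hout s ⟨hlt, hs.2⟩ (subset_closure hmem)
    · subst heq
      exact notMem_of_mem_frontier G.isOpen hτ.2.2.1 hmem

end Geometry

section Geometry
variable {Ω : Set R3} {E : R3 → R3} {K : ℝ≥0} {M : ℝ} {lam : R3 → ℝ} {a b : ℝ}
  [IsFiniteMeasure (surfaceMeasure Ω)] (G : TransportGeometry Ω E K M lam a b)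
  {J : Set ℝ} {u F γ : ℝ × Phase → ℝ}
include G

lemma TransportGeometry.integrableOn_trace_div
    (hγ : LocallyIntegrable γ ((volume : Measure ℝ).prod (boundaryMeasure Ω)))
    {S : Set (ℝ × Phase)} (hS : IsCompact S) :
    IntegrableOn (fun p => γ p / lam p.2.1) S ((volume : Measure ℝ).prod (outMeasure Ω lam)) := by
  rw [← integrable_indicator_iff hS.measurableSet, G.integrable_outMeasure_iff]
  have h1 : (fun p : ℝ × Phase => lam p.2.1 * S.indicator (fun p => γ p / lam p.2.1) p) =
      S.indicator γ := by
    funext p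
    by_cases hp : p ∈ S
    · rw [indicator_of_mem hp, indicator_of_mem hp, mul_div_cancel₀ _ (G.density_pos _).ne']
    · rw [indicator_of_notMem hp, indicator_of_notMem hp, mul_zero]
  rw [h1, integrable_indicator_iff hS.measurableSet]
  exact (LocallyIntegrable.mono_measure' hγ prod_sigmaOut_le).integrableOn_isCompact hS

/-- After the averages in the tube identity are moved from the test function `φ` to `F` and `γ`, it
says that `u + ∫ F - γ / lam`, with the trace taken at the exit, is orthogonal to all smooth `φ`
supported in the tube. So it vanishes almost everywhere there. -/
theorem IsWeakTriple.exit_formula_tube (ht : IsWeakTriple Ω E J u F γ) (hJ : IsOpen J)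
    (hFm : Measurable F) (hγm : Measurable γ) {L ε r t₀ : ℝ} {z₀ : Phase}
    (hL : 0 < L) (hB : IsTube Ω E L (Metric.closedBall z₀ r))
    (hJ' : ∀ t ∈ Metric.ball t₀ ε, ∀ s ∈ Icc 0 L, t + s ∈ J) :
    ∀ᵐ p ∂((volume : Measure ℝ).prod (interiorMeasure Ω)),
      p ∈ Metric.ball t₀ ε ×ˢ Metric.ball z₀ r →
      u p + ∫ s in (0 : ℝ)..exitTime Ω E p.2, F (spacetimeFlow E s p) =
        γ (exitMap Ω E p) / lam (exitMap Ω E p).2.1 := by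
  have h := G.field
  set D : Set (ℝ × Phase) := univ ×ˢ (Ω ×ˢ univ)
  have hD : MeasurableSet D := MeasurableSet.univ.prod (G.isOpen.measurableSet.prod .univ)
  have hν : (volume : Measure ℝ).prod (interiorMeasure Ω) = volume.restrict D :=
    prod_interiorMeasure Ω
  set U : Set (ℝ × Phase) := Metric.ball t₀ ε ×ˢ Metric.ball z₀ r
  set S : Set (ℝ × Phase) := Metric.closedBall t₀ ε ×ˢ Metric.closedBall z₀ r
  have hUo : IsOpen U := Metric.isOpen_ball.prod Metric.isOpen_ball
  have hS : IsCompact S := (isCompact_closedBall _ _).prod (isCompact_closedBall _ _)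
  have hUS : U ⊆ S := prod_mono Metric.ball_subset_closedBall Metric.ball_subset_closedBall
  have hUD : ∀ p ∈ U, p ∈ D := fun p hp => by
    obtain ⟨τ, -, hτ, -⟩ := hB _ (hUS hp).2
    exact ⟨mem_univ _, hτ.mem h, mem_univ _⟩
  set F₀ := D.indicator F
  have hF₀m : Measurable F₀ := hFm.indicator hD
  have hF₀ : LocallyIntegrable F₀ volume := by
    refine locallyIntegrable_iff.2 fun k hk => ?_
    have h1 := ht.locallyIntegrable_source.integrableOn_isCompact hk
    rw [hν, IntegrableOn, Measure.restrict_restrict hk.measurableSet, inter_comm,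
      ← Measure.restrict_restrict hD] at h1
    exact (integrable_indicator_iff hD).2 h1
  set g := fun p : ℝ × Phase => γ p / lam p.2.1
  have hgm : Measurable g := hγm.div (G.measurable_density.comp measurable_snd.fst)
  have hg : ∀ S, IsCompact S → IntegrableOn g S ((volume : Measure ℝ).prod (outMeasure Ω lam)) :=
    fun S hS => G.integrableOn_trace_div ht.locallyIntegrable_trace hS
  set F' := fun p => ∫ s in (0 : ℝ)..L, F₀ (spacetimeFlow E s p)
  let χ : ℝ × Phase → ℝ := U.indicator 1
  have hχm : Measurable χ := measurable_one.indicator hUo.measurableSet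
  have hχS : ∀ p ∉ S, χ p = 0 := fun p hp => indicator_of_notMem (fun hpU => hp (hUS hpU)) _
  have hχ1 : ∀ p, |χ p| ≤ 1 := fun p => by
    by_cases hp : p ∈ U <;> simp [χ, hp]
  have hχB : ∀ p, χ p ≠ 0 → p.2 ∈ Metric.closedBall z₀ r := fun p hp =>
    (hUS (mem_of_indicator_ne_zero hp)).2
  have hχmul : ∀ w : ℝ × Phase → ℝ, (fun p => χ p * w p) = U.indicator w := fun w => by
    funext p
    by_cases hp : p ∈ U <;> simp [χ, hp]
  have i1 : IntegrableOn u U ((volume : Measure ℝ).prod (interiorMeasure Ω)) :=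
    (ht.locallyIntegrable.integrableOn_isCompact hS).mono_set hUS
  have i2 : IntegrableOn F' U ((volume : Measure ℝ).prod (interiorMeasure Ω)) := by
    have := integrable_mul_flowIntegral h hF₀m hF₀ hχm hS hχS hχ1 hL.le
    rw [hχmul, integrable_indicator_iff hUo.measurableSet] at this
    rw [hν]
    exact IntegrableOn.mono_measure this Measure.restrict_le_self
  have i3 : IntegrableOn (fun p => g (exitMap Ω E p)) U
      ((volume : Measure ℝ).prod (interiorMeasure Ω)) := by
    have := (G.integrable_mul_exit hgm hg hχm hS hχS hχ1 hB hχB hL.le).1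
    rwa [hχmul, integrable_indicator_iff hUo.measurableSet] at this
  have key := hUo.ae_eq_zero_of_integral_contDiff_smul_eq_zero
    (f := fun p => u p + F' p - g (exitMap Ω E p))
    (((i1.add i2).sub i3).locallyIntegrableOn) (fun φ hφ hφc hφU => ?_)
  · filter_upwards [key] with p hp hpU
    have h1 := hp hpU
    have h2 : F' p = ∫ s in (0 : ℝ)..exitTime Ω E p.2, F (spacetimeFlow E s p) :=
      G.integral_tube hB (hUS hpU).2
    rw [h2] at h1
    linarith
  · obtain ⟨C, hC⟩ := (hφ.of_le (by exact_mod_cast le_top) :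
      ContDiff ℝ 1 φ).lipschitzWith_of_hasCompactSupport hφc one_ne_zero
    have hφm := hφ.continuous.measurable
    obtain ⟨c, hc⟩ := hφ.continuous.bounded_above_of_compact_support hφc
    have hφS : ∀ p ∉ S, φ p = 0 := fun p hp =>
      image_eq_zero_of_notMem_tsupport fun hmem => hp (hUS (hφU hmem))
    have hφ0 : ∀ p ∉ U, φ p = 0 := fun p hp =>
      image_eq_zero_of_notMem_tsupport fun hmem => hp (hφU hmem)
    have hφB : ∀ p, φ p ≠ 0 → p.2 ∈ Metric.closedBall z₀ r := fun p hp =>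
      (hUS (hφU (subset_tsupport φ hp))).2
    have t1 := ht.tube_identity h G.isOpen G.convex G.smooth hJ hC hφc hL hB hJ'
      (hφU.trans (prod_mono subset_rfl Metric.ball_subset_closedBall))
    have t2 : ∫ p, F p * backAverage E L φ p ∂((volume : Measure ℝ).prod (interiorMeasure Ω)) =
        ∫ p, φ p * F' p ∂((volume : Measure ℝ).prod (interiorMeasure Ω)) := by
      have := integral_mul_backAverage h hF₀m hF₀ hφm hS hφS hc hL.le
      rw [hν, setIntegral_eq_integral_of_forall_compl_eq_zero (f := fun p => φ p * F' p)
        fun p hp => by rw [hφ0 p fun hpU => hp (hUD p hpU), zero_mul], ← this,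
        ← integral_indicator hD]
      refine integral_congr_ae (Eventually.of_forall fun p => ?_)
      by_cases hp : p ∈ D <;> simp [F₀, hp]
    have t3 : ∫ p, γ p * backAverage E L φ p ∂((volume : Measure ℝ).prod (sigmaOut Ω)) =
        ∫ p, φ p * g (exitMap Ω E p) ∂((volume : Measure ℝ).prod (interiorMeasure Ω)) := by
      rw [← (G.integrable_mul_exit hgm hg hφm hS hφS hc hB hφB hL.le).2, G.integral_outMeasure]
      refine integral_congr_ae (Eventually.of_forall fun p => ?_)
      have : lam p.2.1 ≠ 0 := (G.density_pos _).ne'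
      simp only [g]
      field_simp
    have j : ∀ w : ℝ × Phase → ℝ, IntegrableOn w U ((volume : Measure ℝ).prod (interiorMeasure Ω)) →
        Integrable (fun p => φ p * w p) ((volume : Measure ℝ).prod (interiorMeasure Ω)) := by
      intro w hw
      have e : (fun p => φ p * w p) = fun p => φ p * U.indicator w p := by
        funext p
        by_cases hp : p ∈ U
        · rw [indicator_of_mem hp]
        · rw [hφ0 p hp, zero_mul, zero_mul]
      rw [e]
      exact ((integrable_indicator_iff hUo.measurableSet).2 hw).bdd_mul
        hφm.aestronglyMeasurable (Eventually.of_forall hc)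
    rw [t2, t3] at t1
    simp only [smul_eq_mul, mul_sub, mul_add]
    have j12 : Integrable (fun p => φ p * u p + φ p * F' p)
        ((volume : Measure ℝ).prod (interiorMeasure Ω)) := (j u i1).add (j F' i2)
    rw [integral_sub j12 (j _ i3), integral_add (j u i1) (j F' i2), ← t1]
    simp only [mul_comm (u _), sub_self]

/-- Integration along characteristics up to `Γ₊`. -/
theorem IsWeakTriple.exit_formula (ht : IsWeakTriple Ω E J u F γ) (hJ : IsOpen J)
    (hFm : Measurable F) (hγm : Measurable γ) :
    ∀ᵐ p ∂((volume : Measure ℝ).prod (interiorMeasure Ω)),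
      Icc p.1 (p.1 + exitTime Ω E p.2) ⊆ J →
      u p + ∫ s in (0 : ℝ)..exitTime Ω E p.2, F (spacetimeFlow E s p) =
        γ (exitMap Ω E p) / lam (exitMap Ω E p).2.1 := by
  have hex : ∀ᵐ p ∂((volume : Measure ℝ).prod (interiorMeasure Ω)), p.2 ∈ exitSet Ω E :=
    Measure.quasiMeasurePreserving_snd.ae
      (ae_mem_exitSet G.isOpen G.convex G.smooth G.field G.bounded G.nonempty)
  have hnull := measure_null_of_locally_null (μ := (volume : Measure ℝ).prod (interiorMeasure Ω))
    {p | p.2 ∈ exitSet Ω E ∧ Icc p.1 (p.1 + exitTime Ω E p.2) ⊆ J ∧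
      u p + ∫ s in (0 : ℝ)..exitTime Ω E p.2, F (spacetimeFlow E s p) ≠
        γ (exitMap Ω E p) / lam (exitMap Ω E p).2.1} (by
    rintro ⟨t₀, z₀⟩ ⟨hz, hsub, -⟩
    obtain ⟨ε, hε, hth⟩ := isCompact_Icc.exists_thickening_subset_open hJ hsub
    obtain ⟨L, r, hL, hLε, hr, hT⟩ :=
      exists_tube_closedBall G.isOpen G.convex G.smooth G.field hz (half_pos hε)
    have hτ := (exitsAt_exitTime hz).1
    have hJ' : ∀ t ∈ Metric.ball t₀ (ε / 2), ∀ s ∈ Icc 0 L, t + s ∈ J := by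
      intro t ht' s hs
      -- The comparison point is `t₀ + min s τ`, where `τ` is the exit time of `z₀`: `t` differs
      -- from `t₀` by less than `ε/2`, and `s ≤ L` exceeds `τ` by less than `ε/2`.
      refine hth (Metric.mem_thickening_iff.2
        ⟨t₀ + min s (exitTime Ω E z₀), ⟨?_, ?_⟩, ?_⟩)
      · have : 0 ≤ min s (exitTime Ω E z₀) := le_min hs.1 hτ.le
        simpa using this
      · simp
      · rw [Metric.mem_ball, Real.dist_eq, abs_lt] at ht'
        rw [Real.dist_eq, abs_lt]
        rcases le_total s (exitTime Ω E z₀) with hle | hle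
        · rw [min_eq_left hle]
          constructor <;> linarith
        · rw [min_eq_right hle]
          constructor <;> linarith [hs.2]
    have hae := ht.exit_formula_tube G hJ hFm hγm (hτ.trans hL) hT hJ'
    refine ⟨_, inter_mem_nhdsWithin _ ((Metric.isOpen_ball.prod Metric.isOpen_ball).mem_nhds
      (⟨Metric.mem_ball_self (half_pos hε), Metric.mem_ball_self hr⟩ :
        (t₀, z₀) ∈ Metric.ball t₀ (ε / 2) ×ˢ Metric.ball z₀ r)), ?_⟩
    refine measure_mono_null ?_ (ae_iff.1 hae)
    rintro p ⟨hp1, hp2⟩ hcon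
    exact hp1.2.2 (hcon hp2))
  filter_upwards [hex, (measure_eq_zero_iff_ae_notMem.1 hnull)] with p hp1 hp2 hsub
  by_contra hne
  exact hp2 ⟨hp1, hsub, hne⟩

end Geometry

/-! ### Time reversal -/

/-- Reversal of the velocity. -/
noncomputable def flipVel : Phase ≃ₜ Phase := (Homeomorph.refl R3).prodCongr (Homeomorph.neg R3)

/-- Reversal of time and velocity. -/
noncomputable def timeFlip : ℝ × Phase ≃ₜ ℝ × Phase := (Homeomorph.neg ℝ).prodCongr flipVel

lemma flipVel_apply (z : Phase) : flipVel z = (z.1, -z.2) := rfl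

lemma timeFlip_apply (p : ℝ × Phase) : timeFlip p = (-p.1, flipVel p.2) := rfl

lemma flipVel_flipVel (z : Phase) : flipVel (flipVel z) = z := by simp [flipVel_apply]

lemma timeFlip_timeFlip (p : ℝ × Phase) : timeFlip (timeFlip p) = p := by
  simp [timeFlip_apply, flipVel_flipVel]

lemma flipVel_mem_outgoing_iff {Ω : Set R3} {z : Phase} :
    flipVel z ∈ outgoing Ω ↔ z ∈ incoming Ω := by
  simp [outgoing, incoming, flipVel_apply]

lemma flipVel_mem_incoming_iff {Ω : Set R3} {z : Phase} :
    flipVel z ∈ incoming Ω ↔ z ∈ outgoing Ω := by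
  simp [outgoing, incoming, flipVel_apply]

/-! ### Invariance of the measures under reversal of time and velocity. -/

section Measures
variable {Ω : Set R3} [IsFiniteMeasure (surfaceMeasure Ω)]

omit [IsFiniteMeasure (surfaceMeasure Ω)] in
lemma measurePreserving_flipVel_interior (hΩo : IsOpen Ω) :
    MeasurePreserving flipVel (interiorMeasure Ω) (interiorMeasure Ω) := by
  have h1 : MeasurePreserving flipVel (volume : Measure Phase) volume :=
    (MeasurePreserving.id (volume : Measure R3)).prod (Measure.measurePreserving_neg volume)
  have h2 := h1.restrict_preimage (s := Ω ×ˢ univ) (hΩo.measurableSet.prod .univ)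
  exact h2

lemma measurePreserving_flipVel_boundary :
    MeasurePreserving flipVel (boundaryMeasure Ω) (boundaryMeasure Ω) := by
  have h1 : MeasurePreserving flipVel ((surfaceMeasure Ω).prod (volume : Measure R3))
      ((surfaceMeasure Ω).prod volume) :=
    (MeasurePreserving.id (surfaceMeasure Ω)).prod (Measure.measurePreserving_neg volume)
  refine ⟨flipVel.continuous.measurable, Measure.ext fun s hs => ?_⟩
  rw [Measure.map_apply flipVel.continuous.measurable hs, boundaryMeasure, withDensity_apply _ hs,
    withDensity_apply _ (flipVel.continuous.measurable hs)]
  have := h1.setLIntegral_comp_preimage_emb flipVel.measurableEmbedding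
    (fun z => ENNReal.ofReal |inner ℝ (outerNormal Ω z.1) z.2|) s
  rw [surfaceMeasure] at this
  rw [← this]
  simp [flipVel_apply]

lemma measurePreserving_flipVel_sigmaOut (hΩo : IsOpen Ω) (hΩc : Convex ℝ Ω)
    (hΩs : HasSmoothBoundary Ω) : MeasurePreserving flipVel (sigmaOut Ω) (sigmaIn Ω) := by
  have h2 := (measurePreserving_flipVel_boundary (Ω := Ω)).restrict_preimage
    (measurableSet_incoming hΩo hΩc hΩs)
  have e : flipVel ⁻¹' (incoming Ω) = outgoing Ω := by
    ext z
    exact flipVel_mem_incoming_iff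
  rwa [e] at h2

lemma measurePreserving_flipVel_sigmaIn (hΩo : IsOpen Ω) (hΩc : Convex ℝ Ω)
    (hΩs : HasSmoothBoundary Ω) : MeasurePreserving flipVel (sigmaIn Ω) (sigmaOut Ω) := by
  have h2 := (measurePreserving_flipVel_boundary (Ω := Ω)).restrict_preimage
    (measurableSet_outgoing hΩo hΩc hΩs)
  have e : flipVel ⁻¹' (outgoing Ω) = incoming Ω := by
    ext z
    exact flipVel_mem_outgoing_iff
  rwa [e] at h2

lemma measurePreserving_timeFlip {μ ν : Measure Phase} [SFinite μ] [SFinite ν]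
    (hf : MeasurePreserving flipVel μ ν) :
    MeasurePreserving timeFlip ((volume : Measure ℝ).prod μ) ((volume : Measure ℝ).prod ν) :=
  (Measure.measurePreserving_neg volume).prod hf

lemma integral_comp_timeFlip {μ ν : Measure Phase} [SFinite μ] [SFinite ν]
    (hf : MeasurePreserving flipVel μ ν) (w : ℝ × Phase → ℝ) :
    ∫ p, w (timeFlip p) ∂((volume : Measure ℝ).prod μ) = ∫ p, w p ∂((volume : Measure ℝ).prod ν) :=
  (measurePreserving_timeFlip hf).integral_comp timeFlip.measurableEmbedding w

lemma locallyIntegrable_comp_timeFlip {μ ν : Measure Phase} [SFinite μ] [SFinite ν]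
    (hf : MeasurePreserving flipVel μ ν) {w : ℝ × Phase → ℝ}
    (hw : LocallyIntegrable w ((volume : Measure ℝ).prod ν)) :
    LocallyIntegrable (fun p => w (timeFlip p)) ((volume : Measure ℝ).prod μ) := by
  refine locallyIntegrable_iff.2 fun k hk => ?_
  have h1 := hw.integrableOn_isCompact (hk.image timeFlip.continuous)
  have h2 := ((measurePreserving_timeFlip hf).integrableOn_comp_preimage
    timeFlip.measurableEmbedding).2 h1
  rwa [preimage_image_eq _ timeFlip.injective] at h2

end Measures

lemma contDiff_timeFlip : ContDiff ℝ 1 timeFlip :=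
  contDiff_fst.neg.prodMk (contDiff_snd.fst.prodMk contDiff_snd.snd.neg)

lemma transport_comp_timeFlip {E : R3 → R3} {η : ℝ × Phase → ℝ} (hη : ContDiff ℝ 1 η)
    (p : ℝ × Phase) :
    transport E (fun p => η (timeFlip p)) p = -transport E η (timeFlip p) := by
  let L : ℝ × Phase →L[ℝ] ℝ × Phase := (-ContinuousLinearMap.fst ℝ ℝ Phase).prod
    (((ContinuousLinearMap.fst ℝ R3 R3).comp (ContinuousLinearMap.snd ℝ ℝ Phase)).prod
      (-((ContinuousLinearMap.snd ℝ R3 R3).comp (ContinuousLinearMap.snd ℝ ℝ Phase))))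
  have h1 : HasFDerivAt timeFlip L p :=
    L.hasFDerivAt.congr_of_eventuallyEq (Eventually.of_forall fun p => rfl)
  have h2 := ((hη.differentiable one_ne_zero (timeFlip p)).hasFDerivAt).comp p h1
  have h3 : fderiv ℝ (fun p => η (timeFlip p)) p = _ := h2.fderiv
  rw [transport, h3, transport, ContinuousLinearMap.comp_apply, ← map_neg]
  congr 1
  simp [timeFlip_apply, flipVel_apply, L]

/-- The reversal changes the sign of the transport operator and exchanges `Γ₊` with `Γ₋`. So the
traces correspond without a sign, and the source changes its sign. -/
theorem IsWeakTriple.reverse {Ω : Set R3} [IsFiniteMeasure (surfaceMeasure Ω)] {E : R3 → R3}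
    {J : Set ℝ} {u F γ : ℝ × Phase → ℝ} (ht : IsWeakTriple Ω E J u F γ) (hΩo : IsOpen Ω)
    (hΩc : Convex ℝ Ω) (hΩs : HasSmoothBoundary Ω) :
    IsWeakTriple Ω E (Neg.neg ⁻¹' J) (fun p => u (timeFlip p))
      (fun p => -F (timeFlip p)) (fun p => γ (timeFlip p)) := by
  have hI := measurePreserving_flipVel_interior hΩo
  refine ⟨locallyIntegrable_comp_timeFlip hI ht.locallyIntegrable,
    (locallyIntegrable_comp_timeFlip hI ht.locallyIntegrable_source).neg,
    locallyIntegrable_comp_timeFlip measurePreserving_flipVel_boundary ht.locallyIntegrable_trace,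
    fun η hη hηc hsub => ?_⟩
  have hw := ht.weak (fun p => η (timeFlip p)) (hη.comp contDiff_timeFlip)
    (hηc.comp_homeomorph timeFlip) (by
      have : tsupport (fun p => η (timeFlip p)) ⊆ timeFlip ⁻¹' tsupport η :=
        tsupport_comp_subset_preimage η timeFlip.continuous
      intro p hp
      have h1 : -(timeFlip p).1 ∈ J := (hsub (this hp)).1
      rw [timeFlip_apply, neg_neg] at h1
      exact ⟨h1, mem_univ _⟩)
  have e1 := integral_comp_timeFlip hI (fun p => u p * transport E η (timeFlip p))
  have e2 := integral_comp_timeFlip hI (fun p => F p * η (timeFlip p))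
  have e3 := integral_comp_timeFlip (measurePreserving_flipVel_sigmaOut hΩo hΩc hΩs)
    (fun p => γ p * η (timeFlip p))
  have e4 := integral_comp_timeFlip (measurePreserving_flipVel_sigmaIn hΩo hΩc hΩs)
    (fun p => γ p * η (timeFlip p))
  simp only [timeFlip_timeFlip] at e1 e2 e3 e4
  simp only [transport_comp_timeFlip hη, mul_neg, integral_neg] at hw
  simp only [neg_mul, integral_neg]
  rw [e1, e2, e3, e4]
  linarith

lemma flow_flipVel {E : R3 → R3} {K : ℝ≥0} {M : ℝ} (h : IsForceField E K M) (s : ℝ) (z : Phase) :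
    phaseFlow E s (flipVel z) = flipVel (phaseFlow E (-s) z) := flow_reverse h s z

lemma spacetimeFlow_timeFlip {E : R3 → R3} {K : ℝ≥0} {M : ℝ} (h : IsForceField E K M) (s : ℝ)
    (p : ℝ × Phase) : timeFlip (spacetimeFlow E s p) = spacetimeFlow E (-s) (timeFlip p) := by
  simp only [timeFlip_apply, spacetimeFlow, flow_flipVel h, neg_neg, neg_add]

/-- Time and point at which the characteristic ending at `p` enters the domain. -/
noncomputable def entryMap (Ω : Set R3) (E : R3 → R3) (p : ℝ × Phase) : ℝ × Phase :=
  timeFlip (exitMap Ω E (timeFlip p))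

/-- Integration along characteristics down to `Γ₋`. -/
theorem IsWeakTriple.entry_formula {Ω : Set R3} {E : R3 → R3} {K : ℝ≥0} {M : ℝ} {lam : R3 → ℝ}
    {a b : ℝ} [IsFiniteMeasure (surfaceMeasure Ω)] (G : TransportGeometry Ω E K M lam a b)
    {J : Set ℝ} {u F γ : ℝ × Phase → ℝ} (ht : IsWeakTriple Ω E J u F γ) (hJ : IsOpen J)
    (hFm : Measurable F) (hγm : Measurable γ) :
    ∀ᵐ p ∂((volume : Measure ℝ).prod (interiorMeasure Ω)),
      Icc (p.1 - exitTime Ω E (flipVel p.2)) p.1 ⊆ J →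
      u p - ∫ s in (0 : ℝ)..exitTime Ω E (flipVel p.2), F (spacetimeFlow E (-s) p) =
        γ (entryMap Ω E p) / lam (entryMap Ω E p).2.1 := by
  have hfm := timeFlip.continuous.measurable
  have h1 := (ht.reverse G.isOpen G.convex G.smooth).exit_formula G (hJ.preimage continuous_neg)
    (hFm.comp hfm).neg (hγm.comp hfm)
  have hmp := measurePreserving_timeFlip (measurePreserving_flipVel_interior G.isOpen)
  filter_upwards [hmp.quasiMeasurePreserving.ae h1] with p hp hsub
  have h2 := hp (fun t ht' => by
    refine hsub ⟨?_, ?_⟩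
    · have := ht'.2
      rw [timeFlip_apply] at this
      linarith
    · have := ht'.1
      rw [timeFlip_apply] at this
      linarith)
  simp only [spacetimeFlow_timeFlip G.field, timeFlip_timeFlip, intervalIntegral.integral_neg] at h2
  exact h2

/-! ### Chords -/

/-- The backward characteristic of `z ∈ Γ₊` stays in `Ω` precisely during `(0, ℓ)` and is on `Γ₋` at
time `-ℓ`. -/
structure IsChord (Ω : Set R3) (E : R3 → R3) (z : Phase) (ℓ : ℝ) : Prop where
  pos : 0 < ℓ
  mem_iff : ∀ s, (z, s) ∈ backSet Ω E ↔ s ∈ Ioo 0 ℓ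
  mem_incoming : phaseFlow E (-ℓ) z ∈ incoming Ω

/-- The length in time of the backward characteristic of `z ∈ Γ₊`. -/
noncomputable def chordLength (Ω : Set R3) (E : R3 → R3) (z : Phase) : ℝ :=
  ((volume : Measure ℝ) {s | (z, s) ∈ backSet Ω E}).toReal

/-- The starting point on `Γ₋` of the backward characteristic of `z ∈ Γ₊`. -/
noncomputable def entryPoint (Ω : Set R3) (E : R3 → R3) (z : Phase) : Phase :=
  phaseFlow E (-chordLength Ω E z) z

/-- The measure `λ dσ` on `Γ₋`. -/
noncomputable def inMeasure (Ω : Set R3) (lam : R3 → ℝ) : Measure Phase :=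
  (sigmaIn Ω).withDensity fun z => ENNReal.ofReal (lam z.1)

instance sfinite_inMeasure {Ω : Set R3} {lam : R3 → ℝ} [IsFiniteMeasure (surfaceMeasure Ω)] :
    SFinite (inMeasure Ω lam) := inferInstanceAs (SFinite ((sigmaIn Ω).withDensity _))

variable {Ω : Set R3} {E : R3 → R3} {K : ℝ≥0} {M : ℝ} {lam : R3 → ℝ} {a b : ℝ}

lemma IsChord.setOf_eq {z : Phase} {ℓ : ℝ} (hz : IsChord Ω E z ℓ) :
    {s | (z, s) ∈ backSet Ω E} = Ioo 0 ℓ := ext hz.mem_iff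

lemma IsChord.chordLength_eq {z : Phase} {ℓ : ℝ} (hz : IsChord Ω E z ℓ) :
    chordLength Ω E z = ℓ := by
  rw [chordLength, hz.setOf_eq, Real.volume_Ioo, sub_zero, ENNReal.toReal_ofReal hz.pos.le]

/-- The chord through `p` consists of its forward piece, of duration `τ`, and of its backward piece,
which is the forward piece after reversal and has duration `τ'`. -/
lemma TransportGeometry.isChord_exitPoint (G : TransportGeometry Ω E K M lam a b) {p : Phase}
    {τ τ' : ℝ} (hp : ExitsAt Ω E p τ) (hp' : ExitsAt Ω E (flipVel p) τ') :
    IsChord Ω E (phaseFlow E τ p) (τ + τ') := by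
  have h := G.field
  have hin : phaseFlow E (-(τ + τ')) (phaseFlow E τ p) ∈ incoming Ω := by
    have := hp'.2.2
    rw [flow_flipVel h, flipVel_mem_outgoing_iff] at this
    rwa [← flow_add h, neg_add_rev, neg_add_cancel_right]
  refine ⟨add_pos hp.1 hp'.1, fun s => ?_, hin⟩
  rw [mem_backSet_iff h]
  constructor
  · rintro ⟨-, hs0, hs⟩
    refine ⟨hs0, lt_of_not_ge fun hle => ?_⟩
    exact notMem_of_mem_frontier G.isOpen hin.1 (hs _ ⟨add_pos hp.1 hp'.1, hle⟩)
  · rintro ⟨hs0, hs⟩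
    refine ⟨hp.2.2, hs0, fun r hr => ?_⟩
    rw [← flow_add h]
    rcases le_or_gt r τ with hle | hlt
    · exact hp.2.1 _ ⟨by linarith, by linarith [hr.1]⟩
    · have := hp'.2.1 (r - τ) ⟨by linarith, by linarith [hr.2]⟩
      rw [flow_flipVel h] at this
      rwa [show -r + τ = -(r - τ) by ring]

lemma IsChord.exitsAt {z : Phase} {ℓ s : ℝ} (hz : IsChord Ω E z ℓ) (hs : s ∈ Ioo 0 ℓ) :
    ExitsAt Ω E (phaseFlow E (-s) z) s := (hz.mem_iff s).2 hs

lemma TransportGeometry.exitsAt_flip (G : TransportGeometry Ω E K M lam a b) {z : Phase} {ℓ s : ℝ}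
    (hz : IsChord Ω E z ℓ) (hs : s ∈ Ioo 0 ℓ) :
    ExitsAt Ω E (flipVel (phaseFlow E (-s) z)) (ℓ - s) := by
  have h := G.field
  have hflow : ∀ r, phaseFlow E r (flipVel (phaseFlow E (-s) z)) =
      flipVel (phaseFlow E (-(r + s)) z) := fun r => by
    rw [flow_flipVel h, ← flow_add h, neg_add]
  refine ⟨by linarith [hs.2], fun r hr => ?_, ?_⟩
  · rw [hflow]
    have := ((mem_backSet_iff h).1 ((hz.mem_iff (r + s)).2
      ⟨by linarith [hr.1, hs.1], by linarith [hr.2]⟩)).2.2 (r + s) ⟨by linarith [hr.1, hs.1], le_rfl⟩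
    exact this
  · rw [hflow, sub_add_cancel, flipVel_mem_outgoing_iff]
    exact hz.mem_incoming

/-- Backward characteristics of points of `Γ₊` enter the domain. -/
lemma TransportGeometry.exists_backSet (G : TransportGeometry Ω E K M lam a b) {z : Phase}
    (hz : z ∈ outgoing Ω) : ∃ ε > 0, ∀ s ∈ Ioo 0 ε, (z, s) ∈ backSet Ω E := by
  have h := G.field
  obtain ⟨ρ, hρ⟩ := G.smooth _ hz.1
  have hpos := hz.2
  rw [outerNormal_eq G.isOpen G.convex G.smooth hz.1 hρ, inner_smul_left] at hpos
  replace hpos : 0 < inner ℝ (gradient ρ z.1) z.2 := pos_of_mul_pos_right hpos (by simp)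
  have hd : HasDerivAt (fun s => ρ (phaseFlow E s z).1) (inner ℝ (gradient ρ z.1) z.2) 0 := by
    have := (hρ.hasFDerivAt (phaseFlow E 0 z).1).comp_hasDerivAt 0 (hasDerivAt_flow_fst h z 0)
    rw [flow_zero h] at this
    exact this
  have h0 : ρ (phaseFlow E 0 z).1 = 0 := by rw [flow_zero h, hρ.zero]
  have hc : Continuous fun s => (phaseFlow E s z).1 :=
    continuous_fst.comp (continuous_flow_comp h continuous_id continuous_const)
  have hmem : ∀ᶠ s in 𝓝[<] (0 : ℝ), (phaseFlow E s z).1 ∈ Ω := by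
    have hev : ∀ᶠ s in 𝓝[<] (0 : ℝ), ((phaseFlow E s z).1 ∈ Ω ↔ ρ (phaseFlow E s z).1 < 0) :=
      nhdsWithin_le_nhds ((hc.tendsto' 0 z.1 (by rw [flow_zero h])).eventually hρ.mem_iff)
    have hsl := hd.tendsto_slope.mono_left
      (nhdsWithin_mono (0 : ℝ) (fun s (hs : s < 0) => hs.ne))
    filter_upwards [hev, hsl.eventually (lt_mem_nhds hpos), self_mem_nhdsWithin] with s h1 h2 h3
    refine h1.2 ?_
    rw [slope_def_field, h0, sub_zero, sub_zero] at h2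
    by_contra hge
    exact absurd h2 (not_lt.2 (div_nonpos_of_nonneg_of_nonpos (not_lt.1 hge) h3.le))
  obtain ⟨l, hl, hsub⟩ := (mem_nhdsLT_iff_exists_Ioo_subset).1 hmem
  refine ⟨-l, neg_pos.2 hl, fun s hs => (mem_backSet_iff h).2 ⟨hz, hs.1, fun r hr => ?_⟩⟩
  exact hsub ⟨by linarith [hr.2, hs.2], by linarith [hr.1]⟩

/-- As the measure of a slice of a measurable set, the length is measurable by Fubini; this
motivates its definition. -/
lemma TransportGeometry.measurable_chordLength (G : TransportGeometry Ω E K M lam a b) :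
    Measurable (chordLength Ω E) :=
  (measurable_measure_prodMk_left
    (measurableSet_backSet G.isOpen G.convex G.smooth G.field)).ennreal_toReal

lemma TransportGeometry.measurable_entryPoint (G : TransportGeometry Ω E K M lam a b) :
    Measurable (entryPoint Ω E) :=
  (continuous_flow_comp G.field continuous_fst continuous_snd).measurable.comp
    (G.measurable_chordLength.neg.prodMk measurable_id)

section Geometry
variable [IsFiniteMeasure (surfaceMeasure Ω)] (G : TransportGeometry Ω E K M lam a b)
include G

omit [IsFiniteMeasure (surfaceMeasure Ω)] in
lemma TransportGeometry.ae_exits : ∀ᵐ z ∂interiorMeasure Ω,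
    z ∈ exitSet Ω E ∧ flipVel z ∈ exitSet Ω E := by
  have h1 := ae_mem_exitSet G.isOpen G.convex G.smooth G.field G.bounded G.nonempty
  exact h1.and ((measurePreserving_flipVel_interior G.isOpen).quasiMeasurePreserving.ae h1)

lemma TransportGeometry.measurePreserving_backMeasure :
    MeasurePreserving (fun q : Phase × ℝ => phaseFlow E (-q.2) q.1) (backMeasure Ω E lam)
      (interiorMeasure Ω) :=
  ⟨(continuous_flow_comp G.field continuous_snd.neg continuous_fst).measurable,
    map_backMeasure G.isOpen G.convex G.smooth G.field G.measurable_density G.density_pos G.triple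
      G.bounded G.nonempty⟩

lemma TransportGeometry.ae_backMeasure {P : Phase → Prop} (hP : ∀ᵐ z ∂interiorMeasure Ω, P z) :
    ∀ᵐ z ∂(outMeasure Ω lam), ∀ᵐ s, (z, s) ∈ backSet Ω E → P (phaseFlow E (-s) z) := by
  have h1 := G.measurePreserving_backMeasure.quasiMeasurePreserving.ae hP
  rw [backMeasure, ae_restrict_iff' (measurableSet_backSet G.isOpen G.convex G.smooth G.field)] at h1
  exact Measure.ae_ae_of_ae_prod h1

/-- Almost every interior point exits forwards and backwards. In the coordinates of `Γ₊` this holds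
for almost every `z` and almost every admissible backward time. As these times contain an interval,
a single good one exists, and the chord through the corresponding point is the chord of `z`. -/
theorem TransportGeometry.ae_isChord :
    ∀ᵐ z ∂(outMeasure Ω lam), IsChord Ω E z (chordLength Ω E z) := by
  have hout : ∀ᵐ z ∂(outMeasure Ω lam), z ∈ outgoing Ω :=
    (withDensity_absolutelyContinuous _ _).ae_le
      (ae_restrict_mem (measurableSet_outgoing G.isOpen G.convex G.smooth))
  filter_upwards [hout, G.ae_backMeasure G.ae_exits] with z hz hae
  obtain ⟨ε, hε, hback⟩ := G.exists_backSet hz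
  obtain ⟨s, hs, hsε⟩ : ∃ s, ((z, s) ∈ backSet Ω E → phaseFlow E (-s) z ∈ exitSet Ω E ∧
      flipVel (phaseFlow E (-s) z) ∈ exitSet Ω E) ∧ s ∈ Ioo 0 ε := by
    by_contra! hcon
    have h0 : volume (Ioo 0 ε) = 0 := measure_mono_null (fun s hs hP => hcon s hP hs) hae
    simp [hε.not_ge] at h0
  have hb := hback s hsε
  obtain ⟨τ', hτ'⟩ := (hs hb).2
  have := G.isChord_exitPoint (p := phaseFlow E (-s) z) hb hτ'
  rw [flow_flow_neg G.field] at this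
  rw [this.chordLength_eq]
  exact this

/-- The integrand is constant along each chord, and division by the length of the chord cancels the
integration along it. The weight is symmetric under reversal of the velocity, which makes the
formula comparable with its reversed version. -/
lemma TransportGeometry.lintegral_exitPoint {k : Phase → ℝ≥0∞} (hk : Measurable k) :
    ∫⁻ z, k (exitPoint Ω E z) / ENNReal.ofReal (exitTime Ω E z + exitTime Ω E (flipVel z))
      ∂(interiorMeasure Ω) = ∫⁻ z, k z ∂(outMeasure Ω lam) := by
  have h := G.field
  have hτ := measurable_exitTime G.isOpen G.convex G.smooth h
  have hb := measurableSet_backSet G.isOpen G.convex G.smooth h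
  have hm : Measurable fun z : Phase => k (exitPoint Ω E z) /
      ENNReal.ofReal (exitTime Ω E z + exitTime Ω E (flipVel z)) :=
    (hk.comp (measurable_exitPoint G.isOpen G.convex G.smooth h)).div
      (hτ.add (hτ.comp flipVel.continuous.measurable)).ennreal_ofReal
  have hm' : Measurable fun q : Phase × ℝ => k (exitPoint Ω E (phaseFlow E (-q.2) q.1)) /
      ENNReal.ofReal (exitTime Ω E (phaseFlow E (-q.2) q.1) +
        exitTime Ω E (flipVel (phaseFlow E (-q.2) q.1))) :=
    hm.comp (continuous_flow_comp h continuous_snd.neg continuous_fst).measurable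
  have h1 := G.measurePreserving_backMeasure.lintegral_comp hm
  rw [← h1, backMeasure, ← lintegral_indicator hb, lintegral_prod _ (hm'.indicator hb).aemeasurable]
  refine lintegral_congr_ae ?_
  filter_upwards [G.ae_isChord] with z hz
  set ℓ := chordLength Ω E z
  have hpos := hz.pos
  have e : ∀ s, (backSet Ω E).indicator (fun q : Phase × ℝ =>
      k (exitPoint Ω E (phaseFlow E (-q.2) q.1)) /
      ENNReal.ofReal (exitTime Ω E (phaseFlow E (-q.2) q.1) +
        exitTime Ω E (flipVel (phaseFlow E (-q.2) q.1)))) (z, s) =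
      (Ioo 0 ℓ).indicator (fun _ => k z / ENNReal.ofReal ℓ) s := by
    intro s
    by_cases hs : s ∈ Ioo 0 ℓ
    · rw [indicator_of_mem hs, indicator_of_mem ((hz.mem_iff s).2 hs)]
      have e1 := (hz.exitsAt hs).exitTime_eq G.isOpen
      have e2 := (G.exitsAt_flip hz hs).exitTime_eq G.isOpen
      simp only [exitPoint, e1, e2, flow_flow_neg h, add_sub_cancel]
    · rw [indicator_of_notMem hs, indicator_of_notMem fun hmem => hs ((hz.mem_iff s).1 hmem)]
  simp_rw [e]
  rw [lintegral_indicator measurableSet_Ioo, setLIntegral_const, Real.volume_Ioo, sub_zero]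
  exact ENNReal.div_mul_cancel (by simpa using hpos) ENNReal.ofReal_ne_top

lemma TransportGeometry.measurePreserving_flipVel_outMeasure :
    MeasurePreserving flipVel (outMeasure Ω lam) (inMeasure Ω lam) := by
  have h1 := measurePreserving_flipVel_sigmaOut G.isOpen G.convex G.smooth
  refine ⟨flipVel.continuous.measurable, Measure.ext fun s hs => ?_⟩
  rw [Measure.map_apply flipVel.continuous.measurable hs, outMeasure, inMeasure,
    withDensity_apply _ hs, withDensity_apply _ (flipVel.continuous.measurable hs)]
  exact h1.setLIntegral_comp_preimage_emb flipVel.measurableEmbedding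
    (fun z => ENNReal.ofReal (lam z.1)) s

/-- The entry map preserves the flux measure. -/
theorem TransportGeometry.measurePreserving_entryPoint :
    MeasurePreserving (entryPoint Ω E) (outMeasure Ω lam) (inMeasure Ω lam) := by
  have h := G.field
  have hfl := flipVel.continuous.measurable
  have hem := G.measurable_entryPoint
  refine ⟨hem, Measure.ext_of_lintegral _ fun k hk => ?_⟩
  have hI := measurePreserving_flipVel_interior G.isOpen
  have hτ := measurable_exitTime G.isOpen G.convex G.smooth h
  rw [lintegral_map hk hem, ← G.measurePreserving_flipVel_outMeasure.lintegral_comp hk]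
  -- Both flux integrals are written as integrals over the interior with the same symmetric weight;
  -- reversal of the velocity exchanges exit and entry points.
  refine ((G.lintegral_exitPoint (hk.comp hem)).symm.trans ?_).trans
    (G.lintegral_exitPoint (hk.comp hfl))
  refine Eq.trans ?_ ( hI.lintegral_comp (f := fun z => (k ∘ flipVel) (exitPoint Ω E z) /
    ENNReal.ofReal (exitTime Ω E z + exitTime Ω E (flipVel z)))
    (((hk.comp hfl).comp (measurable_exitPoint G.isOpen G.convex G.smooth h)).div
      (hτ.add (hτ.comp hfl)).ennreal_ofReal))
  refine lintegral_congr_ae ?_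
  filter_upwards [G.ae_exits] with z hz
  have h1 := exitsAt_exitTime hz.1
  have h2 := exitsAt_exitTime hz.2
  have hc := G.isChord_exitPoint h1 h2
  have e1 : entryPoint Ω E (exitPoint Ω E z) = flipVel (exitPoint Ω E (flipVel z)) := by
    rw [entryPoint, exitPoint, hc.chordLength_eq, exitPoint, flow_flipVel h, flipVel_flipVel,
      ← flow_add h, neg_add_rev, neg_add_cancel_right]
  simp only [Function.comp_apply, e1, flipVel_flipVel]
  rw [add_comm]

/-- Both formulas of integration along characteristics, in the coordinates of `Γ₊`. -/
theorem IsWeakTriple.chord_formula {T : ℝ} {u F γ : ℝ × Phase → ℝ}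
    (ht : IsWeakTriple Ω E (Iio T) u F γ) (hFm : Measurable F) (hγm : Measurable γ) :
    ∀ᵐ p ∂((volume : Measure ℝ).prod (outMeasure Ω lam)), p.1 < T →
      IsChord Ω E p.2 (chordLength Ω E p.2) ∧ ∀ᵐ s, s ∈ Ioo 0 (chordLength Ω E p.2) →
        u (spacetimeFlow E (-s) p) + ∫ r in (0 : ℝ)..s, F (spacetimeFlow E (-r) p) =
          γ p / lam p.2.1 ∧
        u (spacetimeFlow E (-s) p) - ∫ r in s..chordLength Ω E p.2, F (spacetimeFlow E (-r) p) =
          γ (p.1 - chordLength Ω E p.2, entryPoint Ω E p.2) / lam (entryPoint Ω E p.2).1 := by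
  have h := G.field
  have h1 := G.ae_backCylinder (G.measurePreserving_back.quasiMeasurePreserving.ae
    ((ht.exit_formula G isOpen_Iio hFm hγm).and (ht.entry_formula G isOpen_Iio hFm hγm)))
  filter_upwards [h1, Measure.quasiMeasurePreserving_snd.ae G.ae_isChord] with p hp hc hpT
  refine ⟨hc, ?_⟩
  filter_upwards [hp] with s hs hsℓ
  set ℓ := chordLength Ω E p.2
  have hb := (hc.mem_iff s).2 hsℓ
  obtain ⟨h2, h3⟩ := hs hb
  have e1 := (hc.exitsAt hsℓ).exitTime_eq G.isOpen
  have hfl := G.exitsAt_flip hc hsℓ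
  have e2 := hfl.exitTime_eq G.isOpen
  have e3 : entryMap Ω E (spacetimeFlow E (-s) p) = (p.1 - ℓ, entryPoint Ω E p.2) := by
    have : exitTime Ω E (timeFlip (spacetimeFlow E (-s) p)).2 = ℓ - s := e2
    rw [entryMap, exitMap, exitPoint, this]
    simp only [timeFlip_apply, spacetimeFlow, flow_flipVel h, flipVel_flipVel, ← flow_add h]
    rw [entryPoint, show -(ℓ - s) + -s = -ℓ by ring]
    congr 1
    ring
  have e4 : (spacetimeFlow E (-s) p).2 = phaseFlow E (-s) p.2 := rfl
  have e5 : (spacetimeFlow E (-s) p).1 = p.1 - s := rfl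
  rw [G.exitMap_back hb, e4, e1] at h2
  rw [e3, e4, e2] at h3
  simp only [← spacetimeFlow_add h] at h2 h3
  constructor
  · rw [← h2 fun t ht' => lt_of_le_of_lt ht'.2 (by rw [e5]; linarith)]
    have := intervalIntegral.integral_comp_sub_left (a := 0) (b := s)
      (fun r => F (spacetimeFlow E (-r) p)) s
    rw [sub_self, sub_zero] at this
    rw [← this]
    simp only [show ∀ x : ℝ, -(s - x) = x + -s from fun x => by ring]
  · rw [← h3 fun t ht' => lt_of_le_of_lt ht'.2 (by rw [e5]; linarith [hsℓ.1])]
    have := intervalIntegral.integral_comp_add_right (a := 0) (b := ℓ - s)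
      (fun r => F (spacetimeFlow E (-r) p)) s
    rw [zero_add, sub_add_cancel] at this
    rw [← this]
    simp only [neg_add]

end Geometry

/-! ### One-dimensional lemmas -/

section OneDim

/-- The Cauchy–Schwarz inequality. -/
lemma sq_integral_mul_le {X : Type*} [MeasurableSpace X] {μ : Measure X} {f g : X → ℝ}
    (hf : MemLp f 2 μ) (hg : MemLp g 2 μ) :
    (∫ x, f x * g x ∂μ) ^ 2 ≤ (∫ x, f x ^ 2 ∂μ) * ∫ x, g x ^ 2 ∂μ := by
  have i1 := hf.integrable_sq
  have i2 := hg.integrable_sq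
  have i3 : Integrable (fun x => f x * g x) μ := hf.integrable_mul hg
  have h1 : ∀ y : ℝ, 0 ≤ (∫ x, f x ^ 2 ∂μ) * (y * y) + (2 * ∫ x, f x * g x ∂μ) * y +
      ∫ x, g x ^ 2 ∂μ := by
    intro y
    have h2 : 0 ≤ ∫ x, (y * f x + g x) ^ 2 ∂μ := integral_nonneg fun x => sq_nonneg _
    have h3 : ∫ x, (y * f x + g x) ^ 2 ∂μ =
        ∫ x, (f x ^ 2 * (y * y) + (f x * g x) * (2 * y) + g x ^ 2) ∂μ :=
      integral_congr_ae (Eventually.of_forall fun x => by ring)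
    have i4 : Integrable (fun x => f x ^ 2 * (y * y) + (f x * g x) * (2 * y)) μ :=
      (i1.mul_const _).add (i3.mul_const _)
    rw [h3, integral_add i4 i2, integral_add (i1.mul_const _) (i3.mul_const _), integral_mul_const,
      integral_mul_const] at h2
    linarith
  have h4 := discrim_le_zero h1
  rw [discrim] at h4
  linarith

lemma lipschitzWith_integral_of_bounded {q : ℝ → ℝ} (hqm : Measurable q) {Q : ℝ≥0}
    (hq : ∀ s, |q s| ≤ Q) : LipschitzWith Q fun s => ∫ r in (0 : ℝ)..s, q r := by
  have hi : ∀ x y, IntervalIntegrable q volume x y := fun x y => by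
    refine (intervalIntegrable_const (c := (Q : ℝ))).mono_fun' hqm.aestronglyMeasurable
      (Eventually.of_forall hq)
  refine LipschitzWith.of_dist_le_mul fun x y => ?_
  rw [Real.dist_eq, Real.dist_eq, intervalIntegral.integral_interval_sub_left (hi _ _) (hi _ _)]
  exact intervalIntegral.norm_integral_le_of_norm_le_const (f := q) (C := Q) fun r _ => hq r

/-- Variation of constants for a linear equation with measurable coefficients. -/
theorem integrating_factor {q F S W : ℝ → ℝ} {Q : ℝ≥0} {ℓ c : ℝ} (hℓ : 0 ≤ ℓ) (hqm : Measurable q)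
    (hq : ∀ s, |q s| ≤ Q) (hF : IntervalIntegrable F volume 0 ℓ)
    (hW : ∀ s, W s = c - ∫ r in (0 : ℝ)..s, F r)
    (hode : ∀ᵐ s, s ∈ Ioo 0 ℓ → F s = S s - q s * W s) :
    Real.exp (-∫ r in (0 : ℝ)..ℓ, q r) * W ℓ =
      c - ∫ s in (0 : ℝ)..ℓ, Real.exp (-∫ r in (0 : ℝ)..s, q r) * S s := by
  have hLip := lipschitzWith_integral_of_bounded hqm hq
  have hbd : ∀ s ∈ uIcc 0 ℓ, -(∫ r in (0 : ℝ)..s, q r) ∈ Icc (-(Q * ℓ)) (Q * ℓ) := by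
    intro s hs
    rw [uIcc_of_le hℓ] at hs
    rw [mem_Icc, ← abs_le, abs_neg]
    have := hLip.dist_le_mul s 0
    rw [intervalIntegral.integral_same, Real.dist_eq, Real.dist_eq, sub_zero, sub_zero,
      abs_of_nonneg hs.1] at this
    exact this.trans (mul_le_mul_of_nonneg_left hs.2 Q.2)
  obtain ⟨C, hC⟩ := (Real.contDiff_exp (n := 1)).contDiffOn.exists_lipschitzOnWith one_ne_zero
    (convex_Icc (-(Q * ℓ)) (Q * ℓ)) isCompact_Icc
  set e := fun s => Real.exp (-∫ r in (0 : ℝ)..s, q r)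
  have hneg : LipschitzWith Q fun s => -∫ r in (0 : ℝ)..s, q r := hLip.neg
  -- The coefficients are only measurable, so the product rule is applied to absolutely continuous
  -- functions: `e` is Lipschitz, and `W` is the primitive of an integrable function.
  have hac1 : AbsolutelyContinuousOnInterval e 0 ℓ :=
    (hC.comp (hneg.lipschitzOnWith (s := uIcc 0 ℓ)) hbd).absolutelyContinuousOnInterval
  have hac2 : AbsolutelyContinuousOnInterval (fun s => c - ∫ r in (0 : ℝ)..s, F r) 0 ℓ :=
    ((LipschitzWith.const c).lipschitzOnWith (s := uIcc 0 ℓ)).absolutelyContinuousOnInterval.sub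
      (hF.absolutelyContinuousOnInterval_intervalIntegral left_mem_uIcc)
  have hW' : W = fun s => c - ∫ r in (0 : ℝ)..s, F r := funext hW
  have key := hac1.integral_deriv_mul_eq_sub hac2
  have hqi : IntervalIntegrable q volume 0 ℓ :=
    (intervalIntegrable_const (c := (Q : ℝ))).mono_fun' hqm.aestronglyMeasurable
      (Eventually.of_forall hq)
  have hne : ∀ᵐ s : ℝ, s ≠ ℓ := by simp [ae_iff, measure_singleton]
  have hcongr : ∫ s in (0 : ℝ)..ℓ, (deriv e s * (c - ∫ r in (0 : ℝ)..s, F r) +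
      e s * deriv (fun s => c - ∫ r in (0 : ℝ)..s, F r) s) = ∫ s in (0 : ℝ)..ℓ, -(e s * S s) := by
    refine intervalIntegral.integral_congr_ae ?_
    filter_upwards [hF.ae_hasDerivAt_integral, hqi.ae_hasDerivAt_integral, hode, hne]
      with s h1 h2 h3 h4 hs
    have hsu : s ∈ uIcc 0 ℓ := uIoc_subset_uIcc hs
    rw [uIoc_of_le hℓ] at hs
    have d1 := (h1 hsu 0 left_mem_uIcc).const_sub c
    have d2 := ((h2 hsu 0 left_mem_uIcc).fun_neg).exp
    rw [d1.deriv, d2.deriv, h3 ⟨hs.1, lt_of_le_of_ne hs.2 h4⟩, hW]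
    ring
  rw [hcongr, intervalIntegral.integral_neg] at key
  rw [hW]
  simp only [e, intervalIntegral.integral_same, neg_zero, Real.exp_zero, sub_zero, one_mul] at key
  linarith

/-- Differentiation of a convolution integral with respect to time. -/
theorem integral_convolution {b κ : ℝ → ℝ} {m : ℝ → ℝ → ℝ} {C t : ℝ} (hb : Integrable b)
    (hb0 : ∀ r ≤ 0, b r = 0) (hκm : Measurable κ) (hκ : ∀ r, |κ r| ≤ C)
    (hmm : Measurable (Function.uncurry m)) (hm : ∀ r s, |m r s| ≤ C) (hm0 : ∀ r, ∀ s ≤ 0, m r s = 0)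
    (ht : 0 ≤ t) :
    (∫ r, b r * (if r < t then κ r + ∫ s in (0 : ℝ)..(t - r), m r s else 0)) =
      ∫ s in (0 : ℝ)..t, (b s * κ s + ∫ r, b r * m r (s - r)) := by
  have hmi : ∀ r x y, IntervalIntegrable (m r) volume x y := fun r x y =>
    (intervalIntegrable_const (c := C)).mono_fun'
      (hmm.comp measurable_prodMk_left).aestronglyMeasurable (Eventually.of_forall (hm r))
  have i1 : Integrable (fun r => b r * κ r) :=
    hb.mul_bdd hκm.aestronglyMeasurable (Eventually.of_forall hκ)
  have hmeas : Measurable fun q : ℝ × ℝ => m q.1 (q.2 - q.1) :=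
    hmm.comp (measurable_fst.prodMk (measurable_snd.sub measurable_fst))
  have i2 : Integrable (fun q : ℝ × ℝ => b q.1 * m q.1 (q.2 - q.1))
      (volume.prod (volume.restrict (Ioc 0 t))) :=
    (hb.comp_fst _).mul_bdd hmeas.aestronglyMeasurable
      (Eventually.of_forall fun q => hm q.1 (q.2 - q.1))
  -- For `r > 0` the vanishing of `m r` on `s ≤ 0` allows the inner integral to be written as the
  -- integral of `m r (s - r)` over `0 < s < t`; it is then zero for `r ≥ t`, and Fubini applies
  -- without a moving endpoint.
  have e1 : ∀ r, b r * (if r < t then κ r + ∫ s in (0 : ℝ)..(t - r), m r s else 0) =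
      (Ioo 0 t).indicator (fun r => b r * κ r) r +
        ∫ s in Ioc 0 t, b r * m r (s - r) := by
    intro r
    rcases le_or_gt r 0 with hr | hr
    · rw [indicator_of_notMem fun h => hr.not_gt h.1]
      simp [hb0 r hr]
    rw [integral_const_mul, ← intervalIntegral.integral_of_le ht]
    have hz : ∀ x ≤ 0, ∫ s in x..0, m r s = 0 := fun x hx => by
      rw [intervalIntegral.integral_congr (g := fun _ => (0 : ℝ)) fun s hs => hm0 r s (by
        rw [uIcc_of_le hx] at hs; exact hs.2)]
      simp
    rw [intervalIntegral.integral_comp_sub_right (fun s => m r s) r, zero_sub,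
      ← intervalIntegral.integral_add_adjacent_intervals (hmi r (-r) 0) (hmi r 0 (t - r)),
      hz _ (by linarith), zero_add]
    by_cases hrt : r < t
    · rw [if_pos hrt, indicator_of_mem (show r ∈ Ioo 0 t from ⟨hr, hrt⟩)]
      ring
    · rw [if_neg hrt, indicator_of_notMem fun h => hrt h.2, intervalIntegral.integral_symm,
        hz _ (by linarith)]
      ring
  simp_rw [e1]
  rw [integral_add (i1.indicator measurableSet_Ioo) i2.integral_prod_left,
    integral_indicator measurableSet_Ioo, integral_integral_swap (f := fun r s => b r * m r (s - r)) i2,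
    intervalIntegral.integral_add i1.intervalIntegrable (by
      rw [intervalIntegrable_iff, uIoc_of_le ht]
      exact i2.integral_prod_right), intervalIntegral.integral_of_le ht,
    intervalIntegral.integral_of_le ht, integral_Ioc_eq_integral_Ioo, integral_Ioc_eq_integral_Ioo]

/-- A Volterra inequality in `L²(0,T)`. -/
theorem integral_sq_le_of_volterra {b w : ℝ → ℝ} {T C₁ C₂ : ℝ} (hT : 0 < T)
    (hC₂ : 0 < C₂) (hb : MemLp b 2) (hb0 : ∀ r ∉ Ioo 0 T, b r = 0)
    (hw : MemLp w 2 (volume.restrict (Ioo 0 T)))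
    (hle : ∀ t ∈ Ioo 0 T, C₂ * |b t| ≤ |w t| + C₁ * ∫ r in Ioo 0 t, |b r|) :
    ∫ r, b r ^ 2 ≤ 4 / C₂ ^ 2 * Real.exp (2 * (2 * C₁ ^ 2 * T / C₂ ^ 2 + 1) * T) *
      ∫ t in Ioo 0 T, w t ^ 2 := by
  set μ := (volume : Measure ℝ).restrict (Ioo 0 T)
  -- The weight `exp(-m t)` is chosen so strong that the integral term costs `(m - 1)/m · N/2 ≤ N/2`
  -- and can be absorbed. The summand `1` keeps `m` positive when `C₁ = 0`.
  set m := 2 * C₁ ^ 2 * T / C₂ ^ 2 + 1 with hm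
  have hm0 : 0 < m := by positivity
  have hexp : ∀ t, 0 < Real.exp (-m * t) := fun t => Real.exp_pos _
  have he1 : ∀ t ∈ Ioo 0 T, Real.exp (-m * t) ≤ 1 := fun t ht =>
    Real.exp_le_one_iff.2 (by nlinarith [ht.1])
  have hcont : Continuous fun t => Real.exp (-m * t) := by fun_prop
  have hbμ : MemLp b 2 μ := hb.restrict _
  have hbd : ∀ᵐ t ∂μ, ‖Real.exp (-m * t)‖ ≤ 1 := by
    filter_upwards [ae_restrict_mem measurableSet_Ioo] with t ht
    rw [Real.norm_eq_abs, abs_of_pos (hexp t)]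
    exact he1 t ht
  have hfb : MemLp (fun t => Real.exp (-m * t) * b t) 2 μ := by
    refine hbμ.of_le (hcont.aestronglyMeasurable.mul hbμ.1) ?_
    filter_upwards [hbd] with t ht
    rw [norm_mul]
    exact mul_le_of_le_one_left (norm_nonneg _) ht
  have hfw : MemLp (fun t => Real.exp (-m * t) * w t) 2 μ := by
    refine hw.of_le (hcont.aestronglyMeasurable.mul hw.1) ?_
    filter_upwards [hbd] with t ht
    rw [norm_mul]
    exact mul_le_of_le_one_left (norm_nonneg _) ht
  set N := ∫ t, (Real.exp (-m * t) * b t) ^ 2 ∂μ with hN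
  have hN0 : 0 ≤ N := integral_nonneg fun t => sq_nonneg _
  have hmem : ∀ t ∈ Ioo 0 T, MemLp (fun r => Real.exp (m * r)) 2 (volume.restrict (Ioo 0 t)) := by
    intro t ht
    refine MemLp.of_bound (by fun_prop) (Real.exp (m * t)) ?_
    filter_upwards [ae_restrict_mem measurableSet_Ioo] with r hr
    rw [Real.norm_eq_abs, abs_of_pos (Real.exp_pos _)]
    exact Real.exp_le_exp.2 (by nlinarith [hr.2])
  -- Cauchy–Schwarz for `exp(m r)` times `exp(-m r)|b r|`; the integral of `exp(2 m r)` gains the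
  -- factor `1/(2m)`.
  have hcs : ∀ t ∈ Ioo 0 T, Real.exp (-m * t) ^ 2 * (∫ r in Ioo 0 t, |b r|) ^ 2 ≤ N / (2 * m) := by
    intro t ht
    have hsub : Ioo 0 t ⊆ Ioo 0 T := Ioo_subset_Ioo_right ht.2.le
    have hfb' : MemLp (fun t => |Real.exp (-m * t) * b t|) 2 (volume.restrict (Ioo 0 t)) :=
      (hfb.mono_measure (Measure.restrict_mono hsub le_rfl)).abs
    have h1 := sq_integral_mul_le (hmem t ht) hfb'
    have e1 : ∫ r in Ioo 0 t, Real.exp (m * r) * |Real.exp (-m * r) * b r| =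
        ∫ r in Ioo 0 t, |b r| := by
      refine integral_congr_ae (Eventually.of_forall fun r => ?_)
      simp only
      rw [abs_mul, abs_of_pos (hexp r), ← mul_assoc, ← Real.exp_add,
        show m * r + -m * r = 0 by ring, Real.exp_zero, one_mul]
    have e2 : ∫ r in Ioo 0 t, Real.exp (m * r) ^ 2 ≤ Real.exp (2 * m * t) / (2 * m) := by
      rw [← integral_Ioc_eq_integral_Ioo, ← intervalIntegral.integral_of_le ht.1.le]
      have hd : ∀ r ∈ uIcc 0 t, HasDerivAt (fun r => Real.exp (2 * m * r) / (2 * m))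
          (Real.exp (m * r) ^ 2) r := by
        intro r _
        have := (((hasDerivAt_id r).const_mul (2 * m)).exp).div_const (2 * m)
        refine this.congr_deriv ?_
        simp only [id]
        rw [← Real.exp_nat_mul]
        push_cast
        field_simp
      rw [intervalIntegral.integral_eq_sub_of_hasDerivAt hd
        (Continuous.intervalIntegrable (by fun_prop) _ _), ← sub_div]
      refine div_le_div_of_nonneg_right ?_ (by positivity)
      rw [mul_zero, Real.exp_zero]
      linarith
    have e3 : ∫ r in Ioo 0 t, |Real.exp (-m * r) * b r| ^ 2 ≤ N := by
      simp only [sq_abs]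
      exact setIntegral_mono_set hfb.integrable_sq (Eventually.of_forall fun r => sq_nonneg _)
        (Eventually.of_forall hsub)
    rw [e1] at h1
    have h2 := h1.trans (mul_le_mul e2 e3 (integral_nonneg fun r => sq_nonneg _) (by positivity))
    have h3 := mul_le_mul_of_nonneg_left h2 (sq_nonneg (Real.exp (-m * t)))
    refine h3.trans (le_of_eq ?_)
    have h4 : Real.exp (-m * t) ^ 2 * Real.exp (2 * m * t) = 1 := by
      rw [← Real.exp_nat_mul, ← Real.exp_add, Real.exp_eq_one_iff]
      push_cast
      ring
    rw [← mul_assoc, ← mul_div_assoc, h4]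
    ring
  have hpt : ∀ᵐ t ∂μ, (Real.exp (-m * t) * b t) ^ 2 ≤
      2 / C₂ ^ 2 * (Real.exp (-m * t) * w t) ^ 2 + 2 * C₁ ^ 2 / C₂ ^ 2 * (N / (2 * m)) := by
    filter_upwards [ae_restrict_mem measurableSet_Ioo] with t ht
    set I := ∫ r in Ioo 0 t, |b r|
    have h0 := hle t ht
    have h1 : (C₂ * |b t|) ^ 2 ≤ 2 * |w t| ^ 2 + 2 * (C₁ * I) ^ 2 := by
      have := pow_le_pow_left₀ (by positivity) h0 2
      nlinarith [sq_nonneg (|w t| - C₁ * I)]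
    rw [mul_pow, sq_abs, sq_abs] at h1
    have h2 := hcs t ht
    have h3 : b t ^ 2 ≤ (2 * w t ^ 2 + 2 * (C₁ * I) ^ 2) / C₂ ^ 2 := by
      rw [le_div_iff₀ (by positivity)]
      linarith
    calc (Real.exp (-m * t) * b t) ^ 2 = Real.exp (-m * t) ^ 2 * b t ^ 2 := by ring
      _ ≤ Real.exp (-m * t) ^ 2 * ((2 * w t ^ 2 + 2 * (C₁ * I) ^ 2) / C₂ ^ 2) := by gcongr
      _ = 2 / C₂ ^ 2 * (Real.exp (-m * t) * w t) ^ 2 +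
          2 * C₁ ^ 2 / C₂ ^ 2 * (Real.exp (-m * t) ^ 2 * I ^ 2) := by ring
      _ ≤ _ := by gcongr
  have hint : N ≤ 2 / C₂ ^ 2 * (∫ t, (Real.exp (-m * t) * w t) ^ 2 ∂μ) +
      T * (2 * C₁ ^ 2 / C₂ ^ 2 * (N / (2 * m))) := by
    have i1 := hfw.integrable_sq.const_mul (2 / C₂ ^ 2)
    have := integral_mono_ae hfb.integrable_sq (i1.add (integrable_const _)) hpt
    rw [integral_add' i1 (integrable_const _), integral_const_mul, integral_const] at this
    have e : μ.real univ = T := by simp [μ, hT.le]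
    rwa [e, smul_eq_mul] at this
  have hhalf : T * (2 * C₁ ^ 2 / C₂ ^ 2 * (N / (2 * m))) ≤ N / 2 := by
    have : T * (2 * C₁ ^ 2 / C₂ ^ 2 * (N / (2 * m))) = (m - 1) / m * (N / 2) := by
      rw [hm]
      field_simp
      ring
    rw [this]
    exact mul_le_of_le_one_left (by positivity) ((div_le_one hm0).2 (by linarith))
  have hw1 : ∫ t, (Real.exp (-m * t) * w t) ^ 2 ∂μ ≤ ∫ t, w t ^ 2 ∂μ := by
    refine integral_mono_ae hfw.integrable_sq hw.integrable_sq ?_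
    filter_upwards [ae_restrict_mem measurableSet_Ioo] with t ht
    rw [mul_pow]
    exact mul_le_of_le_one_left (sq_nonneg _) (pow_le_one₀ (hexp t).le (he1 t ht))
  have hb1 : ∫ r, b r ^ 2 ≤ Real.exp (2 * m * T) * N := by
    rw [← setIntegral_eq_integral_of_forall_compl_eq_zero (s := Ioo 0 T)
      (fun r hr => by rw [hb0 r hr]; norm_num), hN, ← integral_const_mul]
    refine integral_mono_ae hbμ.integrable_sq (hfb.integrable_sq.const_mul _) ?_
    filter_upwards [ae_restrict_mem measurableSet_Ioo] with t ht
    rw [mul_pow, ← mul_assoc]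
    refine le_mul_of_one_le_left (sq_nonneg _) ?_
    rw [← Real.exp_nat_mul, ← Real.exp_add]
    refine Real.one_le_exp ?_
    push_cast
    nlinarith [ht.2]
  have hfin : N ≤ 4 / C₂ ^ 2 * ∫ t, w t ^ 2 ∂μ := by
    have : 2 / C₂ ^ 2 * (∫ t, (Real.exp (-m * t) * w t) ^ 2 ∂μ) ≤ 2 / C₂ ^ 2 * ∫ t, w t ^ 2 ∂μ := by
      gcongr
    have e : 4 / C₂ ^ 2 * ∫ t, w t ^ 2 ∂μ = 2 * (2 / C₂ ^ 2 * ∫ t, w t ^ 2 ∂μ) := by ring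
    linarith
  calc ∫ r, b r ^ 2 ≤ Real.exp (2 * m * T) * N := hb1
    _ ≤ Real.exp (2 * m * T) * (4 / C₂ ^ 2 * ∫ t, w t ^ 2 ∂μ) := by gcongr
    _ = _ := by ring

end OneDim

/-! ### The transport equation along chords -/

lemma measurable_intervalIntegral_param {X : Type*} [MeasurableSpace X] {g : X × ℝ → ℝ}
    (hg : Measurable g) {c : X → ℝ} (hc : Measurable c) :
    Measurable fun x => ∫ r in (0 : ℝ)..c x, g (x, r) := by
  have h1 : ∀ S : Set (X × ℝ), MeasurableSet S →
      Measurable fun x => ∫ r, S.indicator g (x, r) := fun S hS =>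
    ((hg.indicator hS).stronglyMeasurable.integral_prod_right').measurable
  have hS1 : MeasurableSet {q : X × ℝ | 0 < q.2 ∧ q.2 ≤ c q.1} :=
    (measurableSet_lt measurable_const measurable_snd).inter
      (measurableSet_le measurable_snd (hc.comp measurable_fst))
  have hS2 : MeasurableSet {q : X × ℝ | c q.1 < q.2 ∧ q.2 ≤ 0} :=
    (measurableSet_lt (hc.comp measurable_fst) measurable_snd).inter
      (measurableSet_le measurable_snd measurable_const)
  convert (h1 _ hS1).sub (h1 _ hS2) using 2 with x
  rw [intervalIntegral, ← integral_indicator measurableSet_Ioc,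
    ← integral_indicator measurableSet_Ioc]
  rfl

/-- The factor `k₁` of the source, extended by `0` to negative times. -/
noncomputable def sourceFactor (κ : Phase → ℝ) (dk : ℝ × Phase → ℝ) (p : ℝ × Phase) : ℝ :=
  if 0 < p.1 then κ p.2 + ∫ s in (0 : ℝ)..p.1, dk (s, p.2) else 0

lemma measurable_sourceFactor {κ : Phase → ℝ} {dk : ℝ × Phase → ℝ} (hκ : Measurable κ)
    (hdk : Measurable dk) : Measurable (sourceFactor κ dk) := by
  refine Measurable.ite (measurableSet_lt measurable_const measurable_fst) ?_ measurable_const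
  have hg : Measurable fun q : (ℝ × Phase) × ℝ => dk (q.2, q.1.2) :=
    hdk.comp (measurable_snd.prodMk measurable_fst.snd)
  exact (hκ.comp measurable_snd).add (measurable_intervalIntegral_param hg measurable_fst)

lemma abs_sourceFactor_le {κ : Phase → ℝ} {dk : ℝ × Phase → ℝ} {C : ℝ} (hκ : ∀ z, |κ z| ≤ C)
    (hdk : ∀ p, |dk p| ≤ C) (p : ℝ × Phase) : |sourceFactor κ dk p| ≤ C + C * |p.1| := by
  have hC : 0 ≤ C := (abs_nonneg _).trans (hκ p.2)
  rw [sourceFactor]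
  split_ifs with h
  · refine (abs_add_le _ _).trans (add_le_add (hκ _) ?_)
    have := intervalIntegral.norm_integral_le_of_norm_le_const (a := 0) (b := p.1)
      (f := fun s => dk (s, p.2)) (C := C) fun s _ => hdk _
    rwa [sub_zero] at this
  · rw [abs_zero]
    positivity

/-- The transport problem with measurable data, extended by zero to negative times. -/
structure IsReducedProblem (Ω : Set R3) (E : R3 → R3) (T : ℝ) (Q : ℝ≥0) (C : ℝ) (f q κ : Phase → ℝ)
    (dk u γ : ℝ × Phase → ℝ) : Prop where
  pos : 0 < T
  measurable_q : Measurable q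
  abs_q_le : ∀ z, |q z| ≤ Q
  measurable_f : Measurable f
  memLp_f : MemLp f 2 (interiorMeasure Ω)
  measurable_κ : Measurable κ
  abs_κ_le : ∀ z, |κ z| ≤ C
  measurable_dk : Measurable dk
  abs_dk_le : ∀ p, |dk p| ≤ C
  dk_eq_zero : ∀ t ≤ 0, ∀ z, dk (t, z) = 0
  measurable_u : Measurable u
  memLp_u : MemLp u 2 ((volume : Measure ℝ).prod (interiorMeasure Ω))
  measurable_γ : Measurable γ
  γ_eq_zero : ∀ t ≤ 0, ∀ z, γ (t, z) = 0
  triple : IsWeakTriple Ω E (Iio T) u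
    (fun p => f p.2 * sourceFactor κ dk p - q p.2 * u p) γ

/-- The attenuation along the backward characteristic of `z` up to time `s`. -/
noncomputable def attenuation (E : R3 → R3) (q : Phase → ℝ) (z : Phase) (s : ℝ) : ℝ :=
  Real.exp (-∫ r in (0 : ℝ)..s, q (phaseFlow E (-r) z))

section Geometry
variable {Ω : Set R3} {E : R3 → R3} {K : ℝ≥0} {M : ℝ} {lam : R3 → ℝ} {a b : ℝ}

lemma IsForceField.measurable_back (h : IsForceField E K M) :
    Measurable fun w : Phase × ℝ => phaseFlow E (-w.2) w.1 :=
  (continuous_flow_comp h continuous_snd.neg continuous_fst).measurable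

lemma measurable_attenuation (h : IsForceField E K M) {q : Phase → ℝ} (hq : Measurable q)
    {X : Type*} [MeasurableSpace X] {α : X → Phase} {β : X → ℝ} (hα : Measurable α)
    (hβ : Measurable β) : Measurable fun x => attenuation E q (α x) (β x) := by
  have hg : Measurable fun w : X × ℝ => q (phaseFlow E (-w.2) (α w.1)) :=
    hq.comp (h.measurable_back.comp ((hα.comp measurable_fst).prodMk measurable_snd))
  exact (measurable_intervalIntegral_param hg hβ).neg.exp

lemma abs_attenuation_exponent_le {q : Phase → ℝ} {Q : ℝ≥0}
    (hq : ∀ z, |q z| ≤ Q) {z : Phase} {s T : ℝ} (hs : 0 ≤ s) (hsT : s ≤ T) :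
    |∫ r in (0 : ℝ)..s, q (phaseFlow E (-r) z)| ≤ Q * T := by
  have := intervalIntegral.norm_integral_le_of_norm_le_const (a := 0) (b := s)
    (f := fun r => q (phaseFlow E (-r) z)) (C := Q) fun s _ => hq _
  rw [sub_zero, abs_of_nonneg hs] at this
  exact this.trans (mul_le_mul_of_nonneg_left hsT Q.2)

lemma attenuation_le {q : Phase → ℝ} {Q : ℝ≥0}
    (hq : ∀ z, |q z| ≤ Q) {z : Phase} {s T : ℝ} (hs : 0 ≤ s) (hsT : s ≤ T) :
    attenuation E q z s ≤ Real.exp (Q * T) :=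
  Real.exp_le_exp.2 (neg_le.1 (abs_le.1 (abs_attenuation_exponent_le (E := E) hq hs hsT)).1)

lemma le_attenuation {q : Phase → ℝ} {Q : ℝ≥0}
    (hq : ∀ z, |q z| ≤ Q) {z : Phase} {s T : ℝ} (hs : 0 ≤ s) (hsT : s ≤ T) :
    Real.exp (-(Q * T)) ≤ attenuation E q z s :=
  Real.exp_le_exp.2 (neg_le_neg (abs_le.1 (abs_attenuation_exponent_le (E := E) hq hs hsT)).2)

lemma attenuation_pos (q : Phase → ℝ) (z : Phase) (s : ℝ) : 0 < attenuation E q z s :=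
  Real.exp_pos _

variable [IsFiniteMeasure (surfaceMeasure Ω)] (G : TransportGeometry Ω E K M lam a b)
include G

lemma TransportGeometry.integrable_back {w : Phase → ℝ} (hw : Integrable w (interiorMeasure Ω)) :
    Integrable ((backSet Ω E).indicator fun x : Phase × ℝ => w (phaseFlow E (-x.2) x.1))
        ((outMeasure Ω lam).prod volume) ∧
      ∫ x, (backSet Ω E).indicator (fun x : Phase × ℝ => w (phaseFlow E (-x.2) x.1)) x
        ∂((outMeasure Ω lam).prod volume) = ∫ z, w z ∂(interiorMeasure Ω) := by
  have hb := measurableSet_backSet G.isOpen G.convex G.smooth G.field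
  have hmp := G.measurePreserving_backMeasure
  constructor
  · rw [integrable_indicator_iff hb]
    exact (hmp.integrable_comp hw.1).2 hw
  · rw [integral_indicator hb]
    have := integral_map hmp.measurable.aemeasurable (f := w) (by rw [hmp.map_eq]; exact hw.1)
    rw [hmp.map_eq] at this
    exact this.symm

lemma TransportGeometry.ae_memLp_back {w : Phase → ℝ} (hwm : Measurable w)
    (hw : MemLp w 2 (interiorMeasure Ω)) : ∀ᵐ z ∂(outMeasure Ω lam),
      MemLp (fun r => w (phaseFlow E (-r) z)) 2 (volume.restrict (Ioo 0 (chordLength Ω E z))) := by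
  have h := G.field
  filter_upwards [(G.integrable_back hw.integrable_sq).1.prod_right_ae, G.ae_isChord] with z hz hc
  have hm : Measurable fun r : ℝ => w (phaseFlow E (-r) z) :=
    hwm.comp (h.measurable_back.comp measurable_prodMk_left)
  rw [memLp_two_iff_integrable_sq hm.aestronglyMeasurable]
  refine (integrable_indicator_iff measurableSet_Ioo).1 (hz.congr (Eventually.of_forall fun r => ?_))
  beta_reduce
  by_cases hr : r ∈ Ioo 0 (chordLength Ω E z)
  · rw [indicator_of_mem hr, indicator_of_mem ((hc.mem_iff r).2 hr)]
  · rw [indicator_of_notMem hr, indicator_of_notMem fun hmem => hr ((hc.mem_iff r).1 hmem)]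

lemma TransportGeometry.ae_memLp_back_spacetime {w : ℝ × Phase → ℝ} (hwm : Measurable w)
    (hw : MemLp w 2 ((volume : Measure ℝ).prod (interiorMeasure Ω))) :
    ∀ᵐ p ∂((volume : Measure ℝ).prod (outMeasure Ω lam)),
      MemLp (fun r => w (spacetimeFlow E (-r) p)) 2
        (volume.restrict (Ioo 0 (chordLength Ω E p.2))) := by
  have h := G.field
  have hmp := G.measurePreserving_back
  have h1 := (hmp.integrable_comp hw.integrable_sq.1).2 hw.integrable_sq
  rw [backCylinder] at h1
  have h2 := ((integrable_indicator_iff G.measurableSet_backSet').2 h1).prod_right_ae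
  filter_upwards [h2, Measure.quasiMeasurePreserving_snd.ae G.ae_isChord] with p hp hc
  have hm : Measurable fun r : ℝ => w (spacetimeFlow E (-r) p) :=
    hwm.comp (continuous_spacetimeFlow_comp h continuous_neg continuous_const).measurable
  rw [memLp_two_iff_integrable_sq hm.aestronglyMeasurable]
  refine (integrable_indicator_iff measurableSet_Ioo).1 (hp.congr (Eventually.of_forall fun r => ?_))
  beta_reduce
  by_cases hr : r ∈ Ioo 0 (chordLength Ω E p.2)
  · rw [indicator_of_mem hr, indicator_of_mem]
    · rfl
    · exact (hc.mem_iff r).2 hr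
  · rw [indicator_of_notMem hr, indicator_of_notMem]
    exact fun hmem => hr ((hc.mem_iff r).1 hmem)

variable {T C : ℝ} {Q : ℝ≥0} {f q κ : Phase → ℝ} {dk u γ : ℝ × Phase → ℝ}

/-- Duhamel's formula for the trace on `Γ₊`. -/
theorem IsReducedProblem.duhamel (hp : IsReducedProblem Ω E T Q C f q κ dk u γ) :
    ∀ᵐ p ∂((volume : Measure ℝ).prod (outMeasure Ω lam)), p.1 < T →
      γ p / lam p.2.1 = (∫ r in Ioo 0 (chordLength Ω E p.2), attenuation E q p.2 r *
          (f (phaseFlow E (-r) p.2) * sourceFactor κ dk (spacetimeFlow E (-r) p))) +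
        attenuation E q p.2 (chordLength Ω E p.2) *
          (γ (p.1 - chordLength Ω E p.2, entryPoint Ω E p.2) / lam (entryPoint Ω E p.2).1) := by
  have h := G.field
  have hSm := measurable_sourceFactor hp.measurable_κ hp.measurable_dk
  have hFm : Measurable fun p : ℝ × Phase => f p.2 * sourceFactor κ dk p - q p.2 * u p :=
    ((hp.measurable_f.comp measurable_snd).mul hSm).sub
      ((hp.measurable_q.comp measurable_snd).mul hp.measurable_u)
  filter_upwards [hp.triple.chord_formula G hFm hp.measurable_γ,
    Measure.quasiMeasurePreserving_snd.ae (G.ae_memLp_back hp.measurable_f hp.memLp_f),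
    G.ae_memLp_back_spacetime hp.measurable_u hp.memLp_u] with p h1 h2 h3 hpT
  obtain ⟨hc, h1⟩ := h1 hpT
  set ℓ := chordLength Ω E p.2
  have hℓ := hc.pos
  have hflow : Measurable fun r : ℝ => spacetimeFlow E (-r) p :=
    (continuous_spacetimeFlow_comp h continuous_neg continuous_const).measurable
  have hflow2 : Measurable fun r : ℝ => phaseFlow E (-r) p.2 := measurable_snd.comp hflow
  have hqm : Measurable fun r : ℝ => q (phaseFlow E (-r) p.2) := hp.measurable_q.comp hflow2
  set F : ℝ → ℝ := fun r => f (phaseFlow E (-r) p.2) * sourceFactor κ dk (spacetimeFlow E (-r) p) -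
    q (phaseFlow E (-r) p.2) * u (spacetimeFlow E (-r) p) with hF
  have hC : 0 ≤ C := (abs_nonneg _).trans (hp.abs_κ_le p.2)
  have hFi : IntervalIntegrable F volume 0 ℓ := by
    rw [intervalIntegrable_iff_integrableOn_Ioo_of_le hℓ.le]
    refine Integrable.sub ?_ ?_
    · refine (h2.integrable one_le_two).mul_bdd (c := C + C * (|p.1| + ℓ))
        (hSm.comp hflow).aestronglyMeasurable ?_
      filter_upwards [ae_restrict_mem measurableSet_Ioo] with r hr
      refine (abs_sourceFactor_le hp.abs_κ_le hp.abs_dk_le _).trans ?_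
      have : |(spacetimeFlow E (-r) p).1| ≤ |p.1| + ℓ := by
        refine (abs_add_le _ _).trans ?_
        rw [abs_neg, abs_of_pos hr.1]
        linarith [hr.2]
      gcongr
    · exact (h3.integrable one_le_two).bdd_mul hqm.aestronglyMeasurable
        (Eventually.of_forall fun r => hp.abs_q_le _)
  -- The formulas from both ends hold for almost every point of the chord. One such point suffices
  -- to link the outgoing value with the incoming one.
  have hfr : ∃ᵐ s, s ∈ Ioo 0 ℓ := fun hcon => by
    have h0 : volume (Ioo 0 ℓ) = 0 := measure_eq_zero_iff_ae_notMem.2 hcon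
    simp [hℓ.not_ge] at h0
  obtain ⟨s, hsℓ, hs⟩ := (hfr.and_eventually h1).exists
  obtain ⟨hA, hB⟩ := hs hsℓ
  have hsub : ∀ x ∈ Icc 0 ℓ, ∀ y ∈ Icc 0 ℓ, IntervalIntegrable F volume x y := fun x hx y hy =>
    hFi.mono_set (by rw [uIcc_of_le hℓ.le]; exact uIcc_subset_Icc hx hy)
  -- `W s` is the outgoing value minus the source accumulated since the backward time `s`, so it
  -- agrees with `u` at almost every point of the chord. Hence `F`, which contains `u`, is `S - q W`
  -- almost everywhere.
  have key := integrating_factor (Q := Q) (W := fun s => γ p / lam p.2.1 - ∫ r in (0 : ℝ)..s, F r)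
    (S := fun r => f (phaseFlow E (-r) p.2) * sourceFactor κ dk (spacetimeFlow E (-r) p))
    hℓ.le hqm (fun r => hp.abs_q_le _) hFi (fun s => rfl) (by
      filter_upwards [h1] with s hs hsℓ
      rw [← (hs hsℓ).1]
      simp only [hF]
      simp only [show ∀ r, (spacetimeFlow E (-r) p).2 = phaseFlow E (-r) p.2 from fun r => rfl]
      ring)
  have hend : γ p / lam p.2.1 - ∫ r in (0 : ℝ)..ℓ, F r =
      γ (p.1 - ℓ, entryPoint Ω E p.2) / lam (entryPoint Ω E p.2).1 := by
    rw [← hB, ← hA, ← intervalIntegral.integral_add_adjacent_intervals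
      (hsub 0 ⟨le_rfl, hℓ.le⟩ s ⟨hsℓ.1.le, hsℓ.2.le⟩) (hsub s ⟨hsℓ.1.le, hsℓ.2.le⟩ ℓ ⟨hℓ.le, le_rfl⟩)]
    simp only [hF, show ∀ r, (spacetimeFlow E (-r) p).2 = phaseFlow E (-r) p.2 from fun r => rfl]
    ring
  rw [hend] at key
  rw [← integral_Ioc_eq_integral_Ioo, ← intervalIntegral.integral_of_le hℓ.le]
  simp only [attenuation]
  linarith

end Geometry

/-! ### The time derivative of the outgoing trace -/

/-- The attenuated source along the backward characteristics of points of `Γ₊`. -/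
noncomputable def chordSource (Ω : Set R3) (E : R3 → R3) (T : ℝ) (q f : Phase → ℝ) :
    Phase × ℝ → ℝ :=
  (backSet Ω E ∩ {w | w.2 < T}).indicator
    fun w => attenuation E q w.1 w.2 * f (phaseFlow E (-w.2) w.1)

/-- The contribution to the time derivative of the initial value of the source. -/
noncomputable def directRate (Ω : Set R3) (E : R3 → R3) (T : ℝ) (q f κ : Phase → ℝ)
    (p : ℝ × Phase) : ℝ :=
  chordSource Ω E T q f (p.2, p.1) * κ (phaseFlow E (-p.1) p.2)

/-- The contribution to the time derivative of the variation in time of the source. -/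
noncomputable def memoryRate (Ω : Set R3) (E : R3 → R3) (T : ℝ) (q f : Phase → ℝ)
    (dk : ℝ × Phase → ℝ) (p : ℝ × Phase) : ℝ :=
  ∫ r, chordSource Ω E T q f (p.2, r) * dk (p.1 - r, phaseFlow E (-r) p.2)

open Classical in
/-- The attenuation along the whole chord, if it is shorter than `T`. -/
noncomputable def chordAttenuation (Ω : Set R3) (E : R3 → R3) (T : ℝ) (q : Phase → ℝ)
    (z : Phase) : ℝ :=
  if 0 < chordLength Ω E z ∧ chordLength Ω E z < T then
    attenuation E q z (chordLength Ω E z) else 0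

/-- The contribution to the time derivative of the incoming trace. -/
noncomputable def inflowRate (Ω : Set R3) (E : R3 → R3) (T : ℝ) (lam : R3 → ℝ) (q : Phase → ℝ)
    (dγ : ℝ × Phase → ℝ) (p : ℝ × Phase) : ℝ :=
  chordAttenuation Ω E T q p.2 *
    (dγ (p.1 - chordLength Ω E p.2, entryPoint Ω E p.2) / lam (entryPoint Ω E p.2).1)

/-- The time derivative of the outgoing trace divided by `λ`. -/
noncomputable def traceRate (Ω : Set R3) (E : R3 → R3) (T : ℝ) (lam : R3 → ℝ) (q f κ : Phase → ℝ)
    (dk dγ : ℝ × Phase → ℝ) (p : ℝ × Phase) : ℝ :=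
  directRate Ω E T q f κ p + memoryRate Ω E T q f dk p + inflowRate Ω E T lam q dγ p

/-! ### Measurability and square integrability of the three parts of the rate. -/

section Geometry
variable {Ω : Set R3} {E : R3 → R3} {K : ℝ≥0} {M : ℝ} {lam : R3 → ℝ} {a b : ℝ}
  {T C : ℝ} {Q : ℝ≥0} {f q κ : Phase → ℝ} {dk u γ dγ : ℝ × Phase → ℝ}

lemma TransportGeometry.chordSource_mem (G : TransportGeometry Ω E K M lam a b) {z : Phase} {r : ℝ}
    (hne : chordSource Ω E T q f (z, r) ≠ 0) : (z, r) ∈ backSet Ω E ∧ r ∈ Ioo 0 T := by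
  have h := mem_of_indicator_ne_zero hne
  exact ⟨h.1, ((mem_backSet_iff G.field).1 h.1).2.1, h.2⟩

lemma TransportGeometry.chordSource_eq_zero (G : TransportGeometry Ω E K M lam a b) {z : Phase}
    {r : ℝ} (hr : r ∉ Ioo 0 T) : chordSource Ω E T q f (z, r) = 0 :=
  by_contra fun hne => hr (G.chordSource_mem hne).2

lemma TransportGeometry.measurable_chordSource (G : TransportGeometry Ω E K M lam a b)
    (hq : Measurable q) (hf : Measurable f) : Measurable (chordSource Ω E T q f) :=
  ((measurable_attenuation G.field hq measurable_fst measurable_snd).mul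
    (hf.comp G.field.measurable_back)).indicator
    ((measurableSet_backSet G.isOpen G.convex G.smooth G.field).inter
      (measurableSet_lt measurable_snd measurable_const))

lemma TransportGeometry.measurable_memory (G : TransportGeometry Ω E K M lam a b)
    (hdk : Measurable dk) :
    Measurable fun w : (ℝ × Phase) × ℝ => dk (w.1.1 - w.2, phaseFlow E (-w.2) w.1.2) :=
  hdk.comp ((measurable_fst.fst.sub measurable_snd).prodMk
    (G.field.measurable_back.comp (measurable_fst.snd.prodMk measurable_snd)))

lemma TransportGeometry.measurable_directRate (G : TransportGeometry Ω E K M lam a b)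
    (hq : Measurable q) (hf : Measurable f) (hκ : Measurable κ) :
    Measurable (directRate Ω E T q f κ) :=
  ((G.measurable_chordSource hq hf).comp (measurable_snd.prodMk measurable_fst)).mul
    (hκ.comp (G.field.measurable_back.comp (measurable_snd.prodMk measurable_fst)))

lemma TransportGeometry.measurable_memoryRate (G : TransportGeometry Ω E K M lam a b)
    (hq : Measurable q) (hf : Measurable f) (hdk : Measurable dk) :
    Measurable (memoryRate Ω E T q f dk) := by
  have h1 : Measurable fun w : (ℝ × Phase) × ℝ => chordSource Ω E T q f (w.1.2, w.2) *
      dk (w.1.1 - w.2, phaseFlow E (-w.2) w.1.2) :=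
    ((G.measurable_chordSource hq hf).comp (measurable_fst.snd.prodMk measurable_snd)).mul
      (G.measurable_memory hdk)
  exact h1.stronglyMeasurable.integral_prod_right'.measurable

lemma TransportGeometry.measurable_chordAttenuation (G : TransportGeometry Ω E K M lam a b)
    (hq : Measurable q) : Measurable (chordAttenuation Ω E T q) :=
  Measurable.ite ((measurableSet_lt measurable_const G.measurable_chordLength).inter
    (measurableSet_lt G.measurable_chordLength measurable_const))
    (measurable_attenuation G.field hq measurable_id G.measurable_chordLength) measurable_const

lemma abs_chordAttenuation_le (hq : ∀ z, |q z| ≤ Q) (z : Phase) :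
    |chordAttenuation Ω E T q z| ≤ Real.exp (Q * T) := by
  rw [chordAttenuation]
  split_ifs with h
  · rw [abs_of_pos (attenuation_pos _ _ _)]
    exact attenuation_le hq h.1.le h.2.le
  · rw [abs_zero]
    exact (Real.exp_pos _).le

lemma TransportGeometry.measurable_inflowRate (G : TransportGeometry Ω E K M lam a b)
    (hq : Measurable q) (hdγ : Measurable dγ) : Measurable (inflowRate Ω E T lam q dγ) := by
  have h1 : Measurable fun p : ℝ × Phase => chordLength Ω E p.2 :=
    G.measurable_chordLength.comp measurable_snd
  have h2 : Measurable fun p : ℝ × Phase => entryPoint Ω E p.2 :=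
    G.measurable_entryPoint.comp measurable_snd
  exact ((G.measurable_chordAttenuation hq).comp measurable_snd).mul
    ((hdγ.comp ((measurable_fst.sub h1).prodMk h2)).div
      (G.measurable_density.comp (measurable_fst.comp h2)))

variable [IsFiniteMeasure (surfaceMeasure Ω)] (G : TransportGeometry Ω E K M lam a b)
include G

lemma TransportGeometry.chordSource_sq (hqm : Measurable q) (hq : ∀ z, |q z| ≤ Q)
    (hfm : Measurable f) (hf : MemLp f 2 (interiorMeasure Ω)) :
    Integrable (fun w => chordSource Ω E T q f w ^ 2) ((outMeasure Ω lam).prod volume) ∧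
      ∫ w, chordSource Ω E T q f w ^ 2 ∂((outMeasure Ω lam).prod volume) ≤
        Real.exp (Q * T) ^ 2 * ∫ z, f z ^ 2 ∂(interiorMeasure Ω) := by
  obtain ⟨h1, h2⟩ := G.integrable_back hf.integrable_sq
  have hle : ∀ w, chordSource Ω E T q f w ^ 2 ≤ Real.exp (Q * T) ^ 2 *
      (backSet Ω E).indicator (fun x : Phase × ℝ => f (phaseFlow E (-x.2) x.1) ^ 2) w := by
    intro w
    by_cases hw : w ∈ backSet Ω E ∩ {w | w.2 < T}
    · have hpos := ((mem_backSet_iff (z := w.1) (s := w.2) G.field).1 hw.1).2.1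
      rw [chordSource, indicator_of_mem hw, indicator_of_mem hw.1, mul_pow]
      gcongr
      · exact (attenuation_pos _ _ _).le
      · exact attenuation_le hq hpos.le (le_of_lt hw.2)
    · rw [chordSource, indicator_of_notMem hw]
      have : 0 ≤ (backSet Ω E).indicator
          (fun x : Phase × ℝ => f (phaseFlow E (-x.2) x.1) ^ 2) w :=
        indicator_nonneg (fun _ _ => sq_nonneg _) _
      rw [zero_pow two_ne_zero]
      positivity
  have hi : Integrable (fun w => chordSource Ω E T q f w ^ 2) ((outMeasure Ω lam).prod volume) := by
    refine (h1.const_mul (Real.exp (Q * T) ^ 2)).mono'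
      ((G.measurable_chordSource hqm hfm).pow_const 2).aestronglyMeasurable
      (Eventually.of_forall fun w => ?_)
    rw [Real.norm_eq_abs, abs_of_nonneg (sq_nonneg _)]
    exact hle w
  refine ⟨hi, ?_⟩
  rw [← h2, ← integral_const_mul]
  exact integral_mono hi (h1.const_mul _) hle

/-- If the source vanishes on long chords it is controlled by the attenuated source. -/
lemma TransportGeometry.integral_sq_le_chordSource (hqm : Measurable q) (hq : ∀ z, |q z| ≤ Q)
    (hfm : Measurable f) (hf : MemLp f 2 (interiorMeasure Ω))
    (hshort : ∀ z s, (z, s) ∈ backSet Ω E → f (phaseFlow E (-s) z) ≠ 0 → s < T) :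
    ∫ z, f z ^ 2 ∂(interiorMeasure Ω) ≤ Real.exp (Q * T) ^ 2 *
      ∫ w, chordSource Ω E T q f w ^ 2 ∂((outMeasure Ω lam).prod volume) := by
  obtain ⟨h1, h2⟩ := G.integrable_back hf.integrable_sq
  have hi := (G.chordSource_sq hqm hq hfm hf (T := T)).1
  rw [← h2, ← integral_const_mul]
  refine integral_mono h1 (hi.const_mul _) fun w => ?_
  by_cases hw : w ∈ backSet Ω E
  · rw [indicator_of_mem hw]
    by_cases hf0 : f (phaseFlow E (-w.2) w.1) = 0
    · rw [hf0, zero_pow two_ne_zero]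
      positivity
    have hT := hshort w.1 w.2 hw hf0
    have hpos := ((mem_backSet_iff (z := w.1) (s := w.2) G.field).1 hw).2.1
    have hle := le_attenuation (E := E) hq (z := w.1) hpos.le hT.le
    rw [chordSource, indicator_of_mem (show w ∈ backSet Ω E ∩ {w | w.2 < T} from ⟨hw, hT⟩), mul_pow,
      ← mul_assoc, ← mul_pow]
    refine le_mul_of_one_le_left (sq_nonneg _) (one_le_pow₀ ?_)
    rw [Real.exp_neg] at hle
    exact (inv_le_iff_one_le_mul₀' (Real.exp_pos _)).1 hle
  · rw [indicator_of_notMem hw]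
    positivity

lemma TransportGeometry.directRate_sq (hqm : Measurable q) (hq : ∀ z, |q z| ≤ Q)
    (hfm : Measurable f) (hf : MemLp f 2 (interiorMeasure Ω)) (hκm : Measurable κ)
    (hκ : ∀ z, |κ z| ≤ C) :
    Integrable (fun p => directRate Ω E T q f κ p ^ 2) (timeCylinder T (outMeasure Ω lam)) ∧
      ∫ p, directRate Ω E T q f κ p ^ 2 ∂(timeCylinder T (outMeasure Ω lam)) ≤
        C ^ 2 * ∫ w, chordSource Ω E T q f w ^ 2 ∂((outMeasure Ω lam).prod volume) := by
  have h1 := (G.chordSource_sq hqm hq hfm hf (T := T)).1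
  have h2 : Integrable (fun p : ℝ × Phase => C ^ 2 * chordSource Ω E T q f (p.2, p.1) ^ 2)
      ((volume : Measure ℝ).prod (outMeasure Ω lam)) := h1.swap.const_mul _
  have hle : timeCylinder T (outMeasure Ω lam) ≤ (volume : Measure ℝ).prod (outMeasure Ω lam) :=
    Measure.prod_mono Measure.restrict_le_self le_rfl
  have hpt : ∀ p, directRate Ω E T q f κ p ^ 2 ≤ C ^ 2 * chordSource Ω E T q f (p.2, p.1) ^ 2 := by
    intro p
    rw [directRate, mul_pow, mul_comm]
    refine mul_le_mul_of_nonneg_right ?_ (sq_nonneg _)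
    rw [← sq_abs]
    exact pow_le_pow_left₀ (abs_nonneg _) (hκ _) 2
  have h3 : Integrable (fun p => directRate Ω E T q f κ p ^ 2)
      (timeCylinder T (outMeasure Ω lam)) := by
    refine (h2.mono_measure hle).mono'
      ((G.measurable_directRate hqm hfm hκm).pow_const 2).aestronglyMeasurable
      (Eventually.of_forall fun p => ?_)
    rw [Real.norm_eq_abs, abs_of_nonneg (sq_nonneg _)]
    exact hpt p
  refine ⟨h3, ?_⟩
  have h4 := integral_prod_swap (μ := outMeasure Ω lam) (ν := (volume : Measure ℝ))
    fun w => chordSource Ω E T q f w ^ 2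
  rw [← h4, ← integral_const_mul]
  refine (integral_mono h3 (h2.mono_measure hle) hpt).trans ?_
  exact integral_mono_measure hle (Eventually.of_forall fun p => by positivity) h2

lemma TransportGeometry.ae_chordSource (hqm : Measurable q) (hq : ∀ z, |q z| ≤ Q)
    (hfm : Measurable f) (hf : MemLp f 2 (interiorMeasure Ω)) :
    ∀ᵐ z ∂(outMeasure Ω lam), MemLp (fun r => chordSource Ω E T q f (z, r)) 2 ∧
      Integrable fun r => chordSource Ω E T q f (z, r) := by
  filter_upwards [(G.chordSource_sq hqm hq hfm hf (T := T)).1.prod_right_ae] with z hz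
  have hm : Measurable fun r => chordSource Ω E T q f (z, r) :=
    (G.measurable_chordSource hqm hfm).comp measurable_prodMk_left
  have h1 : MemLp (fun r => chordSource Ω E T q f (z, r)) 2 :=
    (memLp_two_iff_integrable_sq hm.aestronglyMeasurable).2 hz
  refine ⟨h1, (integrableOn_iff_integrable_of_support_subset (s := Ioo 0 T) fun r hr => ?_).1
    ((h1.restrict (Ioo 0 T)).integrable one_le_two)⟩
  exact by_contra fun hmem => hr (G.chordSource_eq_zero hmem)

/-- Cauchy–Schwarz in `r` over `(0, T)` bounds the square at each time by `C² T` times the integral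
of the squared source; integration in time gives the second factor `T`. -/
lemma TransportGeometry.memoryRate_sq (hT : 0 < T) (hqm : Measurable q) (hq : ∀ z, |q z| ≤ Q)
    (hfm : Measurable f) (hf : MemLp f 2 (interiorMeasure Ω)) (hdkm : Measurable dk)
    (hdk : ∀ p, |dk p| ≤ C) :
    Integrable (fun p => memoryRate Ω E T q f dk p ^ 2) (timeCylinder T (outMeasure Ω lam)) ∧
      ∫ p, memoryRate Ω E T q f dk p ^ 2 ∂(timeCylinder T (outMeasure Ω lam)) ≤
        C ^ 2 * T ^ 2 * ∫ w, chordSource Ω E T q f w ^ 2 ∂((outMeasure Ω lam).prod volume) := by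
  have h1 := (G.chordSource_sq hqm hq hfm hf (T := T)).1
  have h2 := h1.integral_prod_left
  have h3 : Integrable (fun p : ℝ × Phase => C ^ 2 * T * ∫ r, chordSource Ω E T q f (p.2, r) ^ 2)
      (timeCylinder T (outMeasure Ω lam)) := (h2.comp_snd _).const_mul _
  have hpt : ∀ᵐ p ∂(timeCylinder T (outMeasure Ω lam)), memoryRate Ω E T q f dk p ^ 2 ≤
      C ^ 2 * T * ∫ r, chordSource Ω E T q f (p.2, r) ^ 2 := by
    filter_upwards [Measure.quasiMeasurePreserving_snd.ae
      (G.ae_chordSource hqm hq hfm hf (T := T))] with p hp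
    have hr : ∀ w : ℝ → ℝ, (∀ r ∉ Ioo 0 T, w r = 0) → ∫ r, w r = ∫ r in Ioo 0 T, w r :=
      fun w hw => (setIntegral_eq_integral_of_forall_compl_eq_zero hw).symm
    have hz : ∀ r ∉ Ioo 0 T, chordSource Ω E T q f (p.2, r) = 0 := fun r hr =>
      G.chordSource_eq_zero hr
    have hdm : Measurable fun r => dk (p.1 - r, phaseFlow E (-r) p.2) :=
      (G.measurable_memory hdkm).comp measurable_prodMk_left
    have hdL : MemLp (fun r => dk (p.1 - r, phaseFlow E (-r) p.2)) 2 (volume.restrict (Ioo 0 T)) :=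
      MemLp.of_bound hdm.aestronglyMeasurable C (Eventually.of_forall fun r => hdk _)
    have hcs := sq_integral_mul_le (hp.1.restrict (Ioo 0 T)) hdL
    rw [memoryRate, hr _ fun r hr => by rw [hz r hr, zero_mul], hr (fun r => _ ^ 2) fun r hr => by
      simp [hz r hr]]
    refine hcs.trans ?_
    rw [mul_comm]
    refine mul_le_mul_of_nonneg_right ?_ (integral_nonneg fun r => sq_nonneg _)
    have := integral_mono hdL.integrable_sq (integrable_const (C ^ 2)) fun r => by
      beta_reduce
      rw [← sq_abs]
      exact pow_le_pow_left₀ (abs_nonneg _) (hdk _) 2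
    rw [integral_const] at this
    refine this.trans (le_of_eq ?_)
    simp [hT.le, mul_comm]
  have h4 : Integrable (fun p => memoryRate Ω E T q f dk p ^ 2)
      (timeCylinder T (outMeasure Ω lam)) := by
    refine h3.mono' ((G.measurable_memoryRate hqm hfm hdkm).pow_const 2).aestronglyMeasurable ?_
    filter_upwards [hpt] with p hp
    rwa [Real.norm_eq_abs, abs_of_nonneg (sq_nonneg _)]
  refine ⟨h4, (integral_mono_ae h4 h3 hpt).trans (le_of_eq ?_)⟩
  rw [integral_const_mul, integral_prod _ h1, timeCylinder,
    integral_fun_snd (fun z => ∫ r, chordSource Ω E T q f (z, r) ^ 2)]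
  simp [hT.le]
  ring

/-- For a fixed outgoing point the time is only translated by the chord length, and the entry map
preserves the flux measure. So the inflow term keeps its norm when it is transported to `Γ₊`. -/
lemma TransportGeometry.measurePreserving_entry : MeasurePreserving
    (fun p : ℝ × Phase => (p.1 - chordLength Ω E p.2, entryPoint Ω E p.2))
    ((volume : Measure ℝ).prod (outMeasure Ω lam)) ((volume : Measure ℝ).prod (inMeasure Ω lam)) := by
  have h1 : MeasurePreserving (fun q : Phase × ℝ => (entryPoint Ω E q.1, q.2 - chordLength Ω E q.1))
      ((outMeasure Ω lam).prod volume) ((inMeasure Ω lam).prod volume) :=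
    G.measurePreserving_entryPoint.skew_product (g := fun z t => t - chordLength Ω E z)
      (measurable_snd.sub (G.measurable_chordLength.comp measurable_fst))
      (Eventually.of_forall fun z => (measurePreserving_sub_right volume _).map_eq)
  exact (Measure.measurePreserving_swap.comp h1).comp Measure.measurePreserving_swap

lemma TransportGeometry.inflowRate_sq (hqm : Measurable q) (hq : ∀ z, |q z| ≤ Q)
    (hdγm : Measurable dγ) (hdγ : MemLp dγ 2 ((volume : Measure ℝ).prod (inMeasure Ω lam))) :
    Integrable (fun p => inflowRate Ω E T lam q dγ p ^ 2) (timeCylinder T (outMeasure Ω lam)) ∧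
      ∫ p, inflowRate Ω E T lam q dγ p ^ 2 ∂(timeCylinder T (outMeasure Ω lam)) ≤
        (Real.exp (Q * T) / a) ^ 2 * ∫ p, dγ p ^ 2 ∂((volume : Measure ℝ).prod (inMeasure Ω lam)) := by
  have hmp := G.measurePreserving_entry
  have h2 : Integrable (fun p : ℝ × Phase => (Real.exp (Q * T) / a) ^ 2 *
      dγ (p.1 - chordLength Ω E p.2, entryPoint Ω E p.2) ^ 2)
      ((volume : Measure ℝ).prod (outMeasure Ω lam)) :=
    ((hmp.integrable_comp hdγ.integrable_sq.1).2 hdγ.integrable_sq).const_mul _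
  have hle : timeCylinder T (outMeasure Ω lam) ≤ (volume : Measure ℝ).prod (outMeasure Ω lam) :=
    Measure.prod_mono Measure.restrict_le_self le_rfl
  have hpt : ∀ p, inflowRate Ω E T lam q dγ p ^ 2 ≤ (Real.exp (Q * T) / a) ^ 2 *
      dγ (p.1 - chordLength Ω E p.2, entryPoint Ω E p.2) ^ 2 := by
    intro p
    have ha := G.lower_pos
    rw [inflowRate, ← sq_abs, ← sq_abs (dγ _), ← mul_pow, abs_mul, abs_div,
      abs_of_pos (G.density_pos _)]
    refine pow_le_pow_left₀ (by have := G.density_pos (entryPoint Ω E p.2).1; positivity) ?_ 2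
    have h1 : |dγ (p.1 - chordLength Ω E p.2, entryPoint Ω E p.2)| / lam (entryPoint Ω E p.2).1 ≤
        |dγ (p.1 - chordLength Ω E p.2, entryPoint Ω E p.2)| / a :=
      div_le_div_of_nonneg_left (abs_nonneg _) ha (G.lower _)
    refine (mul_le_mul (abs_chordAttenuation_le hq _) h1 (by
      have := G.density_pos (entryPoint Ω E p.2).1
      positivity) (Real.exp_pos _).le).trans (le_of_eq (by ring))
  have h3 : Integrable (fun p => inflowRate Ω E T lam q dγ p ^ 2)
      (timeCylinder T (outMeasure Ω lam)) := by
    refine (h2.mono_measure hle).mono'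
      ((G.measurable_inflowRate hqm hdγm).pow_const 2).aestronglyMeasurable
      (Eventually.of_forall fun p => ?_)
    rw [Real.norm_eq_abs, abs_of_nonneg (sq_nonneg _)]
    exact hpt p
  refine ⟨h3, ?_⟩
  have h4 := integral_map hmp.measurable.aemeasurable (f := fun p => dγ p ^ 2)
    (by rw [hmp.map_eq]; exact hdγ.integrable_sq.1)
  rw [hmp.map_eq] at h4
  rw [h4, ← integral_const_mul]
  refine (integral_mono h3 (h2.mono_measure hle) hpt).trans ?_
  exact integral_mono_measure hle (Eventually.of_forall fun p => by positivity) h2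

end Geometry

/-! ### The outgoing trace as the integral of its rate, and the two estimates for the rate. -/

lemma intervalIntegrable_convolution {b κ : ℝ → ℝ} {m : ℝ → ℝ → ℝ} {C t : ℝ} (hb : Integrable b)
    (hκm : Measurable κ) (hκ : ∀ r, |κ r| ≤ C) (hmm : Measurable (Function.uncurry m))
    (hm : ∀ r s, |m r s| ≤ C) (ht : 0 ≤ t) :
    IntervalIntegrable (fun s => b s * κ s + ∫ r, b r * m r (s - r)) volume 0 t := by
  have i1 : Integrable (fun r => b r * κ r) :=
    hb.mul_bdd hκm.aestronglyMeasurable (Eventually.of_forall hκ)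
  have hmeas : Measurable fun q : ℝ × ℝ => m q.1 (q.2 - q.1) :=
    hmm.comp (measurable_fst.prodMk (measurable_snd.sub measurable_fst))
  have i2 : Integrable (fun q : ℝ × ℝ => b q.1 * m q.1 (q.2 - q.1))
      (volume.prod (volume.restrict (Ioc 0 t))) :=
    (hb.comp_fst _).mul_bdd hmeas.aestronglyMeasurable
      (Eventually.of_forall fun q => hm q.1 (q.2 - q.1))
  refine i1.intervalIntegrable.add ?_
  rw [intervalIntegrable_iff, uIoc_of_le ht]
  exact i2.integral_prod_right

lemma integral_shift_of_eq_zero {w : ℝ → ℝ} (hw : ∀ s ≤ 0, w s = 0)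
    (hi : ∀ x y, IntervalIntegrable w volume x y) {ℓ : ℝ} (hℓ : 0 ≤ ℓ) (t : ℝ) :
    ∫ s in (0 : ℝ)..t, w (s - ℓ) = if 0 < t - ℓ then ∫ s in (0 : ℝ)..(t - ℓ), w s else 0 := by
  have hz : ∀ x ≤ 0, ∫ s in x..0, w s = 0 := fun x hx => by
    rw [intervalIntegral.integral_congr (g := fun _ => (0 : ℝ)) fun s hs => hw s (by
      rw [uIcc_of_le hx] at hs; exact hs.2)]
    simp
  rw [intervalIntegral.integral_comp_sub_right (fun s => w s) ℓ, zero_sub,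
    ← intervalIntegral.integral_add_adjacent_intervals (hi (-ℓ) 0) (hi 0 (t - ℓ)),
    hz _ (by linarith), zero_add]
  split_ifs with h
  · rfl
  · rw [intervalIntegral.integral_symm, hz _ (not_lt.1 h), neg_zero]

/-- The trace `γ` on `Γ₋` has the square integrable weak time derivative `dγ`, extended by `0`. -/
structure IsInflowDeriv (Ω : Set R3) (T : ℝ) (γ dγ : ℝ × Phase → ℝ) : Prop where
  measurable : Measurable dγ
  eq_zero : ∀ t ∉ Ioo 0 T, ∀ z, dγ (t, z) = 0
  memLp : MemLp dγ 2 ((volume : Measure ℝ).prod (sigmaIn Ω))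
  ae_eq : ∀ᵐ z ∂(sigmaIn Ω), ∀ᵐ t, t ∈ Ioo 0 T → γ (t, z) = ∫ s in (0 : ℝ)..t, dγ (s, z)

section Geometry
variable {Ω : Set R3} {E : R3 → R3} {K : ℝ≥0} {M : ℝ} {lam : R3 → ℝ} {a b : ℝ}
  {T C : ℝ} {Q : ℝ≥0} {f q κ : Phase → ℝ} {dk u γ dγ : ℝ × Phase → ℝ}
  [IsFiniteMeasure (surfaceMeasure Ω)] (G : TransportGeometry Ω E K M lam a b)
include G

lemma TransportGeometry.prod_inMeasure_le : (volume : Measure ℝ).prod (inMeasure Ω lam) ≤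
    ENNReal.ofReal b • (volume : Measure ℝ).prod (sigmaIn Ω) := by
  have hm : Measurable fun z : Phase => ENNReal.ofReal (lam z.1) :=
    (G.measurable_density.comp measurable_fst).ennreal_ofReal
  rw [inMeasure, prod_withDensity_right hm, ← withDensity_const]
  exact withDensity_mono (Eventually.of_forall fun p => ENNReal.ofReal_le_ofReal (G.upper _))

lemma IsInflowDeriv.memLp_inMeasure (hd : IsInflowDeriv Ω T γ dγ) :
    MemLp dγ 2 ((volume : Measure ℝ).prod (inMeasure Ω lam)) :=
  hd.memLp.of_measure_le_smul ENNReal.ofReal_ne_top G.prod_inMeasure_le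

lemma IsInflowDeriv.integral_le (hd : IsInflowDeriv Ω T γ dγ) :
    ∫ p, dγ p ^ 2 ∂((volume : Measure ℝ).prod (inMeasure Ω lam)) ≤
      b * ∫ p, dγ p ^ 2 ∂((volume : Measure ℝ).prod (sigmaIn Ω)) := by
  have hb : 0 ≤ b := (G.density_pos 0).le.trans (G.upper 0)
  refine (integral_mono_measure G.prod_inMeasure_le (Eventually.of_forall fun p => sq_nonneg _)
    (hd.memLp.integrable_sq.smul_measure ENNReal.ofReal_ne_top)).trans (le_of_eq ?_)
  rw [integral_smul_measure, ENNReal.toReal_ofReal hb, smul_eq_mul]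

/-- The outgoing trace is the integral of its rate. -/
theorem IsReducedProblem.ae_trace_eq (hp : IsReducedProblem Ω E T Q C f q κ dk u γ)
    (hd : IsInflowDeriv Ω T γ dγ) : ∀ᵐ z ∂(outMeasure Ω lam),
      IntervalIntegrable (fun s => traceRate Ω E T lam q f κ dk dγ (s, z)) volume 0 T ∧
      ∀ᵐ t, t ∈ Ioo 0 T → γ (t, z) / lam z.1 =
        ∫ s in (0 : ℝ)..t, traceRate Ω E T lam q f κ dk dγ (s, z) := by
  have h := G.field
  have hdu : ∀ᵐ z ∂(outMeasure Ω lam), ∀ᵐ t, t < T →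
      γ (t, z) / lam z.1 = (∫ r in Ioo 0 (chordLength Ω E z), attenuation E q z r *
          (f (phaseFlow E (-r) z) * sourceFactor κ dk (spacetimeFlow E (-r) (t, z)))) +
        attenuation E q z (chordLength Ω E z) *
          (γ (t - chordLength Ω E z, entryPoint Ω E z) / lam (entryPoint Ω E z).1) :=
    Measure.ae_ae_of_ae_prod
      (Measure.measurePreserving_swap.quasiMeasurePreserving.ae (hp.duhamel G))
  have hin1 : ∀ᵐ z ∂(inMeasure Ω lam), Integrable fun t => dγ (t, z) ^ 2 :=
    (hd.memLp_inMeasure G).integrable_sq.swap.prod_right_ae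
  have hin2 : ∀ᵐ z ∂(inMeasure Ω lam), ∀ᵐ t, t ∈ Ioo 0 T → γ (t, z) = ∫ s in (0 : ℝ)..t, dγ (s, z) :=
    (withDensity_absolutelyContinuous _ _).ae_le hd.ae_eq
  filter_upwards [hdu, G.ae_isChord, G.ae_chordSource hp.measurable_q hp.abs_q_le hp.measurable_f
    hp.memLp_f (T := T), G.measurePreserving_entryPoint.quasiMeasurePreserving.ae (hin1.and hin2)]
    with z h1 hc h2 h3
  obtain ⟨h3, h4⟩ := h3
  set ℓ := chordLength Ω E z with hℓ
  set e := entryPoint Ω E z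
  have hflow2 : Measurable fun r : ℝ => phaseFlow E (-r) z :=
    h.measurable_back.comp measurable_prodMk_left
  have hκm : Measurable fun r : ℝ => κ (phaseFlow E (-r) z) := hp.measurable_κ.comp hflow2
  have hmm : Measurable (Function.uncurry fun r s : ℝ => dk (s, phaseFlow E (-r) z)) :=
    hp.measurable_dk.comp (measurable_snd.prodMk (hflow2.comp measurable_fst))
  have hdm : Measurable fun s => dγ (s, e) :=
    hd.measurable.comp (measurable_id.prodMk measurable_const)
  have hdi : ∀ x y, IntervalIntegrable (fun s => dγ (s, e)) volume x y := fun x y => by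
    rw [intervalIntegrable_iff]
    change IntegrableOn _ (Ioc (min x y) (max x y)) _
    exact (((memLp_two_iff_integrable_sq hdm.aestronglyMeasurable).2 h3).restrict _).integrable
      one_le_two
  have hdi' : ∀ x y, IntervalIntegrable (fun s => dγ (s - ℓ, e)) volume x y := fun x y => by
    have := (hdi (x - ℓ) (y - ℓ)).comp_sub_right ℓ
    simpa using this
  have hi1 : ∀ t, 0 ≤ t → IntervalIntegrable (fun s => chordSource Ω E T q f (z, s) *
      κ (phaseFlow E (-s) z) + ∫ r, chordSource Ω E T q f (z, r) *
      dk (s - r, phaseFlow E (-r) z)) volume 0 t := fun t ht =>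
    intervalIntegrable_convolution h2.2 hκm (fun r => hp.abs_κ_le _) hmm
      (fun r s => hp.abs_dk_le _) ht
  have hi2 : ∀ t, IntervalIntegrable (fun s => chordAttenuation Ω E T q z *
      (dγ (s - ℓ, e) / lam e.1)) volume 0 t := fun t => ((hdi' 0 t).div_const _).const_mul _
  refine ⟨(hi1 T hp.pos.le).add (hi2 T), ?_⟩
  filter_upwards [h1, (measurePreserving_sub_right volume ℓ).quasiMeasurePreserving.ae h4]
    with t ht1 ht2 htT
  have hsum : ∫ s in (0 : ℝ)..t, traceRate Ω E T lam q f κ dk dγ (s, z) =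
      (∫ s in (0 : ℝ)..t, (chordSource Ω E T q f (z, s) * κ (phaseFlow E (-s) z) +
        ∫ r, chordSource Ω E T q f (z, r) * dk (s - r, phaseFlow E (-r) z))) +
      ∫ s in (0 : ℝ)..t, chordAttenuation Ω E T q z * (dγ (s - ℓ, e) / lam e.1) :=
    intervalIntegral.integral_add (hi1 t htT.1.le) (hi2 t)
  rw [hsum, ht1 htT.2, ← integral_convolution (C := C) h2.2
    (fun r hr => G.chordSource_eq_zero fun hmem => hmem.1.not_ge hr) hκm (fun r => hp.abs_κ_le _) hmm
    (fun r s => hp.abs_dk_le _) (fun r s hs => hp.dk_eq_zero s hs _) htT.1.le]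
  congr 1
  · rw [← integral_indicator measurableSet_Ioo]
    refine integral_congr_ae (Eventually.of_forall fun r => ?_)
    beta_reduce
    have hsf : sourceFactor κ dk (spacetimeFlow E (-r) (t, z)) = if r < t then
        κ (phaseFlow E (-r) z) + ∫ s in (0 : ℝ)..(t - r), dk (s, phaseFlow E (-r) z) else 0 := by
      simp only [sourceFactor, spacetimeFlow, ← sub_eq_add_neg, sub_pos]
    by_cases hr : r ∈ Ioo 0 ℓ
    · rw [indicator_of_mem hr, hsf]
      split_ifs with hrt
      · rw [chordSource, indicator_of_mem (show (z, r) ∈ backSet Ω E ∩ {w | w.2 < T} from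
          ⟨(hc.mem_iff r).2 hr, hrt.trans htT.2⟩), mul_assoc]
      · simp
    · rw [indicator_of_notMem hr]
      have : chordSource Ω E T q f (z, r) = 0 :=
        by_contra fun hne => hr ((hc.mem_iff r).1 (G.chordSource_mem hne).1)
      rw [this, zero_mul]
  · rw [intervalIntegral.integral_const_mul, intervalIntegral.integral_div,
      integral_shift_of_eq_zero (w := fun s => dγ (s, e))
        (fun s hs => hd.eq_zero s (fun hmem => hmem.1.not_ge hs) e) hdi hc.pos.le t]
    -- For `t ≤ ℓ` the inflow is evaluated at a time that is not positive and contributes nothing.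
    -- For `t > ℓ` one has `ℓ < T`, so the cutoff in `chordAttenuation` has no effect.
    split_ifs with hlt
    · rw [chordAttenuation, if_pos ⟨hc.pos, by linarith [htT.2]⟩,
        ht2 ⟨hlt, by linarith [htT.2, hc.pos]⟩]
    · rw [hp.γ_eq_zero _ (not_lt.1 hlt)]
      simp

omit [IsFiniteMeasure (surfaceMeasure Ω)] in
lemma IsReducedProblem.measurable_traceRate (hp : IsReducedProblem Ω E T Q C f q κ dk u γ)
    (hd : IsInflowDeriv Ω T γ dγ) : Measurable (traceRate Ω E T lam q f κ dk dγ) :=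
  ((G.measurable_directRate hp.measurable_q hp.measurable_f hp.measurable_κ).add
    (G.measurable_memoryRate hp.measurable_q hp.measurable_f hp.measurable_dk)).add
    (G.measurable_inflowRate hp.measurable_q hd.measurable)

/-- The rate of the outgoing trace is square integrable. -/
theorem IsReducedProblem.traceRate_sq (hp : IsReducedProblem Ω E T Q C f q κ dk u γ)
    (hd : IsInflowDeriv Ω T γ dγ) :
    MemLp (traceRate Ω E T lam q f κ dk dγ) 2 (timeCylinder T (outMeasure Ω lam)) ∧
      ∫ p, traceRate Ω E T lam q f κ dk dγ p ^ 2 ∂(timeCylinder T (outMeasure Ω lam)) ≤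
        3 * ((C ^ 2 + C ^ 2 * T ^ 2) * Real.exp (Q * T) ^ 2 * ∫ z, f z ^ 2 ∂(interiorMeasure Ω) +
          (Real.exp (Q * T) / a) ^ 2 * b * ∫ p, dγ p ^ 2 ∂((volume : Measure ℝ).prod (sigmaIn Ω))) := by
  obtain ⟨i1, b1⟩ := G.directRate_sq hp.measurable_q hp.abs_q_le hp.measurable_f hp.memLp_f
    hp.measurable_κ hp.abs_κ_le (T := T)
  obtain ⟨i2, b2⟩ := G.memoryRate_sq hp.pos hp.measurable_q hp.abs_q_le hp.measurable_f hp.memLp_f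
    hp.measurable_dk hp.abs_dk_le (T := T)
  obtain ⟨i3, b3⟩ := G.inflowRate_sq hp.measurable_q hp.abs_q_le hd.measurable
    (hd.memLp_inMeasure G) (T := T)
  have b0 := (G.chordSource_sq hp.measurable_q hp.abs_q_le hp.measurable_f hp.memLp_f (T := T)).2
  have hm := hp.measurable_traceRate G hd (lam := lam)
  have i12 : Integrable (fun p => directRate Ω E T q f κ p ^ 2 + memoryRate Ω E T q f dk p ^ 2)
      (timeCylinder T (outMeasure Ω lam)) := i1.add i2
  have i123 : Integrable (fun p => 3 * (directRate Ω E T q f κ p ^ 2 +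
      memoryRate Ω E T q f dk p ^ 2 + inflowRate Ω E T lam q dγ p ^ 2))
      (timeCylinder T (outMeasure Ω lam)) := (i12.add i3).const_mul 3
  have hle : ∀ p, traceRate Ω E T lam q f κ dk dγ p ^ 2 ≤ 3 * (directRate Ω E T q f κ p ^ 2 +
      memoryRate Ω E T q f dk p ^ 2 + inflowRate Ω E T lam q dγ p ^ 2) := fun p => by
    rw [traceRate]
    nlinarith [sq_nonneg (directRate Ω E T q f κ p - memoryRate Ω E T q f dk p),
      sq_nonneg (directRate Ω E T q f κ p - inflowRate Ω E T lam q dγ p),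
      sq_nonneg (memoryRate Ω E T q f dk p - inflowRate Ω E T lam q dγ p)]
  have i4 : Integrable (fun p => traceRate Ω E T lam q f κ dk dγ p ^ 2)
      (timeCylinder T (outMeasure Ω lam)) := by
    refine i123.mono' (hm.pow_const 2).aestronglyMeasurable (Eventually.of_forall fun p => ?_)
    rw [Real.norm_eq_abs, abs_of_nonneg (sq_nonneg _)]
    exact hle p
  refine ⟨(memLp_two_iff_integrable_sq hm.aestronglyMeasurable).2 i4, ?_⟩
  refine (integral_mono i4 i123 hle).trans ?_
  rw [integral_const_mul, integral_add i12 i3, integral_add i1 i2]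
  have c3 := b3.trans (mul_le_mul_of_nonneg_left (hd.integral_le G) (sq_nonneg _))
  have c12 := mul_le_mul_of_nonneg_left b0 (show 0 ≤ C ^ 2 + C ^ 2 * T ^ 2 by positivity)
  rw [add_mul] at c12
  linarith

/-- The source is controlled by the rate of the outgoing trace. -/
theorem IsReducedProblem.chordSource_le_traceRate (hp : IsReducedProblem Ω E T Q C f q κ dk u γ)
    (hd : IsInflowDeriv Ω T γ dγ) {C₂ : ℝ} (hC₂ : 0 < C₂) (hκ : ∀ z, f z ≠ 0 → C₂ ≤ |κ z|) :
    ∫ w, chordSource Ω E T q f w ^ 2 ∂((outMeasure Ω lam).prod volume) ≤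
      4 / C₂ ^ 2 * Real.exp (2 * (2 * C ^ 2 * T / C₂ ^ 2 + 1) * T) *
      ∫ p, traceRate Ω E T lam q f κ dk dγ p ^ 2 ∂(timeCylinder T (outMeasure Ω lam)) := by
  have hi := (G.chordSource_sq hp.measurable_q hp.abs_q_le hp.measurable_f hp.memLp_f (T := T)).1
  have hr := (hp.traceRate_sq G hd).1.integrable_sq
  have hm := hp.measurable_traceRate G hd (lam := lam)
  rw [timeCylinder] at hr ⊢
  rw [integral_prod _ hi, integral_prod_symm _ hr, ← integral_const_mul]
  refine integral_mono_ae hi.integral_prod_left (hr.integral_prod_right.const_mul _) ?_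
  filter_upwards [G.ae_chordSource hp.measurable_q hp.abs_q_le hp.measurable_f
    hp.memLp_f (T := T), hr.prod_left_ae, G.ae_isChord] with z h1 h2 hc
  have hmz : Measurable fun t => traceRate Ω E T lam q f κ dk dγ (t, z) :=
    hm.comp (measurable_id.prodMk measurable_const)
  refine integral_sq_le_of_volterra hp.pos hC₂ h1.1 (fun r hr => G.chordSource_eq_zero hr)
    ((memLp_two_iff_integrable_sq hmz.aestronglyMeasurable).2 h2) fun t ht => ?_
  by_cases h0 : chordSource Ω E T q f (z, t) = 0
  · have hC : 0 ≤ C := (abs_nonneg _).trans (hp.abs_κ_le z)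
    rw [h0, abs_zero, mul_zero]
    exact add_nonneg (abs_nonneg _) (mul_nonneg hC (integral_nonneg fun _ => abs_nonneg _))
  have hb := (G.chordSource_mem h0).1
  have htℓ := (hc.mem_iff t).1 hb
  have hf0 : f (phaseFlow E (-t) z) ≠ 0 := fun hf => h0 (by
    classical
    rw [chordSource, indicator_apply]
    simp [hf])
  -- A nonzero source at backward time `t` means `t < ℓ`: what entered through `Γ₋` has not yet
  -- arrived at time `t`. Hence the inflow does not enter the bound of the source.
  have e3 : inflowRate Ω E T lam q dγ (t, z) = 0 := by
    rw [inflowRate, hd.eq_zero _ (fun hmem => by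
      have := hmem.1
      simp only at this
      linarith [htℓ.2])]
    simp
  -- Only `0 < r < t` contributes, because `dk` is zero at times that are not positive; this is the
  -- causality that makes the inequality one of Volterra type.
  have e2 : |memoryRate Ω E T q f dk (t, z)| ≤ C * ∫ r in Ioo 0 t, |chordSource Ω E T q f (z, r)| := by
    have hz : ∀ r ∉ Ioo 0 t, chordSource Ω E T q f (z, r) * dk (t - r, phaseFlow E (-r) z) = 0 := by
      intro r hr
      by_cases hr0 : 0 < r
      · rw [hp.dk_eq_zero _ (by linarith [not_lt.1 fun hlt => hr ⟨hr0, hlt⟩]), mul_zero]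
      · rw [G.chordSource_eq_zero fun hmem => hr0 hmem.1, zero_mul]
    rw [memoryRate, ← setIntegral_eq_integral_of_forall_compl_eq_zero hz, ← integral_const_mul,
      ← Real.norm_eq_abs]
    refine norm_integral_le_of_norm_le ((h1.2.abs.const_mul C).restrict)
      (Eventually.of_forall fun r => ?_)
    rw [norm_mul, mul_comm]
    exact mul_le_mul_of_nonneg_right (hp.abs_dk_le _) (abs_nonneg _)
  have e1 : C₂ * |chordSource Ω E T q f (z, t)| ≤ |directRate Ω E T q f κ (t, z)| := by
    rw [directRate, abs_mul, mul_comm]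
    exact mul_le_mul_of_nonneg_left (hκ _ hf0) (abs_nonneg _)
  have e4 : directRate Ω E T q f κ (t, z) =
      traceRate Ω E T lam q f κ dk dγ (t, z) - memoryRate Ω E T q f dk (t, z) := by
    rw [traceRate, e3]
    ring
  rw [e4] at e1
  exact (e1.trans (abs_sub _ _)).trans (add_le_add le_rfl e2)

end Geometry

/-! ### Measures on time cylinders -/

section TimeCylinder
variable {T : ℝ} {ν : Measure Phase} [SFinite ν]

lemma timeCylinder_eq_restrict :
    timeCylinder T ν = ((volume : Measure ℝ).prod ν).restrict (Ioo 0 T ×ˢ univ) := by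
  rw [timeCylinder, ← Measure.prod_restrict, Measure.restrict_univ]

lemma measurableSet_cylinder : MeasurableSet (Ioo 0 T ×ˢ univ : Set (ℝ × Phase)) :=
  measurableSet_Ioo.prod MeasurableSet.univ

lemma integral_indicator_cylinder (f : ℝ × Phase → ℝ) :
    ∫ p, (Ioo 0 T ×ˢ univ).indicator f p ∂((volume : Measure ℝ).prod ν) =
      ∫ p, f p ∂(timeCylinder T ν) := by
  rw [timeCylinder_eq_restrict, integral_indicator measurableSet_cylinder]

lemma memLp_indicator_cylinder {f : ℝ × Phase → ℝ} (hf : MemLp f 2 (timeCylinder T ν)) :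
    MemLp ((Ioo 0 T ×ˢ univ).indicator f) 2 ((volume : Measure ℝ).prod ν) := by
  rw [timeCylinder_eq_restrict] at hf
  exact (memLp_indicator_iff_restrict measurableSet_cylinder).2 hf

lemma locallyIntegrable_indicator_cylinder {f : ℝ × Phase → ℝ}
    (hf : LocallyIntegrable f (timeCylinder T ν)) :
    LocallyIntegrable ((Ioo 0 T ×ˢ univ).indicator f) ((volume : Measure ℝ).prod ν) := fun x => by
  rw [timeCylinder_eq_restrict] at hf
  obtain ⟨s, hs, hfs⟩ := hf x
  refine ⟨s, hs, (integrable_indicator_iff measurableSet_cylinder).2 ?_⟩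
  rwa [IntegrableOn, Measure.restrict_comm measurableSet_cylinder]

lemma ae_ae_of_timeCylinder {P : ℝ × Phase → Prop} (h : ∀ᵐ p ∂(timeCylinder T ν), P p) :
    ∀ᵐ z ∂ν, ∀ᵐ t ∂((volume : Measure ℝ).restrict (Ioo 0 T)), P (t, z) :=
  Measure.ae_ae_of_ae_prod (Measure.measurePreserving_swap.quasiMeasurePreserving.ae h)

omit [SFinite ν] in
lemma ae_timeCylinder_snd {P : Phase → Prop} (h : ∀ᵐ z ∂ν, P z) :
    ∀ᵐ p ∂(timeCylinder T ν), P p.2 :=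
  Measure.quasiMeasurePreserving_snd.ae h

lemma ae_timeCylinder_of_ae_ae {P : ℝ × Phase → Prop} (hP : MeasurableSet {p | P p})
    (h : ∀ᵐ z ∂ν, ∀ᵐ t ∂((volume : Measure ℝ).restrict (Ioo 0 T)), P (t, z)) :
    ∀ᵐ p ∂(timeCylinder T ν), P p := by
  have h2 : ∀ᵐ w ∂(ν.prod ((volume : Measure ℝ).restrict (Ioo 0 T))), P (w.2, w.1) :=
    (Measure.ae_prod_iff_ae_ae (measurable_swap hP)).2 h
  exact Measure.measurePreserving_swap.quasiMeasurePreserving.ae h2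

omit [SFinite ν] in
lemma ae_timeCylinder_mem : ∀ᵐ p ∂(timeCylinder T ν), p.1 ∈ Ioo 0 T :=
  Measure.quasiMeasurePreserving_fst.ae (ae_restrict_mem measurableSet_Ioo)

lemma timeCylinder_absolutelyContinuous {ν' : Measure Phase} [SFinite ν'] (h : ν' ≪ ν) :
    timeCylinder T ν' ≪ timeCylinder T ν :=
  Measure.AbsolutelyContinuous.rfl.prod h

lemma HasWeakTimeDeriv.congr {f f' g g' : ℝ × Phase → ℝ} {f₀ g₀ : Phase → ℝ} (hT : 0 ≤ T)
    (h : HasWeakTimeDeriv T ν f f' f₀) (hf : f =ᵐ[timeCylinder T ν] g)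
    (hf' : f' =ᵐ[timeCylinder T ν] g') (h₀ : f₀ =ᵐ[ν] g₀) : HasWeakTimeDeriv T ν g g' g₀ := by
  filter_upwards [h, ae_ae_of_timeCylinder hf, ae_ae_of_timeCylinder hf', h₀]
    with z hz h1 h2 h3
  have h2' : ∀ t ∈ Icc 0 T, (fun s => f' (s, z)) =ᵐ[volume.restrict (uIoc 0 t)]
      fun s => g' (s, z) := fun t ht => by
    rw [uIoc_of_le ht.1]
    refine ae_restrict_of_ae_restrict_of_subset (Ioc_subset_Ioc_right ht.2) ?_
    rwa [← restrict_Ioo_eq_restrict_Ioc]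
  refine ⟨hz.1.congr_ae (h2' T ⟨hT, le_rfl⟩), ?_⟩
  filter_upwards [hz.2, h1, ae_restrict_mem measurableSet_Ioo] with t ht h1t hmem
  rw [← h1t, ht, h3, intervalIntegral.integral_congr_ae_restrict (h2' t ⟨hmem.1.le, hmem.2.le⟩)]

/-- The initial values sit on a null set of times, so measurability of `f` on the cylinder says
nothing about them directly. They are recovered as the time average of `f t - ∫ f'`. -/
lemma HasWeakTimeDeriv.ae_eq_measurable {f f' : ℝ × Phase → ℝ} {f₀ : Phase → ℝ} (hT : 0 < T)
    (h : HasWeakTimeDeriv T ν f f' f₀) (hf : AEStronglyMeasurable f (timeCylinder T ν))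
    (hf' : AEStronglyMeasurable f' (timeCylinder T ν)) : AEStronglyMeasurable f₀ ν := by
  have hd : Measurable hf'.mk := hf'.stronglyMeasurable_mk.measurable
  have hd' : Measurable fun x : (ℝ × Phase) × ℝ => hf'.mk f' (x.2, x.1.2) :=
    hd.comp (measurable_snd.prodMk measurable_fst.snd)
  have hg : Measurable fun p : ℝ × Phase => hf.mk f p - ∫ s in (0 : ℝ)..p.1, hf'.mk f' (s, p.2) :=
    hf.stronglyMeasurable_mk.measurable.sub (measurable_intervalIntegral_param hd' measurable_fst)
  refine ⟨fun z => T⁻¹ * ∫ t in Ioo 0 T, (hf.mk f (t, z) - ∫ s in (0 : ℝ)..t, hf'.mk f' (s, z)),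
    (StronglyMeasurable.integral_prod_left' hg.stronglyMeasurable).const_mul _, ?_⟩
  filter_upwards [h.congr hT.le hf.ae_eq_mk hf'.ae_eq_mk (ae_eq_refl _)] with z hz
  rw [integral_congr_ae (g := fun _ => f₀ z) (hz.2.mono fun t ht => by
    beta_reduce; rw [ht]; ring)]
  simp [hT.le, hT.ne']

end TimeCylinder

lemma exists_measurable_abs_le {X : Type*} [MeasurableSpace X] {μ : Measure X} {f : X → ℝ} {C : ℝ}
    (hC : 0 ≤ C) (hf : AEStronglyMeasurable f μ) (hfC : ∀ᵐ x ∂μ, |f x| ≤ C) :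
    ∃ g : X → ℝ, Measurable g ∧ (∀ x, |g x| ≤ C) ∧ f =ᵐ[μ] g := by
  refine ⟨fun x => max (-C) (min (hf.mk f x) C),
    measurable_const.max (hf.stronglyMeasurable_mk.measurable.min measurable_const),
    fun x => abs_le.2 ⟨le_max_left _ _, max_le (by linarith) (min_le_right _ _)⟩, ?_⟩
  filter_upwards [hf.ae_eq_mk, hfC] with x hx hxC
  rw [abs_le] at hxC
  rw [← hx, min_eq_left hxC.2, max_eq_right hxC.1]

/-! ### Estimates for the outgoing trace -/

section Geometry
variable {Ω : Set R3} {E : R3 → R3} {K : ℝ≥0} {M : ℝ} {lam : R3 → ℝ} {a b : ℝ}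

/-- The outgoing trace of a solution has a square integrable time derivative, which controls the
source and is controlled by the source and the inflow. -/
theorem IsReducedProblem.exists_outflowDeriv [IsFiniteMeasure (surfaceMeasure Ω)]
    (G : TransportGeometry Ω E K M lam a b) {T C C₂ : ℝ} {Q : ℝ≥0} {f q κ : Phase → ℝ}
    {dk u γ dγ : ℝ × Phase → ℝ} (hp : IsReducedProblem Ω E T Q C f q κ dk u γ)
    (hd : IsInflowDeriv Ω T γ dγ) (hC₂ : 0 < C₂) (hκ : ∀ z, f z ≠ 0 → C₂ ≤ |κ z|)
    (hshort : ∀ z s, (z, s) ∈ backSet Ω E → f (phaseFlow E (-s) z) ≠ 0 → s < T) :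
    ∃ dγ' : ℝ × Phase → ℝ, MemLp dγ' 2 (timeCylinder T (sigmaOut Ω)) ∧
      HasWeakTimeDeriv T (sigmaOut Ω) γ dγ' (fun _ => 0) ∧
      ∫ z, f z ^ 2 ∂(interiorMeasure Ω) ≤ Real.exp (Q * T) ^ 2 *
        (4 / C₂ ^ 2 * Real.exp (2 * (2 * C ^ 2 * T / C₂ ^ 2 + 1) * T)) / a *
        ∫ p, dγ' p ^ 2 ∂(timeCylinder T (sigmaOut Ω)) ∧
      ∫ p, dγ' p ^ 2 ∂(timeCylinder T (sigmaOut Ω)) ≤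
        b * (3 * ((C ^ 2 + C ^ 2 * T ^ 2) * Real.exp (Q * T) ^ 2 *
          ∫ z, f z ^ 2 ∂(interiorMeasure Ω) + (Real.exp (Q * T) / a) ^ 2 * b *
          ∫ p, dγ p ^ 2 ∂((volume : Measure ℝ).prod (sigmaIn Ω)))) := by
  obtain ⟨hr, hrle⟩ := hp.traceRate_sq G hd
  have hcs := hp.chordSource_le_traceRate G hd hC₂ hκ
  have hfc := G.integral_sq_le_chordSource hp.measurable_q hp.abs_q_le hp.measurable_f hp.memLp_f
    hshort
  have hb : 0 ≤ b := (G.density_pos 0).le.trans (G.upper 0)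
  set w := traceRate Ω E T lam q f κ dk dγ with hw
  have hwm : Measurable w := hp.measurable_traceRate G hd
  have hlm : Measurable fun p : ℝ × Phase => lam p.2.1 :=
    G.measurable_density.comp (measurable_fst.comp measurable_snd)
  have i1 : Integrable (fun p => lam p.2.1 * w p ^ 2) (timeCylinder T (sigmaOut Ω)) :=
    G.integrable_outMeasure_iff.1 hr.integrable_sq
  have e1 : ∫ p, w p ^ 2 ∂(timeCylinder T (outMeasure Ω lam)) =
      ∫ p, lam p.2.1 * w p ^ 2 ∂(timeCylinder T (sigmaOut Ω)) := G.integral_outMeasure _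
  have hsq : ∀ p : ℝ × Phase, (lam p.2.1 * w p) ^ 2 = lam p.2.1 * (lam p.2.1 * w p ^ 2) :=
    fun p => by ring
  have i2 : Integrable (fun p => (lam p.2.1 * w p) ^ 2) (timeCylinder T (sigmaOut Ω)) := by
    simp_rw [hsq]
    exact i1.bdd_mul hlm.aestronglyMeasurable (Eventually.of_forall fun p => by
      rw [Real.norm_of_nonneg (G.density_pos _).le]; exact G.upper _)
  have h0 : ∀ p : ℝ × Phase, 0 ≤ lam p.2.1 * w p ^ 2 := fun p =>
    mul_nonneg (G.density_pos _).le (sq_nonneg _)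
  have hlow : a * ∫ p, w p ^ 2 ∂(timeCylinder T (outMeasure Ω lam)) ≤
      ∫ p, (lam p.2.1 * w p) ^ 2 ∂(timeCylinder T (sigmaOut Ω)) := by
    rw [e1, ← integral_const_mul]
    refine integral_mono (i1.const_mul a) i2 fun p => ?_
    beta_reduce
    rw [hsq]
    exact mul_le_mul_of_nonneg_right (G.lower _) (h0 p)
  have hupp : ∫ p, (lam p.2.1 * w p) ^ 2 ∂(timeCylinder T (sigmaOut Ω)) ≤
      b * ∫ p, w p ^ 2 ∂(timeCylinder T (outMeasure Ω lam)) := by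
    rw [e1, ← integral_const_mul]
    refine integral_mono i2 (i1.const_mul b) fun p => ?_
    beta_reduce
    rw [hsq]
    exact mul_le_mul_of_nonneg_right (G.upper _) (h0 p)
  -- The rate `w` belongs to `γ / lam`, so the derivative of `γ` itself carries the factor `lam`;
  -- the bounds of `lam` compare the two norms.
  refine ⟨fun p => lam p.2.1 * w p,
    (memLp_two_iff_integrable_sq (hlm.mul hwm).aestronglyMeasurable).2 i2, ?_, ?_,
    hupp.trans (mul_le_mul_of_nonneg_left hrle hb)⟩
  · have hac : sigmaOut Ω ≪ outMeasure Ω lam := withDensity_absolutelyContinuous'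
      (G.measurable_density.comp measurable_fst).ennreal_ofReal.aemeasurable
      (Eventually.of_forall fun z => (ENNReal.ofReal_pos.2 (G.density_pos z.1)).ne')
    filter_upwards [hac.ae_le (hp.ae_trace_eq G hd)] with z hz
    refine ⟨hz.1.const_mul _, (ae_restrict_iff' measurableSet_Ioo).2 ?_⟩
    filter_upwards [hz.2] with t ht hmem
    rw [zero_add, intervalIntegral.integral_const_mul, ← ht hmem,
      mul_div_cancel₀ _ (G.density_pos z.1).ne']
  · have hA : ∫ p, w p ^ 2 ∂(timeCylinder T (outMeasure Ω lam)) ≤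
        (∫ p, (lam p.2.1 * w p) ^ 2 ∂(timeCylinder T (sigmaOut Ω))) / a := by
      rw [le_div_iff₀ G.lower_pos, mul_comm]
      exact hlow
    refine hfc.trans ((mul_le_mul_of_nonneg_left (hcs.trans (mul_le_mul_of_nonneg_left hA
      (by positivity))) (sq_nonneg _)).trans (le_of_eq ?_))
    ring

/-- The admissible weight bounds the length of the characteristics whose velocity lies in `V`. -/
lemma lt_of_mem_backSet (hΩo : IsOpen Ω) {F : R3 → R3} (hF : IsForceField F K M)
    (hFE : EqOn F E (closure Ω)) {V : Set R3} {T β : ℝ} {φ₀ : Phase → ℝ}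
    (hw : IsAdmissibleWeight Ω E V T β φ₀) {I : Set ℝ} (hIV : {v : R3 | v 0 ∈ I} ⊆ V) {z : Phase}
    {s : ℝ} (hz : (z, s) ∈ backSet Ω F) (hI : (phaseFlow F (-s) z).2 0 ∈ I) : s < T := by
  obtain ⟨hzo, hs, hin⟩ := (mem_backSet_iff hF).1 hz
  rw [flow_snd_zero hF] at hI
  -- Since `v₁` is conserved, membership of one velocity in the slab over `I` keeps the whole
  -- characteristic in `V`, where the weight is controlled.
  have hV : ∀ r, (phaseFlow F r z).2 ∈ V := fun r => hIV (by
    rw [mem_ofPred_eq, flow_snd_zero hF]; exact hI)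
  have hmem : ∀ r ∈ Icc (-s) 0, phaseFlow F r z ∈ closure Ω ×ˢ V := fun r hr => by
    refine ⟨?_, hV r⟩
    rcases hr.2.eq_or_lt with rfl | hlt
    · rw [flow_zero hF]
      exact frontier_subset_closure hzo.1
    · have := hin (-r) ⟨neg_pos.2 hlt, by linarith [hr.1]⟩
      rw [neg_neg] at this
      exact subset_closure this
  obtain ⟨R, r₀, hR, hr₀, -, -, hT⟩ := hw.range
  obtain ⟨c, hc, hpsi⟩ := hw.psi_lower
  have hcont : ContinuousOn (fun r => φ₀ (phaseFlow F r z)) (Icc (-s) 0) :=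
    hw.contDiffOn.continuousOn.comp
      (fun r _ => (hasDerivAt_flow hF z r).continuousAt.continuousWithinAt)
      fun r hr => ⟨(hmem r hr).1, mem_univ _⟩
  have hder : ∀ r ∈ Ioo (-s) 0, HasDerivAt (fun r => φ₀ (phaseFlow F r z))
      (weightPsi Ω E β φ₀ (phaseFlow F r z) + β) r := fun r hr => by
    have hm := hmem r ⟨hr.1.le, hr.2.le⟩
    have ho : (phaseFlow F r z).1 ∈ Ω := by
      have := hin (-r) ⟨neg_pos.2 hr.2, by linarith [hr.1]⟩
      rwa [neg_neg] at this
    have hn : closure Ω ×ˢ univ ∈ 𝓝 (phaseFlow F r z) := by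
      rw [nhds_prod_eq]
      exact prod_mem_prod (mem_of_superset (hΩo.mem_nhds ho) subset_closure) univ_mem
    have hd := ((hw.contDiffOn.differentiableOn two_ne_zero _ ⟨hm.1, mem_univ _⟩).hasFDerivWithinAt
      |>.hasFDerivAt hn).comp_hasDerivAt r (hasDerivAt_flow hF z r)
    have e : weightPsi Ω E β φ₀ (phaseFlow F r z) + β =
        fderivWithin ℝ φ₀ (closure Ω ×ˢ univ) (phaseFlow F r z) (phaseField F (phaseFlow F r z)) := by
      rw [weightPsi, spaceTransport, phaseField, hFE hm.1]
      ring
    rw [e]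
    exact hd
  have hmain := Convex.mul_sub_le_image_sub_of_le_deriv (C := β) (convex_Icc (-s) 0) hcont
    (by
      rw [interior_Icc]
      exact fun r hr => (hder r hr).differentiableAt.differentiableWithinAt)
    (fun r hr => by
      rw [interior_Icc] at hr
      rw [(hder r hr).deriv]
      linarith [hpsi _ (hmem r ⟨hr.1.le, hr.2.le⟩)])
    (-s) ⟨le_rfl, by linarith⟩ 0 ⟨by linarith, le_rfl⟩ (by linarith)
  have h1 := hR.1 (mem_image_of_mem φ₀ (hmem 0 ⟨by linarith, le_rfl⟩))
  have h2 := hr₀.1 (mem_image_of_mem φ₀ (hmem (-s) ⟨le_rfl, by linarith⟩))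
  rw [div_lt_iff₀ hw.beta_pos] at hT
  exact lt_of_mul_lt_mul_left (a := β) (by linarith) hw.beta_pos.le

end Geometry

/-! ### Reduction to the problem with measurable data -/

lemma integral_timeCylinder_eq {T : ℝ} {ν : Measure Phase} [SFinite ν] {g k : ℝ × Phase → ℝ}
    (hgk : g =ᵐ[timeCylinder T ν] k) (hk : ∀ p : ℝ × Phase, p.1 ∉ Ioo 0 T → k p = 0) :
    ∫ p, g p ∂(timeCylinder T ν) = ∫ p, k p ∂((volume : Measure ℝ).prod ν) := by
  rw [integral_congr_ae hgk, ← integral_indicator_cylinder]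
  congr 1
  refine indicator_eq_self.2 fun p hp => ⟨by_contra fun h => hp (hk p h), mem_univ _⟩

/-- A function agrees almost everywhere on a time cylinder with a measurable function that vanishes
outside the cylinder. -/
lemma exists_measurable_cylinder {T : ℝ} {ν : Measure Phase} [SFinite ν] {g : ℝ × Phase → ℝ}
    (hg : AEStronglyMeasurable g (timeCylinder T ν)) :
    ∃ k : ℝ × Phase → ℝ, Measurable k ∧ (∀ p : ℝ × Phase, p.1 ∉ Ioo 0 T → k p = 0) ∧
      g =ᵐ[timeCylinder T ν] k ∧ (MemLp g 2 (timeCylinder T ν) → MemLp k 2 (volume.prod ν)) ∧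
      (LocallyIntegrable g (timeCylinder T ν) → LocallyIntegrable k (volume.prod ν)) := by
  refine ⟨(Ioo 0 T ×ˢ univ).indicator (hg.mk g),
    hg.stronglyMeasurable_mk.measurable.indicator measurableSet_cylinder,
    fun p hp => indicator_of_notMem (fun h => hp h.1) _, ?_,
    fun h => memLp_indicator_cylinder ((memLp_congr_ae hg.ae_eq_mk).1 h),
    fun h => locallyIntegrable_indicator_cylinder (h.congr hg.ae_eq_mk)⟩
  filter_upwards [hg.ae_eq_mk, ae_timeCylinder_mem] with p hp hmem
  rw [hp, indicator_of_mem (show p ∈ Ioo 0 T ×ˢ (univ : Set Phase) from ⟨hmem, mem_univ _⟩)]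

lemma restrict_prod_eq_restrict_interiorMeasure {Ω U : Set R3} (hU : MeasurableSet U) :
    (volume : Measure Phase).restrict (Ω ×ˢ U) = (interiorMeasure Ω).restrict (Prod.snd ⁻¹' U) := by
  rw [interiorMeasure, Measure.restrict_restrict (measurable_snd hU)]
  congr 1
  ext z
  simp [and_comm]

lemma ae_interiorMeasure_of_ae {Ω U : Set R3} (hU : MeasurableSet U) {P : Phase → Prop}
    (h : ∀ᵐ z ∂((volume : Measure Phase).restrict (Ω ×ˢ U)), P z) :
    ∀ᵐ z ∂(interiorMeasure Ω), z.2 ∈ U → P z := by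
  rw [restrict_prod_eq_restrict_interiorMeasure hU, ae_restrict_iff' (measurable_snd hU)] at h
  exact h

lemma ae_timeCylinder_interiorMeasure_of_ae {Ω U : Set R3} (hU : MeasurableSet U) {T : ℝ}
    {P : ℝ × Phase → Prop} (h : ∀ᵐ p ∂(timeCylinder T (volume.restrict (Ω ×ˢ U))), P p) :
    ∀ᵐ p ∂(timeCylinder T (interiorMeasure Ω)), p.2.2 ∈ U → P p := by
  have hm : MeasurableSet (univ ×ˢ (Prod.snd ⁻¹' U) : Set (ℝ × Phase)) :=
    MeasurableSet.univ.prod (measurable_snd hU)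
  rw [restrict_prod_eq_restrict_interiorMeasure hU, timeCylinder,
    ← Measure.restrict_univ (μ := (volume : Measure ℝ).restrict (Ioo 0 T)), Measure.prod_restrict,
    ae_restrict_iff' hm] at h
  exact h.mono fun p hp hpU => hp ⟨mem_univ _, hpU⟩

/-- Null sets are repaired so that the bounds hold at every point. `f` is cut off to velocities in
`U` and to points with `|κ| ≥ C₂`, which alters `k₀` on a null set only. Off `U` the values of `k₁`
are irrelevant because `k₀` vanishes there. -/
lemma exists_measurable_source {Ω U : Set R3} (hU : MeasurableSet U) {T C C₂ : ℝ} (hT : 0 < T)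
    (hC : 0 ≤ C) {k₀ : Phase → ℝ} {k₁ dk₁ : ℝ × Phase → ℝ}
    (hk₀ : MemLp k₀ 2 (interiorMeasure Ω)) (hk₀U : ∀ᵐ z ∂(interiorMeasure Ω), z.2 ∉ U → k₀ z = 0)
    (hk₁ : AEStronglyMeasurable k₁ (timeCylinder T (volume.restrict (Ω ×ˢ U))))
    (hdk₁ : AEStronglyMeasurable dk₁ (timeCylinder T (volume.restrict (Ω ×ˢ U))))
    (hder : HasWeakTimeDeriv T (volume.restrict (Ω ×ˢ U)) k₁ dk₁ (fun z => k₁ (0, z)))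
    (hdC : ∀ᵐ p ∂(timeCylinder T (volume.restrict (Ω ×ˢ U))), |dk₁ p| ≤ C)
    (h0C : ∀ᵐ z ∂((volume : Measure Phase).restrict (Ω ×ˢ U)),
      |k₁ (0, z)| ≤ C ∧ C₂ ≤ |k₁ (0, z)|) :
    ∃ (f κ : Phase → ℝ) (dk : ℝ × Phase → ℝ), Measurable f ∧ Measurable κ ∧ Measurable dk ∧
      (∀ z, |κ z| ≤ C) ∧ (∀ p, |dk p| ≤ C) ∧ (∀ t ≤ 0, ∀ z, dk (t, z) = 0) ∧
      (∀ z, f z ≠ 0 → z.2 ∈ U ∧ C₂ ≤ |κ z|) ∧ k₀ =ᵐ[interiorMeasure Ω] f ∧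
      (fun p => k₀ p.2 * k₁ p) =ᵐ[timeCylinder T (interiorMeasure Ω)]
        fun p => f p.2 * sourceFactor κ dk p := by
  obtain ⟨κ, hκm, hκC, hκe⟩ := exists_measurable_abs_le hC (hder.ae_eq_measurable hT hk₁ hdk₁)
    (h0C.mono fun _ h => h.1)
  obtain ⟨g, hgm, hgC, hge⟩ := exists_measurable_abs_le hC hdk₁ hdC
  set S : Set Phase := {z | z.2 ∈ U ∧ C₂ ≤ |κ z|} with hS
  have hSm : MeasurableSet S :=
    (measurable_snd hU).inter (measurableSet_le measurable_const hκm.abs)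
  set dk : ℝ × Phase → ℝ := (Ioo 0 T ×ˢ univ).indicator g with hdk
  have hdkm : Measurable dk := hgm.indicator measurableSet_cylinder
  have hdke : dk₁ =ᵐ[timeCylinder T (volume.restrict (Ω ×ˢ U))] dk := by
    filter_upwards [hge, ae_timeCylinder_mem] with p hp hmem
    rw [hp, hdk, indicator_of_mem (show p ∈ Ioo 0 T ×ˢ (univ : Set Phase) from ⟨hmem, mem_univ _⟩)]
  have hfe : k₀ =ᵐ[interiorMeasure Ω] S.indicator (hk₀.1.mk k₀) := by
    filter_upwards [hk₀.1.ae_eq_mk, hk₀U, ae_interiorMeasure_of_ae hU h0C,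
      ae_interiorMeasure_of_ae hU hκe] with z h1 h2 h3 h4
    by_cases hzU : z.2 ∈ U
    · rw [h1, indicator_of_mem (show z ∈ S from ⟨hzU, by rw [← h4 hzU]; exact (h3 hzU).2⟩)]
    · rw [h2 hzU, indicator_of_notMem fun h => hzU h.1]
  have hk₁e : ∀ᵐ z ∂((volume : Measure Phase).restrict (Ω ×ˢ U)),
      ∀ᵐ t ∂((volume : Measure ℝ).restrict (Ioo 0 T)), hk₁.mk k₁ (t, z) = sourceFactor κ dk (t, z) := by
    filter_upwards [hder.congr hT.le hk₁.ae_eq_mk hdke hκe] with z hz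
    filter_upwards [hz.2, ae_restrict_mem measurableSet_Ioo] with t ht hmem
    rw [ht, sourceFactor, if_pos hmem.1]
  have hk₁U : ∀ᵐ p ∂(timeCylinder T (interiorMeasure Ω)), p.2.2 ∈ U → k₁ p = sourceFactor κ dk p := by
    refine ae_timeCylinder_interiorMeasure_of_ae hU ?_
    filter_upwards [hk₁.ae_eq_mk, ae_timeCylinder_of_ae_ae (measurableSet_eq_fun
      hk₁.stronglyMeasurable_mk.measurable (measurable_sourceFactor hκm hdkm)) hk₁e] with p h1 h2
    rw [h1, h2]
  refine ⟨S.indicator (hk₀.1.mk k₀), κ, dk, hk₀.1.stronglyMeasurable_mk.measurable.indicator hSm,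
    hκm, hdkm, hκC, fun p => ?_, fun t ht z => indicator_of_notMem (fun h => h.1.1.not_ge ht) _,
    fun z hz => by_contra fun h => hz (indicator_of_notMem (s := S) h _), hfe, ?_⟩
  · by_cases hp : p ∈ Ioo 0 T ×ˢ (univ : Set Phase)
    · rw [hdk, indicator_of_mem hp]
      exact hgC p
    · rw [hdk, indicator_of_notMem hp, abs_zero]
      exact hC
  · filter_upwards [ae_timeCylinder_snd hfe, ae_timeCylinder_snd hk₀U, hk₁U] with p h1 h2 h3
    by_cases hp : p.2.2 ∈ U
    · rw [h1, h3 hp]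
    · rw [← h1, h2 hp, zero_mul, zero_mul]

/-! ### From weak solutions on `(0,T)` to solutions extended by zero to negative times. -/

section Reduction
variable {Ω : Set R3} {E F : R3 → R3} {K : ℝ≥0} {M : ℝ}

lemma locallyIntegrable_source {f κ : Phase → ℝ} {dk : ℝ × Phase → ℝ} {C : ℝ}
    (hf : MemLp f 2 (interiorMeasure Ω)) (hκm : Measurable κ) (hdkm : Measurable dk)
    (hκ : ∀ z, |κ z| ≤ C) (hdk : ∀ p, |dk p| ≤ C) :
    LocallyIntegrable (fun p => f p.2 * sourceFactor κ dk p)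
      ((volume : Measure ℝ).prod (interiorMeasure Ω)) := fun p => by
  have hC : 0 ≤ C := (abs_nonneg _).trans (hκ 0)
  refine ⟨Metric.closedBall p.1 1 ×ˢ Metric.closedBall p.2 1, ?_, ?_⟩
  · rw [nhds_prod_eq]
    exact prod_mem_prod (Metric.closedBall_mem_nhds _ one_pos) (Metric.closedBall_mem_nhds _ one_pos)
  have h1 : IsFiniteMeasure ((interiorMeasure Ω).restrict (Metric.closedBall p.2 1)) :=
    ⟨by rw [Measure.restrict_apply_univ]; exact (isCompact_closedBall _ _).measure_lt_top⟩
  have h2 : IsFiniteMeasure ((volume : Measure ℝ).restrict (Metric.closedBall p.1 1)) :=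
    ⟨by rw [Measure.restrict_apply_univ]; exact (isCompact_closedBall _ _).measure_lt_top⟩
  have hfi : Integrable f ((interiorMeasure Ω).restrict (Metric.closedBall p.2 1)) :=
    (hf.restrict _).integrable one_le_two
  rw [IntegrableOn, ← Measure.prod_restrict]
  refine (hfi.comp_snd _).mul_bdd (c := C + C * (|p.1| + 1))
    (measurable_sourceFactor hκm hdkm).aestronglyMeasurable ?_
  have hmem : ∀ᵐ x ∂(((volume : Measure ℝ).restrict (Metric.closedBall p.1 1)).prod
      ((interiorMeasure Ω).restrict (Metric.closedBall p.2 1))), x.1 ∈ Metric.closedBall p.1 1 :=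
    Measure.quasiMeasurePreserving_fst.ae (ae_restrict_mem measurableSet_closedBall)
  filter_upwards [hmem] with x hx
  refine (abs_sourceFactor_le hκ hdk x).trans ?_
  have h3 : |x.1| ≤ |p.1| + 1 := by
    rw [Metric.mem_closedBall, Real.dist_eq] at hx
    have := abs_add_le p.1 (x.1 - p.1)
    rw [add_sub_cancel] at this
    linarith
  gcongr

/-- A weak solution yields a weak solution with measurable data, extended by zero. -/
lemma IsWeakSolution.isWeakTriple [IsFiniteMeasure (surfaceMeasure Ω)] (hΩo : IsOpen Ω)
    (hF : IsForceField F K M) (hFE : EqOn F E (closure Ω)) {T C : ℝ} {Q : ℝ≥0}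
    {q q' f κ : Phase → ℝ} {dk S u u' γ γ' : ℝ × Phase → ℝ}
    (hsol : IsWeakSolution Ω E T q S (fun _ => 0) u γ)
    (hqm : Measurable q') (hqQ : ∀ z, |q' z| ≤ Q) (hqe : q =ᵐ[interiorMeasure Ω] q')
    (hf : MemLp f 2 (interiorMeasure Ω)) (hκm : Measurable κ) (hdkm : Measurable dk)
    (hκ : ∀ z, |κ z| ≤ C) (hdk : ∀ p, |dk p| ≤ C)
    (hS : S =ᵐ[timeCylinder T (interiorMeasure Ω)] fun p => f p.2 * sourceFactor κ dk p)
    (hu : MemLp u' 2 ((volume : Measure ℝ).prod (interiorMeasure Ω)))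
    (hu0 : ∀ p : ℝ × Phase, p.1 ∉ Ioo 0 T → u' p = 0)
    (hue : u =ᵐ[timeCylinder T (interiorMeasure Ω)] u')
    (hγ : LocallyIntegrable γ' ((volume : Measure ℝ).prod (boundaryMeasure Ω)))
    (hγ0 : ∀ p : ℝ × Phase, p.1 ∉ Ioo 0 T → γ' p = 0)
    (hγe : γ =ᵐ[timeCylinder T (boundaryMeasure Ω)] γ') :
    IsWeakTriple Ω F (Iio T) u' (fun p => f p.2 * sourceFactor κ dk p - q' p.2 * u' p) γ' := by
  have hul : LocallyIntegrable u' ((volume : Measure ℝ).prod (interiorMeasure Ω)) :=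
    hu.locallyIntegrable one_le_two
  have hqm' : Measurable fun p : ℝ × Phase => q' p.2 := hqm.comp measurable_snd
  have hqul : LocallyIntegrable (fun p => q' p.2 * u' p)
      ((volume : Measure ℝ).prod (interiorMeasure Ω)) := fun x =>
    let ⟨s, hs, hi⟩ := hul x
    ⟨s, hs, hi.bdd_mul hqm'.aestronglyMeasurable (Eventually.of_forall fun p => hqQ _)⟩
  have hsl := locallyIntegrable_source hf hκm hdkm hκ hdk
  refine ⟨hul, hsl.sub hqul, hγ, fun η hη hηc hηT => ?_⟩
  have hηT' : ∀ p : ℝ × Phase, T ≤ p.1 → η p = 0 := fun p hp =>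
    image_eq_zero_of_notMem_tsupport fun h => (hηT h).1.not_ge hp
  have htc : Continuous (transport F η) := continuous_transport hF hη
  have hts : HasCompactSupport (transport F η) :=
    HasCompactSupport.intro hηc.isCompact fun p hp => transport_eq_zero_of_notMem hp
  have i1 : Integrable (fun p => u' p * transport F η p)
      ((volume : Measure ℝ).prod (interiorMeasure Ω)) := by
    simpa only [smul_eq_mul, mul_comm] using hul.integrable_smul_left_of_hasCompactSupport htc hts
  have i2 : Integrable (fun p => q' p.2 * u' p * η p)
      ((volume : Measure ℝ).prod (interiorMeasure Ω)) := by
    simpa only [smul_eq_mul, mul_comm] using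
      hqul.integrable_smul_left_of_hasCompactSupport hη.continuous hηc
  have i3 : Integrable (fun p => f p.2 * sourceFactor κ dk p * η p)
      ((volume : Measure ℝ).prod (interiorMeasure Ω)) := by
    simpa only [smul_eq_mul, mul_comm] using
      hsl.integrable_smul_left_of_hasCompactSupport hη.continuous hηc
  have hΩ : ∀ᵐ p ∂(timeCylinder T (interiorMeasure Ω)), p.2.1 ∈ Ω := ae_timeCylinder_snd
    ((ae_restrict_mem (hΩo.measurableSet.prod MeasurableSet.univ)).mono fun z hz => hz.1)
  have e1 : ∫ p, u p * (-transport E η p + q p.2 * η p) ∂(timeCylinder T (interiorMeasure Ω)) =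
      ∫ p, (q' p.2 * u' p * η p - u' p * transport F η p)
        ∂((volume : Measure ℝ).prod (interiorMeasure Ω)) := by
    refine integral_timeCylinder_eq ?_ fun p hp => by rw [hu0 p hp]; ring
    filter_upwards [hue, ae_timeCylinder_snd hqe, hΩ] with p h1 h2 h3
    rw [h1, h2, transport, transport, hFE (subset_closure h3)]
    ring
  have e2 : ∫ p, S p * η p ∂(timeCylinder T (interiorMeasure Ω)) =
      ∫ p, f p.2 * sourceFactor κ dk p * η p ∂((volume : Measure ℝ).prod (interiorMeasure Ω)) := by
    refine integral_timeCylinder_eq (hS.mono fun p hp => by beta_reduce; rw [hp]) fun p hp => ?_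
    by_cases h0 : 0 < p.1
    · rw [hηT' p (not_lt.1 fun h => hp ⟨h0, h⟩), mul_zero]
    · rw [sourceFactor, if_neg h0, mul_zero, zero_mul]
  have e3 : ∀ ν : Measure Phase, SFinite ν → ν ≪ boundaryMeasure Ω →
      ∫ p, γ p * η p ∂(timeCylinder T ν) = ∫ p, γ' p * η p ∂((volume : Measure ℝ).prod ν) :=
    fun ν _ hν => integral_timeCylinder_eq
      ((show γ =ᵐ[timeCylinder T ν] γ' from (timeCylinder_absolutelyContinuous hν).ae_le hγe).mono
        fun p hp => by beta_reduce; rw [hp])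
      fun p hp => by rw [hγ0 p hp, zero_mul]
  -- The initial value is zero, so there is no contribution from `t = 0`: test functions need not
  -- vanish there, and the extension by zero solves the equation for all times before `T`.
  have hmain := hsol.weak η hη hηc hηT
  simp only [zero_mul, integral_zero, add_zero] at hmain
  rw [e1, e2, e3 (sigmaOut Ω) inferInstance Measure.restrict_le_self.absolutelyContinuous,
    e3 (sigmaIn Ω) inferInstance Measure.restrict_le_self.absolutelyContinuous,
    integral_sub i2 i1] at hmain
  simp only [sub_mul]
  rw [integral_sub i3 i2]
  linarith

end Reduction

/-! ### The estimates for weak solutions -/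

theorem exists_transportGeometry {Ω : Set R3} (hΩo : IsOpen Ω) (hΩn : Ω.Nonempty)
    (hΩb : Bornology.IsBounded Ω) (hΩc : Convex ℝ Ω) (hΩs : HasSmoothBoundary Ω) {E : R3 → R3}
    (hE : ContDiffOn ℝ 1 E (closure Ω)) (hE₁ : ∀ x ∈ closure Ω, E x 0 = 0) :
    IsFiniteMeasure (surfaceMeasure Ω) ∧
      ∃ (F : R3 → R3) (K : ℝ≥0) (M : ℝ) (lam : R3 → ℝ) (a b : ℝ),
        TransportGeometry Ω F K M lam a b ∧ EqOn F E (closure Ω) := by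
  obtain ⟨F, K, M, hF, hFE⟩ := exists_forceField_extension hΩc hΩb hE hE₁
  obtain ⟨hfin, lam, a, b, hlm, ha, hab, hgg⟩ := exists_gaussGreen hΩo hΩc hΩb hΩn hΩs
  exact ⟨hfin, F, K, M, lam, a, b, ⟨hΩo, hΩc, hΩs, hΩb, hΩn, hF, hlm, ha, fun x => (hab x).1,
    fun x => (hab x).2, isWeakTriple_one hΩo hΩc hΩs hlm
      (fun x => abs_le.2 ⟨by linarith [hab x], (hab x).2⟩) hgg hF.lipschitz.continuous⟩, hFE⟩

theorem IsWeakSolution.exists_outflowDeriv {Ω : Set R3} {E F : R3 → R3} {K : ℝ≥0} {M : ℝ}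
    {lam : R3 → ℝ} {a b : ℝ} [IsFiniteMeasure (surfaceMeasure Ω)]
    (G : TransportGeometry Ω F K M lam a b) (hFE : EqOn F E (closure Ω)) {V : Set R3} {T β : ℝ}
    {φ₀ : Phase → ℝ} (hw : IsAdmissibleWeight Ω E V T β φ₀) {I : Set ℝ}
    (hIV : {v : R3 | v 0 ∈ I} ⊆ V) {U : Set R3} (hU : MeasurableSet U)
    (hUI : U ⊆ {v : R3 | v 0 ∈ I}) (hT : 0 < T) {Q : ℝ≥0} {C C₂ : ℝ} (hC : 0 ≤ C) (hC₂ : 0 < C₂)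
    {q k₀ : Phase → ℝ} {k₁ dk₁ u γ dγ : ℝ × Phase → ℝ}
    (hq : AEStronglyMeasurable q (interiorMeasure Ω)) (hqQ : ∀ᵐ z ∂(interiorMeasure Ω), |q z| ≤ Q)
    (hk₀ : MemLp k₀ 2 (interiorMeasure Ω)) (hk₀U : ∀ᵐ z ∂(interiorMeasure Ω), z.2 ∉ U → k₀ z = 0)
    (hk₁ : AEStronglyMeasurable k₁ (timeCylinder T (volume.restrict (Ω ×ˢ U))))
    (hdk₁ : AEStronglyMeasurable dk₁ (timeCylinder T (volume.restrict (Ω ×ˢ U))))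
    (hder : HasWeakTimeDeriv T (volume.restrict (Ω ×ˢ U)) k₁ dk₁ (fun z => k₁ (0, z)))
    (hdC : ∀ᵐ p ∂(timeCylinder T (volume.restrict (Ω ×ˢ U))), |dk₁ p| ≤ C)
    (h0C : ∀ᵐ z ∂((volume : Measure Phase).restrict (Ω ×ˢ U)),
      |k₁ (0, z)| ≤ C ∧ C₂ ≤ |k₁ (0, z)|)
    (hsol : IsWeakSolution Ω E T q (fun p => k₀ p.2 * k₁ p) (fun _ => 0) u γ)
    (hdγ : MemLp dγ 2 (timeCylinder T (sigmaIn Ω)))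
    (hγdγ : HasWeakTimeDeriv T (sigmaIn Ω) γ dγ (fun _ => 0)) :
    ∃ dγ' : ℝ × Phase → ℝ, MemLp dγ' 2 (timeCylinder T (sigmaOut Ω)) ∧
      HasWeakTimeDeriv T (sigmaOut Ω) γ dγ' (fun _ => 0) ∧
      ∫ z, k₀ z ^ 2 ∂(interiorMeasure Ω) ≤ Real.exp (Q * T) ^ 2 *
        (4 / C₂ ^ 2 * Real.exp (2 * (2 * C ^ 2 * T / C₂ ^ 2 + 1) * T)) / a *
        ∫ p, dγ' p ^ 2 ∂(timeCylinder T (sigmaOut Ω)) ∧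
      ∫ p, dγ' p ^ 2 ∂(timeCylinder T (sigmaOut Ω)) ≤
        b * (3 * ((C ^ 2 + C ^ 2 * T ^ 2) * Real.exp (Q * T) ^ 2 *
          ∫ z, k₀ z ^ 2 ∂(interiorMeasure Ω) + (Real.exp (Q * T) / a) ^ 2 * b *
          ∫ p, dγ p ^ 2 ∂(timeCylinder T (sigmaIn Ω)))) := by
  have := isFiniteMeasureOnCompacts_boundaryMeasure G.isOpen G.convex G.smooth
  obtain ⟨q', hq'm, hq'Q, hqe⟩ := exists_measurable_abs_le Q.2 hq hqQ
  obtain ⟨f, κ, dk, hfm, hκm, hdkm, hκC, hdkC, hdk0, hfκ, hfe, hS⟩ :=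
    exists_measurable_source hU hT hC hk₀ hk₀U hk₁ hdk₁ hder hdC h0C
  obtain ⟨u', hu'm, hu'0, hue, hu'L, -⟩ := exists_measurable_cylinder hsol.memLp.1
  obtain ⟨γ', hγ'm, hγ'0, hγe, -, hγ'l⟩ :=
    exists_measurable_cylinder hsol.trace_locallyIntegrable.aestronglyMeasurable
  obtain ⟨δ, hδm, hδ0, hδe, hδL, -⟩ := exists_measurable_cylinder hdγ.1
  have hf : MemLp f 2 (interiorMeasure Ω) := (memLp_congr_ae hfe).1 hk₀
  have hp : IsReducedProblem Ω F T Q C f q' κ dk u' γ' :=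
    ⟨hT, hq'm, hq'Q, hfm, hf, hκm, hκC, hdkm, hdkC, hdk0, hu'm, hu'L hsol.memLp, hγ'm,
      fun t ht z => hγ'0 _ fun h => h.1.not_ge ht,
      hsol.isWeakTriple G.isOpen G.field hFE hq'm hq'Q hqe hf hκm hdkm hκC hdkC hS
        (hu'L hsol.memLp) hu'0 hue (hγ'l hsol.trace_locallyIntegrable) hγ'0 hγe⟩
  have hγe' : ∀ ν : Measure Phase, SFinite ν → ν ≪ boundaryMeasure Ω →
      γ =ᵐ[timeCylinder T ν] γ' := fun ν _ hν =>
    (timeCylinder_absolutelyContinuous hν).ae_le hγe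
  have hin := hγe' (sigmaIn Ω) inferInstance Measure.restrict_le_self.absolutelyContinuous
  have hout := hγe' (sigmaOut Ω) inferInstance Measure.restrict_le_self.absolutelyContinuous
  have hd : IsInflowDeriv Ω T γ' δ := by
    refine ⟨hδm, fun t ht z => hδ0 _ ht, hδL hdγ, ?_⟩
    filter_upwards [hγdγ.congr hT.le hin hδe (ae_eq_refl _)] with z hz
    filter_upwards [(ae_restrict_iff' measurableSet_Ioo).1 hz.2] with t ht hmem
    rw [ht hmem, zero_add]
  obtain ⟨w, h1, h2, h3, h4⟩ := hp.exists_outflowDeriv G hd hC₂ (fun z hz => (hfκ z hz).2)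
    fun z s hzs hz => lt_of_mem_backSet G.isOpen G.field hFE hw hIV hzs (hUI (hfκ _ hz).1)
  have ek : ∫ z, k₀ z ^ 2 ∂(interiorMeasure Ω) = ∫ z, f z ^ 2 ∂(interiorMeasure Ω) :=
    integral_congr_ae (hfe.mono fun z hz => by beta_reduce; rw [hz])
  have eδ : ∫ p, dγ p ^ 2 ∂(timeCylinder T (sigmaIn Ω)) =
      ∫ p, δ p ^ 2 ∂((volume : Measure ℝ).prod (sigmaIn Ω)) :=
    integral_timeCylinder_eq (hδe.mono fun p hp => by beta_reduce; rw [hp])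
      fun p hp => by rw [hδ0 p hp, zero_pow two_ne_zero]
  rw [ek, eδ]
  exact ⟨w, h1, h2.congr hT.le hout.symm (ae_eq_refl _) (ae_eq_refl _), h3, h4⟩

theorem mainTheorem3
    (Ω : Set R3) (hΩ_open : IsOpen Ω) (hΩ_ne : Ω.Nonempty) (hΩ_bdd : Bornology.IsBounded Ω)
    (hΩ_convex : Convex ℝ Ω) (hΩ_smooth : HasSmoothBoundary Ω)
    (E : R3 → R3) (hE : ContDiffOn ℝ 1 E (closure Ω))
    -- the pseudo-3D case
    (hE₁ : ∀ x ∈ closure Ω, E x 0 = 0)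
    (T β : ℝ) (φ₀ : Phase → ℝ) (V : Set R3) (hV : IsOpen V)
    (hweight : IsAdmissibleWeight Ω E V T β φ₀)
    (I : Set ℝ) (hI : IsOpen I) (hIV : {v : R3 | v 0 ∈ I} ⊆ V)
    (U : Set R3) (hU : MeasurableSet U) (hUI : U ⊆ {v : R3 | v 0 ∈ I})
    (C₀ C₁ C₂ : ℝ) (hC₂ : 0 < C₂) :
    ∃ c C : ℝ, 0 < c ∧ 0 < C ∧
      ∀ (q k₀ : Phase → ℝ) (k₁ dk₁ : ℝ × Phase → ℝ) (u γ dγ : ℝ × Phase → ℝ),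
        -- the absorption coefficient
        AEStronglyMeasurable q (interiorMeasure Ω) →
        (∀ᵐ z ∂(interiorMeasure Ω), |q z| ≤ C₀) →
        -- the factor `k₀`, supported in `U` with respect to the velocity
        MemLp k₀ 2 (interiorMeasure Ω) →
        (∀ᵐ z ∂(interiorMeasure Ω), z.2 ∉ U → k₀ z = 0) →
        -- the factor `k₁`, with `∂ₜk₁ = dk₁`, on `[0,T] × Ω × U`
        AEStronglyMeasurable k₁ (timeCylinder T (volume.restrict (Ω ×ˢ U))) →
        AEStronglyMeasurable dk₁ (timeCylinder T (volume.restrict (Ω ×ˢ U))) →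
        HasWeakTimeDeriv T (volume.restrict (Ω ×ˢ U)) k₁ dk₁ (fun z => k₁ (0, z)) →
        (∀ᵐ p ∂(timeCylinder T (volume.restrict (Ω ×ˢ U))), |dk₁ p| ≤ C₁) →
        (∀ᵐ z ∂((volume : Measure Phase).restrict (Ω ×ˢ U)),
          |k₁ (0, z)| ≤ C₁ ∧ C₂ ≤ |k₁ (0, z)|) →
        -- `u` solves `P u = k₀ k₁` with `u(0,·) = 0`, and `γ` is its trace on `Γ₊ ∪ Γ₋`
        IsWeakSolution Ω E T q (fun p => k₀ p.2 * k₁ p) (fun _ => 0) u γ →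
        -- on `Γ₋`, both `u` and `∂ₜu = dγ` are square integrable, and `u` is compatible with
        -- the zero initial value
        MemLp γ 2 (timeCylinder T (sigmaIn Ω)) →
        MemLp dγ 2 (timeCylinder T (sigmaIn Ω)) →
        HasWeakTimeDeriv T (sigmaIn Ω) γ dγ (fun _ => 0) →
        -- then `u` has a square integrable time derivative `dγ'` on `Γ₊`, and the estimates hold
        ∃ dγ' : ℝ × Phase → ℝ,
          MemLp dγ' 2 (timeCylinder T (sigmaOut Ω)) ∧
          HasWeakTimeDeriv T (sigmaOut Ω) γ dγ' (fun _ => 0) ∧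
          ∫ z, k₀ z ^ 2 ∂(interiorMeasure Ω) ≤
            C * ((∫ p, dγ' p ^ 2 ∂(timeCylinder T (sigmaOut Ω)))
              + ∫ p, dγ p ^ 2 ∂(timeCylinder T (sigmaIn Ω))) ∧
          ((∀ᵐ p ∂(timeCylinder T (sigmaIn Ω)), γ p = 0) →
            c * (∫ p, dγ' p ^ 2 ∂(timeCylinder T (sigmaOut Ω))) ≤
                ∫ z, k₀ z ^ 2 ∂(interiorMeasure Ω) ∧
              ∫ z, k₀ z ^ 2 ∂(interiorMeasure Ω) ≤
                C * ∫ p, dγ' p ^ 2 ∂(timeCylinder T (sigmaOut Ω))) := by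
  obtain ⟨hfin, F, K, M, lam, a, b, G, hFE⟩ :=
    exists_transportGeometry hΩ_open hΩ_ne hΩ_bdd hΩ_convex hΩ_smooth hE hE₁
  obtain ⟨R, r, -, -, -, hrR, hRT⟩ := hweight.range
  have hT : 0 < T := (div_pos (sub_pos.2 hrR) hweight.beta_pos).trans hRT
  have ha := G.lower_pos
  have hb : 0 < b := (G.density_pos 0).trans_le (G.upper 0)
  -- `C₀` and `C₁` are arbitrary reals; their absolute values give nonnegative constants and weaken
  -- the bounds.
  set Q : ℝ≥0 := |C₀|.toNNReal
  have hQ : C₀ ≤ Q := (le_abs_self C₀).trans (Real.le_coe_toNNReal _)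
  set A : ℝ := Real.exp (Q * T) ^ 2 *
    (4 / C₂ ^ 2 * Real.exp (2 * (2 * |C₁| ^ 2 * T / C₂ ^ 2 + 1) * T)) / a with hA
  set B : ℝ := b * (3 * ((|C₁| ^ 2 + |C₁| ^ 2 * T ^ 2) * Real.exp (Q * T) ^ 2)) with hB
  have hA0 : 0 < A := by positivity
  have hB0 : 0 ≤ B := by positivity
  -- `B` is zero when `C₁ = 0`, hence the summand `1`. The constant `A` bounds the source by the
  -- outgoing rate alone; the incoming term is added at no cost.
  refine ⟨(B + 1)⁻¹, A, by positivity, hA0, ?_⟩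
  intro q k₀ k₁ dk₁ u γ dγ hq hqC hk₀ hk₀U hk₁ hdk₁ hder hdC h0C hsol _ hdγ hγdγ
  have hI0 : 0 ≤ ∫ z, k₀ z ^ 2 ∂(interiorMeasure Ω) := integral_nonneg fun z => sq_nonneg _
  have hD0 : 0 ≤ ∫ p, dγ p ^ 2 ∂(timeCylinder T (sigmaIn Ω)) := integral_nonneg fun z => sq_nonneg _
  have key := fun (δ : ℝ × Phase → ℝ) hδ hγδ => hsol.exists_outflowDeriv (dγ := δ) G hFE hweight hIV
    hU hUI hT (abs_nonneg C₁) hC₂ hq (hqC.mono fun z hz => hz.trans hQ) hk₀ hk₀U hk₁ hdk₁ hder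
    (hdC.mono fun p hp => hp.trans (le_abs_self _))
    (h0C.mono fun z hz => ⟨hz.1.trans (le_abs_self _), hz.2⟩) hδ hγδ
  -- One function has to serve in both estimates. If the inflow vanishes, the argument is run with
  -- the incoming derivative `0` in place of `dγ`, so that the inflow term disappears from the upper
  -- bound.
  by_cases hγ0 : ∀ᵐ p ∂(timeCylinder T (sigmaIn Ω)), γ p = 0
  · have hzero : HasWeakTimeDeriv T (sigmaIn Ω) γ (fun _ => 0) (fun _ => 0) := by
      filter_upwards [ae_ae_of_timeCylinder hγ0] with z hz
      exact ⟨by simp, hz.mono fun t ht => by simp [ht]⟩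
    obtain ⟨w, h1, h2, h3, h4⟩ := key (fun _ => 0) MemLp.zero' hzero
    rw [← hA] at h3
    simp only [zero_pow two_ne_zero, integral_zero, mul_zero, add_zero] at h4
    refine ⟨w, h1, h2, h3.trans (mul_le_mul_of_nonneg_left (le_add_of_nonneg_right hD0) hA0.le),
      fun _ => ⟨?_, h3⟩⟩
    rw [inv_mul_le_iff₀ (by positivity)]
    refine h4.trans ?_
    rw [← mul_assoc, ← mul_assoc, mul_assoc b, ← hB]
    nlinarith
  · obtain ⟨w, h1, h2, h3, -⟩ := key dγ hdγ hγdγ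
    exact ⟨w, h1, h2, h3.trans (mul_le_mul_of_nonneg_left (le_add_of_nonneg_right hD0) hA0.le),
      fun h => absurd h hγ0⟩
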